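/- **Setting.** Let $M$ be a compact oriented smooth manifold with boundary, of dimension $m\ge 1$, let $\iota:\partial M\to M$ be the inclusion of its boundary with the induced (outward normal first) orientation, let $E\to M$ be a smooth real vector bundle of finite rank with a smooth linear connection $\nabla$, and let $0\le k\le m$. Write $V=\Omega^k(M,E)$, and $E^*$ also for $\iota^*E^*$. Let $\Lambda^s_r(M,E^*)=\Gamma(\bigwedge^sTM\otimes\bigwedge^rT^*M\otimes E^*)$; forms of negative degree are $0$. Write $\chi\cdot\varphi$ for the full contraction of $\chi\in\Lambda^k_r$ with $\varphi\in\Omega^k(M,E)$ (an $r$-form), and $\varphi\wedge\alpha\in\Omega^m(M)$ for the wedge product, combined with the pairing of $E$ and $E^*$, of $\varphi\in\Omega^k(M,E)$ and $\alpha\in\Omega^{m-k}(M,E^*)$. Similar notation is used on $\partial M$. The two restricted duals of $V$ are * $V^\star=\Lambda^k_m(M,E^*)\times\Lambda^k_{m-1}(\partial M,E^*)$ with $\langle(\alpha,\alpha_\partial),\varphi\rangle_\star=\int_M\alpha\cdot\varphi+\int_{\partial M}\alpha_\partial\cdot\iota^*\varphi$; * $V^\dagger=\Omega^{m-k}(M,E^*)\times\Omega^{m-k-1}(\partial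 M,E^*)$ with $\langle(\alpha,\alpha_\partial),\varphi\rangle_\dagger=\int_M\varphi\wedge\alpha+\int_{\partial M}\iota^*\varphi\wedge\alpha_\partial$. Let $V^*$ be one of these and put $T^*V=V\times V^*$. The tangent spaces of $T^*V$ are $V\times V^*$, and its restricted cotangent spaces are $V^*\times V$, where $(\beta,\psi)$ acts on a tangent vector $(\delta\varphi,\delta p)$ by $\langle\beta,\delta\varphi\rangle+\langle\delta p,\psi\rangle$. Let $\Theta(\varphi,p)\cdot(\delta\varphi,\delta p)=\langle p,\delta\varphi\rangle$ and $\Omega=-\mathrm d\Theta$. The canonical Dirac structure $D_{T^*V}$ is the graph of $\Omega^\flat$. Let $\mathscr L$ be a smooth fibre-preserving (not necessarily linear) map from $(\bigwedge^kT^*M\otimes E)\times_M(\bigwedge^kT^*M\otimes E)\times_M(\bigwedge^{k+1}T^*M\otimes E)$ to $\bigwedge^mT^*M$, with arguments denoted $(\varphi,\nu,\zeta)$, and let $L_\nabla(\varphi,\nu)=\int_M\mathscr L(\varphi,\nu,\mathrm d^\nabla\varphi)$ for $\varphi,\nu\in V$. Its partial functional derivatives, the functionals $\frac{\delta L_\nabla}{\delta\varphi}(\varphi,\nu)(\delta\varphi)=\frac{d}{d\epsilon}|_{0}L_\nabla(\varphi+\epsilon\delta\varphi,\nu)$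 and similarly $\frac{\delta L_\nabla}{\delta\nu}$, are represented through the pairing by elements of $V^*$. Put $$\mathrm d_DL_\nabla(\varphi,\nu)=\Big(\varphi,\tfrac{\delta L_\nabla}{\delta\nu},-\tfrac{\delta L_\nabla}{\delta\varphi},\nu\Big)\in T^*(T^*V),$$ a covector at the base point $(\varphi,\frac{\delta L_\nabla}{\delta\nu})$ of $T^*V$. An external force is a map $V\times V\to V^*$, $(\varphi,\nu)\mapsto(\mathcal F,\mathcal F_\partial)$; let $\widetilde F(\varphi,\nu)$ be the covector $((\mathcal F,\mathcal F_\partial),0)$ at the same base point. A solution of the forced Lagrange--Dirac system is a smooth curve $(\varphi,\nu,\alpha,\alpha_\partial):[t_0,t_1]\to V\times V\times V^*$, $t_0<t_1$, such that for all $t$ $$\big((\varphi,\alpha,\alpha_\partial,\dot\varphi,\dot\alpha,\dot\alpha_\partial),\ \mathrm d_DL_\nabla(\varphi,\nu)-\widetilde F(\varphi,\nu)\big)\in D_{T^*V}(\varphi,\alpha,\alpha_\partial).\tag{1}$$ The fibre derivatives $\frac{\partial\mathscr L}{\partial\varphi},\frac{\partial\mathscr L}{\partial\nu}\in\Lambda^k_m$,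 $\frac{\partial\mathscr L}{\partial\zeta}\in\Lambda^{k+1}_m$ are defined by $\frac{\partial\mathscr L}{\partial\varphi}\cdot\delta\varphi=\frac{d}{d\epsilon}|_0\mathscr L(\varphi+\epsilon\delta\varphi,\nu,\zeta)$, etc., and the fibre derivatives ⅁$\mathscr L$/⅁$\varphi$, ⅁$\mathscr L$/⅁$\nu\in\Omega^{m-k}(M,E^*)$, ⅁$\mathscr L$/⅁$\zeta\in\Omega^{m-k-1}(M,E^*)$ by $\delta\varphi\wedge$⅁$\mathscr L$/⅁$\varphi=\frac{d}{d\epsilon}|_0\mathscr L(\varphi+\epsilon\delta\varphi,\nu,\zeta)$, etc. Let $\mathrm d^{\nabla^*}$ be the covariant exterior derivative of the dual connection. The trace $\mathrm{tr}:\Lambda^{k+1}_m\to\Lambda^k_{m-1}$ is $$\mathrm{tr}(U_1\wedge\dots\wedge U_{k+1}\otimes\mu\otimes\eta)=\sum_{i=1}^{k+1}(-1)^{i-1}\,U_1\wedge\dots\widehat{U_i}\dots\wedge U_{k+1}\otimes i_{U_i}\mu\otimes\eta,$$ and $\mathrm{div}^{\nabla^*}:\Lambda^{k+1}_m\to\Lambda^k_m$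 is $\mathrm{div}^{\nabla^*}\chi=(-1)^k\,\mathrm d^{\nabla^*}(\mathrm{tr}\,\chi)$, where the multivector part of $\mathrm{tr}\,\chi$ is expanded in the coordinate multivectors $\partial_I$ of a chart and $\mathrm d^{\nabla^*}(\partial_I\otimes\theta)=\partial_I\otimes\mathrm d^{\nabla^*}\theta$. (With these conventions $(\mathrm{tr}\,\chi)\cdot\varphi=\varphi\wedge\Phi(\chi)$ and $(\mathrm{div}^{\nabla^*}\chi)\cdot\varphi=\varphi\wedge\mathrm d^{\nabla^*}\Phi(\chi)$, where $\Phi(U\otimes\mu\otimes\eta)=i_U\mu\otimes\eta$.) The tensor $\iota^*(\mathrm{tr}\,\chi)\in\Lambda^k_{m-1}(\partial M,E^*)$ is obtained by evaluating $\mathrm{tr}\,\chi$ on vectors tangent to $\partial M$ and on arbitrary extensions to $TM$ of covectors of $\partial M$. **Proposition.** In each case, all fibre derivatives being evaluated at $(\varphi,\nu,\mathrm d^\nabla\varphi)$: (i) For $V^*=V^\star$, a smooth curve $(\varphi,\nu,\alpha,\alpha_\partial)$ satisfies (1) for all $t\in[t_0,t_1]$ if and only if for all $t\in[t_0,t_1]$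 $$\dot\varphi=\nu,\quad \alpha=\frac{\partial\mathscr L}{\partial\nu},\quad \dot\alpha=\frac{\partial\mathscr L}{\partial\varphi}-(-1)^k\mathrm{div}^{\nabla^*}\frac{\partial\mathscr L}{\partial\zeta}+\mathcal F(\varphi,\nu),\quad \alpha_\partial=0,\quad \dot\alpha_\partial=\iota^*\Big(\mathrm{tr}\frac{\partial\mathscr L}{\partial\zeta}\Big)+\mathcal F_\partial(\varphi,\nu).$$ (ii) For $V^*=V^\dagger$, a smooth curve $(\varphi,\nu,\alpha,\alpha_\partial)$ satisfies (1) for all $t\in[t_0,t_1]$ if and only if for all $t\in[t_0,t_1]$: $\dot\varphi=\nu$, $\alpha=$ ⅁$\mathscr L$/⅁$\nu$, $\dot\alpha=$ ⅁$\mathscr L$/⅁$\varphi-(-1)^k\mathrm d^{\nabla^*}($⅁$\mathscr L$/⅁$\zeta)+\mathcal F(\varphi,\nu)$, $\alpha_\partial=0$, and $\dot\alpha_\partial=\iota^*($⅁$\mathscr L$/⅁$\zeta)+\mathcal F_\partial(\varphi,\nu)$. (For $k=m$ the components in degree $m-k-1=-1$ are $0$, the last two equations are void, and the term with $\mathrm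 d^{\nabla^*}$ is absent.) -/

import Mathlib

open scoped Manifold ContDiff Topology Bundle

noncomputable section

namespace LagrangeDirac

/-! ## Multilinear algebra in one fibre

`T` plays the role of a tangent space `T_x M`, `A` the role of a fibre `E_x`. -/

section Algebra

variable {T A : Type*} [AddCommGroup T] [Module ℝ T] [AddCommMonoid A] [Module ℝ A]

/-- `⋀ˢ T ⊗ ⋀ʳ T* ⊗ A*`, where an `s`-vector is regarded as an alternating function of `s`
covectors and an `A*`-valued `r`-covector as an alternating function of `r` vectors. -/
abbrev SkewTensor (T A : Type*) [AddCommGroup T] [Module ℝ T] [AddCommMonoid A] [Module ℝ A]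
    (s r : ℕ) : Type _ :=
  Module.Dual ℝ T [⋀^Fin s]→ₗ[ℝ] (T [⋀^Fin r]→ₗ[ℝ] Module.Dual ℝ A)

/-- The contraction `χ • φ`, in both sets of indices, of `χ ∈ ⋀ᵏ T ⊗ ⋀ʳ T* ⊗ A*` with
`φ ∈ ⋀ᵏ T* ⊗ A`, computed in a basis `b` of `T` by summing over increasing multi-indices. -/
def contract {m k r : ℕ} (b : Module.Basis (Fin m) ℝ T) (χ : SkewTensor T A k r)
    (φ : T [⋀^Fin k]→ₗ[ℝ] A) : T [⋀^Fin r]→ₗ[ℝ] ℝ :=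
  ∑ J : Fin k ↪o Fin m,
    (Module.Dual.eval ℝ A (φ fun i => b (J i))).compAlternatingMap (χ fun i => b.coord (J i))

/-- The wedge product of `φ ∈ ⋀ᵏ T* ⊗ A` with `α ∈ ⋀ʲ T* ⊗ A*`, combined with the pairing of
`A` and `A*`; it is a real-valued form of degree `m = k + j`. -/
def wedge {k j m : ℕ} (h : k + j = m) (φ : T [⋀^Fin k]→ₗ[ℝ] A)
    (α : T [⋀^Fin j]→ₗ[ℝ] Module.Dual ℝ A) : T [⋀^Fin m]→ₗ[ℝ] ℝ :=
  letI : AddCommGroup A := Module.addCommMonoidToAddCommGroup ℝ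
  ((contractRight ℝ A).compAlternatingMap (φ.domCoprod α)).domDomCongr
    (finSumFinEquiv.trans (finCongr h))

/-- Interior product of an `A*`-valued form with a vector in the first slot. -/
def insertFirst {r : ℕ} (v : T) :
    (T [⋀^Fin (r + 1)]→ₗ[ℝ] Module.Dual ℝ A) →ₗ[ℝ] (T [⋀^Fin r]→ₗ[ℝ] Module.Dual ℝ A) :=
  (AlternatingMap.curryLeftLinearMap (R := ℝ)).flip v

/-- The trace `⋀ˢ⁺¹ T ⊗ ⋀ʳ⁺¹ T* ⊗ A* → ⋀ˢ T ⊗ ⋀ʳ T* ⊗ A*`, which contracts the first vector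
index with the first form index. On decomposable elements it is
`U₁ ∧ … ∧ U_{s+1} ⊗ μ ⊗ η ↦ ∑ᵢ (-1)^(i-1) (U₁ ∧ … Ûᵢ … ∧ U_{s+1}) ⊗ i_{Uᵢ} μ ⊗ η`. -/
def trace {m s r : ℕ} (b : Module.Basis (Fin m) ℝ T) (χ : SkewTensor T A (s + 1) (r + 1)) :
    SkewTensor T A s r :=
  ∑ i : Fin m, (insertFirst (b i)).compAlternatingMap (χ.curryLeft (b.coord i))

/-- The fibre derivative, in the realisation `⋀ᵏ T ⊗ ⋀ʳ T* ⊗ A*`, of a map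
`g : ⋀ᵏ T* ⊗ A → ⋀ʳ T*` at `a`: the element `χ` with `χ • δ = d/dε|₀ g (a + ε δ)` for all `δ`. -/
def fiberDeriv {m k r : ℕ} (b : Module.Basis (Fin m) ℝ T)
    (g : (T [⋀^Fin k]→ₗ[ℝ] A) → (T [⋀^Fin r]→ₗ[ℝ] ℝ)) (a : T [⋀^Fin k]→ₗ[ℝ] A) :
    SkewTensor T A k r :=
  Classical.epsilon fun χ => ∀ (δ : T [⋀^Fin k]→ₗ[ℝ] A) (u : Fin r → T),
    HasDerivAt (fun ε : ℝ => g (a + ε • δ) u) (contract b χ δ u) 0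

/-- The fibre derivative, in the realisation `⋀ʲ T* ⊗ A*`, of a map `g : ⋀ᵏ T* ⊗ A → ⋀ᵐ T*` at
`a`, where `k + j = m`: the element `ψ` with `δ ∧ ψ = d/dε|₀ g (a + ε δ)` for all `δ`. -/
def fiberDerivWedge {k j m : ℕ} (h : k + j = m)
    (g : (T [⋀^Fin k]→ₗ[ℝ] A) → (T [⋀^Fin m]→ₗ[ℝ] ℝ)) (a : T [⋀^Fin k]→ₗ[ℝ] A) :
    T [⋀^Fin j]→ₗ[ℝ] Module.Dual ℝ A :=
  Classical.epsilon fun ψ => ∀ (δ : T [⋀^Fin k]→ₗ[ℝ] A) (u : Fin m → T),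
    HasDerivAt (fun ε : ℝ => g (a + ε • δ) u) (wedge h δ ψ u) 0

end Algebra

/-! ## Tangent vectors, charts and orientations -/

section Manifold

variable {m : ℕ} {H : Type*} [TopologicalSpace H]
  (I : ModelWithCorners ℝ (EuclideanSpace ℝ (Fin m)) H)
  {X : Type*} [TopologicalSpace X] [ChartedSpace H X] [IsManifold I ∞ X]

/-- A basis of `T_x X`: the coordinate frame, at `x`, of the preferred chart at `x`. -/
def tangentBasis (x : X) : Module.Basis (Fin m) ℝ (TangentSpace I x) :=
  (EuclideanSpace.basisFun (Fin m) ℝ).toBasis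

/-- Components of a vector of `T_x X` in the chart at `c`. -/
def tangentCoord (c x : X) : TangentSpace I x →ₗ[ℝ] EuclideanSpace ℝ (Fin m) :=
  (trivializationAt (EuclideanSpace ℝ (Fin m)) (TangentSpace I) c).linearMapAt ℝ x

/-- The vector of `T_x X` with given components in the chart at `c`. -/
def tangentVec (c x : X) : EuclideanSpace ℝ (Fin m) →ₗ[ℝ] TangentSpace I x :=
  (trivializationAt (EuclideanSpace ℝ (Fin m)) (TangentSpace I) c).symmₗ ℝ x

/-- The coordinate frame `∂₁, …, ∂ₘ` of the chart at `c`, at the point `x` of its domain. -/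
def chartFrame (c x : X) (i : Fin m) : TangentSpace I x :=
  tangentVec I c x (EuclideanSpace.basisFun (Fin m) ℝ i)

/-- The vector field around `x` that has constant components in the chart at `x` and extends
`w ∈ T_x X`. -/
def extendVec (x : X) (w : TangentSpace I x) (y : X) : TangentSpace I y :=
  tangentVec I x y (tangentCoord I x x w)

/-- The covector field around `x` that has constant components in the chart at `x` and extends
`β ∈ T*_x X`. -/
def extendCovec (x : X) (β : Module.Dual ℝ (TangentSpace I x)) (y : X) :
    Module.Dual ℝ (TangentSpace I y) :=
  β ∘ₗ tangentVec I x x ∘ₗ tangentCoord I x y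

/-- `1`, `-1` or `0` according to whether a family of vectors is a positively oriented basis, a
negatively oriented basis, or not a basis. -/
def frameSign {T : Type*} [AddCommGroup T] [Module ℝ T] (o : Orientation ℝ T (Fin m))
    (u : Fin m → T) : ℝ :=
  (SignType.sign (o.someVector u) : ℝ)

variable (X) in
/-- An orientation of a manifold: orientations of all tangent spaces, for which the sign of each
coordinate frame is locally constant. -/
structure ManifoldOrientation where
  /-- The orientation of the tangent space at a point. -/
  orient : ∀ x : X, Orientation ℝ (TangentSpace I x) (Fin m)
  locally_constant : ∀ c : X, ∀ᶠ x in 𝓝 c,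
    frameSign (orient x) (chartFrame I c x) = frameSign (orient c) (chartFrame I c c)

variable (X) in
/-- A smooth partition of unity subordinate to the preferred charts. -/
def chartPartition [T2Space X] [SigmaCompactSpace X] : SmoothPartitionOfUnity X I X Set.univ :=
  (SmoothPartitionOfUnity.exists_isSubordinate_chartAt_source I X).choose

/-- The integral over a compact manifold `X` of a top-degree form `θ`, with respect to the
orientation for which `sgn` is the sign of frames. In the chart at `c` the form
`θ = f dx¹ ∧ … ∧ dxᵐ` has `f = θ(∂₁, …, ∂ₘ)`, and it contributes
`± ∫ ρ_c f dx¹ … dxᵐ`, where `ρ` is the partition of unity and `±` is the sign of the frame. -/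
def integral [T2Space X] [SigmaCompactSpace X]
    (sgn : ∀ x : X, (Fin m → TangentSpace I x) → ℝ)
    (θ : ∀ x : X, TangentSpace I x [⋀^Fin m]→ₗ[ℝ] ℝ) : ℝ :=
  ∑ᶠ c : X, ∫ y in (extChartAt I c).target,
    chartPartition I X c ((extChartAt I c).symm y)
      * sgn ((extChartAt I c).symm y) (chartFrame I c ((extChartAt I c).symm y))
      * θ ((extChartAt I c).symm y) (chartFrame I c ((extChartAt I c).symm y))

end Manifold

/-! ## Bundle-valued tensor fields -/

section Fields

variable {m : ℕ} {H : Type*} [TopologicalSpace H]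
  (I : ModelWithCorners ℝ (EuclideanSpace ℝ (Fin m)) H)
  {X : Type*} [TopologicalSpace X] [ChartedSpace H X] [IsManifold I ∞ X]
  (F : Type*) [NormedAddCommGroup F] [NormedSpace ℝ F]
  (E : X → Type*) [∀ x, AddCommMonoid (E x)] [∀ x, Module ℝ (E x)]

/-- `E`-valued `k`-covectors at `x`, the fibre of `⋀ᵏ T*X ⊗ E`. -/
abbrev Form (k : ℕ) (x : X) : Type _ := TangentSpace I x [⋀^Fin k]→ₗ[ℝ] E x

/-- `E*`-valued `j`-covectors at `x`, the fibre of `⋀ʲ T*X ⊗ E*`. -/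
abbrev DualForm (j : ℕ) (x : X) : Type _ :=
  TangentSpace I x [⋀^Fin j]→ₗ[ℝ] Module.Dual ℝ (E x)

/-- The fibre of `⋀ˢ TX ⊗ ⋀ʳ T*X ⊗ E*` at `x`. -/
abbrev DualTensor (s r : ℕ) (x : X) : Type _ := SkewTensor (TangentSpace I x) (E x) s r

variable [TopologicalSpace (Bundle.TotalSpace F E)] [∀ x, TopologicalSpace (E x)]
  [FiberBundle F E] [VectorBundle ℝ F E]

/-- Components of an element of `E_x` in the preferred trivialization at `c`. -/
def bundleCoord (c x : X) : E x →ₗ[ℝ] F := (trivializationAt F E c).linearMapAt ℝ x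

/-- The element of `E_x` with given components in the preferred trivialization at `c`. -/
def bundleVec (c x : X) : F →ₗ[ℝ] E x := (trivializationAt F E c).symmₗ ℝ x

/-- The section of `E` around `x` that has constant components in the preferred trivialization
at `x` and extends `e ∈ E_x`. -/
def extendSec (x : X) (e : E x) (y : X) : E y := bundleVec F E x y (bundleCoord F E x x e)

/-- A component (in `F`) of an `E`-valued form, in the chart and trivialization at `c`. -/
def formComp {k : ℕ} (c : X) (v : Fin k → EuclideanSpace ℝ (Fin m)) (x : X)
    (θ : Form I E k x) : F :=
  bundleCoord F E c x (θ fun i => tangentVec I c x (v i))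

/-- A component of an `E*`-valued form, in the chart and trivialization at `c`. -/
def dualFormComp {j : ℕ} (c : X) (v : Fin j → EuclideanSpace ℝ (Fin m)) (f : F) (x : X)
    (θ : DualForm I E j x) : ℝ :=
  θ (fun i => tangentVec I c x (v i)) (bundleVec F E c x f)

/-- A component of a section of `⋀ˢ TX ⊗ ⋀ʳ T*X ⊗ E*`, in the chart and trivialization at `c`. -/
def dualTensorComp {s r : ℕ} (c : X) (β : Fin s → Module.Dual ℝ (EuclideanSpace ℝ (Fin m)))
    (v : Fin r → EuclideanSpace ℝ (Fin m)) (f : F) (x : X) (χ : DualTensor I E s r x) : ℝ :=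
  χ (fun i => β i ∘ₗ tangentCoord I c x) (fun i => tangentVec I c x (v i)) (bundleVec F E c x f)

/-- `Ωᵏ(X, E)`, the smooth `E`-valued `k`-forms: all components are smooth. -/
def Omega (k : ℕ) : Submodule ℝ (∀ x : X, Form I E k x) where
  carrier := {θ | ∀ (c : X) (v : Fin k → EuclideanSpace ℝ (Fin m)),
    ContMDiffAt I 𝓘(ℝ, F) ∞ (fun x => formComp I F E c v x (θ x)) c}
  add_mem' {θ θ'} h h' c v := by
    simpa [formComp] using! (h c v).add (h' c v)
  zero_mem' c v := by
    simpa [formComp] using! (contMDiffAt_const : ContMDiffAt I 𝓘(ℝ, F) ∞ (fun _ : X => (0 : F)) c)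
  smul_mem' a θ h c v := by
    simpa [formComp] using! (contMDiffAt_const :
      ContMDiffAt I 𝓘(ℝ, ℝ) ∞ (fun _ : X => a) c).smul (h c v)

/-- `Ωʲ(X, E*)`, the smooth `E*`-valued `j`-forms. -/
def OmegaDual (j : ℕ) : Submodule ℝ (∀ x : X, DualForm I E j x) where
  carrier := {θ | ∀ (c : X) (v : Fin j → EuclideanSpace ℝ (Fin m)) (f : F),
    ContMDiffAt I 𝓘(ℝ, ℝ) ∞ (fun x => dualFormComp I F E c v f x (θ x)) c}
  add_mem' {θ θ'} h h' c v f := by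
    simpa [dualFormComp] using! (h c v f).add (h' c v f)
  zero_mem' c v f := by
    simpa [dualFormComp] using!
      (contMDiffAt_const : ContMDiffAt I 𝓘(ℝ, ℝ) ∞ (fun _ : X => (0 : ℝ)) c)
  smul_mem' a θ h c v f := by
    simpa [dualFormComp] using! (contMDiffAt_const :
      ContMDiffAt I 𝓘(ℝ, ℝ) ∞ (fun _ : X => a) c).smul (h c v f)

/-- `Λˢᵣ(X, E*)`, the smooth sections of `⋀ˢ TX ⊗ ⋀ʳ T*X ⊗ E*`. -/
def Lambda (s r : ℕ) : Submodule ℝ (∀ x : X, DualTensor I E s r x) where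
  carrier := {χ | ∀ (c : X) (β : Fin s → Module.Dual ℝ (EuclideanSpace ℝ (Fin m)))
    (v : Fin r → EuclideanSpace ℝ (Fin m)) (f : F),
    ContMDiffAt I 𝓘(ℝ, ℝ) ∞ (fun x => dualTensorComp I F E c β v f x (χ x)) c}
  add_mem' {θ θ'} h h' c β v f := by
    simpa [dualTensorComp] using! (h c β v f).add (h' c β v f)
  zero_mem' c β v f := by
    simpa [dualTensorComp] using!
      (contMDiffAt_const : ContMDiffAt I 𝓘(ℝ, ℝ) ∞ (fun _ : X => (0 : ℝ)) c)
  smul_mem' a θ h c β v f := by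
    simpa [dualTensorComp] using! (contMDiffAt_const :
      ContMDiffAt I 𝓘(ℝ, ℝ) ∞ (fun _ : X => a) c).smul (h c β v f)

instance (j : ℕ) : AddCommGroup (OmegaDual I F E j) := Module.addCommMonoidToAddCommGroup ℝ

instance (s r : ℕ) : AddCommGroup (Lambda I F E s r) := Module.addCommMonoidToAddCommGroup ℝ

end Fields

/-! ## Covariant exterior derivatives and divergence -/

section Connection

variable {m : ℕ} {H : Type*} [TopologicalSpace H]
  {I : ModelWithCorners ℝ (EuclideanSpace ℝ (Fin m)) H}
  {X : Type*} [TopologicalSpace X] [ChartedSpace H X] [IsManifold I ∞ X]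
  {F : Type*} [NormedAddCommGroup F] [NormedSpace ℝ F]
  {E : X → Type*} [∀ x, AddCommGroup (E x)] [∀ x, Module ℝ (E x)]
  [TopologicalSpace (Bundle.TotalSpace F E)] [∀ x, TopologicalSpace (E x)]
  [FiberBundle F E] [VectorBundle ℝ F E]

/-- The section `φ(W₁, …, W_k)` of `E`, where `Wᵢ` extends `wᵢ ∈ T_x X` with constant components
in the chart at `x`. -/
def evalExtend {k : ℕ} (φ : Omega I F E k) (x : X) (w : Fin k → TangentSpace I x) (y : X) : E y :=
  (φ : ∀ y, Form I E k y) y fun i => extendVec I x (w i) y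

theorem mdifferentiableAt_evalExtend {k : ℕ} (φ : Omega I F E k) (x : X)
    (w : Fin k → TangentSpace I x) :
    MDifferentiableAt I (I.prod 𝓘(ℝ, F))
      (fun y => Bundle.TotalSpace.mk' F y (evalExtend φ x w y)) x := by
  have h := φ.2 x (fun i => tangentCoord I x x (w i))
  have h2 : ContMDiffAt I (I.prod 𝓘(ℝ, F)) ∞
      (fun y => Bundle.TotalSpace.mk' F y (evalExtend φ x w y)) x := by
    rw [Bundle.contMDiffAt_section]
    refine h.congr_of_eventuallyEq ?_
    filter_upwards [(trivializationAt F E x).open_baseSet.mem_nhds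
      (FiberBundle.mem_baseSet_trivializationAt F E x)] with y hy
    simp only [formComp, bundleCoord, Bundle.Trivialization.coe_linearMapAt_of_mem _ hy]
    rfl
  exact h2.mdifferentiableAt (by simp)

variable [∀ x, IsTopologicalAddGroup (E x)] [∀ x, ContinuousSMul ℝ (E x)]

/-- `w ↦ ∇_v (φ(W₁, …, W_k))` at `x`, with the `Wᵢ` as in `evalExtend`. -/
def covDerivForm (nab : CovariantDerivative I F E) {k : ℕ} (φ : Omega I F E k) (x : X) :
    TangentSpace I x →ₗ[ℝ] Form I E k x where
  toFun v :=
    { toFun := fun w => nab (evalExtend φ x w) x v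
      map_update_add' := by
        intro _ w i a b
        have e : evalExtend φ x (Function.update w i (a + b)) =
            evalExtend φ x (Function.update w i a) + evalExtend φ x (Function.update w i b) := by
          funext y
          exact ((φ : ∀ y, Form I E k y) y |>.compLinearMap
            (tangentVec I x y ∘ₗ tangentCoord I x x)).map_update_add w i a b
        rw [e, nab.isCovariantDerivativeOnUniv.add (mdifferentiableAt_evalExtend φ x _)
          (mdifferentiableAt_evalExtend φ x _)]
        rfl
      map_update_smul' := by
        intro _ w i a b
        have e : evalExtend φ x (Function.update w i (a • b)) =
            a • evalExtend φ x (Function.update w i b) := by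
          funext y
          exact ((φ : ∀ y, Form I E k y) y |>.compLinearMap
            (tangentVec I x y ∘ₗ tangentCoord I x x)).map_update_smul w i a b
        rw [e, nab.isCovariantDerivativeOnUniv.smul_const a (mdifferentiableAt_evalExtend φ x _)]
        rfl
      map_eq_zero_of_eq' := by
        intro w i j hw hij
        have e : evalExtend φ x w = 0 := by
          funext y
          exact ((φ : ∀ y, Form I E k y) y |>.compLinearMap
            (tangentVec I x y ∘ₗ tangentCoord I x x)).map_eq_zero_of_eq w hw hij
        rw [e, nab.zero]
        rfl }
  map_add' v v' := by ext w; simp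
  map_smul' a v := by ext w; simp

/-- The covariant exterior derivative `d^∇ : Ωᵏ(X, E) → Ωᵏ⁺¹(X, E)`. At `x`,
`(d^∇ φ)(w₀, …, w_k) = ∑ᵢ (-1)ⁱ ∇_{wᵢ} (φ(W₀, …, Ŵᵢ, …, W_k))`, where `Wᵢ` extends `wᵢ` with
constant components in the chart at `x` (so that the brackets `[Wᵢ, Wⱼ]` vanish). -/
def extCovDeriv (nab : CovariantDerivative I F E) {k : ℕ} (φ : Omega I F E k) (x : X) :
    Form I E (k + 1) x :=
  AlternatingMap.alternatizeUncurryFin (covDerivForm nab φ x)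

/-- The dual connection: `(∇*_v η)(e) = v(η(ξ)) - η(∇_v ξ)` at `x`, where the section `ξ`
extends `e ∈ E_x`. -/
def dualCovDeriv (nab : CovariantDerivative I F E) (η : ∀ y : X, Module.Dual ℝ (E y)) (x : X)
    (v : TangentSpace I x) (e : E x) : ℝ :=
  mvfderiv I (fun y => η y (extendSec F E x e y)) x v - η x (nab (extendSec F E x e) x v)

/-- The covariant exterior derivative `d^{∇*}` of an `E*`-valued `j`-form, given by the same
formula as `extCovDeriv` with `∇*` in place of `∇`, evaluated on vectors `u₀, …, u_j ∈ T_x X` and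
on `e ∈ E_x`. -/
def extCovDerivDual (nab : CovariantDerivative I F E) {j : ℕ} (θ : ∀ x : X, DualForm I E j x)
    (x : X) (u : Fin (j + 1) → TangentSpace I x) (e : E x) : ℝ :=
  ∑ i : Fin (j + 1), (-1) ^ (i : ℕ) *
    dualCovDeriv nab (fun y => θ y fun l => extendVec I x (u (i.succAbove l)) y) x (u i) e

/-- The covariant divergence `div^{∇*} : Λᵏ⁺¹ᵣ₊₁(X, E*) → Λᵏᵣ₊₁(X, E*)` (used when
`r + 1 = dim X`): the derivative `d^{∇*}` of `tr χ`, whose multivector part is expanded in the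
coordinate multivectors of a chart, with the sign `(-1)ᵏ` that comes from moving `d^{∇*}` past
the `k`-vector part. It is evaluated at `x` on `k` covectors, `r + 1` vectors, and `e ∈ E_x`. -/
def divergence (nab : CovariantDerivative I F E) {k r : ℕ}
    (χ : ∀ x : X, DualTensor I E (k + 1) (r + 1) x) (x : X)
    (β : Fin k → Module.Dual ℝ (TangentSpace I x)) (u : Fin (r + 1) → TangentSpace I x)
    (e : E x) : ℝ :=
  (-1) ^ k * extCovDerivDual nab
    (fun y => trace (tangentBasis I y) (χ y) fun i => extendCovec I x (β i) y) x u e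

end Connection

/-! ## Canonical forms, Dirac structure and Lagrange--Dirac systems on `V × V*`

`R` is a restricted dual of the vector space `V`, through the pairing `pair`. The following
identifications are used: `T V = V × V`, `T* V = V × R`, `T(T* V) = (V × R) × (V × R)`,
`T*(T V) = (V × V) × (R × R)` and `T*(T* V) = (V × R) × (R × V)`. -/

section Dirac

variable {V R : Type*} [AddCommGroup V] [Module ℝ V] [AddCommGroup R] [Module ℝ R]
  (pair : R → V → ℝ)

/-- The canonical one-form `Θ(z) · δz = ⟨z, Tπ(δz)⟩`. -/
def canonicalOneForm (z dz : V × R) : ℝ := pair z.2 dz.1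

/-- The canonical two-form `Ω = -dΘ`, where
`dΘ(z)(u, w) = D_u (Θ(·) w)(z) - D_w (Θ(·) u)(z)`. -/
def canonicalTwoForm (z u w : V × R) : ℝ :=
  -(deriv (fun ε : ℝ => canonicalOneForm pair (z + ε • u) w) 0
    - deriv (fun ε : ℝ => canonicalOneForm pair (z + ε • w) u) 0)

/-- The pairing of a covector `(β, ψ) ∈ R × V` on `T* V` with a tangent vector `w ∈ V × R`. -/
def covectorPairing (a : R × V) (w : V × R) : ℝ := pair a.1 w.1 + pair w.2 a.2

/-- The canonical Dirac structure: the graph of `Ω♭ : T(T* V) → T*(T* V)`, a set of pairs formed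
of a tangent vector and a covector of `T* V` with the same base point. -/
def canonicalDirac : Set (((V × R) × (V × R)) × ((V × R) × (R × V))) :=
  {p | p.1.1 = p.2.1 ∧
    ∀ w : V × R, covectorPairing pair p.2.2 w = canonicalTwoForm pair p.1.1 p.1.2 w}

/-- The element of the restricted dual that represents a functional on `V`. -/
def representative (l : V → ℝ) : R := Function.invFun pair l

/-- The partial functional derivative `δL/δφ (φ, ν)`, as a functional on `V`. -/
def partialPhi (L : V → V → ℝ) (φ ν δ : V) : ℝ := deriv (fun ε : ℝ => L (φ + ε • δ) ν) 0

/-- The partial functional derivative `δL/δν (φ, ν)`, as a functional on `V`. -/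
def partialNu (L : V → V → ℝ) (φ ν δ : V) : ℝ := deriv (fun ε : ℝ => L φ (ν + ε • δ)) 0

/-- The differential `dL : TV → T*(TV)`, with values in the restricted cotangent bundle. -/
def differential (L : V → V → ℝ) (φ ν : V) : (V × V) × (R × R) :=
  ((φ, ν), (representative pair (partialPhi L φ ν), representative pair (partialNu L φ ν)))

/-- The isomorphism `γ : T*(TV) → T*(T*V)`, `(φ, ν, β, p) ↦ (φ, p, -β, ν)`, of the Tulczyjew
triple. -/
def tulczyjew (q : (V × V) × (R × R)) : (V × R) × (R × V) :=
  ((q.1.1, q.2.2), (-q.2.1, q.1.2))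

/-- The Dirac differential `d_D L = γ ∘ dL`. -/
def diracDifferential (L : V → V → ℝ) (φ ν : V) : (V × R) × (R × V) :=
  tulczyjew (differential pair L φ ν)

/-- The Legendre transform `(φ, ν) ↦ (φ, δL/δν)`. -/
def legendre (L : V → V → ℝ) (φ ν : V) : V × R := (φ, representative pair (partialNu L φ ν))

/-- The Lagrangian force field of an external force `(φ, ν) ↦ (φ, f φ ν)`: the covector
`w ↦ ⟨f φ ν, Tπ(w)⟩` at the point of `T* V` given by the Legendre transform. -/
def forceField (L : V → V → ℝ) (f : V → V → R) (φ ν : V) : (V × R) × (R × V) :=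
  (legendre pair L φ ν, (f φ ν, 0))

/-- The condition `((z, ż), d_D L(φ, ν) - F̃(φ, ν)) ∈ D(z)`, where `z = (φ, p)`. The difference is
taken in the fibre over the common base point of `d_D L(φ, ν)` and `F̃(φ, ν)`. -/
def LagrangeDiracCondition (L : V → V → ℝ) (f : V → V → R) (φ ν : V) (p : R) (dφ : V) (dp : R) : Prop :=
  (((φ, p), (dφ, dp)),
    ((diracDifferential pair L φ ν).1,
      (diracDifferential pair L φ ν).2 - (forceField pair L f φ ν).2)) ∈ canonicalDirac pair

end Dirac

/-! ## Smooth curves of tensor fields -/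

section Curves

variable {m : ℕ} {H : Type*} [TopologicalSpace H]
  {I : ModelWithCorners ℝ (EuclideanSpace ℝ (Fin m)) H}
  {X : Type*} [TopologicalSpace X] [ChartedSpace H X] [IsManifold I ∞ X]
  {F : Type*} [NormedAddCommGroup F] [NormedSpace ℝ F]
  {E : X → Type*} [∀ x, AddCommMonoid (E x)] [∀ x, Module ℝ (E x)]
  [TopologicalSpace (Bundle.TotalSpace F E)] [∀ x, TopologicalSpace (E x)]
  [FiberBundle F E] [VectorBundle ℝ F E]

/-- A smooth curve `S → Ωᵏ(X, E)`: the components depend smoothly on `(t, x)`. -/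
def Omega.SmoothCurve {k : ℕ} (S : Set ℝ) (γ : ℝ → Omega I F E k) : Prop :=
  ∀ t ∈ S, ∀ (c : X) (v : Fin k → EuclideanSpace ℝ (Fin m)),
    ContMDiffWithinAt (𝓘(ℝ, ℝ).prod I) 𝓘(ℝ, F) ∞
      (fun q : ℝ × X => formComp I F E c v q.2 ((γ q.1).1 q.2)) (S ×ˢ Set.univ) (t, c)

/-- A smooth curve `S → Ωʲ(X, E*)`. -/
def OmegaDual.SmoothCurve {j : ℕ} (S : Set ℝ) (γ : ℝ → OmegaDual I F E j) : Prop :=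
  ∀ t ∈ S, ∀ (c : X) (v : Fin j → EuclideanSpace ℝ (Fin m)) (f : F),
    ContMDiffWithinAt (𝓘(ℝ, ℝ).prod I) 𝓘(ℝ, ℝ) ∞
      (fun q : ℝ × X => dualFormComp I F E c v f q.2 ((γ q.1).1 q.2)) (S ×ˢ Set.univ) (t, c)

/-- A smooth curve `S → Λˢᵣ(X, E*)`. -/
def Lambda.SmoothCurve {s r : ℕ} (S : Set ℝ) (γ : ℝ → Lambda I F E s r) : Prop :=
  ∀ t ∈ S, ∀ (c : X) (β : Fin s → Module.Dual ℝ (EuclideanSpace ℝ (Fin m)))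
    (v : Fin r → EuclideanSpace ℝ (Fin m)) (f : F),
    ContMDiffWithinAt (𝓘(ℝ, ℝ).prod I) 𝓘(ℝ, ℝ) ∞
      (fun q : ℝ × X => dualTensorComp I F E c β v f q.2 ((γ q.1).1 q.2)) (S ×ˢ Set.univ) (t, c)

/-- `γ̇(t) = γ'` for a curve of `E`-valued forms, at each point and on each family of vectors. -/
def Omega.HasTimeDeriv {k : ℕ} (S : Set ℝ) (γ : ℝ → Omega I F E k) (t : ℝ)
    (γ' : ∀ x : X, (Fin k → TangentSpace I x) → E x) : Prop :=
  ∀ (x : X) (w : Fin k → TangentSpace I x),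
    HasDerivWithinAt (fun s => bundleCoord F E x x ((γ s).1 x w)) (bundleCoord F E x x (γ' x w)) S t

/-- `γ̇(t) = γ'` for a curve of `E*`-valued forms. -/
def OmegaDual.HasTimeDeriv {j : ℕ} (S : Set ℝ) (γ : ℝ → OmegaDual I F E j) (t : ℝ)
    (γ' : ∀ x : X, (Fin j → TangentSpace I x) → E x → ℝ) : Prop :=
  ∀ (x : X) (w : Fin j → TangentSpace I x) (e : E x),
    HasDerivWithinAt (fun s => (γ s).1 x w e) (γ' x w e) S t

/-- `γ̇(t) = γ'` for a curve in `Λˢᵣ(X, E*)`. -/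
def Lambda.HasTimeDeriv {s r : ℕ} (S : Set ℝ) (γ : ℝ → Lambda I F E s r) (t : ℝ)
    (γ' : ∀ x : X, (Fin s → Module.Dual ℝ (TangentSpace I x)) → (Fin r → TangentSpace I x) →
      E x → ℝ) : Prop :=
  ∀ (x : X) (β : Fin s → Module.Dual ℝ (TangentSpace I x)) (w : Fin r → TangentSpace I x)
    (e : E x), HasDerivWithinAt (fun s => (γ s).1 x β w e) (γ' x β w e) S t

end Curves

/-! ## Manifolds with boundary: pairings, Lagrangians and Lagrange--Dirac systems -/

section Boundary

variable {n : ℕ}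
  {M : Type*} [TopologicalSpace M] [ChartedSpace (EuclideanHalfSpace (n + 1)) M]
  [IsManifold (𝓡∂ (n + 1)) ∞ M] [T2Space M] [CompactSpace M]
  {N : Type*} [TopologicalSpace N] [ChartedSpace (EuclideanSpace ℝ (Fin n)) N]
  [IsManifold (𝓡 n) ∞ N] [T2Space N] [CompactSpace N]
  {F : Type*} [NormedAddCommGroup F] [NormedSpace ℝ F]
  {E : M → Type*} [∀ x, AddCommGroup (E x)] [∀ x, Module ℝ (E x)]
  [TopologicalSpace (Bundle.TotalSpace F E)] [∀ x, TopologicalSpace (E x)]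
  [FiberBundle F E] [VectorBundle ℝ F E]

/-- `ι : N → M` exhibits the manifold `N` as the boundary of `M`. -/
structure IsBoundaryInclusion (ι : C^∞⟮𝓡 n, N; 𝓡∂ (n + 1), M⟯) : Prop where
  isEmbedding : Topology.IsEmbedding ι
  injective_mfderiv : ∀ p, Function.Injective (mfderiv (𝓡 n) (𝓡∂ (n + 1)) ι p)
  range_eq : Set.range ι = (𝓡∂ (n + 1)).boundary M

/-- An outward pointing vector at a boundary point: minus the first coordinate vector of the
preferred chart, which takes values in the half-space where the first coordinate is `≥ 0`. -/
def outward (x : M) : TangentSpace (𝓡∂ (n + 1)) x :=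
  -(EuclideanSpace.basisFun (Fin (n + 1)) ℝ 0 : EuclideanSpace ℝ (Fin (n + 1)))

/-- The sign of a frame of the boundary for the induced orientation: a frame is positive if,
preceded by an outward pointing vector, it is a positive frame of `M`. -/
def boundarySign (o : ManifoldOrientation (𝓡∂ (n + 1)) M) (ι : C^∞⟮𝓡 n, N; 𝓡∂ (n + 1), M⟯)
    (p : N) (u : Fin n → TangentSpace (𝓡 n) p) : ℝ :=
  frameSign (o.orient (ι p))
    (Fin.cons (outward (ι p)) fun i => mfderiv (𝓡 n) (𝓡∂ (n + 1)) ι p (u i))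

/-- The differential of `ι` at `p`. -/
def tangentMap (ι : C^∞⟮𝓡 n, N; 𝓡∂ (n + 1), M⟯) (p : N) :
    TangentSpace (𝓡 n) p →ₗ[ℝ] TangentSpace (𝓡∂ (n + 1)) (ι p) :=
  (mfderiv (𝓡 n) (𝓡∂ (n + 1)) ι p).toLinearMap

/-- The pull-back `ι* φ` of an `E`-valued form, a form with values in the pull-back bundle. -/
def pullForm (ι : C^∞⟮𝓡 n, N; 𝓡∂ (n + 1), M⟯) {k : ℕ} (φ : ∀ x : M, Form (𝓡∂ (n + 1)) E k x)
    (p : N) : Form (𝓡 n) (ι *ᵖ E) k p :=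
  (φ (ι p)).compLinearMap (tangentMap ι p)

/-- The pull-back `ι* θ` of an `E*`-valued form. -/
def pullDualForm (ι : C^∞⟮𝓡 n, N; 𝓡∂ (n + 1), M⟯) {j : ℕ}
    (θ : ∀ x : M, DualForm (𝓡∂ (n + 1)) E j x) (p : N) : DualForm (𝓡 n) (ι *ᵖ E) j p :=
  (θ (ι p)).compLinearMap (tangentMap ι p)

/-- The pull-back `ι* χ` of a section of `⋀ˢ TM ⊗ ⋀ʳ T*M ⊗ E*`, evaluated on `s` covectors
of `N`, on `r` vectors of `N` and on `e ∈ E`: the vectors are pushed forward by `Tι`, and the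
covectors are extended from `T_p N` to `T_{ι p} M` by means of a left inverse of `Tι`. For
`χ = tr ξ` with `ξ ∈ Λᵏ⁺¹ₘ(M, E*)` this does not depend on the left inverse, and it satisfies
`(ι* χ) • (ι* φ) = ι*(χ • φ)`. -/
def pullDualTensor (ι : C^∞⟮𝓡 n, N; 𝓡∂ (n + 1), M⟯) {s r : ℕ}
    (χ : ∀ x : M, DualTensor (𝓡∂ (n + 1)) E s r x) (p : N)
    (β : Fin s → Module.Dual ℝ (TangentSpace (𝓡 n) p)) (u : Fin r → TangentSpace (𝓡 n) p)
    (e : (ι *ᵖ E) p) : ℝ :=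
  χ (ι p) (fun i => β i ∘ₗ (tangentMap ι p).leftInverse) (fun i => tangentMap ι p (u i)) e

variable (F E) in
/-- The restricted dual `V⋆ = Λᵏₘ(M, E*) × Λᵏₘ₋₁(∂M, E*)` of `V = Ωᵏ(M, E)`, for `m = n + 1`. -/
abbrev DualStar (ι : C^∞⟮𝓡 n, N; 𝓡∂ (n + 1), M⟯) (k : ℕ) : Type _ :=
  Lambda (𝓡∂ (n + 1)) F E k (n + 1) × Lambda (𝓡 n) F (ι *ᵖ E) k n

variable (F E) in
/-- The restricted dual `V† = Ωᵐ⁻ᵏ(M, E*) × Ωᵐ⁻ᵏ⁻¹(∂M, E*)` of `V = Ωᵏ(M, E)`, for `m = n + 1`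
and `j = m - k - 1`. -/
abbrev DualDagger (ι : C^∞⟮𝓡 n, N; 𝓡∂ (n + 1), M⟯) (j : ℕ) : Type _ :=
  OmegaDual (𝓡∂ (n + 1)) F E (j + 1) × OmegaDual (𝓡 n) F (ι *ᵖ E) j

/-- The pairing `⟨(α, α_∂), φ⟩_⋆ = ∫_M α • φ + ∫_∂M α_∂ • ι* φ`. -/
def pairStar (o : ManifoldOrientation (𝓡∂ (n + 1)) M) (ι : C^∞⟮𝓡 n, N; 𝓡∂ (n + 1), M⟯) {k : ℕ}
    (a : DualStar F E ι k) (φ : Omega (𝓡∂ (n + 1)) F E k) : ℝ :=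
  integral (𝓡∂ (n + 1)) (fun x => frameSign (o.orient x))
      (fun x => contract (tangentBasis (𝓡∂ (n + 1)) x) (a.1.1 x) (φ.1 x))
    + integral (𝓡 n) (boundarySign o ι)
      (fun p => contract (tangentBasis (𝓡 n) p) (a.2.1 p) (pullForm ι φ.1 p))

/-- The pairing `⟨(α, α_∂), φ⟩_† = ∫_M φ ∧ α + ∫_∂M ι* φ ∧ α_∂`. -/
def pairDagger (o : ManifoldOrientation (𝓡∂ (n + 1)) M) (ι : C^∞⟮𝓡 n, N; 𝓡∂ (n + 1), M⟯)
    {k j : ℕ} (h : k + j = n) (a : DualDagger F E ι j) (φ : Omega (𝓡∂ (n + 1)) F E k) : ℝ :=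
  integral (𝓡∂ (n + 1)) (fun x => frameSign (o.orient x))
      (fun x => wedge (congrArg Nat.succ h) (φ.1 x) (a.1.1 x))
    + integral (𝓡 n) (boundarySign o ι) (fun p => wedge h (pullForm ι φ.1 p) (a.2.1 p))

/-- The pairing `⟨α, φ⟩_† = ∫_M φ ∧ α` for forms `φ` of degree `k = m`. In that case
`V† = Ω⁰(M, E*) × {0}`, since a form of degree `m - k - 1` on `∂M` is `0`, and the component `0` is
left out. -/
def pairDaggerTop (o : ManifoldOrientation (𝓡∂ (n + 1)) M) {k : ℕ} (h : k = n + 1)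
    (a : OmegaDual (𝓡∂ (n + 1)) F E 0) (φ : Omega (𝓡∂ (n + 1)) F E k) : ℝ :=
  integral (𝓡∂ (n + 1)) (fun x => frameSign (o.orient x)) (fun x => wedge (j := 0) h (φ.1 x) (a.1 x))

/-- A fibre preserving map
`(⋀ᵏ T*M ⊗ E) ×_M (⋀ᵏ T*M ⊗ E) ×_M (⋀ᵏ⁺¹ T*M ⊗ E) → ⋀ᵐ T*M`, for `m = n + 1`. -/
abbrev Density (n : ℕ) {M : Type*} [TopologicalSpace M]
    [ChartedSpace (EuclideanHalfSpace (n + 1)) M] (E : M → Type*) [∀ x, AddCommGroup (E x)]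
    [∀ x, Module ℝ (E x)] (k : ℕ) : Type _ :=
  ∀ x : M, Form (𝓡∂ (n + 1)) E k x → Form (𝓡∂ (n + 1)) E k x → Form (𝓡∂ (n + 1)) E (k + 1) x →
    (TangentSpace (𝓡∂ (n + 1)) x [⋀^Fin (n + 1)]→ₗ[ℝ] ℝ)

variable (F E) in
/-- The element of `⋀ᵏ T*_x M ⊗ E_x` with given components in the chart and trivialization
at `c`. -/
def formOfCoord {k : ℕ} (c x : M) (a : EuclideanSpace ℝ (Fin (n + 1)) [⋀^Fin k]→L[ℝ] F) :
    Form (𝓡∂ (n + 1)) E k x :=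
  (bundleVec F E c x).compAlternatingMap
    (a.toAlternatingMap.compLinearMap (tangentCoord (𝓡∂ (n + 1)) c x))

variable (F) in
/-- Smoothness of a density as a map between total spaces: in charts and trivializations it is a
smooth function of the base point and of the components of its arguments. -/
def Density.IsSmooth {k : ℕ} (ℒ : Density n E k) : Prop :=
  ∀ (c : M) (a₀ : (EuclideanSpace ℝ (Fin (n + 1)) [⋀^Fin k]→L[ℝ] F) ×
      (EuclideanSpace ℝ (Fin (n + 1)) [⋀^Fin k]→L[ℝ] F) ×
      (EuclideanSpace ℝ (Fin (n + 1)) [⋀^Fin (k + 1)]→L[ℝ] F)),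
    ContMDiffAt ((𝓡∂ (n + 1)).prod 𝓘(ℝ, (EuclideanSpace ℝ (Fin (n + 1)) [⋀^Fin k]→L[ℝ] F) ×
      (EuclideanSpace ℝ (Fin (n + 1)) [⋀^Fin k]→L[ℝ] F) ×
      (EuclideanSpace ℝ (Fin (n + 1)) [⋀^Fin (k + 1)]→L[ℝ] F))) 𝓘(ℝ, ℝ) ∞
      (fun q : M × ((EuclideanSpace ℝ (Fin (n + 1)) [⋀^Fin k]→L[ℝ] F) ×
          (EuclideanSpace ℝ (Fin (n + 1)) [⋀^Fin k]→L[ℝ] F) ×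
          (EuclideanSpace ℝ (Fin (n + 1)) [⋀^Fin (k + 1)]→L[ℝ] F)) =>
        ℒ q.1 (formOfCoord F E c q.1 q.2.1) (formOfCoord F E c q.1 q.2.2.1)
          (formOfCoord F E c q.1 q.2.2.2) (chartFrame (𝓡∂ (n + 1)) c q.1))
      (c, a₀)

variable [∀ x, IsTopologicalAddGroup (E x)] [∀ x, ContinuousSMul ℝ (E x)]

/-- The Lagrangian `L_∇(φ, ν) = ∫_M ℒ(φ, ν, d^∇ φ)`. -/
def lagrangian (o : ManifoldOrientation (𝓡∂ (n + 1)) M)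
    (nab : CovariantDerivative (𝓡∂ (n + 1)) F E) {k : ℕ} (ℒ : Density n E k)
    (φ ν : Omega (𝓡∂ (n + 1)) F E k) : ℝ :=
  integral (𝓡∂ (n + 1)) (fun x => frameSign (o.orient x))
    (fun x => ℒ x (φ.1 x) (ν.1 x) (extCovDeriv nab φ x))

section Derivatives

variable (nab : CovariantDerivative (𝓡∂ (n + 1)) F E) {k : ℕ} (ℒ : Density n E k)
  (φ ν : Omega (𝓡∂ (n + 1)) F E k)

/-- `∂ℒ/∂φ (φ, ν, d^∇ φ) ∈ Λᵏₘ(M, E*)`. -/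
def derivPhi (x : M) : DualTensor (𝓡∂ (n + 1)) E k (n + 1) x :=
  fiberDeriv (tangentBasis (𝓡∂ (n + 1)) x)
    (fun a => ℒ x a (ν.1 x) (extCovDeriv nab φ x)) (φ.1 x)

/-- `∂ℒ/∂ν (φ, ν, d^∇ φ) ∈ Λᵏₘ(M, E*)`. -/
def derivNu (x : M) : DualTensor (𝓡∂ (n + 1)) E k (n + 1) x :=
  fiberDeriv (tangentBasis (𝓡∂ (n + 1)) x)
    (fun a => ℒ x (φ.1 x) a (extCovDeriv nab φ x)) (ν.1 x)

/-- `∂ℒ/∂ζ (φ, ν, d^∇ φ) ∈ Λᵏ⁺¹ₘ(M, E*)`. -/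
def derivZeta (x : M) : DualTensor (𝓡∂ (n + 1)) E (k + 1) (n + 1) x :=
  fiberDeriv (tangentBasis (𝓡∂ (n + 1)) x)
    (fun a => ℒ x (φ.1 x) (ν.1 x) a) (extCovDeriv nab φ x)

/-- The fibre derivative in the direction of `φ`, in the realisation `Ωᵐ⁻ᵏ(M, E*)`. -/
def derivWedgePhi {j : ℕ} (h : k + j = n + 1) (x : M) : DualForm (𝓡∂ (n + 1)) E j x :=
  fiberDerivWedge h (fun a => ℒ x a (ν.1 x) (extCovDeriv nab φ x)) (φ.1 x)

/-- The fibre derivative in the direction of `ν`, in the realisation `Ωᵐ⁻ᵏ(M, E*)`. -/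
def derivWedgeNu {j : ℕ} (h : k + j = n + 1) (x : M) : DualForm (𝓡∂ (n + 1)) E j x :=
  fiberDerivWedge h (fun a => ℒ x (φ.1 x) a (extCovDeriv nab φ x)) (ν.1 x)

/-- The fibre derivative in the direction of `ζ`, in the realisation `Ωᵐ⁻ᵏ⁻¹(M, E*)`. -/
def derivWedgeZeta {j : ℕ} (h : k + 1 + j = n + 1) (x : M) : DualForm (𝓡∂ (n + 1)) E j x :=
  fiberDerivWedge h (fun a => ℒ x (φ.1 x) (ν.1 x) a) (extCovDeriv nab φ x)

end Derivatives

variable (o : ManifoldOrientation (𝓡∂ (n + 1)) M) (ι : C^∞⟮𝓡 n, N; 𝓡∂ (n + 1), M⟯)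
  (nab : CovariantDerivative (𝓡∂ (n + 1)) F E) {k : ℕ} (ℒ : Density n E k)

/-- The curve `(φ, ν, α, α_∂) : S → TV ⊕ T⋆V` solves the forced Lagrange--Dirac system
`(V, D_{T⋆V}, L_∇, f)`. -/
def IsSolutionStar
    (f : Omega (𝓡∂ (n + 1)) F E k → Omega (𝓡∂ (n + 1)) F E k → DualStar F E ι k) (S : Set ℝ)
    (φ ν : ℝ → Omega (𝓡∂ (n + 1)) F E k) (α : ℝ → Lambda (𝓡∂ (n + 1)) F E k (n + 1))
    (αb : ℝ → Lambda (𝓡 n) F (ι *ᵖ E) k n) : Prop :=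
  ∀ t ∈ S, ∃ (dφ : Omega (𝓡∂ (n + 1)) F E k) (dα : Lambda (𝓡∂ (n + 1)) F E k (n + 1))
    (dαb : Lambda (𝓡 n) F (ι *ᵖ E) k n),
    Omega.HasTimeDeriv S φ t (fun x w => dφ.1 x w) ∧
    Lambda.HasTimeDeriv S α t (fun x β w e => dα.1 x β w e) ∧
    Lambda.HasTimeDeriv S αb t (fun x β w e => dαb.1 x β w e) ∧
    LagrangeDiracCondition (pairStar o ι) (lagrangian o nab ℒ) f (φ t) (ν t) (α t, αb t) dφ (dα, dαb)

/-- The curve `(φ, ν, α, α_∂) : S → TV ⊕ T†V` solves the forced Lagrange--Dirac system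
`(V, D_{T†V}, L_∇, f)`, for `k < m`. -/
def IsSolutionDagger {j : ℕ} (h : k + j = n)
    (f : Omega (𝓡∂ (n + 1)) F E k → Omega (𝓡∂ (n + 1)) F E k → DualDagger F E ι j) (S : Set ℝ)
    (φ ν : ℝ → Omega (𝓡∂ (n + 1)) F E k) (α : ℝ → OmegaDual (𝓡∂ (n + 1)) F E (j + 1))
    (αb : ℝ → OmegaDual (𝓡 n) F (ι *ᵖ E) j) : Prop :=
  ∀ t ∈ S, ∃ (dφ : Omega (𝓡∂ (n + 1)) F E k) (dα : OmegaDual (𝓡∂ (n + 1)) F E (j + 1))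
    (dαb : OmegaDual (𝓡 n) F (ι *ᵖ E) j),
    Omega.HasTimeDeriv S φ t (fun x w => dφ.1 x w) ∧
    OmegaDual.HasTimeDeriv S α t (fun x w e => dα.1 x w e) ∧
    OmegaDual.HasTimeDeriv S αb t (fun x w e => dαb.1 x w e) ∧
    LagrangeDiracCondition (pairDagger o ι h) (lagrangian o nab ℒ) f (φ t) (ν t) (α t, αb t)
      dφ (dα, dαb)

/-- The curve `(φ, ν, α, 0) : S → TV ⊕ T†V` solves the forced Lagrange--Dirac system
`(V, D_{T†V}, L_∇, f)`, for `k = m`. -/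
def IsSolutionDaggerTop (h : k = n + 1)
    (f : Omega (𝓡∂ (n + 1)) F E k → Omega (𝓡∂ (n + 1)) F E k → OmegaDual (𝓡∂ (n + 1)) F E 0)
    (S : Set ℝ) (φ ν : ℝ → Omega (𝓡∂ (n + 1)) F E k)
    (α : ℝ → OmegaDual (𝓡∂ (n + 1)) F E 0) : Prop :=
  ∀ t ∈ S, ∃ (dφ : Omega (𝓡∂ (n + 1)) F E k) (dα : OmegaDual (𝓡∂ (n + 1)) F E 0),
    Omega.HasTimeDeriv S φ t (fun x w => dφ.1 x w) ∧
    OmegaDual.HasTimeDeriv S α t (fun x w e => dα.1 x w e) ∧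
    LagrangeDiracCondition (pairDaggerTop o h) (lagrangian o nab ℒ) f (φ t) (ν t) (α t) dφ dα

end Boundary
end LagrangeDirac
end

open scoped Manifold ContDiff Topology Bundle

noncomputable section

namespace LagrangeDirac

set_option linter.unusedSectionVars false

/-! ### Contraction and trace of skew tensors in one fibre. -/

section ContractAlgebra

variable {T A : Type*} [AddCommGroup T] [Module ℝ T] [AddCommMonoid A] [Module ℝ A]

/-! Condition (1) is an identity between covectors on `V × V*`. If the pairing of `V*` with `V` is
bilinear and nondegenerate on both sides, then testing it on tangent vectors `(0, c)` and `(v, 0)`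
turns it into `φ̇ = ν`, `p = δL/δν`, `ṗ = δL/δφ + f` (`lagrangeDiracCondition_iff`). It remains to
prove nondegeneracy and to compute the two representatives.

Nondegeneracy is treated for the three pairings at once (`IsFieldPairing`). Multiplying a test form
by a bump function localises the integrals. Bumps supported away from the boundary kill the interior
field at interior points, hence everywhere by continuity; bumps around a boundary point then see the
boundary integral alone. Pointwise one needs that contraction and wedge product are nondegenerate in
a fibre (`contract_smulRight`, `eq_zero_of_wedge_left`, `exists_contract_eq`, `exists_wedge_eq`) and
that a smooth form can have any prescribed value at a point (`exists_omega_eq`).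

For the representatives, differentiation under the integral sign gives `δL/δν (δ) = ∫ ∂ℒ/∂ν • δ`,
which has no boundary part; this is why `α_∂ = 0`. It also gives `δL/δφ (δ) = ∫ ∂ℒ/∂φ • δ + ∂ℒ/∂ζ •
d^∇ δ`. The last term is integrated by parts. With `χ = ∂ℒ/∂ζ` the Leibniz rule reads `d((tr χ) • δ)
= χ • d^∇ δ + (-1)ᵏ (div χ) • δ`, and in the other realisation `d(δ ∧ ψ) = d^∇ δ ∧ ψ + (-1)ᵏ δ ∧
d^{∇*} ψ`. Both rest on an identity of multilinear algebra (`alternatize_contract`,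
`alternatize_wedge`) and on the Leibniz rule of the dual connection (`mvfderiv_pairing`). Stokes'
theorem (`stokes`) moves the exact term to the boundary, where it becomes the pairing of `ι* δ` with
`ι*(tr χ)` or with `ι* ψ`. For tensors this uses that the pull-back of a trace does not depend on
how covectors are extended (`pullTensor_trace_eq`).

Elements of `V*` have to be smooth, whereas fibre derivatives and divergences are given point by
point. Smoothness is obtained by testing: a field whose products with all smooth test forms are
smooth is smooth (`mem_Lambda_of_contract`, `mem_OmegaDual_of_wedge`). For the combination with the
divergence that product is the difference of two smooth top forms.

Derivatives, frames and traces are written at each point in the preferred chart of that point, which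
varies discontinuously. Each is therefore first shown to be independent of the basis or chart, and
then computed near `c` in the chart at `c`. In the same way the integral of a form supported in one
coordinate domain is computed in these coordinates (`integral_eq_setIntegral_image`), which together
with a partition of unity reduces Stokes' theorem to the divergence theorem on a half-space. -/

/-- An injective multi-index is an increasing one composed with a unique permutation, found by
sorting. -/
theorem sum_pi_eq_factorial_mul_sum_orderEmb {k m : ℕ} (G : (Fin k → Fin m) → ℝ)
    (hperm : ∀ K (σ : Equiv.Perm (Fin k)), G (K ∘ σ) = G K)
    (hinj : ∀ K, ¬ Function.Injective K → G K = 0) :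
    ∑ K, G K = k.factorial * ∑ J : Fin k ↪o Fin m, G J := by
  have h := Fintype.sum_of_injective
    (fun q : (Fin k ↪o Fin m) × Equiv.Perm (Fin k) => (q.1 : Fin k → Fin m) ∘ q.2) ?_
    (fun q => G q.1) G ?_ (fun q => (hperm _ _).symm)
  · rw [← h, Fintype.sum_prod_type, Finset.mul_sum]
    simp [Fintype.card_perm]
  · rintro ⟨J, σ⟩ ⟨J', σ'⟩ h
    have hr : Set.range J = Set.range J' := by
      have := congrArg Set.range h
      simpa [Set.range_comp] using this
    have hJ : J = J' := by
      rw [← OrderEmbedding.range_inj]; exact hr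
    subst hJ
    have : σ = σ' := by
      ext i
      have := congrFun h i
      exact congrArg Fin.val (J.injective this)
    rw [this]
  · intro K hK
    refine hinj K fun hKi => hK ?_
    have hs : StrictMono (K ∘ Tuple.sort K) :=
      (Tuple.monotone_sort K).strictMono_of_injective (hKi.comp (Tuple.sort K).injective)
    refine ⟨(OrderEmbedding.ofStrictMono _ hs, (Tuple.sort K)⁻¹), ?_⟩
    funext i
    simp

theorem AlternatingMap.sum_apply' {W Y ι κ : Type*} [AddCommMonoid W] [Module ℝ W]
    [AddCommMonoid Y] [Module ℝ Y] (s : Finset ι) (f : ι → W [⋀^κ]→ₗ[ℝ] Y) (v : κ → W) :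
    (∑ i ∈ s, f i) v = ∑ i ∈ s, f i v :=
  map_sum (⟨⟨fun f : W [⋀^κ]→ₗ[ℝ] Y => f v, rfl⟩, fun _ _ => rfl⟩ : (W [⋀^κ]→ₗ[ℝ] Y) →+ Y) f s

theorem contract_apply {m k r : ℕ} (b : Module.Basis (Fin m) ℝ T) (χ : SkewTensor T A k r)
    (φ : T [⋀^Fin k]→ₗ[ℝ] A) (u : Fin r → T) :
    contract b χ φ u =
      ∑ J : Fin k ↪o Fin m, χ (fun i => b.coord (J i)) u (φ fun i => b (J i)) := by
  simp [contract, AlternatingMap.sum_apply']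

theorem AlternatingMap.map_perm' {W Y : Type*} [AddCommMonoid W] [Module ℝ W] [AddCommGroup Y]
    [Module ℝ Y] {k : ℕ} (Φ : W [⋀^Fin k]→ₗ[ℝ] Y) (w : Fin k → W) (σ : Equiv.Perm (Fin k)) :
    Φ (fun i => w (σ i)) = ((Equiv.Perm.sign σ : ℤ) : ℝ) • Φ w := by
  have := Φ.map_perm w σ
  rw [Function.comp_def] at this
  rw [this, Units.smul_def, Int.cast_smul_eq_zsmul]

/-- Unrestricted multi-indices, with the factor `1 / k!`, are easier to reindex and to expand
multilinearly than increasing ones. -/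
theorem contract_eq_sum {m k r : ℕ} (b : Module.Basis (Fin m) ℝ T) (χ : SkewTensor T A k r)
    (φ : T [⋀^Fin k]→ₗ[ℝ] A) (u : Fin r → T) :
    contract b χ φ u = (k.factorial : ℝ)⁻¹ *
      ∑ K : Fin k → Fin m, χ (fun i => b.coord (K i)) u (φ fun i => b (K i)) := by
  let _ : AddCommGroup A := Module.addCommMonoidToAddCommGroup ℝ
  rw [sum_pi_eq_factorial_mul_sum_orderEmb, contract_apply, ← mul_assoc, inv_mul_cancel₀, one_mul]
  · positivity
  · intro K σ
    have h1 := AlternatingMap.map_perm' (Y := T [⋀^Fin r]→ₗ[ℝ] Module.Dual ℝ A) χ (fun i => b.coord (K i)) σ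
    have h2 := AlternatingMap.map_perm' φ (fun i => b (K i)) σ
    simp only [Function.comp_apply]
    rw [h1, h2]
    rcases Int.units_eq_one_or (Equiv.Perm.sign σ) with h | h <;> simp [h]
  · intro K hK
    rw [AlternatingMap.map_eq_zero_of_not_injective χ]
    · simp
    · intro h
      apply hK
      intro i j hij
      exact h (by simp [hij])

/-- Expansion of an alternating map on linear combinations. -/
theorem factorial_smul_map_sum {W Y : Type*} [AddCommMonoid W] [Module ℝ W] [AddCommGroup Y]
    [Module ℝ Y] {k m : ℕ} (Φ : W [⋀^Fin k]→ₗ[ℝ] Y) (C : Fin k → Fin m → ℝ) (w : Fin m → W) :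
    (k.factorial : ℝ) • Φ (fun j => ∑ l, C j l • w l) =
      ∑ K : Fin k → Fin m, (Matrix.of fun j i => C j (K i)).det • Φ (fun i => w (K i)) := by
  have h1 : ∀ C : Fin k → Fin m → ℝ, Φ (fun j => ∑ l, C j l • w l) =
      ∑ K : Fin k → Fin m, (∏ i, C i (K i)) • Φ (fun i => w (K i)) := by
    intro C
    have := Φ.toMultilinearMap.map_sum (fun j l => C j l • w l)
    simp only [AlternatingMap.coe_multilinearMap] at this
    rw [this]
    refine Finset.sum_congr rfl fun K _ => ?_
    exact Φ.toMultilinearMap.map_smul_univ (fun i => C i (K i)) (fun i => w (K i))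
  simp only [Matrix.det_apply', Matrix.of_apply, Finset.sum_smul]
  rw [Finset.sum_comm]
  -- Each permutation in the Leibniz formula for the determinant contributes the same value: its
  -- sign is undone by alternation.
  have h2 : ∀ σ : Equiv.Perm (Fin k),
      ∑ K : Fin k → Fin m, (((Equiv.Perm.sign σ : ℤ) : ℝ) * ∏ i, C (σ i) (K i)) •
        Φ (fun i => w (K i)) = Φ (fun j => ∑ l, C j l • w l) := by
    intro σ
    simp only [mul_smul]
    rw [← Finset.smul_sum, ← h1 (fun i => C (σ i)),
      AlternatingMap.map_perm' Φ (fun j => ∑ l, C j l • w l) σ, smul_smul]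
    rcases Int.units_eq_one_or (Equiv.Perm.sign σ) with h | h <;> simp [h]
  rw [Finset.sum_congr rfl fun σ _ => h2 σ]
  simp [Fintype.card_perm, Nat.cast_smul_eq_nsmul]

/-- `β₁ ∧ … ∧ β_k`, an alternating function of the covectors `βᵢ` and of vectors. -/
def detForm (T : Type*) [AddCommGroup T] [Module ℝ T] (k : ℕ) :
    Module.Dual ℝ T [⋀^Fin k]→ₗ[ℝ] (T [⋀^Fin k]→ₗ[ℝ] ℝ) :=
  -- A determinant may be read by rows or by columns, so alternation in the covectors follows from
  -- alternation in the vectors.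
  have key : ∀ (β : Fin k → Module.Dual ℝ T) (v : Fin k → T),
      Matrix.detRowAlternating.compLinearMap (LinearMap.pi β) v =
      Matrix.detRowAlternating.compLinearMap
        (LinearMap.pi fun i => Module.Dual.eval ℝ T (v i)) β := by
    intro β v
    exact (Matrix.det_transpose _).symm
  { toFun := fun β => Matrix.detRowAlternating.compLinearMap (LinearMap.pi β)
    map_update_add' := by
      intro _ β i x y
      obtain rfl : ‹DecidableEq (Fin k)› = instDecidableEqFin k := Subsingleton.elim _ _
      ext v
      rw [AlternatingMap.add_apply, key, key, key, AlternatingMap.map_update_add]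
    map_update_smul' := by
      intro _ β i a x
      obtain rfl : ‹DecidableEq (Fin k)› = instDecidableEqFin k := Subsingleton.elim _ _
      ext v
      rw [AlternatingMap.smul_apply, key, key, AlternatingMap.map_update_smul]
    map_eq_zero_of_eq' := by
      intro β i j h hij
      ext v
      rw [key, AlternatingMap.map_eq_zero_of_eq _ _ h hij]
      rfl }

theorem detForm_apply {k : ℕ} (β : Fin k → Module.Dual ℝ T) (v : Fin k → T) :
    detForm T k β v = (Matrix.of fun j i => β i (v j)).det := rfl

theorem detForm_apply' {k : ℕ} (β : Fin k → Module.Dual ℝ T) (v : Fin k → T) :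
    detForm T k β v = (Matrix.of fun j i => β j (v i)).det := (Matrix.det_transpose _).symm

/-- Expanding `β` in the dual basis of `b` produces exactly the minors that occur in
`contract_eq_sum`. The value does not mention `b`, so this formula recovers a tensor from its
contractions and also yields independence of the basis. -/
theorem contract_smulRight {m k r : ℕ} (b : Module.Basis (Fin m) ℝ T) (χ : SkewTensor T A k r)
    (β : Fin k → Module.Dual ℝ T) (e : A) (u : Fin r → T) :
    contract b χ ((detForm T k β).smulRight e) u = χ β u e := by
  rw [contract_eq_sum]
  have h := factorial_smul_map_sum (Y := T [⋀^Fin r]→ₗ[ℝ] Module.Dual ℝ A) χ (fun j l => β j (b l)) (fun l => b.coord l)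
  have hβ : (fun j => ∑ l, β j (b l) • b.coord l) = β := by
    funext j
    refine b.ext fun l => ?_
    simp [Finsupp.single_apply]
  rw [hβ] at h
  have h2 := congrArg (fun Z : T [⋀^Fin r]→ₗ[ℝ] Module.Dual ℝ A => Z u e) h
  simp only [AlternatingMap.smul_apply, LinearMap.smul_apply, smul_eq_mul,
    AlternatingMap.sum_apply', LinearMap.sum_apply] at h2
  simp only [AlternatingMap.smulRight_apply, map_smul, smul_eq_mul, detForm_apply']
  rw [← h2, ← mul_assoc, inv_mul_cancel₀ (by positivity), one_mul]

theorem sum_detForm_smulRight {m k : ℕ} (b : Module.Basis (Fin m) ℝ T)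
    (φ : T [⋀^Fin k]→ₗ[ℝ] A) :
    (k.factorial : ℝ)⁻¹ • ∑ K : Fin k → Fin m,
      (detForm T k fun i => b.coord (K i)).smulRight (φ fun i => b (K i)) = φ := by
  let _ : AddCommGroup A := Module.addCommMonoidToAddCommGroup ℝ
  ext v
  have h := factorial_smul_map_sum φ (fun j l => b.coord l (v j)) b
  have hv : (fun j => ∑ l, b.coord l (v j) • b l) = v := by
    funext j; simp [Module.Basis.sum_repr]
  rw [hv] at h
  simp only [AlternatingMap.smul_apply, AlternatingMap.sum_apply', AlternatingMap.smulRight_apply,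
    detForm_apply]
  rw [← h, smul_smul, inv_mul_cancel₀ (by positivity), one_smul]

theorem contract_add_right {m k r : ℕ} (b : Module.Basis (Fin m) ℝ T) (χ : SkewTensor T A k r)
    (φ φ' : T [⋀^Fin k]→ₗ[ℝ] A) : contract b χ (φ + φ') = contract b χ φ + contract b χ φ' := by
  ext u; simp [contract_apply, Finset.sum_add_distrib]

theorem contract_smul_right {m k r : ℕ} (b : Module.Basis (Fin m) ℝ T) (χ : SkewTensor T A k r)
    (a : ℝ) (φ : T [⋀^Fin k]→ₗ[ℝ] A) : contract b χ (a • φ) = a • contract b χ φ := by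
  ext u; simp [contract_apply, Finset.mul_sum]

theorem contract_add_left {m k r : ℕ} (b : Module.Basis (Fin m) ℝ T) (χ χ' : SkewTensor T A k r)
    (φ : T [⋀^Fin k]→ₗ[ℝ] A) : contract b (χ + χ') φ = contract b χ φ + contract b χ' φ := by
  ext u; simp [contract_apply, Finset.sum_add_distrib]

theorem contract_smul_left {m k r : ℕ} (b : Module.Basis (Fin m) ℝ T) (a : ℝ)
    (χ : SkewTensor T A k r) (φ : T [⋀^Fin k]→ₗ[ℝ] A) :
    contract b (a • χ) φ = a • contract b χ φ := by
  ext u; simp [contract_apply, Finset.mul_sum]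

/-- The contraction as a bilinear map. -/
def contractₗ {m : ℕ} (b : Module.Basis (Fin m) ℝ T) (A : Type*) [AddCommMonoid A] [Module ℝ A]
    (k r : ℕ) : SkewTensor T A k r →ₗ[ℝ] (T [⋀^Fin k]→ₗ[ℝ] A) →ₗ[ℝ] (T [⋀^Fin r]→ₗ[ℝ] ℝ) :=
  LinearMap.mk₂ ℝ (contract b) (contract_add_left b) (contract_smul_left b)
    (contract_add_right b) (fun a χ φ => contract_smul_right b χ a φ)

theorem contractₗ_apply {m k r : ℕ} (b : Module.Basis (Fin m) ℝ T) (χ : SkewTensor T A k r)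
    (φ : T [⋀^Fin k]→ₗ[ℝ] A) : contractₗ b A k r χ φ = contract b χ φ := rfl

/-- A linear map out of `⋀ᵏ T* ⊗ A` in terms of its values on decomposable elements. -/
theorem map_eq_sum_smulRight {m k : ℕ} {Y : Type*} [AddCommGroup Y] [Module ℝ Y]
    (b : Module.Basis (Fin m) ℝ T) (l : (T [⋀^Fin k]→ₗ[ℝ] A) →ₗ[ℝ] Y) (φ : T [⋀^Fin k]→ₗ[ℝ] A) :
    l φ = (k.factorial : ℝ)⁻¹ • ∑ K : Fin k → Fin m,
      l ((detForm T k fun i => b.coord (K i)).smulRight (φ fun i => b (K i))) := by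
  conv_lhs => rw [← sum_detForm_smulRight b φ]
  simp

/-- Both sides are linear in the form, and on decomposable forms `contract_smulRight` gives the same
value for every basis. -/
theorem contract_eq_of_basis {m k r : ℕ} (b b' : Module.Basis (Fin m) ℝ T)
    (χ : SkewTensor T A k r) (φ : T [⋀^Fin k]→ₗ[ℝ] A) : contract b χ φ = contract b' χ φ := by
  ext u
  rw [← contractₗ_apply b', map_eq_sum_smulRight b, contract_eq_sum]
  simp [AlternatingMap.sum_apply', contractₗ_apply, contract_smulRight]

/-- Every linear map `⋀ᵏ T* ⊗ A → ⋀ʳ T*` is a contraction. -/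
theorem exists_contract_eq {m k r : ℕ} (b : Module.Basis (Fin m) ℝ T)
    (l : (T [⋀^Fin k]→ₗ[ℝ] A) →ₗ[ℝ] (T [⋀^Fin r]→ₗ[ℝ] ℝ)) :
    ∃ χ : SkewTensor T A k r, ∀ φ, contract b χ φ = l φ := by
  have hadd : ∀ (f : T [⋀^Fin k]→ₗ[ℝ] ℝ) (e e' : A),
      f.smulRight (e + e') = f.smulRight e + f.smulRight e' := by
    intros; ext; simp
  have hsmul : ∀ (f : T [⋀^Fin k]→ₗ[ℝ] ℝ) (a : ℝ) (e : A),
      f.smulRight (a • e) = a • f.smulRight e := by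
    intro f a e; ext v; exact smul_comm (f v) a e
  have hadd' : ∀ (f g : T [⋀^Fin k]→ₗ[ℝ] ℝ) (e : A),
      (f + g).smulRight e = f.smulRight e + g.smulRight e := by
    intros; ext; simp [add_smul]
  have hsmul' : ∀ (f : T [⋀^Fin k]→ₗ[ℝ] ℝ) (a : ℝ) (e : A),
      (a • f).smulRight e = a • f.smulRight e := by
    intros; ext; simp [mul_smul]
  -- By `contract_smulRight` there is no choice: the value of the tensor on `β`, `u`, `e` must be `l
  -- (β₁ ∧ … ∧ β_k ⊗ e) u`.
  let inner : (Fin k → Module.Dual ℝ T) → (T [⋀^Fin r]→ₗ[ℝ] Module.Dual ℝ A) := fun β =>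
    { toFun := fun u =>
        { toFun := fun e => l ((detForm T k β).smulRight e) u
          map_add' := by intro e e'; simp [hadd]
          map_smul' := by intro a e; simp [hsmul] }
      map_update_add' := by intro _ u i x y; ext e; simp
      map_update_smul' := by intro _ u i a x; ext e; simp
      map_eq_zero_of_eq' := by
        intro u i j h hij; ext e; exact AlternatingMap.map_eq_zero_of_eq _ _ h hij }
  let χ : SkewTensor T A k r :=
    { toFun := inner
      map_update_add' := by
        intro _ β i x y; ext u e
        simp [inner, hadd']
      map_update_smul' := by
        intro _ β i a x; ext u e
        simp [inner, hsmul']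
      map_eq_zero_of_eq' := by
        intro β i j h hij; ext u e
        have : detForm T k β = 0 := AlternatingMap.map_eq_zero_of_eq _ _ h hij
        have h0 : (0 : T [⋀^Fin k]→ₗ[ℝ] ℝ).smulRight e = 0 := by ext; simp
        simp [inner, this, h0] }
  refine ⟨χ, fun φ => ?_⟩
  ext u
  rw [contract_eq_sum, map_eq_sum_smulRight b l]
  simp [AlternatingMap.sum_apply', χ, inner]

theorem eq_zero_of_contract_left {m k r : ℕ} (b : Module.Basis (Fin m) ℝ T)
    (χ : SkewTensor T A k r) (h : ∀ φ, contract b χ φ = 0) : χ = 0 := by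
  ext β u e
  rw [← contract_smulRight b χ β e u, h]; rfl

theorem trace_apply {m s r : ℕ} (b : Module.Basis (Fin m) ℝ T) (χ : SkewTensor T A (s + 1) (r + 1))
    (β : Fin s → Module.Dual ℝ T) (u : Fin r → T) (e : A) :
    trace b χ β u e = ∑ i, χ (Matrix.vecCons (b.coord i) β) (Matrix.vecCons (b i) u) e := by
  simp [trace, AlternatingMap.sum_apply', LinearMap.sum_apply, insertFirst]

/-- The tensor `∑ᵢ bⁱ ⊗ bᵢ` is the identity: expanding `bⁱ` in the dual basis of `b'`, and `b'ⱼ` in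
`b`, gives the same double sum. -/
theorem trace_eq_of_basis {m s r : ℕ} (b b' : Module.Basis (Fin m) ℝ T)
    (χ : SkewTensor T A (s + 1) (r + 1)) : trace b χ = trace b' χ := by
  ext β u e
  rw [trace_apply, trace_apply]
  have hB : ∀ (x : Module.Dual ℝ T) (v : T), χ (Matrix.vecCons x β) (Matrix.vecCons v u) e =
      (((χ.curryLeft x) β).curryLeft v) u e := by intros; rfl
  have h1 : ∀ i, χ (Matrix.vecCons (b.coord i) β) (Matrix.vecCons (b i) u) e =
      ∑ j, b.coord i (b' j) * χ (Matrix.vecCons (b'.coord j) β) (Matrix.vecCons (b i) u) e := by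
    intro i
    have : b.coord i = ∑ j, b.coord i (b' j) • b'.coord j := by
      refine b'.ext fun l => ?_
      simp [Finsupp.single_apply]
    conv_lhs => rw [hB, this]
    simp [hB, AlternatingMap.sum_apply', LinearMap.sum_apply]
  have h2 : ∀ j, χ (Matrix.vecCons (b'.coord j) β) (Matrix.vecCons (b' j) u) e =
      ∑ i, b.coord i (b' j) * χ (Matrix.vecCons (b'.coord j) β) (Matrix.vecCons (b i) u) e := by
    intro j
    have : b' j = ∑ i, b.coord i (b' j) • b i := by simp [Module.Basis.sum_repr]
    conv_lhs => rw [hB, this]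
    simp only [hB, map_sum, map_smul, AlternatingMap.sum_apply', LinearMap.sum_apply,
      AlternatingMap.smul_apply, LinearMap.smul_apply, smul_eq_mul]
  rw [Finset.sum_congr rfl fun i _ => h1 i, Finset.sum_comm, Finset.sum_congr rfl fun j _ => h2 j]

end ContractAlgebra

/-! ### Signed sums over permutations. -/

section SignedSum

variable {T : Type*}

/-- The signed sum of a function of `N` vectors over all permutations of its arguments. -/
def signedSum {N : ℕ} (G : (Fin N → T) → ℝ) (u : Fin N → T) : ℝ :=
  ∑ σ : Equiv.Perm (Fin N), ((Equiv.Perm.sign σ : ℤ) : ℝ) * G (u ∘ σ)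

theorem sign_mul_sign_cast {ι : Type*} [Fintype ι] [DecidableEq ι] (σ : Equiv.Perm ι) :
    ((Equiv.Perm.sign σ : ℤ) : ℝ) * ((Equiv.Perm.sign σ : ℤ) : ℝ) = 1 := by
  rcases Int.units_eq_one_or (Equiv.Perm.sign σ) with h | h <;> simp [h]

theorem signedSum_comp {N : ℕ} (G : (Fin N → T) → ℝ) (u : Fin N → T) (c : Equiv.Perm (Fin N)) :
    signedSum (fun w => G (w ∘ c)) u = ((Equiv.Perm.sign c : ℤ) : ℝ) * signedSum G u := by
  unfold signedSum
  rw [Finset.mul_sum]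
  refine Fintype.sum_equiv (Equiv.mulRight c) _ _ fun σ => ?_
  have : ((Equiv.Perm.sign (σ * c) : ℤ) : ℝ) =
      ((Equiv.Perm.sign σ : ℤ) : ℝ) * ((Equiv.Perm.sign c : ℤ) : ℝ) := by
    rw [Equiv.Perm.sign_mul]; push_cast; ring
  simp only [Equiv.coe_mulRight, this, Equiv.Perm.coe_mul]
  rw [Function.comp_assoc]
  linear_combination (- ((Equiv.Perm.sign σ : ℤ) : ℝ) * G (u ∘ (σ ∘ c))) * sign_mul_sign_cast c

theorem signedSum_add {N : ℕ} (G G' : (Fin N → T) → ℝ) (u : Fin N → T) :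
    signedSum (fun w => G w + G' w) u = signedSum G u + signedSum G' u := by
  simp [signedSum, mul_add, Finset.sum_add_distrib]

theorem signedSum_sum {N : ℕ} {ι : Type*} (s : Finset ι) (G : ι → (Fin N → T) → ℝ)
    (u : Fin N → T) :
    signedSum (fun w => ∑ i ∈ s, G i w) u = ∑ i ∈ s, signedSum (G i) u := by
  simp only [signedSum, Finset.mul_sum]
  rw [Finset.sum_comm]

theorem signedSum_mul {N : ℕ} (a : ℝ) (G : (Fin N → T) → ℝ) (u : Fin N → T) :
    signedSum (fun w => a * G w) u = a * signedSum G u := by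
  simp only [signedSum, Finset.mul_sum]
  refine Finset.sum_congr rfl fun _ _ => by ring

end SignedSum

/-! ### The wedge product as a signed sum, and the algebraic Leibniz rule. -/

section WedgeAlgebra

variable {T A : Type*} [AddCommGroup T] [Module ℝ T] [AddCommMonoid A] [Module ℝ A]

theorem signedSum_alternating {N : ℕ} (α : T [⋀^Fin N]→ₗ[ℝ] ℝ) (u : Fin N → T) :
    signedSum α u = N.factorial * α u := by
  have : ∀ σ : Equiv.Perm (Fin N), ((Equiv.Perm.sign σ : ℤ) : ℝ) * α (u ∘ σ) = α u := by
    intro σ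
    have := AlternatingMap.map_perm' α u σ
    rw [Function.comp_def, this, smul_eq_mul, ← mul_assoc, sign_mul_sign_cast, one_mul]
  simp [signedSum, this, Fintype.card_perm]

/-- Bringing the argument number `p` to the front is a cycle of sign `(-1) ^ p`. This turns the
signs of exterior derivatives into signs of permutations. -/
theorem comp_cycleRange_symm {N : ℕ} {Y : Type*} (w : Fin (N + 1) → Y) (p : Fin (N + 1)) :
    w ∘ (p.cycleRange⁻¹ : Equiv.Perm (Fin (N + 1))) = Matrix.vecCons (w p) (p.removeNth w) := by
  have h := Fin.cons_comp_cycleRange (w p) (p.removeNth w) p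
  rw [Fin.insertNth_self_removeNth] at h
  conv_lhs => rw [← h]
  funext i
  have e : p.cycleRange (p.cycleRange⁻¹ i) = i := p.cycleRange.apply_symm_apply i
  simp only [Function.comp_apply, e]
  rfl

theorem sign_cycleRange_inv {N : ℕ} (p : Fin (N + 1)) :
    ((Equiv.Perm.sign (p.cycleRange⁻¹ : Equiv.Perm (Fin (N + 1))) : ℤ) : ℝ) = (-1) ^ (p : ℕ) := by
  rw [Equiv.Perm.sign_inv, Fin.sign_cycleRange]; simp

theorem neg_one_pow_mul_self (p : ℕ) : ((-1 : ℝ) ^ p) * (-1) ^ p = 1 := by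
  rw [← mul_pow]; simp

theorem alternatizeUncurryFin_apply_real {Y : Type*} [AddCommGroup Y] [Module ℝ Y] {n : ℕ}
    (f : T →ₗ[ℝ] T [⋀^Fin n]→ₗ[ℝ] Y) (v : Fin (n + 1) → T) :
    AlternatingMap.alternatizeUncurryFin f v =
      ∑ i : Fin (n + 1), (-1 : ℝ) ^ (i : ℕ) • f (v i) (i.removeNth v) := by
  rw [AlternatingMap.alternatizeUncurryFin_apply]
  refine Finset.sum_congr rfl fun i _ => ?_
  rw [← Int.cast_smul_eq_zsmul ℝ]
  simp

/-- Each of the `n + 1` summands is a cyclic rearrangement of the same function and has the same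
signed sum, while the signed sum of the alternating left side is `(n + 1)!` times it. -/
theorem alternatizeUncurryFin_eq_signedSum {n : ℕ} (f : T →ₗ[ℝ] T [⋀^Fin n]→ₗ[ℝ] ℝ)
    (u : Fin (n + 1) → T) :
    AlternatingMap.alternatizeUncurryFin f u =
      (n.factorial : ℝ)⁻¹ * signedSum (fun w => f (w 0) (fun i => w i.succ)) u := by
  have h := signedSum_alternating (AlternatingMap.alternatizeUncurryFin f) u
  have h1 : signedSum (AlternatingMap.alternatizeUncurryFin f) u =
      ∑ p : Fin (n + 1), signedSum (fun w => f (w 0) (fun i => w i.succ)) u := by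
    have : (AlternatingMap.alternatizeUncurryFin f : (Fin (n + 1) → T) → ℝ) =
        fun w => ∑ p : Fin (n + 1), (-1) ^ (p : ℕ) *
          (fun w : Fin (n + 1) → T => f (w 0) (fun i => w i.succ))
            (w ∘ (p.cycleRange⁻¹ : Equiv.Perm (Fin (n + 1)))) := by
      funext w
      rw [AlternatingMap.alternatizeUncurryFin_apply]
      refine Finset.sum_congr rfl fun p _ => ?_
      rw [comp_cycleRange_symm]
      simp
    rw [this, signedSum_sum]
    refine Finset.sum_congr rfl fun p _ => ?_
    rw [signedSum_mul, signedSum_comp (fun w => f (w 0) (fun i => w i.succ)), sign_cycleRange_inv, ← mul_assoc, neg_one_pow_mul_self,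
      one_mul]
  rw [h1] at h
  simp only [Finset.sum_const, Finset.card_univ, Fintype.card_fin, nsmul_eq_mul,
    Nat.factorial_succ] at h
  push_cast at h
  have hn : (n.factorial : ℝ) ≠ 0 := by positivity
  have hn1 : (n : ℝ) + 1 ≠ 0 := by positivity
  have h3 : signedSum (fun w => f (w 0) (fun i => w i.succ)) u =
      n.factorial * AlternatingMap.alternatizeUncurryFin f u := by
    apply mul_left_cancel₀ hn1
    linarith
  rw [h3, ← mul_assoc, inv_mul_cancel₀ hn, one_mul]

/-- The indexing of `k + j = m` vectors used in `wedge`. -/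
def wedgeEquiv {k j m : ℕ} (h : k + j = m) : Fin k ⊕ Fin j ≃ Fin m :=
  finSumFinEquiv.trans (finCongr h)

/-- `domCoprod` sums over permutations modulo those preserving the two blocks; passing to all
permutations costs the factor `k! j!`. -/
theorem wedge_eq_sum {k j m : ℕ} (h : k + j = m) (φ : T [⋀^Fin k]→ₗ[ℝ] A)
    (ψ : T [⋀^Fin j]→ₗ[ℝ] Module.Dual ℝ A) (u : Fin m → T) :
    wedge h φ ψ u = ((k.factorial : ℝ) * j.factorial)⁻¹ *
      ∑ σ : Equiv.Perm (Fin k ⊕ Fin j), ((Equiv.Perm.sign σ : ℤ) : ℝ) *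
        ψ (fun i => u (wedgeEquiv h (σ (Sum.inr i)))) (φ fun i => u (wedgeEquiv h (σ (Sum.inl i)))) := by
  let _ : AddCommGroup A := Module.addCommMonoidToAddCommGroup ℝ
  have hd := MultilinearMap.domCoprod_alternization_eq φ ψ
  have h1 := congrArg (fun Z : T [⋀^Fin k ⊕ Fin j]→ₗ[ℝ] _ =>
    contractRight ℝ A (Z (u ∘ wedgeEquiv h))) hd
  simp only [MultilinearMap.alternatization_apply, AlternatingMap.smul_apply, map_nsmul,
    map_sum, Fintype.card_fin] at h1
  have h2 : contractRight ℝ A (φ.domCoprod ψ (u ∘ wedgeEquiv h)) = wedge h φ ψ u := rfl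
  rw [h2] at h1
  have hk : ((k.factorial : ℝ) * j.factorial) ≠ 0 := by positivity
  rw [eq_inv_mul_iff_mul_eq₀ hk]
  rw [nsmul_eq_mul] at h1
  push_cast at h1
  rw [← h1]
  refine Finset.sum_congr rfl fun σ _ => ?_
  rw [Units.smul_def, map_zsmul, zsmul_eq_mul]
  simp [MultilinearMap.domCoprod_apply, contractRight_apply, Function.comp_def]

theorem wedge_eq_signedSum {k j m : ℕ} (h : k + j = m) (φ : T [⋀^Fin k]→ₗ[ℝ] A)
    (ψ : T [⋀^Fin j]→ₗ[ℝ] Module.Dual ℝ A) (u : Fin m → T) :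
    wedge h φ ψ u = ((k.factorial : ℝ) * j.factorial)⁻¹ *
      signedSum (fun w => ψ (fun i => w (wedgeEquiv h (Sum.inr i)))
        (φ fun i => w (wedgeEquiv h (Sum.inl i)))) u := by
  rw [wedge_eq_sum]
  congr 1
  unfold signedSum
  rw [← (Equiv.permCongr (wedgeEquiv h)).sum_comp]
  refine Finset.sum_congr rfl fun σ _ => ?_
  rw [Equiv.Perm.sign_permCongr]
  simp [Equiv.permCongr_apply]

theorem wedge_add_left {k j m : ℕ} (h : k + j = m) (φ φ' : T [⋀^Fin k]→ₗ[ℝ] A)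
    (ψ : T [⋀^Fin j]→ₗ[ℝ] Module.Dual ℝ A) :
    wedge h (φ + φ') ψ = wedge h φ ψ + wedge h φ' ψ := by
  ext u; simp [wedge_eq_signedSum, signedSum_add, mul_add]

theorem wedge_add_right {k j m : ℕ} (h : k + j = m) (φ : T [⋀^Fin k]→ₗ[ℝ] A)
    (ψ ψ' : T [⋀^Fin j]→ₗ[ℝ] Module.Dual ℝ A) :
    wedge h φ (ψ + ψ') = wedge h φ ψ + wedge h φ ψ' := by
  ext u; simp [wedge_eq_signedSum, signedSum_add, mul_add]

theorem wedge_smul_left {k j m : ℕ} (h : k + j = m) (a : ℝ) (φ : T [⋀^Fin k]→ₗ[ℝ] A)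
    (ψ : T [⋀^Fin j]→ₗ[ℝ] Module.Dual ℝ A) : wedge h (a • φ) ψ = a • wedge h φ ψ := by
  ext u; simp [wedge_eq_signedSum, signedSum_mul, mul_left_comm]

theorem wedge_smul_right {k j m : ℕ} (h : k + j = m) (a : ℝ) (φ : T [⋀^Fin k]→ₗ[ℝ] A)
    (ψ : T [⋀^Fin j]→ₗ[ℝ] Module.Dual ℝ A) : wedge h φ (a • ψ) = a • wedge h φ ψ := by
  ext u; simp [wedge_eq_signedSum, signedSum_mul, mul_left_comm]

/-- The wedge product as a bilinear map. -/
def wedgeₗ (T A : Type*) [AddCommGroup T] [Module ℝ T] [AddCommMonoid A] [Module ℝ A]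
    {k j m : ℕ} (h : k + j = m) :
    (T [⋀^Fin k]→ₗ[ℝ] A) →ₗ[ℝ] (T [⋀^Fin j]→ₗ[ℝ] Module.Dual ℝ A) →ₗ[ℝ] (T [⋀^Fin m]→ₗ[ℝ] ℝ) :=
  LinearMap.mk₂ ℝ (wedge h) (wedge_add_left h) (wedge_smul_left h) (wedge_add_right h)
    (fun a φ ψ => wedge_smul_right h a φ ψ)

theorem wedgeₗ_apply {k j m : ℕ} (h : k + j = m) (φ : T [⋀^Fin k]→ₗ[ℝ] A)
    (ψ : T [⋀^Fin j]→ₗ[ℝ] Module.Dual ℝ A) : wedgeₗ T A h φ ψ = wedge h φ ψ := rfl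

theorem wedge_compLinearMap {T' : Type*} [AddCommGroup T'] [Module ℝ T'] {k j m : ℕ}
    (h : k + j = m) (φ : T [⋀^Fin k]→ₗ[ℝ] A) (ψ : T [⋀^Fin j]→ₗ[ℝ] Module.Dual ℝ A)
    (g : T' →ₗ[ℝ] T) :
    wedge h (φ.compLinearMap g) (ψ.compLinearMap g) = (wedge h φ ψ).compLinearMap g := by
  ext u
  rw [AlternatingMap.compLinearMap_apply, wedge_eq_sum, wedge_eq_sum]
  rfl

section Leibniz

variable {A : Type*} [AddCommGroup A] [Module ℝ A]

variable {k j n : ℕ} (h : k + j = n)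

theorem signedSum_sumCongr {T : Type*} {k' j' N : ℕ} (h : k' + j' = N) (G : (Fin N → T) → ℝ) (u : Fin N → T)
    (σ : Equiv.Perm (Fin k')) (τ : Equiv.Perm (Fin j')) :
    signedSum (fun w => G (w ∘ (wedgeEquiv h).permCongr (Equiv.sumCongr σ τ))) u =
      ((Equiv.Perm.sign σ : ℤ) : ℝ) * ((Equiv.Perm.sign τ : ℤ) : ℝ) * signedSum G u := by
  rw [signedSum_comp, Equiv.Perm.sign_permCongr, Equiv.Perm.sign_sumCongr]
  push_cast; ring

/-- Under the full signed sum the alternation of the first `k + 1` slots is redundant: its `k + 1`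
terms agree after a permutation inside the block, and `k + 1` cancels against `(k + 1)!`. -/
theorem wedge_alternatize_left (h' : k + 1 + j = n + 1) (g : T →ₗ[ℝ] T [⋀^Fin k]→ₗ[ℝ] A)
    (ψ : T [⋀^Fin j]→ₗ[ℝ] Module.Dual ℝ A) (u : Fin (n + 1) → T) :
    wedge h' (AlternatingMap.alternatizeUncurryFin g) ψ u =
      ((k.factorial : ℝ) * j.factorial)⁻¹ *
      signedSum (fun w => ψ (fun i => w (wedgeEquiv h' (Sum.inr i)))
        (g (w (wedgeEquiv h' (Sum.inl 0)))
          (fun i => w (wedgeEquiv h' (Sum.inl i.succ))))) u := by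
  rw [wedge_eq_signedSum]
  set G : (Fin (n + 1) → T) → ℝ := fun w => ψ (fun i => w (wedgeEquiv h' (Sum.inr i)))
        (g (w (wedgeEquiv h' (Sum.inl 0))) (fun i => w (wedgeEquiv h' (Sum.inl i.succ)))) with hG
  have h1 : (fun w : Fin (n + 1) → T => ψ (fun i => w (wedgeEquiv h' (Sum.inr i)))
      (AlternatingMap.alternatizeUncurryFin g fun i => w (wedgeEquiv h' (Sum.inl i)))) =
      fun w => ∑ p : Fin (k + 1), (-1) ^ (p : ℕ) *
        G (w ∘ (wedgeEquiv h').permCongr (Equiv.sumCongr p.cycleRange⁻¹ (1 : Equiv.Perm (Fin j)))) := by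
    funext w
    rw [alternatizeUncurryFin_apply_real, map_sum]
    refine Finset.sum_congr rfl fun p _ => ?_
    have hc := comp_cycleRange_symm (fun i => w (wedgeEquiv h' (Sum.inl i))) p
    have hc0 := congrFun hc 0
    have hcs := fun i : Fin k => congrFun hc i.succ
    simp only [Function.comp_apply, Matrix.cons_val_zero, Matrix.cons_val_succ] at hc0 hcs
    simp only [hG, Function.comp_apply, Equiv.permCongr_apply, Equiv.symm_apply_apply,
      Equiv.sumCongr_apply, Sum.map_inl, Sum.map_inr, hc0, hcs, Equiv.Perm.coe_one, id_eq]
    rw [map_smul, smul_eq_mul]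
  rw [h1, signedSum_sum]
  simp only [signedSum_mul, signedSum_sumCongr, sign_cycleRange_inv, Equiv.Perm.sign_one]
  simp only [← mul_assoc, neg_one_pow_mul_self, Units.val_one, Int.cast_one, one_mul, mul_one]
  simp only [Finset.sum_const, Finset.card_univ, Fintype.card_fin, nsmul_eq_mul,
    Nat.factorial_succ]
  push_cast
  have hn1 : (k : ℝ) + 1 ≠ 0 := by positivity
  field_simp

theorem wedge_alternatize_right (h' : k + (j + 1) = n + 1) (φ : T [⋀^Fin k]→ₗ[ℝ] A)
    (g : T →ₗ[ℝ] T [⋀^Fin j]→ₗ[ℝ] Module.Dual ℝ A) (u : Fin (n + 1) → T) :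
    wedge h' φ (AlternatingMap.alternatizeUncurryFin g) u =
      ((k.factorial : ℝ) * j.factorial)⁻¹ *
      signedSum (fun w => (g (w (wedgeEquiv h' (Sum.inr 0)))
          (fun i => w (wedgeEquiv h' (Sum.inr i.succ))))
          (φ (fun i => w (wedgeEquiv h' (Sum.inl i))))) u := by
  rw [wedge_eq_signedSum]
  set G : (Fin (n + 1) → T) → ℝ := fun w => (g (w (wedgeEquiv h' (Sum.inr 0)))
          (fun i => w (wedgeEquiv h' (Sum.inr i.succ))))
          (φ (fun i => w (wedgeEquiv h' (Sum.inl i)))) with hG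
  have h1 : (fun w : Fin (n + 1) → T => AlternatingMap.alternatizeUncurryFin g
      (fun i => w (wedgeEquiv h' (Sum.inr i))) (φ fun i => w (wedgeEquiv h' (Sum.inl i)))) =
      fun w => ∑ p : Fin (j + 1), (-1) ^ (p : ℕ) *
        G (w ∘ (wedgeEquiv h').permCongr (Equiv.sumCongr (1 : Equiv.Perm (Fin k)) p.cycleRange⁻¹)) := by
    funext w
    rw [alternatizeUncurryFin_apply_real, LinearMap.sum_apply]
    refine Finset.sum_congr rfl fun p _ => ?_
    have hc := comp_cycleRange_symm (fun i => w (wedgeEquiv h' (Sum.inr i))) p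
    have hc0 := congrFun hc 0
    have hcs := fun i : Fin j => congrFun hc i.succ
    simp only [Function.comp_apply, Matrix.cons_val_zero, Matrix.cons_val_succ] at hc0 hcs
    simp only [hG, Function.comp_apply, Equiv.permCongr_apply, Equiv.symm_apply_apply,
      Equiv.sumCongr_apply, Sum.map_inl, Sum.map_inr, hc0, hcs, Equiv.Perm.coe_one, id_eq]
    rfl
  rw [h1, signedSum_sum]
  simp only [signedSum_mul, signedSum_sumCongr, sign_cycleRange_inv, Equiv.Perm.sign_one]
  simp only [Units.val_one, Int.cast_one, one_mul, ← mul_assoc, neg_one_pow_mul_self]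
  simp only [Finset.sum_const, Finset.card_univ, Fintype.card_fin, nsmul_eq_mul,
    Nat.factorial_succ]
  push_cast
  have hn1 : (j : ℝ) + 1 ≠ 0 := by positivity
  field_simp

/-- An inner signed sum over the permutations that fix the slot `0` is absorbed by the outer one,
which counts it `n!` times. -/
theorem signedSum_tail {T : Type*} (P : T → (Fin n → T) → ℝ) (u : Fin (n + 1) → T) :
    signedSum (fun w => signedSum (P (w 0)) (fun i => w i.succ)) u =
      n.factorial * signedSum (fun w => P (w 0) (fun i => w i.succ)) u := by
  have h1 : (fun w : Fin (n + 1) → T => signedSum (P (w 0)) (fun i => w i.succ)) =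
      fun w => ∑ τ : Equiv.Perm (Fin n), ((Equiv.Perm.sign τ : ℤ) : ℝ) *
        (fun w : Fin (n + 1) → T => P (w 0) (fun i => w i.succ))
          (w ∘ Equiv.Perm.decomposeFin.symm (0, τ)) := by
    funext w
    simp [signedSum, Function.comp_def]
  rw [h1, signedSum_sum]
  simp only [signedSum_mul]
  have h2 : ∀ τ : Equiv.Perm (Fin n), ((Equiv.Perm.sign τ : ℤ) : ℝ) *
      signedSum (fun w => (fun w : Fin (n + 1) → T => P (w 0) (fun i => w i.succ))
          (w ∘ Equiv.Perm.decomposeFin.symm (0, τ))) u =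
      signedSum (fun w => P (w 0) (fun i => w i.succ)) u := by
    intro τ
    rw [signedSum_comp (fun w => P (w 0) (fun i => w i.succ)), Equiv.Perm.decomposeFin.symm_sign, if_pos rfl, one_mul]
    rw [← mul_assoc, sign_mul_sign_cast, one_mul]
  rw [Finset.sum_congr rfl fun τ _ => h2 τ]
  simp [Fintype.card_perm]

/-- The Leibniz rule with the derivatives removed: `g` and `g'` stand for `v ↦ ∇_v φ` and `v ↦ ∇*_v
ψ`. The sign `(-1) ^ k` is that of the cycle which moves the derivative slot past the `k` arguments
of `φ`. -/
theorem alternatize_wedge (h₁ : k + 1 + j = n + 1) (h₂ : k + (j + 1) = n + 1)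
    (φ : T [⋀^Fin k]→ₗ[ℝ] A) (ψ : T [⋀^Fin j]→ₗ[ℝ] Module.Dual ℝ A)
    (g : T →ₗ[ℝ] T [⋀^Fin k]→ₗ[ℝ] A) (g' : T →ₗ[ℝ] T [⋀^Fin j]→ₗ[ℝ] Module.Dual ℝ A) :
    AlternatingMap.alternatizeUncurryFin
      ((wedgeₗ T A h).flip ψ ∘ₗ g + wedgeₗ T A h φ ∘ₗ g') =
      wedge h₁ (AlternatingMap.alternatizeUncurryFin g) ψ +
        (-1 : ℝ) ^ k • wedge h₂ φ (AlternatingMap.alternatizeUncurryFin g') := by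
  ext u
  rw [AlternatingMap.add_apply, AlternatingMap.smul_apply, wedge_alternatize_left,
    wedge_alternatize_right, alternatizeUncurryFin_eq_signedSum]
  simp only [LinearMap.add_apply, LinearMap.comp_apply, LinearMap.flip_apply, wedgeₗ_apply,
    AlternatingMap.add_apply]
  rw [signedSum_add]
  simp only [wedge_eq_signedSum h, signedSum_mul]
  rw [signedSum_tail (fun v w => ψ (fun i => w (wedgeEquiv h (Sum.inr i)))
        (g v fun i => w (wedgeEquiv h (Sum.inl i)))),
    signedSum_tail (fun v w => g' v (fun i => w (wedgeEquiv h (Sum.inr i)))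
        (φ fun i => w (wedgeEquiv h (Sum.inl i))))]
  have hn : (n.factorial : ℝ) ≠ 0 := by positivity
  have e1 : signedSum (fun w => ψ (fun i => w (wedgeEquiv h (Sum.inr i)).succ)
        (g (w 0) fun i => w (wedgeEquiv h (Sum.inl i)).succ)) u =
      signedSum (fun w => ψ (fun i => w (wedgeEquiv h₁ (Sum.inr i)))
        (g (w (wedgeEquiv h₁ (Sum.inl 0)))
          (fun i => w (wedgeEquiv h₁ (Sum.inl i.succ))))) u := by
    congr 1
    funext w
    have a1 : ∀ i, (wedgeEquiv h (Sum.inr i)).succ = wedgeEquiv h₁ (Sum.inr i) := by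
      intro i; ext; simp [wedgeEquiv]; ring
    have a2 : ∀ i, (wedgeEquiv h (Sum.inl i)).succ = wedgeEquiv h₁ (Sum.inl i.succ) := by
      intro i; ext; simp [wedgeEquiv]
    have a3 : (0 : Fin (n + 1)) = wedgeEquiv h₁ (Sum.inl 0) := by
      ext; simp [wedgeEquiv]
    simp only [a1, a2, ← a3]
  have hkn : k < n + 1 := by omega
  -- In the second wedge product the derivative slot has index `k` instead of `0`; the cycle that
  -- brings `k` to the front identifies the two indexings.
  have e2 : (-1 : ℝ) ^ k * signedSum (fun w => g' (w 0) (fun i => w (wedgeEquiv h (Sum.inr i)).succ)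
        (φ fun i => w (wedgeEquiv h (Sum.inl i)).succ)) u =
      signedSum (fun w => (g' (w (wedgeEquiv h₂ (Sum.inr 0)))
          (fun i => w (wedgeEquiv h₂ (Sum.inr i.succ))))
          (φ (fun i => w (wedgeEquiv h₂ (Sum.inl i))))) u := by
    have := signedSum_comp (fun w => g' (w 0) (fun i => w (wedgeEquiv h (Sum.inr i)).succ)
        (φ fun i => w (wedgeEquiv h (Sum.inl i)).succ)) u
        ((⟨k, hkn⟩ : Fin (n + 1)).cycleRange⁻¹)
    rw [sign_cycleRange_inv] at this
    rw [← this]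
    congr 1
    funext w
    simp only [comp_cycleRange_symm]
    have a1 : ∀ i, (⟨k, hkn⟩ : Fin (n + 1)).succAbove (wedgeEquiv h (Sum.inr i)) =
        wedgeEquiv h₂ (Sum.inr i.succ) := by
      intro i
      rw [Fin.succAbove_of_le_castSucc]
      · ext; simp [wedgeEquiv]; ring
      · simp [Fin.le_def, wedgeEquiv]
    have a2 : ∀ i, (⟨k, hkn⟩ : Fin (n + 1)).succAbove (wedgeEquiv h (Sum.inl i)) =
        wedgeEquiv h₂ (Sum.inl i) := by
      intro i
      rw [Fin.succAbove_of_castSucc_lt]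
      · ext; simp [wedgeEquiv]
      · simp [Fin.lt_def, wedgeEquiv]
    have a3 : (⟨k, hkn⟩ : Fin (n + 1)) = wedgeEquiv h₂ (Sum.inr 0) := by
      ext; simp [wedgeEquiv]
    simp only [Matrix.cons_val_zero, Matrix.cons_val_succ, Fin.removeNth_apply, a1, a2]
    rw [a3]
  rw [e1, ← e2, smul_eq_mul]
  have hkk := neg_one_pow_mul_self k
  generalize signedSum (fun w => ψ (fun i => w (wedgeEquiv h₁ (Sum.inr i)))
        (g (w (wedgeEquiv h₁ (Sum.inl 0)))
          (fun i => w (wedgeEquiv h₁ (Sum.inl i.succ))))) u = X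
  generalize signedSum (fun w => g' (w 0) (fun i => w (wedgeEquiv h (Sum.inr i)).succ)
        (φ fun i => w (wedgeEquiv h (Sum.inl i)).succ)) u = Y
  generalize ((k.factorial : ℝ) * j.factorial)⁻¹ = Z
  have : (-1 : ℝ) ^ k * (Z * ((-1) ^ k * Y)) = Z * Y := by
    linear_combination Z * Y * hkk
  rw [this]
  field_simp

end Leibniz

end WedgeAlgebra

/-! ### Nondegeneracy of the wedge pairing in complementary degrees. -/

section WedgePairing

variable {T A : Type*} [AddCommGroup T] [Module ℝ T] [AddCommMonoid A] [Module ℝ A]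

theorem exists_sum_equiv {k j m : ℕ} (h : k + j = m) (L : Fin j → Fin m)
    (hL : Function.Injective L) : ∃ τ : Fin k ⊕ Fin j ≃ Fin m, ∀ i, τ (Sum.inr i) = L i := by
  classical
  have hc : Fintype.card {x // x ∉ Set.range L} = k := by
    have h1 := Fintype.card_subtype_compl (fun x => x ∈ Set.range L)
    have h2 : Fintype.card {x // x ∈ Set.range L} = j := by
      have := Fintype.card_congr (Equiv.ofInjective L hL)
      rw [Fintype.card_fin] at this
      exact this.symm
    rw [h2, Fintype.card_fin] at h1
    omega
  let e1 : Fin k ≃ {x // x ∉ Set.range L} := (Fintype.equivFinOfCardEq hc).symm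
  let e2 : Fin j ≃ {x // x ∈ Set.range L} := Equiv.ofInjective L hL
  refine ⟨(Equiv.sumComm _ _).trans ((Equiv.sumCongr e2 e1).trans (Equiv.sumCompl _)), ?_⟩
  intro i
  simp [e2]

/-- For a product of two dual basis elements only the `k! j!` permutations preserving the blocks
contribute, and they contribute equally. -/
theorem sum_perm_eq_of_sumCongr {k j : ℕ} (f : Equiv.Perm (Fin k ⊕ Fin j) → ℝ) (c : ℝ)
    (h0 : ∀ σ, σ ∉ Set.range (fun q : Equiv.Perm (Fin k) × Equiv.Perm (Fin j) =>
      Equiv.sumCongr q.1 q.2) → f σ = 0)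
    (h1 : ∀ σ τ, f (Equiv.sumCongr σ τ) = c) :
    ∑ σ, f σ = (k.factorial : ℝ) * j.factorial * c := by
  rw [← Fintype.sum_of_injective
    (fun q : Equiv.Perm (Fin k) × Equiv.Perm (Fin j) => (Equiv.sumCongr q.1 q.2 : Equiv.Perm _))
    ?_ (fun _ => c) f h0 (fun q => (h1 _ _).symm)]
  · simp [Fintype.card_perm, Fintype.card_prod]
  · rintro ⟨a, b⟩ ⟨a', b'⟩ hab
    have h := fun s => congrArg (fun e : Equiv.Perm (Fin k ⊕ Fin j) => e s) hab
    refine Prod.ext (Equiv.ext fun i => ?_) (Equiv.ext fun i => ?_)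
    · simpa using h (Sum.inl i)
    · simpa using h (Sum.inr i)

theorem exists_inl_eq_inr_of_not_mem_range {k j : ℕ} (σ : Equiv.Perm (Fin k ⊕ Fin j))
    (h : σ ∉ Set.range (fun q : Equiv.Perm (Fin k) × Equiv.Perm (Fin j) =>
      (Equiv.sumCongr q.1 q.2 : Equiv.Perm _))) : ∃ i l, σ (Sum.inl i) = Sum.inr l := by
  by_contra hc
  apply h
  push Not at hc
  have hm : Set.MapsTo σ (Set.range (Sum.inl : Fin k → Fin k ⊕ Fin j)) (Set.range Sum.inl) := by
    rintro _ ⟨i, rfl⟩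
    rcases hs : σ (Sum.inl i) with a | b
    · exact ⟨a, rfl⟩
    · exact absurd hs (hc i b)
  have := Equiv.Perm.mem_sumCongrHom_range_of_perm_mapsTo_inl hm
  obtain ⟨q, hq⟩ := this
  exact ⟨q, hq⟩

theorem exists_inr_eq_inl_of_not_mem_range {k j : ℕ} (σ : Equiv.Perm (Fin k ⊕ Fin j))
    (h : σ ∉ Set.range (fun q : Equiv.Perm (Fin k) × Equiv.Perm (Fin j) =>
      (Equiv.sumCongr q.1 q.2 : Equiv.Perm _))) : ∃ i l, σ (Sum.inr i) = Sum.inl l := by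
  obtain ⟨i, l, hil⟩ := exists_inl_eq_inr_of_not_mem_range σ h
  by_contra hc
  push Not at hc
  have : ∀ x, ∃ y, σ (Sum.inr x) = Sum.inr y := by
    intro x
    rcases hs : σ (Sum.inr x) with a | b
    · exact absurd hs (hc x a)
    · exact ⟨b, rfl⟩
  choose g hg using this
  have hgi : Function.Injective g := by
    intro x y hxy
    have : σ (Sum.inr x) = σ (Sum.inr y) := by rw [hg, hg, hxy]
    simpa using σ.injective this
  obtain ⟨x, hx⟩ := (Finite.injective_iff_surjective.1 hgi) l
  have : σ (Sum.inr x) = σ (Sum.inl i) := by rw [hg, hil, hx]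
  simpa using σ.injective this

/-- Wedging with the covectors dual to the complementary basis vectors isolates one component of
`ψ`. A permutation mixing the blocks produces a zero row in the determinant; for the others the
signs occur twice and cancel. -/
theorem wedge_detForm_left {k j m : ℕ} (h : k + j = m) (b : Module.Basis (Fin m) ℝ T)
    (τ : Fin k ⊕ Fin j ≃ Fin m) (e : A) (ψ : T [⋀^Fin j]→ₗ[ℝ] Module.Dual ℝ A) :
    wedge h ((detForm T k fun i => b.coord (τ (Sum.inl i))).smulRight e) ψ
      (fun i => b (τ ((wedgeEquiv h).symm i))) = ψ (fun i => b (τ (Sum.inr i))) e := by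
  rw [wedge_eq_sum, sum_perm_eq_of_sumCongr _ (ψ (fun i => b (τ (Sum.inr i))) e)]
  · rw [← mul_assoc, inv_mul_cancel₀ (by positivity), one_mul]
  · intro σ hσ
    obtain ⟨i, l, hil⟩ := exists_inl_eq_inr_of_not_mem_range σ hσ
    have : detForm T k (fun i => b.coord (τ (Sum.inl i)))
        (fun i => b (τ ((wedgeEquiv h).symm (wedgeEquiv h (σ (Sum.inl i)))))) = 0 := by
      rw [detForm_apply]
      refine Matrix.det_eq_zero_of_row_eq_zero i fun i' => ?_
      simp [hil, Finsupp.single_apply]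
    rw [AlternatingMap.smulRight_apply, this]
    simp
  · intro σ σ'
    simp only [Equiv.symm_apply_apply, Equiv.sumCongr_apply, Sum.map_inl, Sum.map_inr,
      AlternatingMap.smulRight_apply]
    have h1 := AlternatingMap.map_perm' (Y := Module.Dual ℝ A) ψ
      (fun i => b (τ (Sum.inr i))) σ'
    have h2 := AlternatingMap.map_perm' (detForm T k (fun i => b.coord (τ (Sum.inl i))))
      (fun i => b (τ (Sum.inl i))) σ
    rw [h1, h2]
    have h3 : detForm T k (fun i => b.coord (τ (Sum.inl i))) (fun i => b (τ (Sum.inl i))) = 1 := by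
      rw [detForm_apply]
      convert Matrix.det_one (n := Fin k) (R := ℝ)
      ext i i'
      simp [Finsupp.single_apply, Matrix.one_apply]
    rw [h3, Equiv.Perm.sign_sumCongr]
    have s1 := sign_mul_sign_cast σ
    have s2 := sign_mul_sign_cast σ'
    simp only [smul_eq_mul, mul_one, map_smul, LinearMap.smul_apply, Units.val_mul, Int.cast_mul]
    generalize ((Equiv.Perm.sign σ : ℤ) : ℝ) = x at *
    generalize ((Equiv.Perm.sign σ' : ℤ) : ℝ) = y at *
    linear_combination (ψ (fun i => b (τ (Sum.inr i))) e) * (y * y * s1 + s2)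

theorem wedge_detForm_right {k j m : ℕ} (h : k + j = m) (b : Module.Basis (Fin m) ℝ T)
    (τ : Fin k ⊕ Fin j ≃ Fin m) (φ : T [⋀^Fin k]→ₗ[ℝ] A) (η : Module.Dual ℝ A) :
    wedge h φ ((detForm T j fun i => b.coord (τ (Sum.inr i))).smulRight η)
      (fun i => b (τ ((wedgeEquiv h).symm i))) = η (φ (fun i => b (τ (Sum.inl i)))) := by
  let _ : AddCommGroup A := Module.addCommMonoidToAddCommGroup ℝ
  rw [wedge_eq_sum, sum_perm_eq_of_sumCongr _ (η (φ (fun i => b (τ (Sum.inl i)))))]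
  · rw [← mul_assoc, inv_mul_cancel₀ (by positivity), one_mul]
  · intro σ hσ
    obtain ⟨i, l, hil⟩ := exists_inr_eq_inl_of_not_mem_range σ hσ
    have : detForm T j (fun i => b.coord (τ (Sum.inr i)))
        (fun i => b (τ ((wedgeEquiv h).symm (wedgeEquiv h (σ (Sum.inr i)))))) = 0 := by
      rw [detForm_apply]
      refine Matrix.det_eq_zero_of_row_eq_zero i fun i' => ?_
      simp [hil, Finsupp.single_apply]
    rw [AlternatingMap.smulRight_apply, this]
    simp
  · intro σ σ'
    simp only [Equiv.symm_apply_apply, Equiv.sumCongr_apply, Sum.map_inl, Sum.map_inr,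
      AlternatingMap.smulRight_apply]
    have h1 := AlternatingMap.map_perm' φ (fun i => b (τ (Sum.inl i))) σ
    have h2 := AlternatingMap.map_perm' (detForm T j (fun i => b.coord (τ (Sum.inr i))))
      (fun i => b (τ (Sum.inr i))) σ'
    rw [h1, h2]
    have h3 : detForm T j (fun i => b.coord (τ (Sum.inr i))) (fun i => b (τ (Sum.inr i))) = 1 := by
      rw [detForm_apply]
      convert Matrix.det_one (n := Fin j) (R := ℝ)
      ext i i'
      simp [Finsupp.single_apply, Matrix.one_apply]
    rw [h3, Equiv.Perm.sign_sumCongr]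
    have s1 := sign_mul_sign_cast σ
    have s2 := sign_mul_sign_cast σ'
    simp only [smul_eq_mul, mul_one, map_smul, LinearMap.smul_apply, Units.val_mul, Int.cast_mul]
    generalize ((Equiv.Perm.sign σ : ℤ) : ℝ) = x at *
    generalize ((Equiv.Perm.sign σ' : ℤ) : ℝ) = y at *
    linear_combination (η (φ (fun i => b (τ (Sum.inl i))))) * (y * y * s1 + s2)

/-- An alternating map is determined by its values on distinct basis vectors, and
`wedge_detForm_left` reads off each of them. -/
theorem eq_zero_of_wedge_left {k j m : ℕ} (h : k + j = m) (b : Module.Basis (Fin m) ℝ T)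
    (ψ : T [⋀^Fin j]→ₗ[ℝ] Module.Dual ℝ A)
    (hψ : ∀ φ : T [⋀^Fin k]→ₗ[ℝ] A, wedge h φ ψ = 0) : ψ = 0 := by
  refine Module.Basis.ext_alternating b fun L hL => ?_
  obtain ⟨τ, hτ⟩ := exists_sum_equiv h L hL
  ext e
  have := wedge_detForm_left h b τ e ψ
  rw [hψ] at this
  simpa [hτ] using this.symm

theorem eq_zero_of_wedge_right {k j m : ℕ} (h : k + j = m) (b : Module.Basis (Fin m) ℝ T)
    (φ : T [⋀^Fin k]→ₗ[ℝ] A)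
    (hφ : ∀ ψ : T [⋀^Fin j]→ₗ[ℝ] Module.Dual ℝ A, wedge h φ ψ = 0) : φ = 0 := by
  let _ : AddCommGroup A := Module.addCommMonoidToAddCommGroup ℝ
  refine Module.Basis.ext_alternating b fun L hL => ?_
  obtain ⟨τ', hτ'⟩ := exists_sum_equiv (k := j) (j := k) (by omega) L hL
  let τ := (Equiv.sumComm (Fin k) (Fin j)).trans τ'
  refine (Module.forall_dual_apply_eq_zero_iff ℝ _).1 fun η => ?_
  have := wedge_detForm_right h b τ φ η
  rw [hφ] at this
  simpa [τ, hτ'] using this.symm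

theorem finite_alternatingMap {m : ℕ} (b : Module.Basis (Fin m) ℝ T) (k : ℕ) (Y : Type*)
    [AddCommGroup Y] [Module ℝ Y] [Module.Finite ℝ Y] : Module.Finite ℝ (T [⋀^Fin k]→ₗ[ℝ] Y) := by
  have : Module.Finite ℝ T := Module.Finite.of_basis b
  refine Module.Finite.of_injective
    (AlternatingMap.toMultilinearMapLM (R := ℝ) (S := ℝ) :
      (T [⋀^Fin k]→ₗ[ℝ] Y) →ₗ[ℝ] MultilinearMap ℝ (fun _ : Fin k => T) Y) ?_
  exact AlternatingMap.coe_multilinearMap_injective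

/-- Injectivity of both maps into the duals forces equal dimensions, so both are surjective. -/
theorem exists_functional_of_nondegenerate {U W : Type*} [AddCommGroup U] [Module ℝ U]
    [AddCommGroup W] [Module ℝ W] [Module.Finite ℝ U] [Module.Finite ℝ W]
    (B : U →ₗ[ℝ] W →ₗ[ℝ] ℝ) (h1 : ∀ x, (∀ y, B x y = 0) → x = 0)
    (h2 : ∀ y, (∀ x, B x y = 0) → y = 0) :
    (∀ l : U →ₗ[ℝ] ℝ, ∃ y, ∀ x, B x y = l x) ∧ (∀ l : W →ₗ[ℝ] ℝ, ∃ x, ∀ y, B x y = l y) := by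
  have i1 : Function.Injective (B : U →ₗ[ℝ] Module.Dual ℝ W) := by
    rw [← LinearMap.ker_eq_bot, LinearMap.ker_eq_bot']
    exact fun x hx => h1 x (LinearMap.congr_fun hx)
  have i2 : Function.Injective (B.flip : W →ₗ[ℝ] Module.Dual ℝ U) := by
    rw [← LinearMap.ker_eq_bot, LinearMap.ker_eq_bot']
    exact fun y hy => h2 y (LinearMap.congr_fun hy)
  have d1 := LinearMap.finrank_le_finrank_of_injective i1
  have d2 := LinearMap.finrank_le_finrank_of_injective i2
  rw [Subspace.dual_finrank_eq] at d1 d2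
  have hd := le_antisymm d1 d2
  have s1 := (LinearMap.injective_iff_surjective_of_finrank_eq_finrank
      (by rw [Subspace.dual_finrank_eq]; exact hd)).1 i1
  have s2 := (LinearMap.injective_iff_surjective_of_finrank_eq_finrank
      (by rw [Subspace.dual_finrank_eq]; exact hd.symm)).1 i2
  refine ⟨fun l => ?_, fun l => ?_⟩
  · obtain ⟨ψ, hψ⟩ := s2 l
    exact ⟨ψ, fun φ => LinearMap.congr_fun hψ φ⟩
  · obtain ⟨φ, hφ⟩ := s1 l
    exact ⟨φ, fun ψ => LinearMap.congr_fun hφ ψ⟩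

theorem exists_wedge_functional {k j m : ℕ} (h : k + j = m) (b : Module.Basis (Fin m) ℝ T)
    [Module.Finite ℝ A] :
    (∀ l : (T [⋀^Fin k]→ₗ[ℝ] A) →ₗ[ℝ] ℝ, ∃ ψ : T [⋀^Fin j]→ₗ[ℝ] Module.Dual ℝ A,
      ∀ φ, wedge h φ ψ b = l φ) ∧
    (∀ l : (T [⋀^Fin j]→ₗ[ℝ] Module.Dual ℝ A) →ₗ[ℝ] ℝ, ∃ φ : T [⋀^Fin k]→ₗ[ℝ] A,
      ∀ ψ, wedge h φ ψ b = l ψ) := by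
  let _ : AddCommGroup A := Module.addCommMonoidToAddCommGroup ℝ
  have : Module.Finite ℝ (T [⋀^Fin k]→ₗ[ℝ] A) := finite_alternatingMap b k A
  have : Module.Finite ℝ (T [⋀^Fin j]→ₗ[ℝ] Module.Dual ℝ A) :=
    finite_alternatingMap b j (Module.Dual ℝ A)
  let B : (T [⋀^Fin k]→ₗ[ℝ] A) →ₗ[ℝ] (T [⋀^Fin j]→ₗ[ℝ] Module.Dual ℝ A) →ₗ[ℝ] ℝ :=
    LinearMap.mk₂ ℝ (fun φ ψ => wedge h φ ψ b)
      (fun φ φ' ψ => by rw [wedge_add_left]; rfl) (fun a φ ψ => by rw [wedge_smul_left]; rfl)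
      (fun φ ψ ψ' => by rw [wedge_add_right]; rfl) (fun a φ ψ => by rw [wedge_smul_right]; rfl)
  -- A top form is known from its value on one basis, so the form-valued wedge product may be
  -- replaced by a scalar pairing.
  have hz : ∀ θ : T [⋀^Fin m]→ₗ[ℝ] ℝ, θ b = 0 → θ = 0 := by
    intro θ hθ
    have := θ.eq_smul_basis_det b
    rw [this, hθ, zero_smul]
  exact (exists_functional_of_nondegenerate B
    (fun φ hφ => eq_zero_of_wedge_right h b φ fun ψ => hz _ (hφ ψ))
    (fun ψ hψ => eq_zero_of_wedge_left h b ψ fun φ => hz _ (hψ φ)))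

/-- Every linear map `⋀ᵏ T* ⊗ A → ⋀ᵐ T*` is a wedge product, for `m = dim T`. -/
theorem exists_wedge_eq {k j m : ℕ} (h : k + j = m) (b : Module.Basis (Fin m) ℝ T)
    [Module.Finite ℝ A] (l : (T [⋀^Fin k]→ₗ[ℝ] A) →ₗ[ℝ] (T [⋀^Fin m]→ₗ[ℝ] ℝ)) :
    ∃ ψ : T [⋀^Fin j]→ₗ[ℝ] Module.Dual ℝ A, ∀ φ, wedge h φ ψ = l φ := by
  obtain ⟨ψ, hψ⟩ := (exists_wedge_functional h b).1
    ((LinearMap.mk (AddHom.mk (fun θ : T [⋀^Fin m]→ₗ[ℝ] ℝ => θ b) (fun _ _ => rfl))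
      (fun _ _ => rfl)) ∘ₗ l)
  refine ⟨ψ, fun φ => ?_⟩
  rw [(wedge h φ ψ).eq_smul_basis_det b, (l φ).eq_smul_basis_det b, hψ]
  rfl

end WedgePairing

/-! ### The algebraic Leibniz rule for contractions with a trace. -/

section ContractLeibniz

variable {T A : Type*} [AddCommGroup T] [Module ℝ T] [AddCommGroup A] [Module ℝ A]

theorem alternatingMap_eq_zero_of_lt {m p : ℕ} {Y : Type*} [AddCommMonoid Y] [Module ℝ Y]
    (b : Module.Basis (Fin m) ℝ T) (hp : m < p) (θ : T [⋀^Fin p]→ₗ[ℝ] Y) : θ = 0 := by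
  let _ : AddCommGroup Y := Module.addCommMonoidToAddCommGroup ℝ
  refine Module.Basis.ext_alternating b fun L hL => ?_
  have := Fintype.card_le_of_injective L hL
  simp at this
  omega

/-- The alternation of `w ↦ μ(·)(G w)` has degree above the dimension and therefore vanishes;
evaluated on `v, u₀, …, uₙ`, it separates into the two sides. -/
theorem sum_neg_one_pow_eq_of_top {m : ℕ} (b : Module.Basis (Fin m) ℝ T)
    (μ : T [⋀^Fin m]→ₗ[ℝ] Module.Dual ℝ A) (G : T →ₗ[ℝ] A) (v : T) {n : ℕ} (hn : m = n + 1)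
    (u : Fin (n + 1) → T) :
    ∑ i : Fin (n + 1), (-1 : ℝ) ^ (i : ℕ) *
      μ ((Matrix.vecCons v (i.removeNth u) : Fin (n + 1) → T) ∘ Fin.cast hn) (G (u i)) =
      μ (u ∘ Fin.cast hn) (G v) := by
  subst hn
  let f : T →ₗ[ℝ] T [⋀^Fin (n + 1)]→ₗ[ℝ] ℝ :=
    LinearMap.mk (AddHom.mk
      (fun w => ((Module.Dual.eval ℝ A (G w)).compAlternatingMap μ))
      (by intro x y; ext; simp)) (by intro a x; ext; simp)
  have h0 := alternatingMap_eq_zero_of_lt b (Nat.lt_succ_self _)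
    (AlternatingMap.alternatizeUncurryFin f)
  have h1 := congrArg (fun θ : T [⋀^Fin (n + 1 + 1)]→ₗ[ℝ] ℝ => θ (Matrix.vecCons v u)) h0
  simp only [alternatizeUncurryFin_apply_real, AlternatingMap.zero_apply] at h1
  rw [Fin.sum_univ_succ] at h1
  have hr : ∀ i : Fin (n + 1), (i.succ.removeNth (Matrix.vecCons v u) : Fin (n + 1) → T) =
      Matrix.vecCons v (i.removeNth u) := by
    intro i
    funext l
    refine Fin.cases ?_ (fun l => ?_) l
    · simp [Fin.removeNth_apply]
    · simp [Fin.removeNth_apply]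
  have hr0 : ((0 : Fin (n + 2)).removeNth (Matrix.vecCons v u) : Fin (n + 1) → T) = u := by
    funext l; simp [Fin.removeNth_apply]
  simp only [hr, hr0, Matrix.cons_val_zero, Matrix.cons_val_succ, Fin.val_succ, Fin.val_zero,
    pow_zero, pow_succ, smul_eq_mul] at h1
  have hf : ∀ (w : T) (z : Fin (n + 1) → T), f w z = μ z (G w) := fun _ _ => rfl
  simp only [hf] at h1
  have h2 : ∑ i : Fin (n + 1), (-1 : ℝ) ^ (i : ℕ) * -1 *
      μ (Matrix.vecCons v (i.removeNth u)) (G (u i)) =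
      - ∑ i : Fin (n + 1), (-1 : ℝ) ^ (i : ℕ) *
      μ (Matrix.vecCons v (i.removeNth u)) (G (u i)) := by
    rw [← Finset.sum_neg_distrib]
    exact Finset.sum_congr rfl fun i _ => by ring
  rw [h2] at h1
  simp only [Fin.cast_refl, Function.comp_id]
  linarith

/-- Antisymmetrisation of a linear family of elements of `⋀ᵏ T ⊗ ⋀ʳ T* ⊗ A*` in the form
indices. -/
def alternatizeSkew {k r : ℕ} (g : T →ₗ[ℝ] SkewTensor T A k r) : SkewTensor T A k (r + 1) where
  toFun β := AlternatingMap.alternatizeUncurryFin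
    (LinearMap.mk (AddHom.mk (fun v => g v β) (by intro x y; simp)) (by intro a x; simp))
  map_update_add' := by
    intro _ β i x y
    ext u e
    simp [alternatizeUncurryFin_apply_real, LinearMap.sum_apply, Finset.sum_add_distrib]
  map_update_smul' := by
    intro _ β i a x
    ext u e
    simp [alternatizeUncurryFin_apply_real, LinearMap.sum_apply, Finset.mul_sum, mul_left_comm]
  map_eq_zero_of_eq' := by
    intro β i j h hij
    ext u e
    simp only [alternatizeUncurryFin_apply_real]
    have : ∀ v, g v β = 0 := fun v => AlternatingMap.map_eq_zero_of_eq _ _ h hij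
    simp [this]

theorem alternatizeSkew_apply {k r : ℕ} (g : T →ₗ[ℝ] SkewTensor T A k r)
    (β : Fin k → Module.Dual ℝ T) (u : Fin (r + 1) → T) (e : A) :
    alternatizeSkew g β u e =
      ∑ i : Fin (r + 1), (-1 : ℝ) ^ (i : ℕ) * g (u i) β (i.removeNth u) e := by
  have h : alternatizeSkew g β = AlternatingMap.alternatizeUncurryFin
    (LinearMap.mk (AddHom.mk (fun v => g v β) (by intro x y; simp)) (by intro a x; simp)) := rfl
  rw [h, alternatizeUncurryFin_apply_real]
  simp [LinearMap.sum_apply]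

/-- The top degree of `χ` is essential. Alternation of `χ` makes the `k + 1` positions of the
derivative slot equivalent, so a basis vector `b l` is fed to `g`; `sum_neg_one_pow_eq_of_top` then
exchanges it with the vectors `u i` fed to `χ`, which is what the trace does. -/
theorem contract_alternatize {n k : ℕ} (b : Module.Basis (Fin (n + 1)) ℝ T)
    (χ : SkewTensor T A (k + 1) (n + 1)) (g : T →ₗ[ℝ] T [⋀^Fin k]→ₗ[ℝ] A) (u : Fin (n + 1) → T) :
    contract b χ (AlternatingMap.alternatizeUncurryFin g) u =
      ∑ i : Fin (n + 1), (-1 : ℝ) ^ (i : ℕ) *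
        contract b (trace b χ) (g (u i)) (i.removeNth u) := by
  have hL : contract b χ (AlternatingMap.alternatizeUncurryFin g) u =
      (k.factorial : ℝ)⁻¹ * ∑ l : Fin (n + 1), ∑ K : Fin k → Fin (n + 1),
        χ (Matrix.vecCons (b.coord l) fun i => b.coord (K i)) u (g (b l) fun i => b (K i)) := by
    rw [contract_eq_sum]
    simp only [alternatizeUncurryFin_apply_real, map_sum]
    rw [Finset.sum_comm]
    have hp : ∀ p : Fin (k + 1), ∑ J : Fin (k + 1) → Fin (n + 1),
        χ (fun i => b.coord (J i)) u ((-1 : ℝ) ^ (p : ℕ) • g (b (J p))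
          (p.removeNth fun i => b (J i))) =
        ∑ l : Fin (n + 1), ∑ K : Fin k → Fin (n + 1),
        χ (Matrix.vecCons (b.coord l) fun i => b.coord (K i)) u (g (b l) fun i => b (K i)) := by
      intro p
      -- A multi-index of length `k + 1` is split into its entry at `p` and the rest; moving that
      -- entry to the front in `χ` cancels `(-1) ^ p`.
      rw [← Fintype.sum_prod_type', ← (Fin.insertNthEquiv (fun _ => Fin (n + 1)) p).sum_comp]
      refine Finset.sum_congr rfl fun q _ => ?_
      simp only [Fin.insertNthEquiv_apply]
      have h1 : (fun i => b.coord ((p.insertNth q.1 q.2 : Fin (k + 1) → Fin (n + 1)) i)) =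
          p.insertNth (b.coord q.1) (fun i => b.coord (q.2 i)) := by
        funext i
        refine p.succAboveCases ?_ (fun i => ?_) i <;> simp
      have h2 : (p.removeNth fun i => b ((p.insertNth q.1 q.2 : Fin (k + 1) → Fin (n + 1)) i)) =
          fun i => b (q.2 i) := by
        funext i
        simp [Fin.removeNth_apply]
      have h3 := AlternatingMap.map_insertNth (N := T [⋀^Fin (n + 1)]→ₗ[ℝ] Module.Dual ℝ A) χ p
        (b.coord q.1) (fun i => b.coord (q.2 i))
      rw [h1, h2, h3, ← Int.cast_smul_eq_zsmul ℝ]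
      simp only [Fin.insertNth_apply_same, AlternatingMap.smul_apply, LinearMap.smul_apply,
        map_smul, smul_eq_mul, Int.cast_pow, Int.cast_neg, Int.cast_one]
      rw [← mul_assoc, neg_one_pow_mul_self, one_mul]
    rw [Finset.sum_congr rfl fun p _ => hp p]
    simp only [Finset.sum_const, Finset.card_univ, Fintype.card_fin, nsmul_eq_mul,
      Nat.factorial_succ]
    push_cast
    have hn1 : (k : ℝ) + 1 ≠ 0 := by positivity
    field_simp
  rw [hL]
  simp only [contract_eq_sum, trace_apply]
  have hR : ∀ i : Fin (n + 1), (-1 : ℝ) ^ (i : ℕ) * ((k.factorial : ℝ)⁻¹ *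
      ∑ K : Fin k → Fin (n + 1), ∑ l : Fin (n + 1),
        χ (Matrix.vecCons (b.coord l) fun i => b.coord (K i)) (Matrix.vecCons (b l) (i.removeNth u))
          (g (u i) fun i => b (K i))) =
      (k.factorial : ℝ)⁻¹ * ∑ l : Fin (n + 1), ∑ K : Fin k → Fin (n + 1), (-1 : ℝ) ^ (i : ℕ) *
        χ (Matrix.vecCons (b.coord l) fun i => b.coord (K i)) (Matrix.vecCons (b l) (i.removeNth u))
          (g (u i) fun i => b (K i)) := by
    intro i
    rw [Finset.sum_comm, mul_left_comm]
    simp only [Finset.mul_sum]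
  rw [Finset.sum_congr rfl fun i _ => hR i, ← Finset.mul_sum]
  refine congrArg _ (Eq.trans ?_ Finset.sum_comm)
  refine Finset.sum_congr rfl fun l _ => Eq.trans ?_ Finset.sum_comm
  refine Finset.sum_congr rfl fun K _ => ?_
  let G : T →ₗ[ℝ] A := LinearMap.mk (AddHom.mk (fun v => g v fun i => b (K i))
    (by intro x y; simp)) (by intro a x; simp)
  have := sum_neg_one_pow_eq_of_top b
    (χ (Matrix.vecCons (b.coord l) fun i => b.coord (K i))) G (b l) rfl u
  simpa [G] using this.symm

theorem contract_alternatizeSkew {m n k : ℕ} (b : Module.Basis (Fin m) ℝ T)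
    (g : T →ₗ[ℝ] SkewTensor T A k n) (φ : T [⋀^Fin k]→ₗ[ℝ] A) (u : Fin (n + 1) → T) :
    contract b (alternatizeSkew g) φ u =
      ∑ i : Fin (n + 1), (-1 : ℝ) ^ (i : ℕ) * contract b (g (u i)) φ (i.removeNth u) := by
  simp only [contract_apply, alternatizeSkew_apply, Finset.mul_sum]
  rw [Finset.sum_comm]

/-- The counterpart of `alternatize_wedge`, with `g` for `∇ φ` and `g'` for `∇*` of the trace. The
derivative slot is already the first form slot, so no sign appears. -/
theorem alternatize_contract {n k : ℕ} (b : Module.Basis (Fin (n + 1)) ℝ T)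
    (χ : SkewTensor T A (k + 1) (n + 1)) (φ : T [⋀^Fin k]→ₗ[ℝ] A)
    (g : T →ₗ[ℝ] T [⋀^Fin k]→ₗ[ℝ] A) (g' : T →ₗ[ℝ] SkewTensor T A k n) :
    AlternatingMap.alternatizeUncurryFin
      (contractₗ b A k n (trace b χ) ∘ₗ g + (contractₗ b A k n).flip φ ∘ₗ g' :
        T →ₗ[ℝ] T [⋀^Fin n]→ₗ[ℝ] ℝ) =
      contract b χ (AlternatingMap.alternatizeUncurryFin g) + contract b (alternatizeSkew g') φ := by
  ext u
  rw [AlternatingMap.add_apply, contract_alternatize, contract_alternatizeSkew,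
    ← Finset.sum_add_distrib, alternatizeUncurryFin_apply_real]
  refine Finset.sum_congr rfl fun i _ => ?_
  simp only [LinearMap.add_apply, LinearMap.comp_apply, LinearMap.flip_apply, contractₗ_apply,
    AlternatingMap.add_apply, smul_eq_mul, mul_add]

end ContractLeibniz

/-! ### Alternating maps on Euclidean space as a normed space. -/

section ContinuousForms

variable {m k : ℕ} {Y : Type*} [NormedAddCommGroup Y] [NormedSpace ℝ Y]

theorem alternatingMap_eq_sum_basisFun (a : EuclideanSpace ℝ (Fin m) [⋀^Fin k]→ₗ[ℝ] Y)
    (v : Fin k → EuclideanSpace ℝ (Fin m)) :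
    a v = ∑ K : Fin k → Fin m, (∏ i, v i (K i)) •
      a (fun i => EuclideanSpace.basisFun (Fin m) ℝ (K i)) := by
  have h : v = fun i => ∑ j, v i j • EuclideanSpace.basisFun (Fin m) ℝ j := by
    funext i
    exact ((EuclideanSpace.basisFun (Fin m) ℝ).sum_repr (v i)).symm
  have h1 : a v = a.toMultilinearMap
      (fun i => ∑ j, v i j • EuclideanSpace.basisFun (Fin m) ℝ j) := congrArg a h
  rw [h1, MultilinearMap.map_sum]
  exact Finset.sum_congr rfl fun K _ => a.toMultilinearMap.map_smul_univ _ _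

theorem alternatingMap_continuous (a : EuclideanSpace ℝ (Fin m) [⋀^Fin k]→ₗ[ℝ] Y) :
    Continuous a := by
  have h : (a : (Fin k → EuclideanSpace ℝ (Fin m)) → Y) = fun v =>
      ∑ K : Fin k → Fin m, (∏ i, v i (K i)) •
        a (fun i => EuclideanSpace.basisFun (Fin m) ℝ (K i)) :=
    funext (alternatingMap_eq_sum_basisFun a)
  rw [h]
  fun_prop

/-- An alternating map on a Euclidean space, as a continuous alternating map. -/
def continuousAlternating (a : EuclideanSpace ℝ (Fin m) [⋀^Fin k]→ₗ[ℝ] Y) :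
    EuclideanSpace ℝ (Fin m) [⋀^Fin k]→L[ℝ] Y :=
  { a with cont := alternatingMap_continuous a }

@[simp] theorem continuousAlternating_apply (a : EuclideanSpace ℝ (Fin m) [⋀^Fin k]→ₗ[ℝ] Y)
    (v : Fin k → EuclideanSpace ℝ (Fin m)) : continuousAlternating a v = a v := rfl

/-- The values of an alternating map on the families of standard basis vectors. -/
def basisValues (m k : ℕ) (Y : Type*) [NormedAddCommGroup Y] [NormedSpace ℝ Y] :
    (EuclideanSpace ℝ (Fin m) [⋀^Fin k]→L[ℝ] Y) →ₗ[ℝ] ((Fin k → Fin m) → Y) where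
  toFun a K := a fun i => EuclideanSpace.basisFun (Fin m) ℝ (K i)
  map_add' _ _ := rfl
  map_smul' _ _ := rfl

theorem basisValues_injective : Function.Injective (basisValues m k Y) := by
  intro a a' h
  ext v
  have e := alternatingMap_eq_sum_basisFun a.toAlternatingMap v
  have e' := alternatingMap_eq_sum_basisFun a'.toAlternatingMap v
  refine e.trans (Eq.trans ?_ e'.symm)
  exact Finset.sum_congr rfl fun K _ => congrArg (_ • ·) (congrFun h K)

/-- A continuous left inverse of `basisValues`. -/
theorem exists_basisValues_leftInverse [FiniteDimensional ℝ Y] :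
    ∃ R : ((Fin k → Fin m) → Y) →L[ℝ] (EuclideanSpace ℝ (Fin m) [⋀^Fin k]→L[ℝ] Y),
      ∀ a, R (basisValues m k Y a) = a := by
  obtain ⟨R, hR⟩ := (basisValues m k Y).exists_leftInverse_of_injective
    (LinearMap.ker_eq_bot.2 basisValues_injective)
  exact ⟨LinearMap.toContinuousLinearMap R, fun a => LinearMap.congr_fun hR a⟩

end ContinuousForms

theorem two_le_infty : (2 : WithTop ℕ∞) ≤ ∞ :=
  WithTop.coe_le_coe.2 (le_top : (2 : ℕ∞) ≤ ⊤)

/-! ### Tangent vectors, derivatives and exterior derivatives in an arbitrary chart. -/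

section Charts

variable {m : ℕ} {H : Type*} [TopologicalSpace H]
  (I : ModelWithCorners ℝ (EuclideanSpace ℝ (Fin m)) H)
  {X : Type*} [TopologicalSpace X] [ChartedSpace H X] [IsManifold I ∞ X]

theorem tangentVec_tangentCoord {c x : X} (hx : x ∈ (chartAt H c).source) (w : TangentSpace I x) :
    tangentVec I c x (tangentCoord I c x w) = w :=
  (trivializationAt (EuclideanSpace ℝ (Fin m)) (TangentSpace I) c).symmₗ_linearMapAt
    (R := ℝ) (by simpa using hx) w

theorem tangentCoord_tangentVec {c x : X} (hx : x ∈ (chartAt H c).source)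
    (v : EuclideanSpace ℝ (Fin m)) : tangentCoord I c x (tangentVec I c x v) = v :=
  (trivializationAt (EuclideanSpace ℝ (Fin m)) (TangentSpace I) c).linearMapAt_symmₗ
    (R := ℝ) (by simpa using hx) v

theorem tangentCoord_eq {c x : X} (hx : x ∈ (chartAt H c).source) (w : TangentSpace I x) :
    tangentCoord I c x w = tangentCoordChange I x c x w :=
  congrArg (fun L : TangentSpace I x →L[ℝ] EuclideanSpace ℝ (Fin m) => L w)
    (TangentBundle.continuousLinearMapAt_trivializationAt_eq_core (I := I) hx)

theorem tangentVec_eq {c x : X} (hx : x ∈ (chartAt H c).source) (v : EuclideanSpace ℝ (Fin m)) :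
    tangentVec I c x v = tangentCoordChange I c x x v :=
  congrArg (fun L : EuclideanSpace ℝ (Fin m) →L[ℝ] TangentSpace I x => L v)
    (TangentBundle.symmL_trivializationAt_eq_core (I := I) hx)

theorem tangentCoord_self (x : X) (w : TangentSpace I x) : tangentCoord I x x w = w := by
  have h : ∀ v : EuclideanSpace ℝ (Fin m), tangentCoordChange I x x x v = v := fun v =>
    tangentCoordChange_self (mem_extChartAt_source x)
  exact (tangentCoord_eq I (mem_chart_source H x) w).trans (h w)

theorem tangentVec_self (x : X) (v : EuclideanSpace ℝ (Fin m)) : tangentVec I x x v = v := by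
  have h : tangentCoordChange I x x x v = v := tangentCoordChange_self (mem_extChartAt_source x)
  exact (tangentVec_eq I (mem_chart_source H x) v).trans h

theorem extendVec_self (x : X) (w : TangentSpace I x) : extendVec I x w x = w :=
  tangentVec_tangentCoord I (mem_chart_source H x) w

theorem tangentCoord_tangentVec_change {c c' x : X} (hx : x ∈ (chartAt H c).source)
    (hx' : x ∈ (chartAt H c').source) (v : EuclideanSpace ℝ (Fin m)) :
    tangentCoord I c' x (tangentVec I c x v) = tangentCoordChange I c c' x v := by
  refine (tangentCoord_eq I hx' _).trans ?_
  exact (congrArg (tangentCoordChange I x c' x) (tangentVec_eq I hx v)).trans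
    (tangentCoordChange_comp (E := EuclideanSpace ℝ (Fin m)) (by simp [hx, hx']))

theorem tangentCoord_eq_mfderiv {c x : X} (hx : x ∈ (chartAt H c).source) (w : TangentSpace I x) :
    tangentCoord I c x w = mfderiv I 𝓘(ℝ, EuclideanSpace ℝ (Fin m)) (extChartAt I c) x w :=
  congrArg (fun L : TangentSpace I x →L[ℝ] EuclideanSpace ℝ (Fin m) => L w)
    (have : IsManifold I 1 X := IsManifold.of_le (n := ∞) (by simp)
     TangentBundle.continuousLinearMapAt_trivializationAt (I := I) hx)

variable {Y : Type*} [NormedAddCommGroup Y] [NormedSpace ℝ Y]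

theorem mdifferentiableAt_iff_chart {c x : X} (hx : x ∈ (chartAt H c).source) {g : X → Y} :
    MDifferentiableAt I 𝓘(ℝ, Y) g x ↔
      ContinuousAt g x ∧
      DifferentiableWithinAt ℝ (g ∘ (extChartAt I c).symm) (Set.range I) (extChartAt I c x) := by
  have : IsManifold I 1 X := IsManifold.of_le (n := ∞) (by simp)
  have := mdifferentiableAt_iff_of_mem_source (I := I) (I' := 𝓘(ℝ, Y)) (f := g) (x := c) (y := g x)
    hx (by simp)
  simpa using! this

/-- Any chart whose domain contains the point computes the derivative, by the chain rule, and not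
only the preferred chart at that point. -/
theorem mvfderiv_eq_chart {c x : X} (hx : x ∈ (chartAt H c).source) {g : X → Y}
    (hg : MDifferentiableAt I 𝓘(ℝ, Y) g x) (w : TangentSpace I x) :
    mvfderiv I g x w = fderivWithin ℝ (g ∘ (extChartAt I c).symm) (Set.range I) (extChartAt I c x)
      (tangentCoord I c x w) := by
  have : IsManifold I 1 X := IsManifold.of_le (n := ∞) (by simp)
  have h1 := ((mdifferentiableAt_iff_chart I hx).1 hg).2.hasFDerivWithinAt.hasMFDerivWithinAt
  have h2 : HasMFDerivAt I 𝓘(ℝ, EuclideanSpace ℝ (Fin m)) (extChartAt I c) x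
      (mfderiv I 𝓘(ℝ, EuclideanSpace ℝ (Fin m)) (extChartAt I c) x) :=
    (mdifferentiableAt_extChartAt hx).hasMFDerivAt
  have h3 := (HasMFDerivWithinAt.comp (u := Set.range I) (s := Set.univ) x h1
    h2.hasMFDerivWithinAt (fun y _ => by simp [extChartAt])).hasMFDerivAt Filter.univ_mem
  have h4 : HasMFDerivAt I 𝓘(ℝ, Y) g x _ := h3.congr_of_eventuallyEq (by
    filter_upwards [(chartAt H c).open_source.mem_nhds hx] with y hy
    simp [(chartAt H c).left_inv hy])
  rw [mvfderiv, h4.mfderiv, tangentCoord_eq_mfderiv I hx]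
  rfl

theorem contMDiffAt_iff_chart {r : WithTop ℕ∞} (hr : r ≤ ∞) {c x : X}
    (hx : x ∈ (chartAt H c).source) {g : X → Y} :
    ContMDiffAt I 𝓘(ℝ, Y) r g x ↔
      ContDiffWithinAt ℝ r (g ∘ (extChartAt I c).symm) (Set.range I) (extChartAt I c x) := by
  have : IsManifold I r X := IsManifold.of_le (n := ∞) hr
  rw [contMDiffAt_iff_source_of_mem_source hx, contMDiffWithinAt_iff_contDiffWithinAt]

theorem mvfderiv_congr {g g' : X → Y} {x : X} (h : g =ᶠ[𝓝 x] g') :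
    mvfderiv I g x = mvfderiv I g' x := by
  ext w
  have e : mfderiv I 𝓘(ℝ, Y) g x = mfderiv I 𝓘(ℝ, Y) g' x := h.mfderiv_eq
  simp only [mvfderiv]
  exact congrArg (fun L : TangentSpace I x →L[ℝ] Y => L w) e

theorem mvfderiv_clm_comp {Z : Type*} [NormedAddCommGroup Z] [NormedSpace ℝ Z] (L : Y →L[ℝ] Z)
    {g : X → Y} {x : X} (hg : MDifferentiableAt I 𝓘(ℝ, Y) g x) (w : TangentSpace I x) :
    mvfderiv I (fun y => L (g y)) x w = L (mvfderiv I g x w) := by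
  have hx := mem_chart_source H x
  have hd := ((mdifferentiableAt_iff_chart I hx).1 hg).2
  have hL : MDifferentiableAt I 𝓘(ℝ, Z) (fun y => L (g y)) x :=
    L.differentiableAt.comp_mdifferentiableAt hg
  rw [mvfderiv_eq_chart I hx hL, mvfderiv_eq_chart I hx hg]
  have h := (L.hasFDerivAt.comp_hasFDerivWithinAt _ hd.hasFDerivWithinAt).fderivWithin
    (I.uniqueDiffOn _ (by simp [extChartAt]))
  exact congrArg (fun A => A (tangentCoord I x x w)) h

/-- A form with values in a vector space, read in the chart at `c`. -/
def chartForm {k : ℕ} (θ : ∀ y : X, TangentSpace I y [⋀^Fin k]→ₗ[ℝ] Y) (c : X)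
    (z : EuclideanSpace ℝ (Fin m)) : EuclideanSpace ℝ (Fin m) [⋀^Fin k]→L[ℝ] Y :=
  continuousAlternating
    ((θ ((extChartAt I c).symm z)).compLinearMap (tangentVec I c ((extChartAt I c).symm z)))

/-- The exterior derivative of a form with values in a vector space. -/
def dForm {k : ℕ} (θ : ∀ y : X, TangentSpace I y [⋀^Fin k]→ₗ[ℝ] Y) (x : X)
    (w : Fin (k + 1) → TangentSpace I x) : Y :=
  ∑ j : Fin (k + 1), (-1 : ℝ) ^ (j : ℕ) •
    mvfderiv I (fun y => θ y fun i => extendVec I x (w (j.succAbove i)) y) x (w j)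

variable [FiniteDimensional ℝ Y]

/-- A continuous left inverse of the evaluation on basis families reduces smoothness in the space of
alternating maps to smoothness of components. -/
theorem contDiffWithinAt_chartForm {r : WithTop ℕ∞} (hr : r ≤ ∞) {k : ℕ}
    {θ : ∀ y : X, TangentSpace I y [⋀^Fin k]→ₗ[ℝ] Y} {c x : X} (hx : x ∈ (chartAt H c).source)
    (hθ : ∀ v : Fin k → EuclideanSpace ℝ (Fin m),
      ContMDiffAt I 𝓘(ℝ, Y) r (fun y => θ y fun i => tangentVec I c y (v i)) x) :
    ContDiffWithinAt ℝ r (chartForm I θ c) (Set.range I) (extChartAt I c x) := by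
  obtain ⟨R, hR⟩ := exists_basisValues_leftInverse (m := m) (k := k) (Y := Y)
  have e : chartForm I θ c = fun z => R (basisValues m k Y (chartForm I θ c z)) :=
    funext fun z => (hR _).symm
  rw [e]
  refine R.contDiff.comp_contDiffWithinAt (contDiffWithinAt_pi.2 fun K => ?_)
  exact (contMDiffAt_iff_chart I hr hx).1 (hθ _)

/-- Two chart expressions of a form differ by pull-back along the transition map. This holds only
near the point, within the range of the model, since boundary points are allowed. -/
theorem chartForm_change {k : ℕ} (θ : ∀ y : X, TangentSpace I y [⋀^Fin k]→ₗ[ℝ] Y) {c c' x : X}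
    (hx : x ∈ (chartAt H c).source) (hx' : x ∈ (chartAt H c').source) :
    ∀ᶠ z in 𝓝[Set.range I] (extChartAt I c x), chartForm I θ c z =
      (chartForm I θ c' ((extChartAt I c' ∘ (extChartAt I c).symm) z)).compContinuousLinearMap
        (fderivWithin ℝ (extChartAt I c' ∘ (extChartAt I c).symm) (Set.range I) z) := by
  have ht : (extChartAt I c).target ∈ 𝓝[Set.range I] (extChartAt I c x) :=
    extChartAt_target_mem_nhdsWithin_of_mem
      ((extChartAt I c).map_source (by simpa using hx))
  have hc : ContinuousAt (extChartAt I c).symm (extChartAt I c x) :=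
    continuousAt_extChartAt_symm' (by simpa using hx)
  have hs : ∀ᶠ z in 𝓝[Set.range I] (extChartAt I c x),
      (extChartAt I c).symm z ∈ (chartAt H c').source := by
    refine hc.continuousWithinAt.eventually_mem ((chartAt H c').open_source.mem_nhds ?_)
    rwa [(extChartAt I c).left_inv (by simpa using hx)]
  filter_upwards [ht, hs] with z hz hz'
  have h1 : (extChartAt I c).symm z ∈ (chartAt H c).source := by
    simpa using (extChartAt I c).map_target hz
  ext v
  have e : (extChartAt I c').symm ((extChartAt I c' ∘ (extChartAt I c).symm) z)
      = (extChartAt I c).symm z := (extChartAt I c').left_inv (by simpa using hz')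
  have e2 : ∀ u, tangentCoord I c' ((extChartAt I c).symm z)
      (tangentVec I c ((extChartAt I c).symm z) u) =
      fderivWithin ℝ (extChartAt I c' ∘ (extChartAt I c).symm) (Set.range I) z u := by
    intro u
    rw [tangentCoord_tangentVec_change I h1 hz', tangentCoordChange_def,
      (extChartAt I c).right_inv hz]
  simp only [chartForm, continuousAlternating_apply, AlternatingMap.compLinearMap_apply,
    ContinuousAlternatingMap.compContinuousLinearMap_apply]
  rw [e]
  congr 1
  funext i
  simp only [Function.comp]
  exact ((tangentVec_tangentCoord I hz' _).symm).trans
    (congrArg (tangentVec I c' ((extChartAt I c).symm z)) (e2 (v i)))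

theorem coordChange_contDiffWithinAt {c c' x : X}
    (hx : x ∈ (chartAt H c).source) (hx' : x ∈ (chartAt H c').source) :
    ContDiffWithinAt ℝ ∞ (extChartAt I c' ∘ (extChartAt I c).symm) (Set.range I)
      (extChartAt I c x) := by
  refine contDiffWithinAt_ext_coord_change c' c ?_
  rw [PartialEquiv.trans_source'', PartialEquiv.symm_symm, PartialEquiv.symm_target]
  exact Set.mem_image_of_mem _ ⟨by simpa using hx, by simpa using hx'⟩

theorem extChartAt_mem_range (c x : X) : extChartAt I c x ∈ Set.range I := by simp [extChartAt]

/-- The exterior derivative commutes with pull-back along the transition map, because second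
derivatives of that map are symmetric. Hence `d` does not depend on the chart. -/
theorem differentiableWithinAt_chartForm_change {k : ℕ}
    {θ : ∀ y : X, TangentSpace I y [⋀^Fin k]→ₗ[ℝ] Y} {c c' x : X}
    (hx : x ∈ (chartAt H c).source) (hx' : x ∈ (chartAt H c').source)
    (hθ : DifferentiableWithinAt ℝ (chartForm I θ c') (Set.range I) (extChartAt I c' x)) :
    DifferentiableWithinAt ℝ (chartForm I θ c) (Set.range I) (extChartAt I c x) ∧
    extDerivWithin (chartForm I θ c) (Set.range I) (extChartAt I c x) =
      (extDerivWithin (chartForm I θ c') (Set.range I) (extChartAt I c' x)).compContinuousLinearMap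
        (tangentCoordChange I c c' x) := by
  set f := extChartAt I c' ∘ (extChartAt I c).symm with hf
  have hfs : ContDiffWithinAt ℝ ∞ f (Set.range I) (extChartAt I c x) :=
    coordChange_contDiffWithinAt I hx hx'
  have hmem := extChartAt_mem_range I c x
  have hfx : f (extChartAt I c x) = extChartAt I c' x := by
    simp [hf, (chartAt H c).left_inv hx]
  have hst : Set.MapsTo f (Set.range I) (Set.range I) := fun z _ =>
    extChartAt_mem_range I c' _
  have hev := chartForm_change I θ hx hx'
  have hpt := hev.self_of_nhdsWithin hmem
  have hd2 : DifferentiableWithinAt ℝ (fderivWithin ℝ f (Set.range I)) (Set.range I)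
      (extChartAt I c x) :=
    (hfs.fderivWithin_right I.uniqueDiffOn (m := 1) (by rw [one_add_one_eq_two]; exact two_le_infty)
      hmem).differentiableWithinAt one_ne_zero
  rw [← hfx] at hθ
  constructor
  · refine DifferentiableWithinAt.congr_of_eventuallyEq ?_ hev hpt
    exact DifferentiableWithinAt.continuousAlternatingMapCompContinuousLinearMap
      (hθ.comp _ (hfs.differentiableWithinAt (by simp)) hst) hd2
  · rw [Filter.EventuallyEq.extDerivWithin_eq hev hpt]
    have := extDerivWithin_pullback (r := ∞) (s := Set.range I) (t := Set.range I) hθ hfs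
      (by rw [minSmoothness_of_isRCLikeNormedField]; exact two_le_infty) I.uniqueDiffOn
      (I.range_subset_closure_interior hmem) hmem hst
    rw [this, hfx]
    rfl

/-- `dForm` uses a different chart at each point. Naturality replaces all of them by one fixed
chart. -/
theorem dForm_eq_extDerivWithin {k : ℕ} {θ : ∀ y : X, TangentSpace I y [⋀^Fin k]→ₗ[ℝ] Y}
    {c x : X} (hx : x ∈ (chartAt H c).source)
    (hθ : DifferentiableWithinAt ℝ (chartForm I θ c) (Set.range I) (extChartAt I c x))
    (w : Fin (k + 1) → TangentSpace I x) :
    dForm I θ x w = extDerivWithin (chartForm I θ c) (Set.range I) (extChartAt I c x)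
      fun i => tangentCoord I c x (w i) := by
  have hxx := mem_chart_source H x
  obtain ⟨h1, h2⟩ := differentiableWithinAt_chartForm_change I hxx hx hθ
  have h3 : dForm I θ x w = extDerivWithin (chartForm I θ x) (Set.range I) (extChartAt I x x)
      fun i => tangentCoord I x x (w i) := by
    rw [extDerivWithin_apply h1 (I.uniqueDiffOn _ (extChartAt_mem_range I x x))]
    refine Finset.sum_congr rfl fun j _ => ?_
    have hg : MDifferentiableAt I 𝓘(ℝ, Y)
        (fun y => θ y fun i => extendVec I x (w (j.succAbove i)) y) x := by
      have hd := (ContinuousAlternatingMap.apply ℝ _ Y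
        (fun i => tangentCoord I x x (w (j.succAbove i)))).differentiableAt.comp_differentiableWithinAt _ h1
      rw [mdifferentiableAt_iff_chart I hxx]
      refine ⟨?_, hd⟩
      have hc := hd.continuousWithinAt
      have hcomp : ContinuousAt (((ContinuousAlternatingMap.apply ℝ _ Y
        (fun i => tangentCoord I x x (w (j.succAbove i)))) ∘ (chartForm I θ x)) ∘ extChartAt I x) x := by
        rw [← continuousWithinAt_univ]
        exact hc.comp (continuousAt_extChartAt x).continuousWithinAt
          (fun y _ => extChartAt_mem_range I x y)
      refine hcomp.congr ?_
      filter_upwards [(chartAt H x).open_source.mem_nhds hxx] with y hy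
      have e : (extChartAt I x).symm (extChartAt I x y) = y :=
        (extChartAt I x).left_inv (by simpa using hy)
      simp only [Function.comp, chartForm, ContinuousAlternatingMap.apply_apply,
        continuousAlternating_apply, AlternatingMap.compLinearMap_apply]
      rw [e]
      rfl
    rw [mvfderiv_eq_chart I hxx hg, ← Int.cast_smul_eq_zsmul ℝ]
    push_cast
    rfl
  rw [h3, h2, ContinuousAlternatingMap.compContinuousLinearMap_apply]
  congr 1
  funext i
  simp only [Function.comp]
  rw [tangentCoord_self]
  exact (tangentCoord_eq I hx (w i)).symm

/-- Near `c` the exterior derivative is the one computed in the single chart at `c`, where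
smoothness is visible. -/
theorem contMDiffAt_dForm {k : ℕ} {θ : ∀ y : X, TangentSpace I y [⋀^Fin k]→ₗ[ℝ] Y} {c : X}
    (hθ : ∀ v : Fin k → EuclideanSpace ℝ (Fin m),
      ContMDiffAt I 𝓘(ℝ, Y) ∞ (fun y => θ y fun i => tangentVec I c y (v i)) c)
    (v : Fin (k + 1) → EuclideanSpace ℝ (Fin m)) :
    ContMDiffAt I 𝓘(ℝ, Y) ∞ (fun y => dForm I θ y fun i => tangentVec I c y (v i)) c := by
  have hc := mem_chart_source H c
  have h1 := contDiffWithinAt_chartForm I le_rfl hc hθ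
  have h2 : ∀ᶠ x in 𝓝 c, ∀ v : Fin (k + 1) → EuclideanSpace ℝ (Fin m),
      dForm I θ x (fun i => tangentVec I c x (v i)) =
      extDerivWithin (chartForm I θ c) (Set.range I) (extChartAt I c x) v := by
    have h3 : ∀ᶠ z in 𝓝[Set.range I] (extChartAt I c c),
        DifferentiableWithinAt ℝ (chartForm I θ c) (Set.range I) z := by
      have := (h1.of_le (m := 1) (by exact_mod_cast le_top)).eventually (by simp)
      rw [Set.insert_eq_of_mem (extChartAt_mem_range I c c)] at this
      exact this.mono fun z hz => hz.differentiableWithinAt one_ne_zero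
    have h4 : Filter.Tendsto (extChartAt I c) (𝓝 c) (𝓝[Set.range I] (extChartAt I c c)) :=
      tendsto_nhdsWithin_of_tendsto_nhds_of_eventually_within _ (continuousAt_extChartAt c)
        (Filter.Eventually.of_forall fun y => extChartAt_mem_range I c y)
    filter_upwards [h4.eventually h3, (chartAt H c).open_source.mem_nhds hc] with x hx hxc v
    rw [dForm_eq_extDerivWithin I hxc hx]
    congr 1
    funext i
    exact tangentCoord_tangentVec I hxc _
  refine ContMDiffAt.congr_of_eventuallyEq ?_ (h2.mono fun x hx => hx v)
  have h5 : ContDiffWithinAt ℝ ∞ (extDerivWithin (chartForm I θ c) (Set.range I)) (Set.range I)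
      (extChartAt I c c) :=
    (ContinuousAlternatingMap.alternatizeUncurryFinCLM ℝ _ Y).contDiff.comp_contDiffWithinAt
      (h1.fderivWithin_right I.uniqueDiffOn (by simp) (extChartAt_mem_range I c c))
  have h6 := (ContinuousAlternatingMap.apply ℝ _ Y v).contDiff.comp_contDiffWithinAt h5
  have h7 : ContMDiffWithinAt I 𝓘(ℝ, Y) ∞ _ Set.univ c :=
    ContMDiffWithinAt.comp c (g := (ContinuousAlternatingMap.apply ℝ _ Y v) ∘
      extDerivWithin (chartForm I θ c) (Set.range I)) (t := Set.range I)
      h6.contMDiffWithinAt (contMDiffAt_extChartAt (n := ∞)).contMDiffWithinAt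
      (fun y _ => extChartAt_mem_range I c y)
  exact h7

end Charts

/-! ### Sections of the bundle in a local trivialization. -/

section BundleCoordinates

variable {m : ℕ} {H : Type*} [TopologicalSpace H]
  {I : ModelWithCorners ℝ (EuclideanSpace ℝ (Fin m)) H}
  {X : Type*} [TopologicalSpace X] [ChartedSpace H X] [IsManifold I ∞ X]
  {F : Type*} [NormedAddCommGroup F] [NormedSpace ℝ F]
  {E : X → Type*} [∀ x, AddCommMonoid (E x)] [∀ x, Module ℝ (E x)]
  [TopologicalSpace (Bundle.TotalSpace F E)] [∀ x, TopologicalSpace (E x)]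
  [FiberBundle F E] [VectorBundle ℝ F E]

theorem bundleVec_bundleCoord {c x : X} (hx : x ∈ (trivializationAt F E c).baseSet) (e : E x) :
    bundleVec F E c x (bundleCoord F E c x e) = e :=
  (trivializationAt F E c).symmₗ_linearMapAt (R := ℝ) hx e

theorem bundleCoord_bundleVec {c x : X} (hx : x ∈ (trivializationAt F E c).baseSet) (f : F) :
    bundleCoord F E c x (bundleVec F E c x f) = f :=
  (trivializationAt F E c).linearMapAt_symmₗ (R := ℝ) hx f

theorem baseSet_mem_nhds {c x : X} (hx : x ∈ (trivializationAt F E c).baseSet) :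
    (trivializationAt F E c).baseSet ∈ 𝓝 x :=
  (trivializationAt F E c).open_baseSet.mem_nhds hx

variable (F E) in
theorem mem_baseSet_self (x : X) : x ∈ (trivializationAt F E x).baseSet :=
  FiberBundle.mem_baseSet_trivializationAt F E x

theorem bundleCoord_eventuallyEq {c x : X} (hx : x ∈ (trivializationAt F E c).baseSet)
    (s : ∀ y, E y) : (fun y => ((trivializationAt F E c) ⟨y, s y⟩).2) =ᶠ[𝓝 x]
      fun y => bundleCoord F E c y (s y) := by
  filter_upwards [baseSet_mem_nhds hx] with y hy
  simp only [bundleCoord, Bundle.Trivialization.coe_linearMapAt_of_mem _ hy]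

theorem extendSec_self (x : X) (e : E x) : extendSec F E x e x = e :=
  bundleVec_bundleCoord (mem_baseSet_self F E x) e

variable [ContMDiffVectorBundle ∞ F E I]

theorem mdifferentiableAt_section_iff_coord {c x : X}
    (hx : x ∈ (trivializationAt F E c).baseSet) {s : ∀ y, E y} :
    MDifferentiableAt I (I.prod 𝓘(ℝ, F)) (fun y => Bundle.TotalSpace.mk' F y (s y)) x ↔
      MDifferentiableAt I 𝓘(ℝ, F) (fun y => bundleCoord F E c y (s y)) x := by
  rw [(trivializationAt F E c).mdifferentiableAt_section_iff I s hx]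
  exact (bundleCoord_eventuallyEq hx s).mdifferentiableAt_iff

theorem contMDiffAt_section_iff_coord {r : WithTop ℕ∞} (hr : r ≤ ∞) {c x : X}
    (hx : x ∈ (trivializationAt F E c).baseSet) {s : ∀ y, E y} :
    ContMDiffAt I (I.prod 𝓘(ℝ, F)) r (fun y => Bundle.TotalSpace.mk' F y (s y)) x ↔
      ContMDiffAt I 𝓘(ℝ, F) r (fun y => bundleCoord F E c y (s y)) x := by
  have : ContMDiffVectorBundle r F E I := ContMDiffVectorBundle.of_le hr
  rw [(trivializationAt F E c).contMDiffAt_section_iff hx]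
  exact (bundleCoord_eventuallyEq hx s).contMDiffAt_iff

theorem bundleCoord_bundleVec_eventuallyEq {c x : X}
    (hx : x ∈ (trivializationAt F E c).baseSet) (f : F) :
    (fun y => bundleCoord F E c y (bundleVec F E c y f)) =ᶠ[𝓝 x] fun _ => f := by
  filter_upwards [baseSet_mem_nhds hx] with y hy
  exact bundleCoord_bundleVec hy f

theorem contMDiffAt_bundleVec {c x : X} (hx : x ∈ (trivializationAt F E c).baseSet) (f : F) :
    ContMDiffAt I (I.prod 𝓘(ℝ, F)) ∞
      (fun y => Bundle.TotalSpace.mk' F y (bundleVec F E c y f)) x :=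
  (contMDiffAt_section_iff_coord le_rfl hx).2
    (contMDiffAt_const.congr_of_eventuallyEq (bundleCoord_bundleVec_eventuallyEq hx f))

theorem mdifferentiableAt_bundleVec {c x : X} (hx : x ∈ (trivializationAt F E c).baseSet) (f : F) :
    MDifferentiableAt I (I.prod 𝓘(ℝ, F))
      (fun y => Bundle.TotalSpace.mk' F y (bundleVec F E c y f)) x :=
  (contMDiffAt_bundleVec hx f).mdifferentiableAt (by simp)

end BundleCoordinates

theorem linearMap_eq_sum_repr {ι U Y : Type*} [Fintype ι] [AddCommGroup U] [Module ℝ U]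
    [AddCommMonoid Y] [Module ℝ Y] (b : Module.Basis ι ℝ U) (L : U →ₗ[ℝ] Y) (u : U) :
    L u = ∑ i, b.repr u i • L (b i) := by
  conv_lhs => rw [← b.sum_repr u, map_sum]
  exact Finset.sum_congr rfl fun i _ => map_smul _ _ _

/-! ### Connection coefficients, `d^∇`, and the dual connection. -/

section Coefficients

variable {m : ℕ} {H : Type*} [TopologicalSpace H]
  {I : ModelWithCorners ℝ (EuclideanSpace ℝ (Fin m)) H}
  {X : Type*} [TopologicalSpace X] [ChartedSpace H X] [IsManifold I ∞ X]
  {F : Type*} [NormedAddCommGroup F] [NormedSpace ℝ F]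
  {E : X → Type*} [∀ x, AddCommGroup (E x)] [∀ x, Module ℝ (E x)]
  [TopologicalSpace (Bundle.TotalSpace F E)] [∀ x, TopologicalSpace (E x)]
  [FiberBundle F E] [VectorBundle ℝ F E] [ContMDiffVectorBundle ∞ F E I]
  [∀ x, IsTopologicalAddGroup (E x)] [∀ x, ContinuousSMul ℝ (E x)]

/-- The flat connection of the preferred trivialization at `c`. -/
def flatDeriv (I : ModelWithCorners ℝ (EuclideanSpace ℝ (Fin m)) H) {X : Type*}
    [TopologicalSpace X] [ChartedSpace H X] [IsManifold I ∞ X]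
    (F : Type*) [NormedAddCommGroup F] [NormedSpace ℝ F]
    (E : X → Type*) [∀ x, AddCommGroup (E x)] [∀ x, Module ℝ (E x)]
    [TopologicalSpace (Bundle.TotalSpace F E)] [∀ x, TopologicalSpace (E x)]
    [FiberBundle F E] [VectorBundle ℝ F E] (c : X)
    (s : ∀ y, E y) (x : X) : TangentSpace I x →L[ℝ] E x :=
  ((trivializationAt F E c).symmL ℝ x).comp (mvfderiv I (fun y => bundleCoord F E c y (s y)) x)

theorem flatDeriv_apply (c : X) (s : ∀ y, E y) (x : X) (v : TangentSpace I x) :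
    flatDeriv I F E c s x v =
      bundleVec F E c x (mvfderiv I (fun y => bundleCoord F E c y (s y)) x v) := rfl

theorem flatDeriv_isCovariantDerivativeOn (c : X) :
    IsCovariantDerivativeOn F (flatDeriv I F E c) (trivializationAt F E c).baseSet where
  add {σ σ' x} hσ hσ' hx := by
    rw [mdifferentiableAt_section_iff_coord hx] at hσ hσ'
    ext v
    have e : (fun y => bundleCoord F E c y ((σ + σ') y)) =
        fun y => bundleCoord F E c y (σ y) + bundleCoord F E c y (σ' y) := by
      funext y
      simp
    rw [add_apply, flatDeriv_apply, flatDeriv_apply, flatDeriv_apply, e,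
      mvfderiv_fun_add hσ hσ']
    simp
  leibniz {σ g x} hσ hg hx := by
    rw [mdifferentiableAt_section_iff_coord hx] at hσ
    ext v
    have e : (fun y => bundleCoord F E c y ((g • σ) y)) =
        fun y => g y • bundleCoord F E c y (σ y) := by
      funext y
      simp
    rw [flatDeriv_apply, e, mvfderiv_fun_smul hg hσ]
    simp [flatDeriv_apply, bundleVec_bundleCoord hx]

variable [FiniteDimensional ℝ F] (nab : CovariantDerivative I F E)

/-- The coefficients of a connection in the preferred trivialization at `c`. -/
def connCoeff (c x : X) : F →ₗ[ℝ] TangentSpace I x →ₗ[ℝ] F where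
  toFun f := bundleCoord F E c x ∘ₗ
    (IsCovariantDerivativeOn.difference (nab.isCovariantDerivativeOn (s := (trivializationAt F E c).baseSet))
      (flatDeriv_isCovariantDerivativeOn (I := I) c) x (bundleVec F E c x f)).toLinearMap
  map_add' f f' := by ext v; simp
  map_smul' a f := by ext v; simp

/-- In a trivialization `∇ = d + Γ`: the difference from the flat connection is tensorial and hence
depends only on the value of the section. -/
theorem bundleCoord_connection {c x : X} (hx : x ∈ (trivializationAt F E c).baseSet)
    {s : ∀ y, E y} (hs : MDifferentiableAt I 𝓘(ℝ, F) (fun y => bundleCoord F E c y (s y)) x)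
    (v : TangentSpace I x) :
    bundleCoord F E c x (nab s x v) = mvfderiv I (fun y => bundleCoord F E c y (s y)) x v
      + connCoeff nab c x (bundleCoord F E c x (s x)) v := by
  have h := IsCovariantDerivativeOn.difference_apply
    (hcov := nab.isCovariantDerivativeOn (s := (trivializationAt F E c).baseSet))
    (hcov' := flatDeriv_isCovariantDerivativeOn (I := I) (E := E) (F := F) c) hx
    ((mdifferentiableAt_section_iff_coord hx).2 hs)
  simp only [connCoeff, LinearMap.coe_mk, AddHom.coe_mk, bundleVec_bundleCoord hx, h,
    LinearMap.comp_apply]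
  simp [flatDeriv_apply, bundleCoord_bundleVec hx]

theorem connCoeff_eq {c x : X} (hx : x ∈ (trivializationAt F E c).baseSet) (f : F)
    (v : TangentSpace I x) :
    connCoeff nab c x f v = bundleCoord F E c x (nab (fun y => bundleVec F E c y f) x v) := by
  have h := bundleCoord_bundleVec_eventuallyEq hx f
  have h2 := bundleCoord_connection nab hx (s := fun y => bundleVec F E c y f)
    (mdifferentiableAt_const.congr_of_eventuallyEq h) v
  rw [h2, mvfderiv_congr I h, mvfderiv_const, bundleCoord_bundleVec hx]
  simp

/-- Smoothness of the connection concerns global sections, so the locally constant section is cut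
off by a bump function; by locality of `∇` this changes nothing near `c`. -/
theorem contMDiffAt_connCoeff [T2Space X] [CovariantDerivative.ContMDiffCovariantDerivative nab ∞]
    (c : X) (f : F) (v : EuclideanSpace ℝ (Fin m)) :
    ContMDiffAt I 𝓘(ℝ, F) ∞ (fun y => connCoeff nab c y f (tangentVec I c y v)) c := by
  have hc := mem_baseSet_self F E c
  obtain ⟨ρ, hρ⟩ : ∃ ρ : SmoothBumpFunction I c, tsupport ρ ⊆ (trivializationAt F E c).baseSet := by
    obtain ⟨ρ, -, h⟩ := (SmoothBumpFunction.nhds_basis_tsupport (I := I) c).mem_iff.1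
      (baseSet_mem_nhds hc)
    exact ⟨ρ, h⟩
  let s : ∀ y, E y := fun y => ρ y • bundleVec F E c y f
  have hs : ContMDiff I (I.prod 𝓘(ℝ, F)) ∞ (fun y => Bundle.TotalSpace.mk' F y (s y)) := by
    intro x
    by_cases hx : x ∈ tsupport ρ
    · have hb := hρ hx
      rw [contMDiffAt_section_iff_coord le_rfl hb]
      refine ContMDiffAt.congr_of_eventuallyEq (ρ.contMDiffAt.smul contMDiffAt_const :
        ContMDiffAt I 𝓘(ℝ, F) ∞ (fun y => ρ y • f) x) ?_
      filter_upwards [baseSet_mem_nhds hb] with y hy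
      simp [s, bundleCoord_bundleVec hy]
    · have hb := mem_baseSet_self F E x
      rw [contMDiffAt_section_iff_coord le_rfl hb]
      refine ContMDiffAt.congr_of_eventuallyEq (contMDiffAt_const :
        ContMDiffAt I 𝓘(ℝ, F) ∞ (fun _ => (0 : F)) x) ?_
      filter_upwards [(isClosed_tsupport ρ).isOpen_compl.mem_nhds hx] with y hy
      simp [s, image_eq_zero_of_notMem_tsupport hy]
  have hn := (CovariantDerivative.ContMDiffCovariantDerivative.contMDiff (cov := nab)
    (k := ∞)).contMDiff (σ := s) (contMDiffOn_univ.2 (by simpa using! hs))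
  have hn' := contMDiffOn_univ.1 hn c
  have hv : ContMDiffAt I (I.prod 𝓘(ℝ, EuclideanSpace ℝ (Fin m))) ∞
      (fun y => Bundle.TotalSpace.mk' (EuclideanSpace ℝ (Fin m)) y
        (bundleVec (EuclideanSpace ℝ (Fin m)) (TangentSpace I) c y v)) c :=
    contMDiffAt_bundleVec (mem_baseSet_self _ _ c) v
  have h1 : ContMDiffAt I (I.prod 𝓘(ℝ, F)) ∞
      (fun y => Bundle.TotalSpace.mk' F y (nab s y (tangentVec I c y v))) c :=
    ContMDiffAt.clm_bundle_apply hn' hv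
  rw [contMDiffAt_section_iff_coord le_rfl hc] at h1
  refine h1.congr_of_eventuallyEq ?_
  -- The bump must equal `1` around `y` and not only at `y`, since `∇` at `y` sees the germ of the
  -- section.
  have he : ∀ᶠ y in 𝓝 c, ∀ᶠ z in 𝓝 y, ρ z = 1 := by
    exact eventually_eventually_nhds.2 ρ.eventuallyEq_one
  filter_upwards [he, baseSet_mem_nhds hc] with y hy hyb
  rw [connCoeff_eq nab hyb]
  have : nab (fun y => bundleVec F E c y f) y = nab s y :=
    nab.isCovariantDerivativeOnUniv.congr_of_eventuallyEq
      (mdifferentiableAt_bundleVec hyb f) (hs.mdifferentiable (by simp) y) Filter.univ_mem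
      (hy.mono fun z hz => by simp [s, hz])
  rw [this]

/-- The components of an `E`-valued form in the preferred trivialization at `c`. -/
def fiberCoordForm (F : Type*) [NormedAddCommGroup F] [NormedSpace ℝ F]
    [TopologicalSpace (Bundle.TotalSpace F E)]
    [FiberBundle F E] [VectorBundle ℝ F E] {k : ℕ} (c : X) (φ : ∀ y, Form I E k y) (y : X) :
    TangentSpace I y [⋀^Fin k]→ₗ[ℝ] F :=
  (bundleCoord F E c y).compAlternatingMap (φ y)

theorem extCovDeriv_apply {k : ℕ} (φ : Omega I F E k) (x : X)
    (w : Fin (k + 1) → TangentSpace I x) :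
    extCovDeriv nab φ x w =
      ∑ j : Fin (k + 1), (-1 : ℝ) ^ (j : ℕ) •
        nab (evalExtend φ x fun i => w (j.succAbove i)) x (w j) :=
  alternatizeUncurryFin_apply_real _ _

theorem bundleCoord_extCovDeriv {k : ℕ} (φ : Omega I F E k) {c x : X}
    (hx : x ∈ (trivializationAt F E c).baseSet) (w : Fin (k + 1) → TangentSpace I x) :
    bundleCoord F E c x (extCovDeriv nab φ x w) = dForm I (fiberCoordForm F c φ.1) x w
      + ∑ j : Fin (k + 1), (-1 : ℝ) ^ (j : ℕ) •
        connCoeff nab c x (bundleCoord F E c x (φ.1 x fun i => w (j.succAbove i))) (w j) := by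
  rw [extCovDeriv_apply, map_sum, dForm, ← Finset.sum_add_distrib]
  refine Finset.sum_congr rfl fun j _ => ?_
  rw [map_smul, ← smul_add, bundleCoord_connection nab hx
    ((mdifferentiableAt_section_iff_coord hx).1 (mdifferentiableAt_evalExtend φ x _))]
  congr 3
  simp [evalExtend, extendVec_self]

theorem contMDiffAt_connCoeff_comp [T2Space X]
    [CovariantDerivative.ContMDiffCovariantDerivative nab ∞]
    (c : X) {g : X → F} (hg : ContMDiffAt I 𝓘(ℝ, F) ∞ g c) (v : EuclideanSpace ℝ (Fin m)) :
    ContMDiffAt I 𝓘(ℝ, F) ∞ (fun y => connCoeff nab c y (g y) (tangentVec I c y v)) c := by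
  let b := Module.finBasis ℝ F
  have e : (fun y => connCoeff nab c y (g y) (tangentVec I c y v)) = fun y =>
      ∑ i, (LinearMap.toContinuousLinearMap (b.coord i)) (g y) •
        connCoeff nab c y (b i) (tangentVec I c y v) := by
    funext y
    exact linearMap_eq_sum_repr b ((connCoeff nab c y).flip (tangentVec I c y v)) (g y)
  rw [e]
  refine contMDiffAt_finsetSum fun i _ => ?_
  exact ((LinearMap.toContinuousLinearMap (b.coord i)).contDiff.contMDiff.contMDiffAt.comp c hg).smul
    (contMDiffAt_connCoeff nab c (b i) v)

/-- In components `d^∇ φ = dφ + Γ ∧ φ`, and both terms are smooth. -/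
theorem extCovDeriv_mem [T2Space X] [CovariantDerivative.ContMDiffCovariantDerivative nab ∞]
    {k : ℕ} (φ : Omega I F E k) : extCovDeriv nab φ ∈ Omega I F E (k + 1) := by
  intro c v
  have hc := mem_baseSet_self F E c
  have h1 := contMDiffAt_dForm I (θ := fiberCoordForm F c φ.1) (c := c) (fun v => φ.2 c v) v
  have h2 : ContMDiffAt I 𝓘(ℝ, F) ∞ (fun x => ∑ j : Fin (k + 1), (-1 : ℝ) ^ (j : ℕ) •
        connCoeff nab c x (bundleCoord F E c x (φ.1 x fun i => tangentVec I c x (v (j.succAbove i))))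
          (tangentVec I c x (v j))) c := by
    refine contMDiffAt_finsetSum fun j _ => ?_
    exact (contMDiffAt_const (I' := 𝓘(ℝ, ℝ)) (c := (-1 : ℝ) ^ (j : ℕ))).smul
      (contMDiffAt_connCoeff_comp nab c (φ.2 c fun i => v (j.succAbove i)) (v j))
  refine (h1.add h2).congr_of_eventuallyEq ?_
  filter_upwards [baseSet_mem_nhds hc] with x hx
  exact bundleCoord_extCovDeriv nab φ hx _

theorem extCovDeriv_add {k : ℕ} (φ ψ : Omega I F E k) (x : X) :
    extCovDeriv nab (φ + ψ) x = extCovDeriv nab φ x + extCovDeriv nab ψ x := by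
  ext w
  rw [AlternatingMap.add_apply, extCovDeriv_apply, extCovDeriv_apply, extCovDeriv_apply,
    ← Finset.sum_add_distrib]
  refine Finset.sum_congr rfl fun j _ => ?_
  rw [← smul_add]
  have e : (evalExtend (φ + ψ) x fun i => w (j.succAbove i)) =
    (evalExtend φ x fun i => w (j.succAbove i)) + evalExtend ψ x fun i => w (j.succAbove i) := rfl
  rw [e, nab.isCovariantDerivativeOnUniv.add (mdifferentiableAt_evalExtend φ x _)
    (mdifferentiableAt_evalExtend ψ x _)]
  rfl

theorem extCovDeriv_smul {k : ℕ} (a : ℝ) (φ : Omega I F E k) (x : X) :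
    extCovDeriv nab (a • φ) x = a • extCovDeriv nab φ x := by
  ext w
  rw [AlternatingMap.smul_apply, extCovDeriv_apply, extCovDeriv_apply, Finset.smul_sum]
  refine Finset.sum_congr rfl fun j _ => ?_
  rw [smul_comm]
  have e : (evalExtend (a • φ) x fun i => w (j.succAbove i)) =
    a • (evalExtend φ x fun i => w (j.succAbove i)) := rfl
  rw [e, nab.isCovariantDerivativeOnUniv.smul_const a (mdifferentiableAt_evalExtend φ x _)]
  rfl

/-! ### The dual connection -/

theorem mvfderiv_sum {ι : Type*} (s : Finset ι) {Y : Type*} [NormedAddCommGroup Y] [NormedSpace ℝ Y]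
    {g : ι → X → Y} {x : X} (hg : ∀ i ∈ s, MDifferentiableAt I 𝓘(ℝ, Y) (g i) x)
    (v : TangentSpace I x) :
    MDifferentiableAt I 𝓘(ℝ, Y) (fun y => ∑ i ∈ s, g i y) x ∧
    mvfderiv I (fun y => ∑ i ∈ s, g i y) x v = ∑ i ∈ s, mvfderiv I (g i) x v := by
  classical
  induction s using Finset.induction_on with
  | empty => simp [mvfderiv_const, mdifferentiableAt_const]
  | insert i s hi ih =>
    obtain ⟨h1, h2⟩ := ih fun j hj => hg j (Finset.mem_insert_of_mem hj)
    have h3 := hg i (Finset.mem_insert_self i s)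
    simp only [Finset.sum_insert hi]
    exact ⟨h3.add h1, by rw [mvfderiv_fun_add h3 h1, add_apply, h2]⟩

theorem mvfderiv_const_mul {g : X → ℝ} {x : X} (a : ℝ) (hg : MDifferentiableAt I 𝓘(ℝ, ℝ) g x)
    (v : TangentSpace I x) :
    mvfderiv I (fun y => a * g y) x v = a * mvfderiv I g x v := by
  rw [mvfderiv_fun_mul mdifferentiableAt_const hg, mvfderiv_const]
  simp

/-- An `E*`-valued function is differentiable at `x` if its components are. -/
def DualDifferentiableAt (I : ModelWithCorners ℝ (EuclideanSpace ℝ (Fin m)) H) {X : Type*}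
    [TopologicalSpace X] [ChartedSpace H X]
    (F : Type*) [NormedAddCommGroup F] [NormedSpace ℝ F]
    {E : X → Type*} [∀ x, AddCommGroup (E x)] [∀ x, Module ℝ (E x)]
    [TopologicalSpace (Bundle.TotalSpace F E)] [∀ x, TopologicalSpace (E x)]
    [FiberBundle F E] [VectorBundle ℝ F E] (η : ∀ y : X, Module.Dual ℝ (E y)) (x : X) : Prop :=
  ∀ f : F, MDifferentiableAt I 𝓘(ℝ, ℝ) (fun y => η y (bundleVec F E x y f)) x

theorem pairing_eventuallyEq (η : ∀ y : X, Module.Dual ℝ (E y)) (s : ∀ y, E y) (x : X) :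
    (fun y => η y (s y)) =ᶠ[𝓝 x] fun y => ∑ i, (LinearMap.toContinuousLinearMap
      ((Module.finBasis ℝ F).coord i)) (bundleCoord F E x y (s y)) *
        η y (bundleVec F E x y (Module.finBasis ℝ F i)) := by
  filter_upwards [baseSet_mem_nhds (mem_baseSet_self F E x)] with y hy
  conv_lhs => rw [← bundleVec_bundleCoord hy (s y)]
  exact linearMap_eq_sum_repr (Module.finBasis ℝ F) (η y ∘ₗ bundleVec F E x y) _

/-- The Leibniz rule for the dual connection. -/
theorem mvfderiv_pairing {η : ∀ y : X, Module.Dual ℝ (E y)} {s : ∀ y, E y} {x : X}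
    (hη : DualDifferentiableAt I F η x)
    (hs : MDifferentiableAt I 𝓘(ℝ, F) (fun y => bundleCoord F E x y (s y)) x)
    (v : TangentSpace I x) :
    MDifferentiableAt I 𝓘(ℝ, ℝ) (fun y => η y (s y)) x ∧
    mvfderiv I (fun y => η y (s y)) x v = dualCovDeriv nab η x v (s x) + η x (nab s x v) := by
  have hx := mem_baseSet_self F E x
  -- Derivative of the pairing in the trivialization at `x`: one term differentiates the components
  -- of `s`, the other the components of `η`.
  have key : ∀ s : ∀ y, E y, MDifferentiableAt I 𝓘(ℝ, F) (fun y => bundleCoord F E x y (s y)) x →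
      MDifferentiableAt I 𝓘(ℝ, ℝ) (fun y => η y (s y)) x ∧
      mvfderiv I (fun y => η y (s y)) x v =
        η x (bundleVec F E x x (mvfderiv I (fun y => bundleCoord F E x y (s y)) x v)) +
        ∑ i, (Module.finBasis ℝ F).coord i (bundleCoord F E x x (s x)) *
          mvfderiv I (fun y => η y (bundleVec F E x y (Module.finBasis ℝ F i))) x v := by
    intro s hs
    have he := pairing_eventuallyEq (F := F) η s x
    have hd : ∀ i, MDifferentiableAt I 𝓘(ℝ, ℝ) (fun y => (LinearMap.toContinuousLinearMap
        ((Module.finBasis ℝ F).coord i)) (bundleCoord F E x y (s y))) x := fun i =>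
      (LinearMap.toContinuousLinearMap
        ((Module.finBasis ℝ F).coord i)).differentiableAt.comp_mdifferentiableAt hs
    obtain ⟨h1, h2⟩ := mvfderiv_sum (I := I) Finset.univ
      (fun i _ => (hd i).mul (hη (Module.finBasis ℝ F i))) v
    refine ⟨h1.congr_of_eventuallyEq he, ?_⟩
    rw [mvfderiv_congr I he]
    refine h2.trans ?_
    have e3 : ∀ i, mvfderiv I ((fun y => (LinearMap.toContinuousLinearMap
        ((Module.finBasis ℝ F).coord i)) (bundleCoord F E x y (s y))) *
        fun y => η y (bundleVec F E x y (Module.finBasis ℝ F i))) x v =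
        (Module.finBasis ℝ F).coord i (mvfderiv I (fun y => bundleCoord F E x y (s y)) x v) *
          η x (bundleVec F E x x (Module.finBasis ℝ F i)) +
        (Module.finBasis ℝ F).coord i (bundleCoord F E x x (s x)) *
          mvfderiv I (fun y => η y (bundleVec F E x y (Module.finBasis ℝ F i))) x v := by
      intro i
      rw [mvfderiv_mul (hd i) (hη (Module.finBasis ℝ F i))]
      rw [add_apply, smul_apply, smul_apply, mvfderiv_clm_comp I _ hs]
      simp only [smul_eq_mul, LinearMap.coe_toContinuousLinearMap']
      ring
    rw [Finset.sum_congr rfl fun i _ => e3 i, Finset.sum_add_distrib]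
    congr 1
    exact (linearMap_eq_sum_repr (Module.finBasis ℝ F) (η x ∘ₗ bundleVec F E x x) _).symm
  -- Comparing `s` with the extension of `s x` by constant components, the terms differentiating `η`
  -- agree. What remains is the derivative of the components of `s`, which is also the difference of
  -- the two covariant derivatives.
  obtain ⟨h1, h2⟩ := key s hs
  have he := bundleCoord_bundleVec_eventuallyEq hx (bundleCoord F E x x (s x))
  have hs' : MDifferentiableAt I 𝓘(ℝ, F)
      (fun y => bundleCoord F E x y (extendSec F E x (s x) y)) x :=
    mdifferentiableAt_const.congr_of_eventuallyEq he
  obtain ⟨h3, h4⟩ := key (extendSec F E x (s x)) hs'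
  refine ⟨h1, ?_⟩
  have h5 := bundleCoord_connection nab hx hs v
  have h6 := bundleCoord_connection nab hx hs' v
  have h7 : mvfderiv I (fun y => bundleCoord F E x y (extendSec F E x (s x) y)) x v = 0 := by
    refine (congrArg (fun L => L v) (mvfderiv_congr I he)).trans ?_
    rw [mvfderiv_const]
    rfl
  rw [extendSec_self] at h4 h6
  rw [h7, zero_add] at h6
  have h8 : nab s x v = bundleVec F E x x (mvfderiv I (fun y => bundleCoord F E x y (s y)) x v)
      + nab (extendSec F E x (s x)) x v := by
    rw [← bundleVec_bundleCoord hx (nab s x v),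
      ← bundleVec_bundleCoord hx (nab (extendSec F E x (s x)) x v), ← map_add, h5, h6]
  rw [dualCovDeriv, h4, h2, h7, h8, map_add, map_zero, map_zero]
  ring

end Coefficients

/-! ### Coordinate frames as bases, and extension of vectors and covectors. -/

section Frames

variable {m : ℕ} {H : Type*} [TopologicalSpace H]
  (I : ModelWithCorners ℝ (EuclideanSpace ℝ (Fin m)) H)
  {X : Type*} [TopologicalSpace X] [ChartedSpace H X] [IsManifold I ∞ X]

/-- The isomorphism of the model space with a tangent space given by the chart at `c`. -/
def tangentEquiv {c x : X} (hx : x ∈ (chartAt H c).source) :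
    EuclideanSpace ℝ (Fin m) ≃ₗ[ℝ] TangentSpace I x :=
  LinearEquiv.ofLinearMap (tangentVec I c x) (tangentCoord I c x)
    (LinearMap.ext fun w => tangentVec_tangentCoord I hx w)
    (LinearMap.ext fun v => tangentCoord_tangentVec I hx v)

/-- The coordinate frame of the chart at `c`, as a basis. -/
def chartBasis {c x : X} (hx : x ∈ (chartAt H c).source) :
    Module.Basis (Fin m) ℝ (TangentSpace I x) :=
  (EuclideanSpace.basisFun (Fin m) ℝ).toBasis.map (tangentEquiv I hx)

theorem chartBasis_apply {c x : X} (hx : x ∈ (chartAt H c).source) (i : Fin m) :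
    chartBasis I hx i = chartFrame I c x i := by
  simp only [chartBasis, Module.Basis.map_apply, OrthonormalBasis.coe_toBasis]
  rfl

theorem coe_chartBasis {c x : X} (hx : x ∈ (chartAt H c).source) :
    ⇑(chartBasis I hx) = chartFrame I c x :=
  funext (chartBasis_apply I hx)

theorem chartBasis_coord {c x : X} (hx : x ∈ (chartAt H c).source) (i : Fin m) :
    (chartBasis I hx).coord i =
      (EuclideanSpace.basisFun (Fin m) ℝ).toBasis.coord i ∘ₗ tangentCoord I c x := by
  ext w
  simp only [chartBasis, Module.Basis.coord_apply, Module.Basis.map_repr, LinearMap.comp_apply]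
  rfl

theorem extendVec_tangentBasis (x y : X) (i : Fin m) :
    extendVec I x (tangentBasis I x i) y = chartFrame I x y i := by
  have : tangentCoord I x x (tangentBasis I x i) = EuclideanSpace.basisFun (Fin m) ℝ i := by
    rw [tangentCoord_self]
    exact congrFun (OrthonormalBasis.coe_toBasis (EuclideanSpace.basisFun (Fin m) ℝ)) i
  rw [extendVec, this, chartFrame]

theorem extendCovec_tangentBasis (x y : X) (i : Fin m) :
    extendCovec I x ((tangentBasis I x).coord i) y =
      (EuclideanSpace.basisFun (Fin m) ℝ).toBasis.coord i ∘ₗ tangentCoord I x y := by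
  ext w
  simp only [extendCovec, LinearMap.comp_apply, tangentVec_self]
  rfl

/-- The extension of vectors as a linear map. -/
def extendVecₗ (x y : X) : TangentSpace I x →ₗ[ℝ] TangentSpace I y :=
  tangentVec I x y ∘ₗ tangentCoord I x x

/-- The extension of covectors as a linear map. -/
def extendCovecₗ (x y : X) :
    Module.Dual ℝ (TangentSpace I x) →ₗ[ℝ] Module.Dual ℝ (TangentSpace I y) :=
  (tangentVec I x x ∘ₗ tangentCoord I x y).dualMap

theorem extendCovec_self (x : X) (β : Module.Dual ℝ (TangentSpace I x)) :
    extendCovec I x β x = β := by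
  ext w
  simp [extendCovec, tangentVec_tangentCoord I (mem_chart_source H x)]

end Frames

/-! ### Covariant derivatives of fields as linear maps, and Leibniz rules. -/

section Bundled

variable {m : ℕ} {H : Type*} [TopologicalSpace H]
  {I : ModelWithCorners ℝ (EuclideanSpace ℝ (Fin m)) H}
  {X : Type*} [TopologicalSpace X] [ChartedSpace H X] [IsManifold I ∞ X]

/-- A map into a finite-dimensional vector space is differentiable if it is so when tested against
a separating family of functionals. -/
theorem exists_linear_derivative {S : Type*} [AddCommMonoid S] [Module ℝ S] [Module.Finite ℝ S]
    {κ : Type*} (l : κ → Module.Dual ℝ S) (hl : ∀ s, (∀ i, l i s = 0) → s = 0) (Z : X → S) (x : X)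
    (hZ : ∀ i, MDifferentiableAt I 𝓘(ℝ, ℝ) (fun y => l i (Z y)) x) :
    ∃ D : TangentSpace I x →ₗ[ℝ] S, ∀ (f : Module.Dual ℝ S) (v : TangentSpace I x),
      mvfderiv I (fun y => f (Z y)) x v = f (D v) := by
  let _ : AddCommGroup S := Module.addCommMonoidToAddCommGroup ℝ
  -- In finite dimension a separating family of functionals spans the dual, because the subspace it
  -- annihilates is zero.
  have hspan : Submodule.span ℝ (Set.range l) = ⊤ := by
    have h0 : (Submodule.span ℝ (Set.range l)).dualCoannihilator = ⊥ := by
      rw [eq_bot_iff]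
      intro s hs
      refine hl s fun i => ?_
      exact (Submodule.mem_dualCoannihilator s).1 hs _ (Submodule.subset_span ⟨i, rfl⟩)
    rw [← Subspace.dualCoannihilator_dualAnnihilator_eq
      (W := Submodule.span ℝ (Set.range l)), h0, Submodule.dualAnnihilator_bot]
  have hd : ∀ f : Module.Dual ℝ S, MDifferentiableAt I 𝓘(ℝ, ℝ) (fun y => f (Z y)) x := by
    intro f
    have hf : f ∈ Submodule.span ℝ (Set.range l) := hspan ▸ Submodule.mem_top
    induction hf using Submodule.span_induction with
    | mem f hf => obtain ⟨i, rfl⟩ := hf; exact hZ i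
    | zero => exact mdifferentiableAt_const
    | add f g _ _ h1 h2 => exact h1.add h2
    | smul a f _ h => exact (mdifferentiableAt_const (c := a)).mul h
  let b := Module.finBasis ℝ S
  refine ⟨∑ i, (mvfderiv I (fun y => b.coord i (Z y)) x).toLinearMap.smulRight (b i), ?_⟩
  intro f v
  have e : (fun y => f (Z y)) = fun y => ∑ i, f (b i) * b.coord i (Z y) := by
    funext y
    rw [linearMap_eq_sum_repr b f]
    exact Finset.sum_congr rfl fun i _ => mul_comm _ _
  have hm : ∀ i, MDifferentiableAt I 𝓘(ℝ, ℝ) (fun y => f (b i) * b.coord i (Z y)) x :=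
    fun i => mdifferentiableAt_const.mul (hd (b.coord i))
  rw [e, (mvfderiv_sum Finset.univ (fun i _ => hm i) v).2]
  simp only [LinearMap.sum_apply, LinearMap.smulRight_apply, map_sum, map_smul]
  refine Finset.sum_congr rfl fun i _ => ?_
  rw [smul_eq_mul, mul_comm]
  exact mvfderiv_const_mul _ (hd _) v

variable {F : Type*} [NormedAddCommGroup F] [NormedSpace ℝ F]
  {E : X → Type*} [∀ x, AddCommGroup (E x)] [∀ x, Module ℝ (E x)]
  [TopologicalSpace (Bundle.TotalSpace F E)] [∀ x, TopologicalSpace (E x)]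
  [FiberBundle F E] [VectorBundle ℝ F E] [ContMDiffVectorBundle ∞ F E I]
  [∀ x, IsTopologicalAddGroup (E x)] [∀ x, ContinuousSMul ℝ (E x)]
  [FiniteDimensional ℝ F] (nab : CovariantDerivative I F E)

theorem finite_fiber {X : Type*} [TopologicalSpace X] (F : Type*) [NormedAddCommGroup F]
    [NormedSpace ℝ F] {E : X → Type*} [∀ x, AddCommGroup (E x)] [∀ x, Module ℝ (E x)]
    [TopologicalSpace (Bundle.TotalSpace F E)] [∀ x, TopologicalSpace (E x)]
    [FiberBundle F E] [VectorBundle ℝ F E] [FiniteDimensional ℝ F] (x : X) :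
    Module.Finite ℝ (E x) :=
  Module.Finite.of_injective (bundleCoord F E x x)
    (Function.LeftInverse.injective (bundleVec_bundleCoord (mem_baseSet_self F E x)))

/-- `v ↦ e ↦ ∇_v` of the section that extends `e` with constant components. -/
def fiberConn (x : X) : TangentSpace I x →ₗ[ℝ] E x →ₗ[ℝ] E x :=
  LinearMap.mk₂ ℝ (fun v e => nab (extendSec F E x e) x v) (by simp) (by simp)
    (by
      intro v e e'
      have h : extendSec F E x (e + e') = extendSec F E x e + extendSec F E x e' := by
        funext y
        simp [extendSec]
      have hx := mem_baseSet_self F E x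
      rw [h, nab.isCovariantDerivativeOnUniv.add (σ := extendSec F E x e)
        (σ' := extendSec F E x e') (mdifferentiableAt_bundleVec hx _)
        (mdifferentiableAt_bundleVec hx _)]
      rfl)
    (by
      intro a v e
      have h : extendSec F E x (a • e) = a • extendSec F E x e := by
        funext y
        simp [extendSec]
      have hx := mem_baseSet_self F E x
      rw [h, nab.isCovariantDerivativeOnUniv.smul_const (σ := extendSec F E x e) a
        (mdifferentiableAt_bundleVec hx _)]
      rfl)

/-- Pull-back of dual forms along a pair of linear maps. -/
def dualFormMap {T T' A A' : Type*} [AddCommGroup T] [Module ℝ T] [AddCommGroup T'] [Module ℝ T']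
    [AddCommMonoid A] [Module ℝ A] [AddCommMonoid A'] [Module ℝ A'] (f : T →ₗ[ℝ] T') (g : A →ₗ[ℝ] A')
    (r : ℕ) : (T' [⋀^Fin r]→ₗ[ℝ] Module.Dual ℝ A') →ₗ[ℝ] (T [⋀^Fin r]→ₗ[ℝ] Module.Dual ℝ A) where
  toFun ψ := (g.dualMap.compAlternatingMap ψ).compLinearMap f
  map_add' _ _ := by ext; simp
  map_smul' _ _ := by ext; simp

theorem dualFormMap_apply {T T' A A' : Type*} [AddCommGroup T] [Module ℝ T] [AddCommGroup T']
    [Module ℝ T'] [AddCommMonoid A] [Module ℝ A] [AddCommMonoid A'] [Module ℝ A'] (f : T →ₗ[ℝ] T')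
    (g : A →ₗ[ℝ] A') {r : ℕ} (ψ : T' [⋀^Fin r]→ₗ[ℝ] Module.Dual ℝ A') (u : Fin r → T) (e : A) :
    dualFormMap f g r ψ u e = ψ (fun i => f (u i)) (g e) := rfl

/-- The covariant derivative of an `E*`-valued form, at a point. -/
theorem exists_covDeriv_dualForm {j : ℕ} {ψ : ∀ y : X, DualForm I E j y} {x : X}
    (hψ : ∀ u : Fin j → TangentSpace I x,
      DualDifferentiableAt I F (fun y => ψ y fun i => extendVec I x (u i) y) x) :
    ∃ D : TangentSpace I x →ₗ[ℝ] DualForm I E j x, ∀ v u e,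
      D v u e = dualCovDeriv nab (fun y => ψ y fun i => extendVec I x (u i) y) x v e := by
  have : Module.Finite ℝ (E x) := finite_fiber F x
  have : Module.Finite ℝ (DualForm I E j x) := finite_alternatingMap (tangentBasis I x) j _
  let l : (Fin j → TangentSpace I x) × E x → Module.Dual ℝ (DualForm I E j x) := fun p =>
    ⟨⟨fun ψ => ψ p.1 p.2, fun _ _ => rfl⟩, fun _ _ => rfl⟩
  -- The form at `y` is carried to the fibre at `x` by constant components in the chart and
  -- trivialization, so the derivative is taken in one vector space. `D` accounts for `v(η(ξ))` and
  -- `Γ` for `η(∇_v ξ)`.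
  obtain ⟨D, hD⟩ := exists_linear_derivative (I := I) l (fun s h => by
      ext u e; exact h (u, e))
    (fun y => dualFormMap (extendVecₗ I x y) (bundleVec F E x y ∘ₗ bundleCoord F E x x) j (ψ y)) x
    (fun p => hψ p.1 _)
  let Γ : TangentSpace I x →ₗ[ℝ] DualForm I E j x :=
    ⟨⟨fun v => dualFormMap LinearMap.id (fiberConn nab x v) j (ψ x), by
        intro v v'; ext; simp [dualFormMap_apply]⟩, by intro a v; ext; simp [dualFormMap_apply]⟩
  refine ⟨D + (-1 : ℝ) • Γ, ?_⟩
  intro v u e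
  have h := hD (l (u, e)) v
  have h2 : l (u, e) (D v) = D v u e := rfl
  rw [h2] at h
  have h3 : (D + (-1 : ℝ) • Γ) v u e = D v u e + (-1 : ℝ) * Γ v u e := rfl
  have h4 : Γ v u e = ψ x u (nab (extendSec F E x e) x v) := rfl
  rw [h3, h4, ← h]
  simp only [dualCovDeriv, extendVec_self, neg_mul, one_mul, ← sub_eq_add_neg]
  rfl

/-- The covariant derivative of a section of `⋀ˢ TX ⊗ ⋀ʳ T*X ⊗ E*`, at a point. -/
theorem exists_covDeriv_dualTensor {s r : ℕ} {χ : ∀ y : X, DualTensor I E s r y} {x : X}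
    (hχ : ∀ (β : Fin s → Module.Dual ℝ (TangentSpace I x)) (u : Fin r → TangentSpace I x),
      DualDifferentiableAt I F (fun y => χ y (fun i => extendCovec I x (β i) y)
        fun i => extendVec I x (u i) y) x) :
    ∃ D : TangentSpace I x →ₗ[ℝ] DualTensor I E s r x, ∀ v β u e,
      D v β u e = dualCovDeriv nab (fun y => χ y (fun i => extendCovec I x (β i) y)
        fun i => extendVec I x (u i) y) x v e := by
  have : Module.Finite ℝ (E x) := finite_fiber F x
  have : Module.Finite ℝ (DualForm I E r x) := finite_alternatingMap (tangentBasis I x) r _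
  have : Module.Finite ℝ (DualTensor I E s r x) :=
    finite_alternatingMap (tangentBasis I x).dualBasis s (DualForm I E r x)
  let l : (Fin s → Module.Dual ℝ (TangentSpace I x)) × (Fin r → TangentSpace I x) × E x →
      Module.Dual ℝ (DualTensor I E s r x) := fun p =>
    ⟨⟨fun χ => χ p.1 p.2.1 p.2.2, fun _ _ => rfl⟩, fun _ _ => rfl⟩
  obtain ⟨D, hD⟩ := exists_linear_derivative (I := I) l (fun s h => by
      ext β u e; exact h (β, u, e))
    (fun y => (dualFormMap (extendVecₗ I x y) (bundleVec F E x y ∘ₗ bundleCoord F E x x)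
      r).compAlternatingMap ((χ y).compLinearMap (extendCovecₗ I x y))) x
    (fun p => hχ p.1 p.2.1 _)
  let Γ : TangentSpace I x →ₗ[ℝ] DualTensor I E s r x :=
    ⟨⟨fun v => (dualFormMap LinearMap.id (fiberConn nab x v) r).compAlternatingMap (χ x), by
        intro v v'; ext; simp [dualFormMap_apply]⟩, by intro a v; ext; simp [dualFormMap_apply]⟩
  refine ⟨D + (-1 : ℝ) • Γ, ?_⟩
  intro v β u e
  have h := hD (l (β, u, e)) v
  have h2 : l (β, u, e) (D v) = D v β u e := rfl
  rw [h2] at h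
  have h3 : (D + (-1 : ℝ) • Γ) v β u e = D v β u e + (-1 : ℝ) * Γ v β u e := rfl
  have h4 : Γ v β u e = χ x β u (nab (extendSec F E x e) x v) := rfl
  rw [h3, h4, ← h]
  simp only [dualCovDeriv, extendVec_self, extendCovec_self, neg_mul, one_mul, ← sub_eq_add_neg]
  rfl

/-! ### Leibniz rules -/

theorem dualDifferentiableAt_of_mem_OmegaDual {j : ℕ} (ψ : OmegaDual I F E j) (x : X)
    (u : Fin j → TangentSpace I x) :
    DualDifferentiableAt I F (fun y => ψ.1 y fun i => extendVec I x (u i) y) x := fun f =>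
  (ψ.2 x (fun i => tangentCoord I x x (u i)) f).mdifferentiableAt (by simp)

theorem dualDifferentiableAt_of_mem_Lambda {s r : ℕ} (χ : Lambda I F E s r) (x : X)
    (β : Fin s → Module.Dual ℝ (TangentSpace I x)) (u : Fin r → TangentSpace I x) :
    DualDifferentiableAt I F (fun y => χ.1 y (fun i => extendCovec I x (β i) y)
      fun i => extendVec I x (u i) y) x := fun f =>
  (χ.2 x (fun i => β i ∘ₗ tangentVec I x x) (fun i => tangentCoord I x x (u i)) f).mdifferentiableAt
    (by simp)

theorem evalExtend_coord_mdifferentiableAt {k : ℕ} (φ : Omega I F E k) (x : X)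
    (w : Fin k → TangentSpace I x) :
    MDifferentiableAt I 𝓘(ℝ, F) (fun y => bundleCoord F E x y (evalExtend φ x w y)) x :=
  (mdifferentiableAt_section_iff_coord (mem_baseSet_self F E x)).1 (mdifferentiableAt_evalExtend φ x w)

theorem covDerivForm_apply {k : ℕ} (φ : Omega I F E k) (x : X) (v : TangentSpace I x)
    (w : Fin k → TangentSpace I x) : covDerivForm nab φ x v w = nab (evalExtend φ x w) x v := rfl

theorem evalExtend_self {k : ℕ} (φ : Omega I F E k) (x : X) (w : Fin k → TangentSpace I x) :
    evalExtend φ x w x = φ.1 x w := by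
  simp [evalExtend, extendVec_self]

/-- Contractions and wedge products, evaluated on vectors extended with constant components, are
finite sums of this kind; this is where derivatives enter both Leibniz rules. -/
theorem mvfderiv_sum_pairing {ι : Type*} (t : Finset ι) (c : ι → ℝ)
    {η : ι → ∀ y : X, Module.Dual ℝ (E y)} {s : ι → ∀ y, E y} {x : X}
    (hη : ∀ i ∈ t, DualDifferentiableAt I F (η i) x)
    (hs : ∀ i ∈ t, MDifferentiableAt I 𝓘(ℝ, F) (fun y => bundleCoord F E x y (s i y)) x)
    (v : TangentSpace I x) :
    mvfderiv I (fun y => ∑ i ∈ t, c i * η i y (s i y)) x v =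
      ∑ i ∈ t, c i * (dualCovDeriv nab (η i) x v (s i x) + η i x (nab (s i) x v)) := by
  have h := fun i hi => mvfderiv_pairing nab (hη i hi) (hs i hi) v
  have hm : ∀ i ∈ t, MDifferentiableAt I 𝓘(ℝ, ℝ) (fun y => c i * η i y (s i y)) x :=
    fun i hi => mdifferentiableAt_const.mul (h i hi).1
  rw [(mvfderiv_sum t hm v).2]
  refine Finset.sum_congr rfl fun i hi => ?_
  rw [mvfderiv_const_mul _ (h i hi).1, (h i hi).2]

/-- The Leibniz rule for the wedge product of an `E`-valued with an `E*`-valued form. -/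
theorem dForm_wedge {n k j : ℕ} (h : k + j = n) (hk' : k + 1 + j = n + 1)
    (hk : k + (j + 1) = n + 1) (φ : Omega I F E k) (ψ : OmegaDual I F E j) (x : X)
    {D : TangentSpace I x →ₗ[ℝ] DualForm I E j x}
    (hD : ∀ v u e, D v u e =
      dualCovDeriv nab (fun y => ψ.1 y fun i => extendVec I x (u i) y) x v e)
    (w : Fin (n + 1) → TangentSpace I x) :
    dForm I (fun y => wedge h (φ.1 y) (ψ.1 y)) x w =
      wedge hk' (extCovDeriv nab φ x) (ψ.1 x) w +
      (-1) ^ k * wedge hk (φ.1 x) (AlternatingMap.alternatizeUncurryFin D) w := by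
  have h1 := congrArg (fun f => f w) (alternatize_wedge h hk' hk (φ.1 x) (ψ.1 x)
    (covDerivForm nab φ x) D)
  simp only [AlternatingMap.add_apply, AlternatingMap.smul_apply, smul_eq_mul] at h1
  refine Eq.trans ?_ h1
  rw [dForm, alternatizeUncurryFin_apply_real]
  refine Finset.sum_congr rfl fun i _ => ?_
  congr 1
  -- The factor `1 / (k! j!)` is moved inside the sum to match the shape of `mvfderiv_sum_pairing`.
  have e : ∀ y, ∀ u : Fin n → TangentSpace I y, ((k.factorial : ℝ) * j.factorial)⁻¹ *
      ∑ σ : Equiv.Perm (Fin k ⊕ Fin j), ((Equiv.Perm.sign σ : ℤ) : ℝ) *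
        ψ.1 y (fun i => u (wedgeEquiv h (σ (Sum.inr i))))
          (φ.1 y fun i => u (wedgeEquiv h (σ (Sum.inl i)))) =
      ∑ σ : Equiv.Perm (Fin k ⊕ Fin j), (((k.factorial : ℝ) * j.factorial)⁻¹ *
        ((Equiv.Perm.sign σ : ℤ) : ℝ)) *
        ψ.1 y (fun i => u (wedgeEquiv h (σ (Sum.inr i))))
          (φ.1 y fun i => u (wedgeEquiv h (σ (Sum.inl i)))) := by
    intro y u
    rw [Finset.mul_sum]
    exact Finset.sum_congr rfl fun σ _ => (mul_assoc _ _ _).symm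
  refine (congrArg (fun g => mvfderiv I g x (w i))
    (funext fun y => (wedge_eq_sum h _ _ _).trans (e y _))).trans ?_
  have key := mvfderiv_sum_pairing nab (Finset.univ : Finset (Equiv.Perm (Fin k ⊕ Fin j)))
    (fun σ => ((k.factorial : ℝ) * j.factorial)⁻¹ * ((Equiv.Perm.sign σ : ℤ) : ℝ))
    (η := fun σ y => ψ.1 y fun l => extendVec I x
      (w (i.succAbove (wedgeEquiv h (σ (Sum.inr l))))) y)
    (s := fun σ => evalExtend φ x fun l => w (i.succAbove (wedgeEquiv h (σ (Sum.inl l)))))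
    (x := x)
    (fun σ _ => dualDifferentiableAt_of_mem_OmegaDual ψ x _)
    (fun σ _ => evalExtend_coord_mdifferentiableAt φ x _) (w i)
  refine key.trans ?_
  simp only [LinearMap.add_apply, LinearMap.comp_apply, LinearMap.flip_apply, wedgeₗ_apply,
    AlternatingMap.add_apply, wedge_eq_sum]
  rw [Finset.mul_sum, Finset.mul_sum, ← Finset.sum_add_distrib]
  refine Finset.sum_congr rfl fun σ _ => ?_
  rw [← hD, evalExtend_self]
  simp only [extendVec_self, covDerivForm_apply]
  rw [mul_add, add_comm, mul_assoc, mul_assoc]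
  rfl

/-- The field of traces. -/
def traceField {s r : ℕ} (χ : ∀ x : X, DualTensor I E (s + 1) (r + 1) x) (x : X) :
    DualTensor I E s r x :=
  trace (tangentBasis I x) (χ x)

/-- The trace is taken in the coordinate frame at `c`, allowed by `trace_eq_of_basis`, so its
components are sums of components of the tensor. -/
theorem dualTensorComp_trace {s r : ℕ} (χ : ∀ x : X, DualTensor I E (s + 1) (r + 1) x) {c y : X}
    (hy : y ∈ (chartAt H c).source) (β : Fin s → Module.Dual ℝ (EuclideanSpace ℝ (Fin m)))
    (v : Fin r → EuclideanSpace ℝ (Fin m)) (f : F) :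
    dualTensorComp I F E c β v f y (traceField χ y) =
      ∑ i, dualTensorComp I F E c
        (Matrix.vecCons ((EuclideanSpace.basisFun (Fin m) ℝ).toBasis.coord i) β)
        (Matrix.vecCons (EuclideanSpace.basisFun (Fin m) ℝ i) v) f y (χ y) := by
  rw [dualTensorComp, traceField, trace_eq_of_basis _ (chartBasis I hy), trace_apply]
  refine Finset.sum_congr rfl fun i _ => ?_
  rw [dualTensorComp, chartBasis_coord, chartBasis_apply]
  congr 2
  · congr 1
    funext l
    refine Fin.cases ?_ (fun l => ?_) l <;> rfl
  · funext l
    refine Fin.cases ?_ (fun l => ?_) l <;> rfl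

theorem traceField_mem {s r : ℕ} (χ : Lambda I F E (s + 1) (r + 1)) :
    traceField χ.1 ∈ Lambda I F E s r := by
  intro c β v f
  have h : ContMDiffAt I 𝓘(ℝ, ℝ) ∞ (fun y => ∑ i, dualTensorComp I F E c
        (Matrix.vecCons ((EuclideanSpace.basisFun (Fin m) ℝ).toBasis.coord i) β)
        (Matrix.vecCons (EuclideanSpace.basisFun (Fin m) ℝ i) v) f y (χ.1 y)) c :=
    contMDiffAt_finsetSum fun i _ => χ.2 c _ _ f
  refine h.congr_of_eventuallyEq ?_
  filter_upwards [(chartAt H c).open_source.mem_nhds (mem_chart_source H c)] with y hy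
  exact dualTensorComp_trace χ.1 hy β v f

end Bundled

/-! ### The Leibniz rule for the divergence. -/

section Divergence

variable {n : ℕ} {H : Type*} [TopologicalSpace H]
  {I : ModelWithCorners ℝ (EuclideanSpace ℝ (Fin (n + 1))) H}
  {X : Type*} [TopologicalSpace X] [ChartedSpace H X] [IsManifold I ∞ X]
  {F : Type*} [NormedAddCommGroup F] [NormedSpace ℝ F]
  {E : X → Type*} [∀ x, AddCommGroup (E x)] [∀ x, Module ℝ (E x)]
  [TopologicalSpace (Bundle.TotalSpace F E)] [∀ x, TopologicalSpace (E x)]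
  [FiberBundle F E] [VectorBundle ℝ F E] [ContMDiffVectorBundle ∞ F E I]
  [∀ x, IsTopologicalAddGroup (E x)] [∀ x, ContinuousSMul ℝ (E x)]
  [FiniteDimensional ℝ F] (nab : CovariantDerivative I F E)

/-- The Leibniz rule for the contraction of a trace with an `E`-valued form. -/
theorem dForm_contract_trace {k : ℕ} (φ : Omega I F E k) (χ : Lambda I F E (k + 1) (n + 1)) (x : X)
    {D : TangentSpace I x →ₗ[ℝ] DualTensor I E k n x}
    (hD : ∀ v β u e, D v β u e = dualCovDeriv nab
      (fun y => traceField χ.1 y (fun i => extendCovec I x (β i) y)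
        fun i => extendVec I x (u i) y) x v e)
    (w : Fin (n + 1) → TangentSpace I x) :
    dForm I (fun y => contract (tangentBasis I y) (traceField χ.1 y) (φ.1 y)) x w =
      contract (tangentBasis I x) (χ.1 x) (extCovDeriv nab φ x) w +
      contract (tangentBasis I x) (alternatizeSkew D) (φ.1 x) w := by
  have h1 := congrArg (fun f => f w) (alternatize_contract (tangentBasis I x) (χ.1 x) (φ.1 x)
    (covDerivForm nab φ x) D)
  simp only [AlternatingMap.add_apply] at h1
  refine Eq.trans ?_ h1
  rw [dForm, alternatizeUncurryFin_apply_real]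
  refine Finset.sum_congr rfl fun i _ => ?_
  congr 1
  -- `tangentBasis I y` changes chart with `y`. Basis independence replaces it by the frame of the
  -- chart at `x`, whose vectors and covectors are the extensions used in `divergence`.
  have e : (fun y => contract (tangentBasis I y) (traceField χ.1 y) (φ.1 y)
        fun l => extendVec I x (w (i.succAbove l)) y) =ᶠ[𝓝 x]
      fun y => ∑ J : Fin k ↪o Fin (n + 1), (1 : ℝ) *
        traceField χ.1 y (fun l => extendCovec I x ((tangentBasis I x).coord (J l)) y)
          (fun l => extendVec I x (w (i.succAbove l)) y)
          (evalExtend φ x (fun l => tangentBasis I x (J l)) y) := by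
    filter_upwards [(chartAt H x).open_source.mem_nhds (mem_chart_source H x)] with y hy
    rw [contract_eq_of_basis _ (chartBasis I hy), contract_apply]
    refine Finset.sum_congr rfl fun J _ => ?_
    simp only [chartBasis_coord, chartBasis_apply, extendCovec_tangentBasis, evalExtend,
      extendVec_tangentBasis, one_mul]
  have key := mvfderiv_sum_pairing nab (Finset.univ : Finset (Fin k ↪o Fin (n + 1)))
    (fun _ => (1 : ℝ))
    (η := fun J y => traceField χ.1 y
      (fun l => extendCovec I x ((tangentBasis I x).coord (J l)) y)
      (fun l => extendVec I x (w (i.succAbove l)) y))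
    (s := fun J => evalExtend φ x fun l => tangentBasis I x (J l)) (x := x)
    (fun J _ => dualDifferentiableAt_of_mem_Lambda ⟨_, traceField_mem χ⟩ x _ _)
    (fun J _ => evalExtend_coord_mdifferentiableAt φ x _) (w i)
  rw [mvfderiv_congr I e]
  refine key.trans ?_
  simp only [LinearMap.add_apply, LinearMap.comp_apply, LinearMap.flip_apply, contractₗ_apply,
    AlternatingMap.add_apply, contract_apply, hD, evalExtend_self, one_mul, extendVec_self,
    extendCovec_self, covDerivForm_apply]
  rw [Finset.sum_add_distrib, add_comm]
  rfl

/-- The divergence as a field of tensors. -/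
theorem exists_divergence {k : ℕ} (χ : Lambda I F E (k + 1) (n + 1)) (x : X) :
    ∃ Z : DualTensor I E k (n + 1) x, (∀ β u e, Z β u e = divergence nab χ.1 x β u e) ∧
      ∀ φ : Omega I F E k, ∀ w,
        dForm I (fun y => contract (tangentBasis I y) (traceField χ.1 y) (φ.1 y)) x w =
          contract (tangentBasis I x) (χ.1 x) (extCovDeriv nab φ x) w +
          (-1) ^ k * contract (tangentBasis I x) Z (φ.1 x) w := by
  obtain ⟨D, hD⟩ := exists_covDeriv_dualTensor nab (χ := traceField χ.1) (x := x)
    (fun β u => dualDifferentiableAt_of_mem_Lambda ⟨_, traceField_mem χ⟩ x β u)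
  -- The sign `(-1) ^ k` in the definition of `divergence` occurs again in the Leibniz formula, and
  -- the two cancel.
  refine ⟨(-1 : ℝ) ^ k • alternatizeSkew D, fun β u e => ?_, fun φ w => ?_⟩
  · simp only [AlternatingMap.smul_apply, LinearMap.smul_apply, smul_eq_mul, divergence,
      alternatizeSkew_apply, extCovDerivDual, hD]
    rfl
  · rw [dForm_contract_trace nab φ χ x hD, contract_smul_left]
    simp only [AlternatingMap.smul_apply, smul_eq_mul]
    rw [← mul_assoc, neg_one_pow_mul_self, one_mul]

end Divergence

/-! ### The Leibniz rule for `d^{∇*}`. -/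

section DualDerivative

variable {m : ℕ} {H : Type*} [TopologicalSpace H]
  {I : ModelWithCorners ℝ (EuclideanSpace ℝ (Fin m)) H}
  {X : Type*} [TopologicalSpace X] [ChartedSpace H X] [IsManifold I ∞ X]
  {F : Type*} [NormedAddCommGroup F] [NormedSpace ℝ F]
  {E : X → Type*} [∀ x, AddCommGroup (E x)] [∀ x, Module ℝ (E x)]
  [TopologicalSpace (Bundle.TotalSpace F E)] [∀ x, TopologicalSpace (E x)]
  [FiberBundle F E] [VectorBundle ℝ F E] [ContMDiffVectorBundle ∞ F E I]
  [∀ x, IsTopologicalAddGroup (E x)] [∀ x, ContinuousSMul ℝ (E x)]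
  [FiniteDimensional ℝ F] (nab : CovariantDerivative I F E)

/-- The covariant exterior derivative of an `E*`-valued form as a form. -/
theorem exists_extCovDerivDual {n k j : ℕ} (h : k + j = n) (hk' : k + 1 + j = n + 1)
    (hk : k + (j + 1) = n + 1) (ψ : OmegaDual I F E j) (x : X) :
    ∃ Z : DualForm I E (j + 1) x, (∀ u e, Z u e = extCovDerivDual nab ψ.1 x u e) ∧
      ∀ φ : Omega I F E k, ∀ w : Fin (n + 1) → TangentSpace I x,
        dForm I (fun y => wedge h (φ.1 y) (ψ.1 y)) x w =
          wedge hk' (extCovDeriv nab φ x) (ψ.1 x) w +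
          (-1) ^ k * wedge hk (φ.1 x) Z w := by
  obtain ⟨D, hD⟩ := exists_covDeriv_dualForm nab (ψ := ψ.1) (x := x)
    (fun u => dualDifferentiableAt_of_mem_OmegaDual ψ x u)
  refine ⟨AlternatingMap.alternatizeUncurryFin D, fun u e => ?_, fun φ w => dForm_wedge nab h hk' hk φ ψ x hD w⟩
  rw [alternatizeUncurryFin_apply_real, LinearMap.sum_apply]
  simp only [LinearMap.smul_apply, smul_eq_mul, extCovDerivDual, hD]
  rfl

end DualDerivative

/-! ### Changing charts and trivializations. -/

section Transitions

variable {m : ℕ} {H : Type*} [TopologicalSpace H]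
  {I : ModelWithCorners ℝ (EuclideanSpace ℝ (Fin m)) H}
  {X : Type*} [TopologicalSpace X] [ChartedSpace H X] [IsManifold I ∞ X]
  {F : Type*} [NormedAddCommGroup F] [NormedSpace ℝ F]
  {E : X → Type*} [∀ x, AddCommMonoid (E x)] [∀ x, Module ℝ (E x)]
  [TopologicalSpace (Bundle.TotalSpace F E)] [∀ x, TopologicalSpace (E x)]
  [FiberBundle F E] [VectorBundle ℝ F E]

theorem chart_source_mem_nhds {c x : X} (hx : x ∈ (chartAt H c).source) :
    (chartAt H c).source ∈ 𝓝 x :=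
  (chartAt H c).open_source.mem_nhds hx

/-- Changing the trivialization preserves smoothness. -/
theorem contMDiffAt_bundleCoord_change [ContMDiffVectorBundle ∞ F E I] {c c' x : X}
    (hx : x ∈ (trivializationAt F E c).baseSet) (hx' : x ∈ (trivializationAt F E c').baseSet)
    {g : X → F} (hg : ContMDiffAt I 𝓘(ℝ, F) ∞ g x) :
    ContMDiffAt I 𝓘(ℝ, F) ∞ (fun y => bundleCoord F E c y (bundleVec F E c' y (g y))) x := by
  rw [← contMDiffAt_section_iff_coord le_rfl hx (s := fun y => bundleVec F E c' y (g y)),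
    contMDiffAt_section_iff_coord le_rfl hx']
  refine hg.congr_of_eventuallyEq ?_
  filter_upwards [baseSet_mem_nhds hx'] with y hy
  exact bundleCoord_bundleVec hy _

theorem contMDiffAt_tangentCoord_change {c c' x : X}
    (hx : x ∈ (chartAt H c).source) (hx' : x ∈ (chartAt H c').source)
    (v : EuclideanSpace ℝ (Fin m)) :
    ContMDiffAt I 𝓘(ℝ, EuclideanSpace ℝ (Fin m)) ∞
      (fun y => tangentCoord I c y (tangentVec I c' y v)) x :=
  contMDiffAt_bundleCoord_change (F := EuclideanSpace ℝ (Fin m)) (E := TangentSpace I)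
    (by simpa using hx) (by simpa using hx') contMDiffAt_const

/-- Only fixed arguments are assumed to give smooth functions; expansion over the standard basis
handles smoothly varying arguments. -/
theorem contMDiffAt_alternating {k m' : ℕ} {Y : Type*} [NormedAddCommGroup Y] [NormedSpace ℝ Y]
    {a : X → EuclideanSpace ℝ (Fin m') [⋀^Fin k]→ₗ[ℝ] Y} {x : X}
    (ha : ∀ v, ContMDiffAt I 𝓘(ℝ, Y) ∞ (fun y => a y v) x)
    {u : X → Fin k → EuclideanSpace ℝ (Fin m')}
    (hu : ∀ i, ContMDiffAt I 𝓘(ℝ, EuclideanSpace ℝ (Fin m')) ∞ (fun y => u y i) x) :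
    ContMDiffAt I 𝓘(ℝ, Y) ∞ (fun y => a y (u y)) x := by
  have e : (fun y => a y (u y)) = fun y => ∑ K : Fin k → Fin m', (∏ i, u y i (K i)) •
      a y (fun i => EuclideanSpace.basisFun (Fin m') ℝ (K i)) :=
    funext fun y => alternatingMap_eq_sum_basisFun (a y) (u y)
  rw [e]
  refine contMDiffAt_finsetSum fun K _ => ?_
  have h : ContMDiffAt I 𝓘(ℝ, ℝ) ∞ (fun y => ∏ i, u y i (K i)) x := by
    refine contMDiffAt_finsetProd fun i _ => ?_
    exact (EuclideanSpace.proj (𝕜 := ℝ) (K i)).contDiff.contMDiff.contMDiffAt.comp x (hu i)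
  exact h.smul (ha _)

theorem formComp_change {k : ℕ} {c c' y : X} (hy : y ∈ (chartAt H c').source)
    (hb : y ∈ (trivializationAt F E c').baseSet) (v : Fin k → EuclideanSpace ℝ (Fin m))
    (θ : Form I E k y) :
    formComp I F E c v y θ = bundleCoord F E c y (bundleVec F E c' y
      (formComp I F E c' (fun i => tangentCoord I c' y (tangentVec I c y (v i))) y θ)) := by
  simp only [formComp, bundleVec_bundleCoord hb, tangentVec_tangentCoord I hy]

/-- The components of an `E`-valued form as an alternating map. -/
def formCoord (I : ModelWithCorners ℝ (EuclideanSpace ℝ (Fin m)) H) {X : Type*}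
    [TopologicalSpace X] [ChartedSpace H X] [IsManifold I ∞ X]
    (F : Type*) [NormedAddCommGroup F] [NormedSpace ℝ F]
    (E : X → Type*) [∀ x, AddCommMonoid (E x)] [∀ x, Module ℝ (E x)]
    [TopologicalSpace (Bundle.TotalSpace F E)] [∀ x, TopologicalSpace (E x)]
    [FiberBundle F E] [VectorBundle ℝ F E] {k : ℕ} (c y : X) (θ : Form I E k y) :
    EuclideanSpace ℝ (Fin m) [⋀^Fin k]→ₗ[ℝ] F :=
  (bundleCoord F E c y).compAlternatingMap (θ.compLinearMap (tangentVec I c y))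

/-- `Omega` requires smoothness of the components for `c` only at the point `c` itself; smoothness
throughout the coordinate domain follows by changing coordinates. -/
theorem contMDiffAt_formComp [ContMDiffVectorBundle ∞ F E I] {k : ℕ} (φ : Omega I F E k) {c x : X}
    (hx : x ∈ (chartAt H c).source) (hb : x ∈ (trivializationAt F E c).baseSet)
    (v : Fin k → EuclideanSpace ℝ (Fin m)) :
    ContMDiffAt I 𝓘(ℝ, F) ∞ (fun y => formComp I F E c v y (φ.1 y)) x := by
  have hxx := mem_chart_source H x
  have hbb := mem_baseSet_self F E x
  have h1 : ContMDiffAt I 𝓘(ℝ, F) ∞ (fun y => formCoord I F E x y (φ.1 y)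
      (fun i => tangentCoord I x y (tangentVec I c y (v i)))) x :=
    contMDiffAt_alternating (fun v => φ.2 x v) fun i => contMDiffAt_tangentCoord_change hxx hx (v i)
  refine (contMDiffAt_bundleCoord_change hb hbb h1).congr_of_eventuallyEq ?_
  filter_upwards [chart_source_mem_nhds hxx, baseSet_mem_nhds hbb] with y hy hby
  exact formComp_change hy hby v (φ.1 y)

/-- The determinant of the coordinate frame at `c` with respect to the one at `c'`. -/
def frameDet (I : ModelWithCorners ℝ (EuclideanSpace ℝ (Fin m)) H) {X : Type*}
    [TopologicalSpace X] [ChartedSpace H X] [IsManifold I ∞ X] (c c' y : X) : ℝ :=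
  (EuclideanSpace.basisFun (Fin m) ℝ).toBasis.det
    fun i => tangentCoord I c' y (chartFrame I c y i)

theorem contMDiffAt_frameDet {c c' x : X} (hx : x ∈ (chartAt H c).source)
    (hx' : x ∈ (chartAt H c').source) :
    ContMDiffAt I 𝓘(ℝ, ℝ) ∞ (frameDet I c c') x :=
  contMDiffAt_alternating
    (a := fun _ => (EuclideanSpace.basisFun (Fin m) ℝ).toBasis.det)
    (fun _ => contMDiffAt_const) fun _ => contMDiffAt_tangentCoord_change hx' hx _

theorem topForm_eq_det {T : Type*} [AddCommGroup T] [Module ℝ T]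
    (b : Module.Basis (Fin m) ℝ T) (θ : T [⋀^Fin m]→ₗ[ℝ] ℝ) (u : Fin m → T) :
    θ u = b.det u * θ b := by
  conv_lhs => rw [θ.eq_smul_basis_det b]
  simp [mul_comm]

theorem chartBasis_det {c y : X} (hy : y ∈ (chartAt H c).source) (u : Fin m → TangentSpace I y) :
    (chartBasis I hy).det u =
      (EuclideanSpace.basisFun (Fin m) ℝ).toBasis.det fun i => tangentCoord I c y (u i) := by
  rw [chartBasis, Module.Basis.det_map]
  rfl

theorem topForm_frame_change {c c' y : X} (hy' : y ∈ (chartAt H c').source)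
    (θ : TangentSpace I y [⋀^Fin m]→ₗ[ℝ] ℝ) :
    θ (chartFrame I c y) = frameDet I c c' y * θ (chartFrame I c' y) := by
  rw [topForm_eq_det (chartBasis I hy') θ, chartBasis_det, coe_chartBasis]
  rfl

/-- Smoothness of a form of top degree. -/
def SmoothTop (I : ModelWithCorners ℝ (EuclideanSpace ℝ (Fin m)) H) {X : Type*}
    [TopologicalSpace X] [ChartedSpace H X] [IsManifold I ∞ X]
    (θ : ∀ x : X, TangentSpace I x [⋀^Fin m]→ₗ[ℝ] ℝ) : Prop :=
  ∀ c, ContMDiffAt I 𝓘(ℝ, ℝ) ∞ (fun y => θ y (chartFrame I c y)) c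

/-- Multiplication of a field by a smooth function preserves smoothness. -/
theorem smul_mem_Omega {k : ℕ} {f : X → ℝ} (hf : ContMDiff I 𝓘(ℝ, ℝ) ∞ f) (φ : Omega I F E k) :
    (fun y => f y • φ.1 y) ∈ Omega I F E k := by
  intro c v
  refine ((hf c).smul (φ.2 c v)).congr_of_eventuallyEq (Filter.Eventually.of_forall fun y => ?_)
  simp [formComp]

end Transitions

/-! ### Test forms, and smoothness by testing. -/

section Extension

variable {m : ℕ} {H : Type*} [TopologicalSpace H]
  {I : ModelWithCorners ℝ (EuclideanSpace ℝ (Fin m)) H}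
  {X : Type*} [TopologicalSpace X] [ChartedSpace H X] [IsManifold I ∞ X]
  {F : Type*} [NormedAddCommGroup F] [NormedSpace ℝ F]
  {E : X → Type*} [∀ x, AddCommMonoid (E x)] [∀ x, Module ℝ (E x)]
  [TopologicalSpace (Bundle.TotalSpace F E)] [∀ x, TopologicalSpace (E x)]
  [FiberBundle F E] [VectorBundle ℝ F E]

/-- The form with given components in the chart and trivialization at `c`. -/
def constForm (I : ModelWithCorners ℝ (EuclideanSpace ℝ (Fin m)) H) {X : Type*}
    [TopologicalSpace X] [ChartedSpace H X] [IsManifold I ∞ X]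
    (F : Type*) [NormedAddCommGroup F] [NormedSpace ℝ F]
    (E : X → Type*) [∀ x, AddCommMonoid (E x)] [∀ x, Module ℝ (E x)]
    [TopologicalSpace (Bundle.TotalSpace F E)] [∀ x, TopologicalSpace (E x)]
    [FiberBundle F E] [VectorBundle ℝ F E] {k : ℕ} (c y : X)
    (a : EuclideanSpace ℝ (Fin m) [⋀^Fin k]→ₗ[ℝ] F) : Form I E k y :=
  (bundleVec F E c y).compAlternatingMap (a.compLinearMap (tangentCoord I c y))

theorem constForm_formCoord {k : ℕ} {c y : X} (hy : y ∈ (chartAt H c).source)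
    (hb : y ∈ (trivializationAt F E c).baseSet) (θ : Form I E k y) :
    constForm I F E c y (formCoord I F E c y θ) = θ := by
  ext w
  simp only [constForm, formCoord, LinearMap.compAlternatingMap_apply,
    AlternatingMap.compLinearMap_apply, bundleVec_bundleCoord hb, tangentVec_tangentCoord I hy]

theorem exists_bump [T2Space X] {c : X} {U : Set X} (hU : U ∈ 𝓝 c) :
    ∃ ρ : X → ℝ, ContMDiff I 𝓘(ℝ, ℝ) ∞ ρ ∧ tsupport ρ ⊆ U ∧ (∀ y, 0 ≤ ρ y) ∧
      ∀ᶠ y in 𝓝 c, ρ y = 1 := by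
  obtain ⟨ρ, -, h⟩ := (SmoothBumpFunction.nhds_basis_tsupport (I := I) c).mem_iff.1 hU
  exact ⟨ρ, ρ.contMDiff, h, fun y => ρ.nonneg, ρ.eventuallyEq_one⟩

/-- Constant components times a bump function supported in the common domain of the chart and the
trivialization. -/
theorem exists_omega_extension [T2Space X] [ContMDiffVectorBundle ∞ F E I] {k : ℕ} (c : X)
    (a : EuclideanSpace ℝ (Fin m) [⋀^Fin k]→ₗ[ℝ] F) :
    ∃ φ : Omega I F E k, ∀ᶠ y in 𝓝 c, φ.1 y = constForm I F E c y a := by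
  obtain ⟨ρ, hρ, hs, -, h1⟩ := exists_bump (I := I) (Filter.inter_mem
    (chart_source_mem_nhds (mem_chart_source H c)) (baseSet_mem_nhds (mem_baseSet_self F E c)))
  refine ⟨⟨fun y => ρ y • constForm I F E c y a, fun c' v => ?_⟩, ?_⟩
  · by_cases hx : c' ∈ tsupport ρ
    · obtain ⟨hx1, hx2⟩ := hs hx
      have h2 : ContMDiffAt I 𝓘(ℝ, F) ∞
          (fun y => a (fun i => tangentCoord I c y (tangentVec I c' y (v i)))) c' :=
        contMDiffAt_alternating (a := fun _ => a) (fun _ => contMDiffAt_const)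
          fun i => contMDiffAt_tangentCoord_change hx1 (mem_chart_source H c') _
      have h3 := (hρ c').smul (contMDiffAt_bundleCoord_change (mem_baseSet_self F E c') hx2 h2)
      refine h3.congr_of_eventuallyEq (Filter.Eventually.of_forall fun y => ?_)
      simp [formComp, constForm]
    · refine ContMDiffAt.congr_of_eventuallyEq (contMDiffAt_const (c := (0 : F))) ?_
      filter_upwards [(isClosed_tsupport ρ).isOpen_compl.mem_nhds hx] with y hy
      simp [formComp, image_eq_zero_of_notMem_tsupport hy]
  · filter_upwards [h1] with y hy
    simp [hy]

theorem exists_omega_eq [T2Space X] [ContMDiffVectorBundle ∞ F E I] {k : ℕ} (x : X) (θ : Form I E k x) :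
    ∃ φ : Omega I F E k, φ.1 x = θ := by
  obtain ⟨φ, hφ⟩ := exists_omega_extension (I := I) (E := E) x (formCoord I F E x x θ)
  exact ⟨φ, hφ.self_of_nhds.trans
    (constForm_formCoord (mem_chart_source H x) (mem_baseSet_self F E x) θ)⟩

/-- A field of tensors whose contractions with smooth forms are smooth is smooth. -/
theorem mem_Lambda_of_contract [T2Space X] [ContMDiffVectorBundle ∞ F E I] {k : ℕ}
    {χ : ∀ x : X, DualTensor I E k m x}
    (h : ∀ φ : Omega I F E k,
      SmoothTop I fun x => contract (tangentBasis I x) (χ x) (φ.1 x)) :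
    χ ∈ Lambda I F E k m := by
  intro c β v f
  -- Against the test form with constant components `β₁ ∧ … ∧ β_k ⊗ f` the contraction is the wanted
  -- component. In top degree only the value on the coordinate frame is needed, and `det v` supplies
  -- the rest.
  obtain ⟨φ, hφ⟩ := exists_omega_extension (I := I) (E := E) c
    ((detForm (EuclideanSpace ℝ (Fin m)) k β).smulRight f)
  have h1 : ContMDiffAt I 𝓘(ℝ, ℝ) ∞ (fun y => (EuclideanSpace.basisFun (Fin m) ℝ).toBasis.det v *
      contract (tangentBasis I y) (χ y) (φ.1 y) (chartFrame I c y)) c :=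
    (contMDiffAt_const (I' := 𝓘(ℝ, ℝ))).mul (h φ c)
  refine h1.congr_of_eventuallyEq ?_
  filter_upwards [hφ, chart_source_mem_nhds (mem_chart_source H c)] with y hy hyc
  have e : constForm I F E c y ((detForm (EuclideanSpace ℝ (Fin m)) k β).smulRight f) =
      (detForm (TangentSpace I y) k fun i => β i ∘ₗ tangentCoord I c y).smulRight
        (bundleVec F E c y f) := by
    ext w
    simp only [constForm, LinearMap.compAlternatingMap_apply, AlternatingMap.compLinearMap_apply,
      AlternatingMap.smulRight_apply, map_smul]
    rfl
  have e2 := topForm_eq_det (chartBasis I hyc)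
    (contract (tangentBasis I y) (χ y) (φ.1 y)) (fun i => tangentVec I c y (v i))
  rw [chartBasis_det, coe_chartBasis] at e2
  simp only [tangentCoord_tangentVec I hyc] at e2
  rw [← e2, hy, e, contract_smulRight]
  rfl

theorem wedge_natural {T T' A A' : Type*} [AddCommGroup T] [Module ℝ T] [AddCommGroup T']
    [Module ℝ T'] [AddCommMonoid A] [Module ℝ A] [AddCommMonoid A'] [Module ℝ A'] {k j m : ℕ}
    (h : k + j = m) (g : A →ₗ[ℝ] A') (φ : T [⋀^Fin k]→ₗ[ℝ] A)
    (ψ : T [⋀^Fin j]→ₗ[ℝ] Module.Dual ℝ A') :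
    wedge h (g.compAlternatingMap φ) ψ = wedge h φ (g.dualMap.compAlternatingMap ψ) := by
  ext u
  rw [wedge_eq_sum, wedge_eq_sum]
  rfl

/-- A field of `E*`-valued forms whose products with smooth forms are smooth is smooth. -/
theorem mem_OmegaDual_of_wedge [T2Space X] [ContMDiffVectorBundle ∞ F E I] [FiniteDimensional ℝ F] {k j : ℕ}
    (hkj : k + j = m) {ψ : ∀ x : X, DualForm I E j x}
    (h : ∀ φ : Omega I F E k, SmoothTop I fun x => wedge hkj (φ.1 x) (ψ x)) :
    ψ ∈ OmegaDual I F E j := by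
  intro c v f
  let l : (EuclideanSpace ℝ (Fin m) [⋀^Fin j]→ₗ[ℝ] Module.Dual ℝ F) →ₗ[ℝ] ℝ :=
    { toFun := fun ξ => ξ v f
      map_add' := fun _ _ => rfl
      map_smul' := fun _ _ => rfl }
  -- `a` represents the functional `ξ ↦ ξ v f` through the wedge pairing on the model space, so the
  -- product with the form of constant components `a` is the wanted component.
  obtain ⟨a, ha⟩ := (exists_wedge_functional hkj
    (EuclideanSpace.basisFun (Fin m) ℝ).toBasis).2 l
  obtain ⟨φ, hφ⟩ := exists_omega_extension (I := I) (E := E) c a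
  refine (h φ c).congr_of_eventuallyEq ?_
  filter_upwards [hφ, chart_source_mem_nhds (mem_chart_source H c)] with y hy hyc
  rw [hy, constForm, wedge_natural (T' := TangentSpace I y)]
  have e := ha (((bundleVec F E c y).dualMap.compAlternatingMap (ψ y)).compLinearMap
    (tangentVec I c y))
  have e2 : ((((bundleVec F E c y).dualMap.compAlternatingMap (ψ y)).compLinearMap
    (tangentVec I c y))).compLinearMap (tangentCoord I c y) =
      (bundleVec F E c y).dualMap.compAlternatingMap (ψ y) := by
    ext w
    simp only [AlternatingMap.compLinearMap_apply, tangentVec_tangentCoord I hyc]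
  rw [← e2, wedge_compLinearMap]
  simp only [AlternatingMap.compLinearMap_apply, chartFrame, tangentCoord_tangentVec I hyc]
  rw [OrthonormalBasis.coe_toBasis] at e
  exact e.symm

end Extension

/-! ### Smooth products, and fields detecting a nonzero form. -/

section Products

variable {m : ℕ} {H : Type*} [TopologicalSpace H]
  {I : ModelWithCorners ℝ (EuclideanSpace ℝ (Fin m)) H}
  {X : Type*} [TopologicalSpace X] [ChartedSpace H X] [IsManifold I ∞ X]
  {F : Type*} [NormedAddCommGroup F] [NormedSpace ℝ F]
  {E : X → Type*} [∀ x, AddCommMonoid (E x)] [∀ x, Module ℝ (E x)]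
  [TopologicalSpace (Bundle.TotalSpace F E)] [∀ x, TopologicalSpace (E x)]
  [FiberBundle F E] [VectorBundle ℝ F E] [FiniteDimensional ℝ F]

/-- In a basis of the model fibre the pairing is a finite sum of products of smooth components. -/
theorem contMDiffAt_pairing {η : ∀ y : X, Module.Dual ℝ (E y)} {s : ∀ y, E y} {x : X}
    (hη : ∀ f : F, ContMDiffAt I 𝓘(ℝ, ℝ) ∞ (fun y => η y (bundleVec F E x y f)) x)
    (hs : ContMDiffAt I 𝓘(ℝ, F) ∞ (fun y => bundleCoord F E x y (s y)) x) :
    ContMDiffAt I 𝓘(ℝ, ℝ) ∞ (fun y => η y (s y)) x := by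
  have h : ContMDiffAt I 𝓘(ℝ, ℝ) ∞ (fun y => ∑ i, (LinearMap.toContinuousLinearMap
      ((Module.finBasis ℝ F).coord i)) (bundleCoord F E x y (s y)) *
        η y (bundleVec F E x y (Module.finBasis ℝ F i))) x := by
    refine contMDiffAt_finsetSum fun i _ => ContMDiffAt.mul ?_ (hη _)
    exact (LinearMap.toContinuousLinearMap
      ((Module.finBasis ℝ F).coord i)).contDiff.contMDiff.contMDiffAt.comp x hs
  refine h.congr_of_eventuallyEq ?_
  filter_upwards [baseSet_mem_nhds (mem_baseSet_self F E x)] with y hy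
  conv_lhs => rw [← bundleVec_bundleCoord hy (s y)]
  exact linearMap_eq_sum_repr (Module.finBasis ℝ F) (η y ∘ₗ bundleVec F E x y) _

/-- Smoothness of a real-valued form. -/
def SmoothForm (I : ModelWithCorners ℝ (EuclideanSpace ℝ (Fin m)) H) {X : Type*}
    [TopologicalSpace X] [ChartedSpace H X] [IsManifold I ∞ X] {r : ℕ}
    (θ : ∀ x : X, TangentSpace I x [⋀^Fin r]→ₗ[ℝ] ℝ) : Prop :=
  ∀ c (v : Fin r → EuclideanSpace ℝ (Fin m)),
    ContMDiffAt I 𝓘(ℝ, ℝ) ∞ (fun y => θ y fun i => tangentVec I c y (v i)) c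

theorem SmoothForm.smoothTop {θ : ∀ x : X, TangentSpace I x [⋀^Fin m]→ₗ[ℝ] ℝ}
    (h : SmoothForm I θ) : SmoothTop I θ := fun c => h c _

theorem SmoothForm.smul {r : ℕ} {θ : ∀ x : X, TangentSpace I x [⋀^Fin r]→ₗ[ℝ] ℝ}
    (h : SmoothForm I θ) {f : X → ℝ} (hf : ContMDiff I 𝓘(ℝ, ℝ) ∞ f) :
    SmoothForm I fun x => f x • θ x := fun c v => (hf c).mul (h c v)

theorem SmoothForm.dForm {r : ℕ} {θ : ∀ x : X, TangentSpace I x [⋀^Fin r]→ₗ[ℝ] ℝ}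
    (h : SmoothForm I θ) {η : ∀ x : X, TangentSpace I x [⋀^Fin (r + 1)]→ₗ[ℝ] ℝ}
    (hη : ∀ x w, η x w = dForm I θ x w) : SmoothForm I η := fun c v =>
  (contMDiffAt_dForm I (fun v => h c v) v).congr_of_eventuallyEq
    (Filter.Eventually.of_forall fun y => hη y _)

theorem smoothForm_contract {k r : ℕ} (χ : Lambda I F E k r) (φ : Omega I F E k) :
    SmoothForm I fun x => contract (tangentBasis I x) (χ.1 x) (φ.1 x) := by
  intro c v
  have h : ContMDiffAt I 𝓘(ℝ, ℝ) ∞ (fun y => ∑ J : Fin k ↪o Fin m,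
      χ.1 y (fun l => (EuclideanSpace.basisFun (Fin m) ℝ).toBasis.coord (J l) ∘ₗ tangentCoord I c y)
        (fun i => tangentVec I c y (v i)) (φ.1 y fun l => chartFrame I c y (J l))) c := by
    refine contMDiffAt_finsetSum fun J _ => ?_
    exact contMDiffAt_pairing (E := E) (fun f => χ.2 c _ v f) (φ.2 c _)
  refine h.congr_of_eventuallyEq ?_
  filter_upwards [chart_source_mem_nhds (mem_chart_source H c)] with y hy
  rw [contract_eq_of_basis _ (chartBasis I hy), contract_apply]
  simp only [chartBasis_coord, chartBasis_apply]

theorem smoothForm_wedge {k j r : ℕ} (h : k + j = r) (φ : Omega I F E k) (ψ : OmegaDual I F E j) :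
    SmoothForm I fun x => wedge h (φ.1 x) (ψ.1 x) := by
  intro c v
  simp only [wedge_eq_sum]
  refine ContMDiffAt.mul contMDiffAt_const (contMDiffAt_finsetSum fun σ _ => ?_)
  refine ContMDiffAt.mul contMDiffAt_const ?_
  exact contMDiffAt_pairing (E := E) (fun f => ψ.2 c _ f) (φ.2 c _)

theorem smul_mem_Lambda {s r : ℕ} {f : X → ℝ} (hf : ContMDiff I 𝓘(ℝ, ℝ) ∞ f)
    (χ : Lambda I F E s r) : (fun y => f y • χ.1 y) ∈ Lambda I F E s r := fun c β v e =>
  (hf c).mul (χ.2 c β v e)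

theorem smul_mem_OmegaDual {j : ℕ} {f : X → ℝ} (hf : ContMDiff I 𝓘(ℝ, ℝ) ∞ f)
    (ψ : OmegaDual I F E j) : (fun y => f y • ψ.1 y) ∈ OmegaDual I F E j := fun c v e =>
  (hf c).mul (ψ.2 c v e)

/-- Expansion of the form into decomposable ones turns `L` into finitely many linear functionals of
components. -/
theorem contMDiffAt_linear_formCoord [ContMDiffVectorBundle ∞ F E I] {k : ℕ}
    (L : (EuclideanSpace ℝ (Fin m) [⋀^Fin k]→ₗ[ℝ] F) →ₗ[ℝ] ℝ) (φ : Omega I F E k) {c x : X}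
    (hx : x ∈ (chartAt H c).source) (hb : x ∈ (trivializationAt F E c).baseSet) :
    ContMDiffAt I 𝓘(ℝ, ℝ) ∞ (fun y => L (formCoord I F E c y (φ.1 y))) x := by
  let b := (EuclideanSpace.basisFun (Fin m) ℝ).toBasis
  let S : (Fin k → Fin m) → F →ₗ[ℝ] (EuclideanSpace ℝ (Fin m) [⋀^Fin k]→ₗ[ℝ] F) := fun K =>
    { toFun := fun e => (detForm (EuclideanSpace ℝ (Fin m)) k fun i => b.coord (K i)).smulRight e
      map_add' := fun e e' => by ext v; simp
      map_smul' := fun a e => by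
        ext v
        exact smul_comm _ _ _ }
  have e : (fun y => L (formCoord I F E c y (φ.1 y))) = fun y => (k.factorial : ℝ)⁻¹ *
      ∑ K : Fin k → Fin m, (LinearMap.toContinuousLinearMap (L ∘ₗ S K))
        (formComp I F E c (fun i => b (K i)) y (φ.1 y)) := by
    funext y
    conv_lhs => rw [← sum_detForm_smulRight b (formCoord I F E c y (φ.1 y)), map_smul, map_sum]
    rfl
  rw [e]
  refine ContMDiffAt.mul contMDiffAt_const (contMDiffAt_finsetSum fun K _ => ?_)
  exact (LinearMap.toContinuousLinearMap (L ∘ₗ S K)).contDiff.contMDiff.contMDiffAt.comp x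
    (contMDiffAt_formComp φ hx hb _)

/-- The linear map from `E`-valued forms at `y` to forms of top degree which has coefficients
`a • L` in the chart and trivialization at `c`. -/
def transportTop (I : ModelWithCorners ℝ (EuclideanSpace ℝ (Fin m)) H) {X : Type*}
    [TopologicalSpace X] [ChartedSpace H X] [IsManifold I ∞ X]
    (F : Type*) [NormedAddCommGroup F] [NormedSpace ℝ F]
    (E : X → Type*) [∀ x, AddCommMonoid (E x)] [∀ x, Module ℝ (E x)]
    [TopologicalSpace (Bundle.TotalSpace F E)] [∀ x, TopologicalSpace (E x)]
    [FiberBundle F E] [VectorBundle ℝ F E] {k : ℕ}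
    (L : (EuclideanSpace ℝ (Fin m) [⋀^Fin k]→ₗ[ℝ] F) →ₗ[ℝ] ℝ) (a : ℝ) (c y : X) :
    Form I E k y →ₗ[ℝ] (TangentSpace I y [⋀^Fin m]→ₗ[ℝ] ℝ) where
  toFun θ := (a * L (formCoord I F E c y θ)) •
    (EuclideanSpace.basisFun (Fin m) ℝ).toBasis.det.compLinearMap (tangentCoord I c y)
  map_add' θ θ' := by
    have : formCoord I F E c y (θ + θ') = formCoord I F E c y θ + formCoord I F E c y θ' := by
      ext v
      simp [formCoord]
    rw [this, map_add, mul_add, add_smul]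
  map_smul' r θ := by
    have : formCoord I F E c y (r • θ) = r • formCoord I F E c y θ := by
      ext v
      simp [formCoord]
    rw [this, map_smul, smul_eq_mul, mul_left_comm, mul_smul, RingHom.id_apply]

theorem smoothTop_transportTop [ContMDiffVectorBundle ∞ F E I] {k : ℕ}
    (L : (EuclideanSpace ℝ (Fin m) [⋀^Fin k]→ₗ[ℝ] F) →ₗ[ℝ] ℝ) {ρ : X → ℝ}
    (hρ : ContMDiff I 𝓘(ℝ, ℝ) ∞ ρ) {c : X}
    (hs : tsupport ρ ⊆ (chartAt H c).source ∩ (trivializationAt F E c).baseSet)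
    (φ : Omega I F E k) : SmoothTop I fun y => transportTop I F E L (ρ y) c y (φ.1 y) := by
  intro c'
  by_cases hx : c' ∈ tsupport ρ
  · obtain ⟨hx1, hx2⟩ := hs hx
    exact ((hρ c').mul (contMDiffAt_linear_formCoord L φ hx1 hx2)).mul
      (contMDiffAt_frameDet (mem_chart_source H c') hx1)
  · refine ContMDiffAt.congr_of_eventuallyEq (contMDiffAt_const (c := (0 : ℝ))) ?_
    filter_upwards [(isClosed_tsupport ρ).isOpen_compl.mem_nhds hx] with y hy
    simp [transportTop, image_eq_zero_of_notMem_tsupport hy]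

/-- A functional not vanishing on the components of `θ` is spread out with constant coefficients and
cut off. It serves both realisations, since a fibrewise linear map to top forms is a contraction and
also a wedge product. -/
theorem exists_transportTop_ne [T2Space X] [ContMDiffVectorBundle ∞ F E I] {k : ℕ} {c : X}
    {θ : Form I E k c} (hθ : θ ≠ 0) :
    ∃ l : ∀ y, Form I E k y →ₗ[ℝ] (TangentSpace I y [⋀^Fin m]→ₗ[ℝ] ℝ), l c θ ≠ 0 ∧
      ∀ φ : Omega I F E k, SmoothTop I fun y => l y (φ.1 y) := by
  obtain ⟨ρ, hρ, hs, -, h1⟩ := exists_bump (I := I) (Filter.inter_mem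
    (chart_source_mem_nhds (mem_chart_source H c)) (baseSet_mem_nhds (mem_baseSet_self F E c)))
  have hc : formCoord I F E c c θ ≠ 0 := by
    intro h
    apply hθ
    rw [← constForm_formCoord (mem_chart_source H c) (mem_baseSet_self F E c) θ, h]
    ext w
    simp [constForm]
  obtain ⟨L, hL⟩ : ∃ L : (EuclideanSpace ℝ (Fin m) [⋀^Fin k]→ₗ[ℝ] F) →ₗ[ℝ] ℝ,
      L (formCoord I F E c c θ) ≠ 0 := by
    by_contra! hL
    exact hc ((Module.forall_dual_apply_eq_zero_iff ℝ _).1 hL)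
  refine ⟨fun y => transportTop I F E L (ρ y) c y, fun h => hL ?_,
    smoothTop_transportTop L hρ hs⟩
  have h2 := congrArg (fun η => η (chartFrame I c c)) h
  simp only [transportTop, LinearMap.coe_mk, AddHom.coe_mk, AlternatingMap.smul_apply,
    AlternatingMap.compLinearMap_apply, h1.self_of_nhds, one_mul, AlternatingMap.zero_apply,
    chartFrame, tangentCoord_tangentVec I (mem_chart_source H c)] at h2
  have h3 := (EuclideanSpace.basisFun (Fin m) ℝ).toBasis.det_self
  rw [OrthonormalBasis.coe_toBasis] at h3
  rw [h3, smul_eq_mul, mul_one] at h2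
  exact h2

/-- A nonzero form has a nonzero contraction with a smooth field of tensors. -/
theorem exists_contract_ne [T2Space X] [ContMDiffVectorBundle ∞ F E I] {k : ℕ} {c : X}
    {θ : Form I E k c} (hθ : θ ≠ 0) :
    ∃ χ : Lambda I F E k m, contract (tangentBasis I c) (χ.1 c) θ ≠ 0 := by
  obtain ⟨l, hl, hs⟩ := exists_transportTop_ne (F := F) hθ
  -- The tensors are chosen fibre by fibre without control of their dependence on `y`; smoothness
  -- follows afterwards by testing.
  choose χ hχ using fun y => exists_contract_eq (tangentBasis I y) (l y)
  refine ⟨⟨χ, mem_Lambda_of_contract fun φ => ?_⟩, ?_⟩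
  · simpa only [hχ] using hs φ
  · rwa [hχ]

/-- A nonzero form has a nonzero product with a smooth `E*`-valued form. -/
theorem exists_wedge_ne [T2Space X] [ContMDiffVectorBundle ∞ F E I] {k j : ℕ} (hkj : k + j = m)
    {c : X} {θ : Form I E k c} (hθ : θ ≠ 0) :
    ∃ ψ : OmegaDual I F E j, wedge hkj θ (ψ.1 c) ≠ 0 := by
  obtain ⟨l, hl, hs⟩ := exists_transportTop_ne (F := F) hθ
  have : ∀ y, Module.Finite ℝ (E y) := fun y =>
    Module.Finite.of_surjective (bundleVec F E y y)
      fun e => ⟨_, bundleVec_bundleCoord (mem_baseSet_self F E y) e⟩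
  choose ψ hψ using fun y => exists_wedge_eq hkj (tangentBasis I y) (l y)
  refine ⟨⟨ψ, mem_OmegaDual_of_wedge hkj fun φ => ?_⟩, ?_⟩
  · simpa only [hψ] using hs φ
  · rwa [hψ]

end Products

/-! ### Top forms depending smoothly on a real parameter. -/

section Parameter

variable {m : ℕ} {H : Type*} [TopologicalSpace H]
  {I : ModelWithCorners ℝ (EuclideanSpace ℝ (Fin m)) H}
  {X : Type*} [TopologicalSpace X] [ChartedSpace H X] [IsManifold I ∞ X]

theorem contDiffWithinAt_parameter {g : ℝ × X → ℝ} {ε : ℝ} {c : X}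
    (hg : ContMDiffAt (𝓘(ℝ, ℝ).prod I) 𝓘(ℝ, ℝ) ∞ g (ε, c)) :
    ContDiffWithinAt ℝ ∞ (fun q : ℝ × EuclideanSpace ℝ (Fin m) => g (q.1, (extChartAt I c).symm q.2))
      (Set.univ ×ˢ Set.range I) (ε, extChartAt I c c) := by
  rw [← contMDiffWithinAt_iff_contDiffWithinAt]
  have h1 : ContMDiffWithinAt 𝓘(ℝ, ℝ × EuclideanSpace ℝ (Fin m)) (𝓘(ℝ, ℝ).prod I) ∞
      (fun q : ℝ × EuclideanSpace ℝ (Fin m) => (q.1, (extChartAt I c).symm q.2))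
      (Set.univ ×ˢ Set.range I) (ε, extChartAt I c c) := by
    refine ContMDiffWithinAt.prodMk contDiff_fst.contMDiff.contMDiffAt.contMDiffWithinAt ?_
    have h2 := contMDiffWithinAt_extChartAt_symm_range (I := I) (n := ∞) c (mem_extChartAt_target c)
    exact ContMDiffWithinAt.comp (t := Set.range I) (ε, extChartAt I c c)
      (f := fun q : ℝ × EuclideanSpace ℝ (Fin m) => q.2) h2
      contDiff_snd.contMDiff.contMDiffAt.contMDiffWithinAt (fun q hq => hq.2)
  refine ContMDiffAt.comp_contMDiffWithinAt _ (g := g) ?_ h1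
  simpa using hg

/-- In the chart the parameter derivative is the derivative within `ℝ × range I` in the direction
`(1, 0)`. The parameter runs over the whole line, so this is a genuine derivative even at boundary
points. -/
theorem exists_parameter_deriv {g : ℝ × X → ℝ} {ε : ℝ} {c : X}
    (hg : ContMDiffAt (𝓘(ℝ, ℝ).prod I) 𝓘(ℝ, ℝ) ∞ g (ε, c)) :
    ∃ g' : ℝ × X → ℝ, ContMDiffAt (𝓘(ℝ, ℝ).prod I) 𝓘(ℝ, ℝ) ∞ g' (ε, c) ∧
      ∀ᶠ q in 𝓝 (ε, c), HasDerivAt (fun s => g (s, q.2)) (g' q) q.1 := by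
  set h := fun q : ℝ × EuclideanSpace ℝ (Fin m) => g (q.1, (extChartAt I c).symm q.2) with hh
  set S : Set (ℝ × EuclideanSpace ℝ (Fin m)) := Set.univ ×ˢ Set.range I with hS
  have h1 : ContDiffWithinAt ℝ ∞ h S (ε, extChartAt I c c) := contDiffWithinAt_parameter hg
  have hu : UniqueDiffOn ℝ S := uniqueDiffOn_univ.prod I.uniqueDiffOn
  have hm : (ε, extChartAt I c c) ∈ S := ⟨trivial, extChartAt_mem_range I c c⟩
  have h2 : ContDiffWithinAt ℝ ∞ (fun q => fderivWithin ℝ h S q (1, 0)) S (ε, extChartAt I c c) :=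
    (h1.fderivWithin_right hu (by simp) hm).clm_apply contDiffWithinAt_const
  have h3 : ContMDiffAt (𝓘(ℝ, ℝ).prod I) 𝓘(ℝ, ℝ × EuclideanSpace ℝ (Fin m)) ∞
      (fun q : ℝ × X => (q.1, extChartAt I c q.2)) (ε, c) := by
    have h4 : ContMDiffAt (𝓘(ℝ, ℝ).prod I) 𝓘(ℝ, EuclideanSpace ℝ (Fin m)) ∞
        (fun q : ℝ × X => extChartAt I c q.2) (ε, c) :=
      ContMDiffAt.comp (ε, c) (contMDiffAt_extChartAt (n := ∞) (I := I) (x := c)) contMDiffAt_snd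
    exact contMDiffAt_fst.prodMk_space h4
  refine ⟨fun q => fderivWithin ℝ h S (q.1, extChartAt I c q.2) (1, 0), ?_, ?_⟩
  · exact ContMDiffWithinAt.comp (ε, c) (t := S) (s := Set.univ)
      (g := fun q => fderivWithin ℝ h S q (1, 0)) h2.contMDiffWithinAt h3.contMDiffWithinAt
      (fun q _ => ⟨trivial, extChartAt_mem_range I c q.2⟩)
  · have h5 : ∀ᶠ q in 𝓝[S] (ε, extChartAt I c c), DifferentiableWithinAt ℝ h S q := by
      have := (h1.of_le (m := 1) (by exact_mod_cast le_top)).eventually (by simp)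
      rw [Set.insert_eq_of_mem hm] at this
      exact this.mono fun z hz => hz.differentiableWithinAt one_ne_zero
    have h6 : Filter.Tendsto (fun q : ℝ × X => (q.1, extChartAt I c q.2)) (𝓝 (ε, c))
        (𝓝[S] (ε, extChartAt I c c)) :=
      tendsto_nhdsWithin_of_tendsto_nhds_of_eventually_within _ h3.continuousAt
        (Filter.Eventually.of_forall fun q => ⟨trivial, extChartAt_mem_range I c q.2⟩)
    have h7 : ∀ᶠ q : ℝ × X in 𝓝 (ε, c), q.2 ∈ (chartAt H c).source :=
      continuousAt_snd.eventually (chart_source_mem_nhds (mem_chart_source H c))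
    filter_upwards [h6.eventually h5, h7] with q hq hqs
    have h8 : HasFDerivWithinAt (fun s : ℝ => (s, extChartAt I c q.2))
        (ContinuousLinearMap.inl ℝ ℝ (EuclideanSpace ℝ (Fin m))) Set.univ q.1 :=
      (hasFDerivAt_prodMk_left q.1 _).hasFDerivWithinAt
    have hmaps : Set.MapsTo (fun s : ℝ => (s, extChartAt I c q.2)) Set.univ S :=
      fun s _ => ⟨trivial, extChartAt_mem_range I c q.2⟩
    have h9 := (hq.hasFDerivWithinAt.comp q.1 h8 hmaps).hasFDerivAt Filter.univ_mem
    have h10 := h9.hasDerivAt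
    have e : (extChartAt I c).symm (extChartAt I c q.2) = q.2 :=
      (extChartAt I c).left_inv (by simpa using hqs)
    simp only [hh, Function.comp_def, e] at h10
    simpa [hh] using h10

/-- A family of top forms which depends smoothly on a parameter and on the base point. -/
def SmoothTopFamily (I : ModelWithCorners ℝ (EuclideanSpace ℝ (Fin m)) H) {X : Type*}
    [TopologicalSpace X] [ChartedSpace H X] [IsManifold I ∞ X]
    (θ : ℝ → ∀ x : X, TangentSpace I x [⋀^Fin m]→ₗ[ℝ] ℝ) : Prop :=
  ∀ (ε : ℝ) (c : X), ContMDiffAt (𝓘(ℝ, ℝ).prod I) 𝓘(ℝ, ℝ) ∞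
    (fun q : ℝ × X => θ q.1 q.2 (chartFrame I c q.2)) (ε, c)

theorem SmoothTopFamily.smoothTop {θ : ℝ → ∀ x : X, TangentSpace I x [⋀^Fin m]→ₗ[ℝ] ℝ}
    (h : SmoothTopFamily I θ) (ε : ℝ) : SmoothTop I (θ ε) := fun c =>
  ContMDiffAt.comp c (f := fun x : X => (ε, x)) (h ε c)
    (contMDiffAt_const.prodMk contMDiffAt_id)

/-- The smooth local derivatives are chosen separately for each point. Uniqueness of derivatives
makes the field of their central values agree with each local choice near its centre, which gives
smoothness. -/
theorem SmoothTopFamily.exists_deriv {θ : ℝ → ∀ x : X, TangentSpace I x [⋀^Fin m]→ₗ[ℝ] ℝ}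
    (h : SmoothTopFamily I θ) : ∃ θ' : ℝ → ∀ x : X, TangentSpace I x [⋀^Fin m]→ₗ[ℝ] ℝ,
      SmoothTopFamily I θ' ∧ ∀ ε x u, HasDerivAt (fun s => θ s x u) (θ' ε x u) ε := by
  choose g' hg' hd using fun ε c => exists_parameter_deriv (h ε c)
  have hu : ∀ ε x (u : Fin m → TangentSpace I x),
      HasDerivAt (fun s => θ s x u) ((chartBasis I (mem_chart_source H x)).det u *
        g' ε x (ε, x)) ε := by
    intro ε x u
    have h1 := ((hd ε x).self_of_nhds).const_mul ((chartBasis I (mem_chart_source H x)).det u)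
    refine h1.congr_of_eventuallyEq (Filter.Eventually.of_forall fun s => ?_)
    simp only
    rw [topForm_eq_det (chartBasis I (mem_chart_source H x)) (θ s x) u, coe_chartBasis]
  refine ⟨fun ε x => g' ε x (ε, x) • (chartBasis I (mem_chart_source H x)).det,
    fun ε c => ?_, fun ε x u => ?_⟩
  · refine (hg' ε c).congr_of_eventuallyEq ?_
    filter_upwards [hd ε c] with q hq
    refine (?_ : HasDerivAt (fun s => θ s q.2 (chartFrame I c q.2)) _ q.1).unique hq
    rw [AlternatingMap.smul_apply, smul_eq_mul, mul_comm]
    exact hu q.1 q.2 _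
  · rw [AlternatingMap.smul_apply, smul_eq_mul, mul_comm]
    exact hu ε x u

end Parameter

theorem contMDiffAt_continuousAlternating {m k : ℕ} {H : Type*} [TopologicalSpace H]
    {I : ModelWithCorners ℝ (EuclideanSpace ℝ (Fin m)) H}
    {X : Type*} [TopologicalSpace X] [ChartedSpace H X]
    {Y : Type*} [NormedAddCommGroup Y] [NormedSpace ℝ Y] [FiniteDimensional ℝ Y]
    {a : X → EuclideanSpace ℝ (Fin m) [⋀^Fin k]→ₗ[ℝ] Y} {x : X}
    (ha : ∀ v, ContMDiffAt I 𝓘(ℝ, Y) ∞ (fun y => a y v) x) :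
    ContMDiffAt I 𝓘(ℝ, EuclideanSpace ℝ (Fin m) [⋀^Fin k]→L[ℝ] Y) ∞
      (fun y => continuousAlternating (a y)) x := by
  obtain ⟨R, hR⟩ := exists_basisValues_leftInverse (m := m) (k := k) (Y := Y)
  have e : (fun y => continuousAlternating (a y)) =
      fun y => R (basisValues m k Y (continuousAlternating (a y))) := funext fun y => (hR _).symm
  rw [e]
  have h : ContMDiffAt I 𝓘(ℝ, (Fin k → Fin m) → Y) ∞
      (fun y => basisValues m k Y (continuousAlternating (a y))) x :=
    contMDiffAt_pi_space.2 fun K => ha _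
  exact R.contDiff.contMDiff.contMDiffAt.comp x h

/-! ### Differentiating a smooth density. -/

section Densities

variable {n : ℕ}
  {M : Type*} [TopologicalSpace M] [ChartedSpace (EuclideanHalfSpace (n + 1)) M]
  [IsManifold (𝓡∂ (n + 1)) ∞ M]
  {F : Type*} [NormedAddCommGroup F] [NormedSpace ℝ F]
  {E : M → Type*} [∀ x, AddCommGroup (E x)] [∀ x, Module ℝ (E x)]
  [TopologicalSpace (Bundle.TotalSpace F E)] [∀ x, TopologicalSpace (E x)]
  [FiberBundle F E] [VectorBundle ℝ F E] {k : ℕ}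

/-- The components of a form as a continuous alternating map. -/
def clmCoord (F : Type*) [NormedAddCommGroup F] [NormedSpace ℝ F]
    (E : M → Type*) [∀ x, AddCommGroup (E x)] [∀ x, Module ℝ (E x)]
    [TopologicalSpace (Bundle.TotalSpace F E)] [∀ x, TopologicalSpace (E x)]
    [FiberBundle F E] [VectorBundle ℝ F E] (c y : M) :
    Form (𝓡∂ (n + 1)) E k y →ₗ[ℝ] EuclideanSpace ℝ (Fin (n + 1)) [⋀^Fin k]→L[ℝ] F where
  toFun θ := continuousAlternating (formCoord (𝓡∂ (n + 1)) F E c y θ)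
  map_add' θ θ' := by
    ext v
    simp [formCoord]
  map_smul' r θ := by
    ext v
    simp [formCoord]

theorem formOfCoord_clmCoord {c y : M} (hy : y ∈ (chartAt (EuclideanHalfSpace (n + 1)) c).source)
    (hb : y ∈ (trivializationAt F E c).baseSet) (θ : Form (𝓡∂ (n + 1)) E k y) :
    formOfCoord F E c y (clmCoord F E c y θ) = θ :=
  constForm_formCoord hy hb θ

variable [FiniteDimensional ℝ F]

theorem contMDiffAt_clmCoord (φ : Omega (𝓡∂ (n + 1)) F E k) (c : M) :
    ContMDiffAt (𝓡∂ (n + 1)) 𝓘(ℝ, EuclideanSpace ℝ (Fin (n + 1)) [⋀^Fin k]→L[ℝ] F) ∞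
      (fun y => clmCoord F E c y (φ.1 y)) c :=
  contMDiffAt_continuousAlternating (a := fun y => formCoord (𝓡∂ (n + 1)) F E c y (φ.1 y))
    fun v => φ.2 c v

/-- The values of a smooth density along a line of smooth fields form a smooth family. -/
theorem Density.IsSmooth.smoothTopFamily {ℒ : Density n E k} (hℒ : ℒ.IsSmooth F)
    (φ ν δφ δν : Omega (𝓡∂ (n + 1)) F E k) (ζ δζ : Omega (𝓡∂ (n + 1)) F E (k + 1)) :
    SmoothTopFamily (𝓡∂ (n + 1)) fun ε x => ℒ x (φ.1 x + ε • δφ.1 x) (ν.1 x + ε • δν.1 x)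
      (ζ.1 x + ε • δζ.1 x) := by
  intro ε c
  have hline : ∀ {j : ℕ} (α β : Omega (𝓡∂ (n + 1)) F E j),
      ContMDiffAt (𝓘(ℝ, ℝ).prod (𝓡∂ (n + 1)))
        𝓘(ℝ, EuclideanSpace ℝ (Fin (n + 1)) [⋀^Fin j]→L[ℝ] F) ∞
        (fun q : ℝ × M => clmCoord F E c q.2 (α.1 q.2) + q.1 • clmCoord F E c q.2 (β.1 q.2))
        (ε, c) := by
    intro j α β
    have h1 : ContMDiffAt (𝓘(ℝ, ℝ).prod (𝓡∂ (n + 1)))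
        𝓘(ℝ, EuclideanSpace ℝ (Fin (n + 1)) [⋀^Fin j]→L[ℝ] F) ∞
        (fun q : ℝ × M => clmCoord F E c q.2 (α.1 q.2)) (ε, c) :=
      ContMDiffAt.comp (ε, c) (contMDiffAt_clmCoord α c) contMDiffAt_snd
    have h2 : ContMDiffAt (𝓘(ℝ, ℝ).prod (𝓡∂ (n + 1)))
        𝓘(ℝ, EuclideanSpace ℝ (Fin (n + 1)) [⋀^Fin j]→L[ℝ] F) ∞
        (fun q : ℝ × M => clmCoord F E c q.2 (β.1 q.2)) (ε, c) :=
      ContMDiffAt.comp (ε, c) (contMDiffAt_clmCoord β c) contMDiffAt_snd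
    exact h1.add (contMDiffAt_fst.smul h2)
  have h3 := ContMDiffAt.comp (ε, c) (hℒ c _) (contMDiffAt_snd.prodMk
    ((hline φ δφ).prodMk_space ((hline ν δν).prodMk_space (hline ζ δζ))))
  refine h3.congr_of_eventuallyEq ?_
  have h4 : ∀ᶠ q : ℝ × M in 𝓝 (ε, c), q.2 ∈ (chartAt (EuclideanHalfSpace (n + 1)) c).source ∩
      (trivializationAt F E c).baseSet :=
    continuousAt_snd.eventually (Filter.inter_mem
      (chart_source_mem_nhds (mem_chart_source (EuclideanHalfSpace (n + 1)) c))
      (baseSet_mem_nhds (mem_baseSet_self F E c)))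
  filter_upwards [h4] with q hq
  simp only [Function.comp_def, ← map_smul, ← map_add, formOfCoord_clmCoord hq.1 hq.2]

/-- Fibre differentiability of a smooth density. -/
theorem Density.IsSmooth.exists_fiberDeriv {ℒ : Density n E k} (hℒ : ℒ.IsSmooth F) (x : M)
    (φ ν : Form (𝓡∂ (n + 1)) E k x) (ζ : Form (𝓡∂ (n + 1)) E (k + 1) x) :
    ∃ l : (Form (𝓡∂ (n + 1)) E k x × Form (𝓡∂ (n + 1)) E k x × Form (𝓡∂ (n + 1)) E (k + 1) x) →ₗ[ℝ]
        (TangentSpace (𝓡∂ (n + 1)) x [⋀^Fin (n + 1)]→ₗ[ℝ] ℝ),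
      ∀ δ u, HasDerivAt (fun ε : ℝ => ℒ x (φ + ε • δ.1) (ν + ε • δ.2.1) (ζ + ε • δ.2.2) u)
        (l δ u) 0 := by
  have hx := mem_chart_source (EuclideanHalfSpace (n + 1)) x
  have hb := mem_baseSet_self F E x
  let C : (Form (𝓡∂ (n + 1)) E k x × Form (𝓡∂ (n + 1)) E k x × Form (𝓡∂ (n + 1)) E (k + 1) x) →ₗ[ℝ]
      ((EuclideanSpace ℝ (Fin (n + 1)) [⋀^Fin k]→L[ℝ] F) ×
      (EuclideanSpace ℝ (Fin (n + 1)) [⋀^Fin k]→L[ℝ] F) ×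
      (EuclideanSpace ℝ (Fin (n + 1)) [⋀^Fin (k + 1)]→L[ℝ] F)) :=
    (clmCoord F E x x).prodMap ((clmCoord F E x x).prodMap (clmCoord F E x x))
  have h1 := ContMDiffAt.comp (C (φ, ν, ζ)) (f := fun a => (x, a)) (hℒ x (C (φ, ν, ζ)))
    (contMDiffAt_const.prodMk contMDiffAt_id)
  obtain ⟨D, h3⟩ : ∃ D, HasFDerivAt (fun a : (EuclideanSpace ℝ (Fin (n + 1)) [⋀^Fin k]→L[ℝ] F) ×
      (EuclideanSpace ℝ (Fin (n + 1)) [⋀^Fin k]→L[ℝ] F) ×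
      (EuclideanSpace ℝ (Fin (n + 1)) [⋀^Fin (k + 1)]→L[ℝ] F) =>
      ℒ x (formOfCoord F E x x a.1) (formOfCoord F E x x a.2.1) (formOfCoord F E x x a.2.2)
        (chartFrame (𝓡∂ (n + 1)) x x)) D (C (φ, ν, ζ)) :=
    ⟨_, ((contMDiffAt_iff_contDiffAt.1 h1).differentiableAt (by simp)).hasFDerivAt⟩
  -- A top form is its value on the coordinate frame times the determinant, so the Fréchet
  -- derivative of one scalar function gives the whole linear map.
  refine ⟨((LinearMap.toSpanSingleton ℝ _ (chartBasis (𝓡∂ (n + 1)) hx).det) ∘ₗ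
    D.toLinearMap ∘ₗ C), fun δ u => ?_⟩
  have h4 : HasDerivAt (fun ε : ℝ => C (φ, ν, ζ) + ε • C δ) (C δ) 0 := by
    simpa using ((hasDerivAt_id (0 : ℝ)).smul_const (C δ)).const_add (C (φ, ν, ζ))
  have h5 := (HasFDerivAt.comp_hasDerivAt_of_eq (0 : ℝ) h3 h4 (by simp)).const_mul
    ((chartBasis (𝓡∂ (n + 1)) hx).det u)
  have h6 : ∀ ε : ℝ, C (φ, ν, ζ) + ε • C δ = C (φ + ε • δ.1, ν + ε • δ.2.1, ζ + ε • δ.2.2) := by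
    intro ε
    rw [← map_smul, ← map_add]
    rfl
  refine (h5.congr_of_eventuallyEq (Filter.Eventually.of_forall fun ε => ?_)).congr_deriv ?_
  · simp only [Function.comp_def, h6]
    rw [topForm_eq_det (chartBasis (𝓡∂ (n + 1)) hx), coe_chartBasis]
    congr 2
    change _ = ℒ x (formOfCoord F E x x (clmCoord F E x x _))
      (formOfCoord F E x x (clmCoord F E x x _)) (formOfCoord F E x x (clmCoord F E x x _))
    simp only [formOfCoord_clmCoord hx hb]
    rfl
  · exact mul_comm _ _

end Densities

/-! ### Fibre derivatives: defining property and smoothness. -/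

section FiberDerivatives

variable {n : ℕ}
  {M : Type*} [TopologicalSpace M] [ChartedSpace (EuclideanHalfSpace (n + 1)) M]
  [IsManifold (𝓡∂ (n + 1)) ∞ M] [T2Space M]
  {F : Type*} [NormedAddCommGroup F] [NormedSpace ℝ F] [FiniteDimensional ℝ F]
  {E : M → Type*} [∀ x, AddCommGroup (E x)] [∀ x, Module ℝ (E x)]
  [TopologicalSpace (Bundle.TotalSpace F E)] [∀ x, TopologicalSpace (E x)]
  [∀ x, IsTopologicalAddGroup (E x)] [∀ x, ContinuousSMul ℝ (E x)]
  [FiberBundle F E] [VectorBundle ℝ F E] [ContMDiffVectorBundle ∞ F E (𝓡∂ (n + 1))]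
  {k : ℕ} (nab : CovariantDerivative (𝓡∂ (n + 1)) F E)
  [CovariantDerivative.ContMDiffCovariantDerivative nab ∞]
  {ℒ : Density n E k} (hℒ : ℒ.IsSmooth F) (φ ν : Omega (𝓡∂ (n + 1)) F E k)

/-- The chosen element has its defining property because every linear map is a contraction
(`exists_contract_eq`); uniqueness of derivatives then identifies the value with `l δ`. -/
theorem fiberDeriv_spec {T A : Type*} [AddCommGroup T] [Module ℝ T] [AddCommMonoid A] [Module ℝ A]
    {m k r : ℕ} (b : Module.Basis (Fin m) ℝ T)
    {g : (T [⋀^Fin k]→ₗ[ℝ] A) → (T [⋀^Fin r]→ₗ[ℝ] ℝ)} {a : T [⋀^Fin k]→ₗ[ℝ] A}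
    (l : (T [⋀^Fin k]→ₗ[ℝ] A) →ₗ[ℝ] (T [⋀^Fin r]→ₗ[ℝ] ℝ))
    (hl : ∀ δ u, HasDerivAt (fun ε : ℝ => g (a + ε • δ) u) (l δ u) 0)
    (δ : T [⋀^Fin k]→ₗ[ℝ] A) : contract b (fiberDeriv b g a) δ = l δ := by
  obtain ⟨χ, hχ⟩ := exists_contract_eq b l
  have h := Classical.epsilon_spec (p := fun χ : SkewTensor T A k r =>
    ∀ (δ : T [⋀^Fin k]→ₗ[ℝ] A) (u : Fin r → T),
      HasDerivAt (fun ε : ℝ => g (a + ε • δ) u) (contract b χ δ u) 0)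
    ⟨χ, fun δ u => by rw [hχ]; exact hl δ u⟩
  ext u
  exact (h δ u).unique (hl δ u)

theorem fiberDerivWedge_spec {T A : Type*} [AddCommGroup T] [Module ℝ T] [AddCommMonoid A]
    [Module ℝ A] [Module.Finite ℝ A] {m k j : ℕ} (h : k + j = m) (b : Module.Basis (Fin m) ℝ T)
    {g : (T [⋀^Fin k]→ₗ[ℝ] A) → (T [⋀^Fin m]→ₗ[ℝ] ℝ)} {a : T [⋀^Fin k]→ₗ[ℝ] A}
    (l : (T [⋀^Fin k]→ₗ[ℝ] A) →ₗ[ℝ] (T [⋀^Fin m]→ₗ[ℝ] ℝ))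
    (hl : ∀ δ u, HasDerivAt (fun ε : ℝ => g (a + ε • δ) u) (l δ u) 0)
    (δ : T [⋀^Fin k]→ₗ[ℝ] A) : wedge h δ (fiberDerivWedge h g a) = l δ := by
  obtain ⟨χ, hχ⟩ := exists_wedge_eq h b l
  have h' := Classical.epsilon_spec (p := fun χ : T [⋀^Fin j]→ₗ[ℝ] Module.Dual ℝ A =>
    ∀ (δ : T [⋀^Fin k]→ₗ[ℝ] A) (u : Fin m → T),
      HasDerivAt (fun ε : ℝ => g (a + ε • δ) u) (wedge h δ χ u) 0)
    ⟨χ, fun δ u => by rw [hχ]; exact hl δ u⟩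
  ext u
  exact (h' δ u).unique (hl δ u)

/-- The derivative of a density at `(φ, ν, d^∇ φ)`, as a linear map. -/
def densityDeriv (ℒ : Density n E k) (x : M) :
    (Form (𝓡∂ (n + 1)) E k x × Form (𝓡∂ (n + 1)) E k x × Form (𝓡∂ (n + 1)) E (k + 1) x) →ₗ[ℝ]
      (TangentSpace (𝓡∂ (n + 1)) x [⋀^Fin (n + 1)]→ₗ[ℝ] ℝ) :=
  Classical.epsilon fun l => ∀ δ u, HasDerivAt (fun ε : ℝ =>
    ℒ x (φ.1 x + ε • δ.1) (ν.1 x + ε • δ.2.1) (extCovDeriv nab φ x + ε • δ.2.2) u) (l δ u) 0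

include hℒ

theorem densityDeriv_spec (x : M) (δ) (u) : HasDerivAt (fun ε : ℝ =>
    ℒ x (φ.1 x + ε • δ.1) (ν.1 x + ε • δ.2.1) (extCovDeriv nab φ x + ε • δ.2.2) u)
      (densityDeriv nab φ ν ℒ x δ u) 0 :=
  Classical.epsilon_spec (hℒ.exists_fiberDeriv x (φ.1 x) (ν.1 x) (extCovDeriv nab φ x)) δ u

/-- At each point this is the parameter derivative at `0` of a smooth family of top forms, and such
a derivative is smooth. -/
theorem smoothTop_densityDeriv (δφ δν : Omega (𝓡∂ (n + 1)) F E k)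
    (δζ : Omega (𝓡∂ (n + 1)) F E (k + 1)) :
    SmoothTop (𝓡∂ (n + 1)) fun x => densityDeriv nab φ ν ℒ x (δφ.1 x, δν.1 x, δζ.1 x) := by
  obtain ⟨θ', h1, h2⟩ := (hℒ.smoothTopFamily φ ν δφ δν ⟨_, extCovDeriv_mem nab φ⟩ δζ).exists_deriv
  have e : (fun x => densityDeriv nab φ ν ℒ x (δφ.1 x, δν.1 x, δζ.1 x)) = θ' 0 := by
    funext x
    ext u
    exact (densityDeriv_spec nab hℒ φ ν x (δφ.1 x, δν.1 x, δζ.1 x) u).unique (h2 0 x u)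
  rw [e]
  exact h1.smoothTop 0

theorem contract_derivPhi (x : M) (δ : Form (𝓡∂ (n + 1)) E k x) :
    contract (tangentBasis (𝓡∂ (n + 1)) x) (derivPhi nab ℒ φ ν x) δ =
      densityDeriv nab φ ν ℒ x (δ, 0, 0) :=
  fiberDeriv_spec _ (densityDeriv nab φ ν ℒ x ∘ₗ LinearMap.inl ℝ _ _) (fun δ u => by
    have h := densityDeriv_spec nab hℒ φ ν x (δ, 0, 0) u
    simp only [smul_zero, add_zero] at h
    exact h) δ

theorem contract_derivNu (x : M) (δ : Form (𝓡∂ (n + 1)) E k x) :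
    contract (tangentBasis (𝓡∂ (n + 1)) x) (derivNu nab ℒ φ ν x) δ =
      densityDeriv nab φ ν ℒ x (0, δ, 0) :=
  fiberDeriv_spec _ (densityDeriv nab φ ν ℒ x ∘ₗ LinearMap.inr ℝ _ _ ∘ₗ LinearMap.inl ℝ _ _)
    (fun δ u => by
    have h := densityDeriv_spec nab hℒ φ ν x (0, δ, 0) u
    simp only [smul_zero, add_zero] at h
    exact h) δ

theorem contract_derivZeta (x : M) (δ : Form (𝓡∂ (n + 1)) E (k + 1) x) :
    contract (tangentBasis (𝓡∂ (n + 1)) x) (derivZeta nab ℒ φ ν x) δ =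
      densityDeriv nab φ ν ℒ x (0, 0, δ) :=
  fiberDeriv_spec _ (densityDeriv nab φ ν ℒ x ∘ₗ LinearMap.inr ℝ _ _ ∘ₗ LinearMap.inr ℝ _ _)
    (fun δ u => by
    have h := densityDeriv_spec nab hℒ φ ν x (0, 0, δ) u
    simp only [smul_zero, add_zero] at h
    exact h) δ

theorem wedge_derivWedgePhi {j : ℕ} (h : k + j = n + 1) (x : M) (δ : Form (𝓡∂ (n + 1)) E k x) :
    wedge h δ (derivWedgePhi nab ℒ φ ν h x) = densityDeriv nab φ ν ℒ x (δ, 0, 0) :=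
  have := finite_fiber (E := E) F x
  fiberDerivWedge_spec h (tangentBasis (𝓡∂ (n + 1)) x)
    (densityDeriv nab φ ν ℒ x ∘ₗ LinearMap.inl ℝ _ _) (fun δ u => by
    have h := densityDeriv_spec nab hℒ φ ν x (δ, 0, 0) u
    simp only [smul_zero, add_zero] at h
    exact h) δ

theorem wedge_derivWedgeNu {j : ℕ} (h : k + j = n + 1) (x : M) (δ : Form (𝓡∂ (n + 1)) E k x) :
    wedge h δ (derivWedgeNu nab ℒ φ ν h x) = densityDeriv nab φ ν ℒ x (0, δ, 0) :=
  have := finite_fiber (E := E) F x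
  fiberDerivWedge_spec h (tangentBasis (𝓡∂ (n + 1)) x)
    (densityDeriv nab φ ν ℒ x ∘ₗ LinearMap.inr ℝ _ _ ∘ₗ LinearMap.inl ℝ _ _) (fun δ u => by
    have h := densityDeriv_spec nab hℒ φ ν x (0, δ, 0) u
    simp only [smul_zero, add_zero] at h
    exact h) δ

theorem wedge_derivWedgeZeta {j : ℕ} (h : k + 1 + j = n + 1) (x : M)
    (δ : Form (𝓡∂ (n + 1)) E (k + 1) x) :
    wedge h δ (derivWedgeZeta nab ℒ φ ν h x) = densityDeriv nab φ ν ℒ x (0, 0, δ) :=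
  have := finite_fiber (E := E) F x
  fiberDerivWedge_spec h (tangentBasis (𝓡∂ (n + 1)) x)
    (densityDeriv nab φ ν ℒ x ∘ₗ LinearMap.inr ℝ _ _ ∘ₗ LinearMap.inr ℝ _ _) (fun δ u => by
    have h := densityDeriv_spec nab hℒ φ ν x (0, 0, δ) u
    simp only [smul_zero, add_zero] at h
    exact h) δ

/-- The fibre derivative is only specified by its contractions with test forms, and these are
derivatives of the density along smooth fields. -/
theorem derivNu_mem : derivNu nab ℒ φ ν ∈ Lambda (𝓡∂ (n + 1)) F E k (n + 1) :=
  mem_Lambda_of_contract fun δ => by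
    simp only [contract_derivNu nab hℒ]
    exact smoothTop_densityDeriv nab hℒ φ ν 0 δ 0

theorem derivZeta_mem : derivZeta nab ℒ φ ν ∈ Lambda (𝓡∂ (n + 1)) F E (k + 1) (n + 1) :=
  mem_Lambda_of_contract fun δ => by
    simp only [contract_derivZeta nab hℒ]
    exact smoothTop_densityDeriv nab hℒ φ ν 0 0 δ

theorem derivWedgePhi_mem {j : ℕ} (h : k + j = n + 1) :
    derivWedgePhi nab ℒ φ ν h ∈ OmegaDual (𝓡∂ (n + 1)) F E j :=
  mem_OmegaDual_of_wedge h fun δ => by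
    simp only [wedge_derivWedgePhi nab hℒ]
    exact smoothTop_densityDeriv nab hℒ φ ν δ 0 0

theorem derivWedgeNu_mem {j : ℕ} (h : k + j = n + 1) :
    derivWedgeNu nab ℒ φ ν h ∈ OmegaDual (𝓡∂ (n + 1)) F E j :=
  mem_OmegaDual_of_wedge h fun δ => by
    simp only [wedge_derivWedgeNu nab hℒ]
    exact smoothTop_densityDeriv nab hℒ φ ν 0 δ 0

theorem derivWedgeZeta_mem {j : ℕ} (h : k + 1 + j = n + 1) :
    derivWedgeZeta nab ℒ φ ν h ∈ OmegaDual (𝓡∂ (n + 1)) F E j :=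
  mem_OmegaDual_of_wedge h fun δ => by
    simp only [wedge_derivWedgeZeta nab hℒ]
    exact smoothTop_densityDeriv nab hℒ φ ν 0 0 δ

end FiberDerivatives

/-! ### Restricting traces to a hyperplane. -/

section Hypersurface

variable {T T' A : Type*} [AddCommGroup T] [Module ℝ T] [AddCommGroup T'] [Module ℝ T']
  [AddCommMonoid A] [Module ℝ A] {n : ℕ}

/-- A vector `w ≠ 0` in the kernel of `K`, put in front of the image of `b'`, makes the dual
covectors with positive index factor through `K`. -/
theorem exists_adapted_basis (b : Module.Basis (Fin (n + 1)) ℝ T) (b' : Module.Basis (Fin n) ℝ T')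
    (J : T' →ₗ[ℝ] T) (K : T →ₗ[ℝ] T') (hK : ∀ u, K (J u) = u) :
    ∃ c : Module.Basis (Fin (n + 1)) ℝ T, (∀ i : Fin n, c i.succ = J (b' i)) ∧
      ∀ i : Fin n, c.coord i.succ = b'.coord i ∘ₗ K := by
  have : Module.Finite ℝ T := Module.Finite.of_basis b
  have : Module.Finite ℝ T' := Module.Finite.of_basis b'
  have hT : Module.finrank ℝ T = n + 1 := by simpa using Module.finrank_eq_card_basis b
  have hT' : Module.finrank ℝ T' = n := by simpa using Module.finrank_eq_card_basis b'
  have hker : LinearMap.ker K ≠ ⊥ := by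
    intro h
    have := LinearMap.finrank_le_finrank_of_injective (LinearMap.ker_eq_bot.1 h)
    omega
  obtain ⟨w, hw, hw0⟩ := (Submodule.ne_bot_iff _).1 hker
  rw [LinearMap.mem_ker] at hw
  have hli : LinearIndependent ℝ (Fin.cons w fun i => J (b' i) : Fin (n + 1) → T) := by
    rw [Fintype.linearIndependent_iff]
    intro g hg
    rw [Fin.sum_univ_succ] at hg
    simp only [Fin.cons_zero, Fin.cons_succ] at hg
    have h1 := congrArg K hg
    simp only [map_add, map_smul, hw, smul_zero, zero_add, map_sum, hK, map_zero] at h1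
    have h2 := Fintype.linearIndependent_iff.1 b'.linearIndependent _ h1
    simp only [h2, zero_smul, Finset.sum_const_zero, add_zero] at hg
    refine Fin.cases ?_ h2
    exact (smul_eq_zero.1 hg).resolve_right hw0
  let c := basisOfLinearIndependentOfCardEqFinrank hli (by simp [hT])
  have hc : ⇑c = Fin.cons w fun i => J (b' i) := coe_basisOfLinearIndependentOfCardEqFinrank _ _
  refine ⟨c, fun i => by rw [hc, Fin.cons_succ], fun i => c.ext fun l => ?_⟩
  rw [Module.Basis.coord_apply, Module.Basis.repr_self, LinearMap.comp_apply]
  refine Fin.cases ?_ (fun l => ?_) l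
  · rw [hc, Fin.cons_zero, hw, map_zero]
    simp
  · rw [hc, Fin.cons_succ, hK, Module.Basis.coord_apply, Module.Basis.repr_self]
    simp [Finsupp.single_apply, Fin.succ_inj]

/-- Restriction of a tensor along `J : T' → T`, with a left inverse `K` of `J` used for covectors. -/
def pullTensor {s r : ℕ} (J : T' →ₗ[ℝ] T) (K : T →ₗ[ℝ] T') (χ : SkewTensor T A s r) :
    SkewTensor T' A s r :=
  (dualFormMap J LinearMap.id r).compAlternatingMap (χ.compLinearMap K.dualMap)

theorem pullTensor_apply {s r : ℕ} (J : T' →ₗ[ℝ] T) (K : T →ₗ[ℝ] T') (χ : SkewTensor T A s r)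
    (β : Fin s → Module.Dual ℝ T') (u : Fin r → T') (e : A) :
    pullTensor J K χ β u e = χ (fun i => β i ∘ₗ K) (fun i => J (u i)) e := rfl

/-- On a frame tangent to the hyperplane only the transversal basis vector survives in the trace;
any other would occur twice among the form arguments. -/
theorem trace_adapted {k : ℕ} (b c : Module.Basis (Fin (n + 1)) ℝ T) (b' : Module.Basis (Fin n) ℝ T')
    (J : T' →ₗ[ℝ] T) (hc : ∀ i : Fin n, c i.succ = J (b' i)) (χ : SkewTensor T A (k + 1) (n + 1))
    (γ : Fin k → Module.Dual ℝ T) :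
    trace b χ γ (fun i => J (b' i)) = χ (Matrix.vecCons (c.coord 0) γ) c := by
  ext e
  rw [trace_eq_of_basis b c, trace_apply, Finset.sum_eq_single 0]
  · congr 2
    funext i
    refine Fin.cases rfl (fun i => ?_) i
    rw [hc]
    rfl
  · intro i _ hi
    obtain ⟨l, rfl⟩ := Fin.exists_succ_eq.2 hi
    rw [AlternatingMap.map_eq_zero_of_eq _ _ (i := 0) (j := l.succ) _ (Fin.succ_ne_zero l).symm]
    · rfl
    · simp [hc]
  · simp

/-- In an adapted basis the trace on tangent vectors is `χ(c⁰, ·)(c)`. Multi-indices containing `0`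
repeat `c⁰` and drop out, and the others are multi-indices of the hyperplane. -/
theorem contract_pullTensor_trace {k : ℕ} (b : Module.Basis (Fin (n + 1)) ℝ T)
    (b' : Module.Basis (Fin n) ℝ T') (J : T' →ₗ[ℝ] T) (K : T →ₗ[ℝ] T') (hK : ∀ u, K (J u) = u)
    (χ : SkewTensor T A (k + 1) (n + 1)) (φ : T [⋀^Fin k]→ₗ[ℝ] A) :
    contract b' (pullTensor J K (trace b χ)) (φ.compLinearMap J) =
      (contract b (trace b χ) φ).compLinearMap J := by
  obtain ⟨c, hc, hcoord⟩ := exists_adapted_basis b b' J K hK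
  have key : contract b' (pullTensor J K (trace b χ)) (φ.compLinearMap J) b' =
      (contract b (trace b χ) φ).compLinearMap J b' := by
    rw [AlternatingMap.compLinearMap_apply, contract_eq_of_basis b c, contract_apply, contract_apply]
    simp only [pullTensor_apply, trace_adapted b c b' J hc, AlternatingMap.compLinearMap_apply]
    let S : (Fin k ↪o Fin n) → (Fin k ↪o Fin (n + 1)) := fun L =>
      L.trans (Fin.succOrderEmb n)
    have hS : Function.Injective S := by
      intro L L' h
      ext i
      have := congrArg (fun Q : Fin k ↪o Fin (n + 1) => ((Q i : Fin (n + 1)) : ℕ)) h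
      simpa [S] using this
    rw [← Finset.sum_subset (Finset.subset_univ (Finset.univ.map ⟨S, hS⟩)), Finset.sum_map]
    · refine Finset.sum_congr rfl fun L _ => ?_
      simp only [Function.Embedding.coeFn_mk]
      have e1 : (fun i => c.coord (S L i)) = fun i => b'.coord (L i) ∘ₗ K :=
        funext fun i => hcoord (L i)
      have e2 : (fun i => c (S L i)) = fun i => J (b' (L i)) := funext fun i => hc (L i)
      rw [e1, e2]
    · intro Q _ hQ
      have h0 : ∃ i, Q i = 0 := by
        by_contra! h0
        refine hQ (Finset.mem_map.2 ⟨OrderEmbedding.ofStrictMono (fun i => (Q i).pred (h0 i))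
          fun i j hij => ?_, Finset.mem_univ _, ?_⟩)
        · exact Fin.pred_lt_pred_iff.2 (Q.strictMono hij)
        · ext i
          exact congrArg Fin.val (Fin.succ_pred (Q i) (h0 i))
      obtain ⟨i, hi⟩ := h0
      rw [AlternatingMap.map_eq_zero_of_eq _ _ (i := 0) (j := i.succ) _ (Fin.succ_ne_zero i).symm]
      · rfl
      · simp [hi]
  rw [AlternatingMap.eq_smul_basis_det b' (contract b' _ _), key,
    ← AlternatingMap.eq_smul_basis_det b']

/-- The right side of `contract_pullTensor_trace` does not contain the left inverse, and
contractions determine the tensor. This makes `ι*(tr χ)` independent of the extension of covectors.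
-/
theorem pullTensor_trace_eq {k : ℕ} (b : Module.Basis (Fin (n + 1)) ℝ T)
    (b' : Module.Basis (Fin n) ℝ T') (J : T' →ₗ[ℝ] T) {K K' : T →ₗ[ℝ] T'} (hK : ∀ u, K (J u) = u)
    (hK' : ∀ u, K' (J u) = u) (χ : SkewTensor T A (k + 1) (n + 1)) :
    pullTensor J K (trace b χ) = pullTensor J K' (trace b χ) := by
  ext β u e
  have h := contract_pullTensor_trace b b' J K hK χ
    (((detForm T' k β).smulRight e).compLinearMap K)
  have h' := contract_pullTensor_trace b b' J K' hK' χ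
    (((detForm T' k β).smulRight e).compLinearMap K)
  have e1 : (((detForm T' k β).smulRight e).compLinearMap K).compLinearMap J =
      (detForm T' k β).smulRight e := by
    ext v
    simp [hK]
  rw [e1] at h h'
  have h2 := congrArg (fun θ => θ u) (h.trans h'.symm)
  simpa only [contract_smulRight] using h2

end Hypersurface

/-! ### Pull-back of fields to the boundary. -/

section PullBack

variable {n : ℕ}
  {M : Type*} [TopologicalSpace M] [ChartedSpace (EuclideanHalfSpace (n + 1)) M]
  [IsManifold (𝓡∂ (n + 1)) ∞ M]
  {N : Type*} [TopologicalSpace N] [ChartedSpace (EuclideanSpace ℝ (Fin n)) N]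
  [IsManifold (𝓡 n) ∞ N]
  {F : Type*} [NormedAddCommGroup F] [NormedSpace ℝ F]
  {E : M → Type*} [∀ x, AddCommGroup (E x)] [∀ x, Module ℝ (E x)]
  [TopologicalSpace (Bundle.TotalSpace F E)] [∀ x, TopologicalSpace (E x)]
  [FiberBundle F E] [VectorBundle ℝ F E]
  (ι : C^∞⟮𝓡 n, N; 𝓡∂ (n + 1), M⟯)

/-- The differential of `ι` at `y`, in the charts at `p` and at `ι p`. -/
def diffCoord (p y : N) : EuclideanSpace ℝ (Fin n) →L[ℝ] EuclideanSpace ℝ (Fin (n + 1)) :=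
  inTangentCoordinates (𝓡 n) (𝓡∂ (n + 1)) id ι (mfderiv (𝓡 n) (𝓡∂ (n + 1)) ι) p y

theorem diffCoord_apply (p y : N) (v : EuclideanSpace ℝ (Fin n)) :
    diffCoord ι p y v = tangentCoord (𝓡∂ (n + 1)) (ι p) (ι y)
      (tangentMap ι y (tangentVec (𝓡 n) p y v)) := rfl

theorem contMDiffAt_diffCoord (p : N) :
    ContMDiffAt (𝓡 n) 𝓘(ℝ, EuclideanSpace ℝ (Fin n) →L[ℝ] EuclideanSpace ℝ (Fin (n + 1))) ∞
      (diffCoord ι p) p :=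
  ι.contMDiff.contMDiffAt.mfderiv_const (by simp)

theorem contMDiffAt_diffCoord_apply (p : N) (v : EuclideanSpace ℝ (Fin n)) :
    ContMDiffAt (𝓡 n) 𝓘(ℝ, EuclideanSpace ℝ (Fin (n + 1))) ∞ (fun y => diffCoord ι p y v) p :=
  (ContinuousLinearMap.apply ℝ (EuclideanSpace ℝ (Fin (n + 1))) v).contDiff.contMDiff.contMDiffAt.comp
    p (contMDiffAt_diffCoord ι p)

theorem eventually_mem_source (p : N) :
    ∀ᶠ y in 𝓝 p, ι y ∈ (chartAt (EuclideanHalfSpace (n + 1)) (ι p)).source :=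
  ι.contMDiff.continuous.continuousAt.eventually (chart_source_mem_nhds (mem_chart_source _ _))

theorem eventually_mem_baseSet (p : N) :
    ∀ᶠ y in 𝓝 p, ι y ∈ (trivializationAt F E (ι p)).baseSet :=
  ι.contMDiff.continuous.continuousAt.eventually (baseSet_mem_nhds (mem_baseSet_self F E (ι p)))

theorem tangentMap_tangentVec {p y : N}
    (hy : ι y ∈ (chartAt (EuclideanHalfSpace (n + 1)) (ι p)).source)
    (v : EuclideanSpace ℝ (Fin n)) :
    tangentMap ι y (tangentVec (𝓡 n) p y v) =
      tangentVec (𝓡∂ (n + 1)) (ι p) (ι y) (diffCoord ι p y v) := by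
  rw [diffCoord_apply, tangentVec_tangentCoord _ hy]

theorem bundleCoord_pullback {p y : N} (hy : ι y ∈ (trivializationAt F E (ι p)).baseSet)
    (e : (ι *ᵖ E) y) : bundleCoord F (ι *ᵖ E) p y e = bundleCoord F E (ι p) (ι y) e := by
  have h : y ∈ (trivializationAt F (ι *ᵖ E) p).baseSet := hy
  simp only [bundleCoord]
  rw [Bundle.Trivialization.coe_linearMapAt_of_mem _ h, Bundle.Trivialization.coe_linearMapAt_of_mem _ hy]
  rfl

theorem bundleVec_pullback {p y : N} (hy : ι y ∈ (trivializationAt F E (ι p)).baseSet)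
    (f : F) : (bundleVec F (ι *ᵖ E) p y f : (ι *ᵖ E) y) = bundleVec F E (ι p) (ι y) f := by
  have h : y ∈ (trivializationAt F (ι *ᵖ E) p).baseSet := hy
  have h1 := bundleVec_bundleCoord (F := F) (E := ι *ᵖ E) h (bundleVec F E (ι p) (ι y) f : E (ι y))
  have h2 : bundleCoord F (ι *ᵖ E) p y (bundleVec F E (ι p) (ι y) f : E (ι y)) = f :=
    (bundleCoord_pullback ι hy _).trans (bundleCoord_bundleVec hy f)
  exact (congrArg (bundleVec F (ι *ᵖ E) p y) h2).symm.trans h1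

/-- In the charts at `p` and `ι p` the arguments become the smoothly varying vectors `diffCoord ι p
y (v i)`. -/
theorem pullForm_mem [ContMDiffVectorBundle ∞ F E (𝓡∂ (n + 1))] {k : ℕ}
    (φ : Omega (𝓡∂ (n + 1)) F E k) : pullForm ι φ.1 ∈ Omega (𝓡 n) F (ι *ᵖ E) k := by
  intro p v
  have h := contMDiffAt_alternating (I := 𝓡 n) (x := p)
    (a := fun y => formCoord (𝓡∂ (n + 1)) F E (ι p) (ι y) (φ.1 (ι y)))
    (fun w => ContMDiffAt.comp p (φ.2 (ι p) w) ι.contMDiff.contMDiffAt)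
    (u := fun y i => diffCoord ι p y (v i)) (fun i => contMDiffAt_diffCoord_apply ι p (v i))
  refine h.congr_of_eventuallyEq ?_
  filter_upwards [eventually_mem_source ι p, eventually_mem_baseSet (F := F) (E := E) ι p]
    with y hy hb
  refine (bundleCoord_pullback ι hb _).trans ?_
  exact congrArg (fun w => bundleCoord F E (ι p) (ι y) (φ.1 (ι y) w))
    (funext fun i => tangentMap_tangentVec ι hy (v i))

theorem pullDualForm_mem {j : ℕ} (ψ : OmegaDual (𝓡∂ (n + 1)) F E j) :
    pullDualForm ι ψ.1 ∈ OmegaDual (𝓡 n) F (ι *ᵖ E) j := by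
  intro p v f
  have h := contMDiffAt_alternating (I := 𝓡 n) (x := p)
    (a := fun y => (Module.Dual.eval ℝ F f).compAlternatingMap
      (dualFormMap (tangentVec (𝓡∂ (n + 1)) (ι p) (ι y)) (bundleVec F E (ι p) (ι y)) j (ψ.1 (ι y))))
    (fun w => ContMDiffAt.comp p (ψ.2 (ι p) w f) ι.contMDiff.contMDiffAt)
    (u := fun y i => diffCoord ι p y (v i)) (fun i => contMDiffAt_diffCoord_apply ι p (v i))
  refine h.congr_of_eventuallyEq ?_
  filter_upwards [eventually_mem_source ι p, eventually_mem_baseSet (F := F) (E := E) ι p]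
    with y hy hb
  refine (congrArg (fun e : E (ι y) => ψ.1 (ι y)
    (fun i => tangentMap ι y (tangentVec (𝓡 n) p y (v i))) e) (bundleVec_pullback ι hb f)).trans ?_
  exact congrArg (fun w => ψ.1 (ι y) w (bundleVec F E (ι p) (ι y) f))
    (funext fun i => tangentMap_tangentVec ι hy (v i))

/-- The pull-back of a smooth real-valued form is smooth. -/
theorem SmoothForm.pull {r : ℕ} {η : ∀ x : M, TangentSpace (𝓡∂ (n + 1)) x [⋀^Fin r]→ₗ[ℝ] ℝ}
    (hη : SmoothForm (𝓡∂ (n + 1)) η) :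
    SmoothForm (𝓡 n) fun p => (η (ι p)).compLinearMap (tangentMap ι p) := by
  intro p v
  have h := contMDiffAt_alternating (I := 𝓡 n) (x := p)
    (a := fun y => (η (ι y)).compLinearMap (tangentVec (𝓡∂ (n + 1)) (ι p) (ι y)))
    (fun w => ContMDiffAt.comp p (hη (ι p) w) ι.contMDiff.contMDiffAt)
    (u := fun y i => diffCoord ι p y (v i)) (fun i => contMDiffAt_diffCoord_apply ι p (v i))
  refine h.congr_of_eventuallyEq ?_
  filter_upwards [eventually_mem_source ι p] with y hy
  simp only [AlternatingMap.compLinearMap_apply, tangentMap_tangentVec ι hy]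

/-- A smooth local left inverse of the differential of an immersion, in charts. -/
theorem exists_smooth_leftInverse {p : N}
    (hp : Function.Injective (mfderiv (𝓡 n) (𝓡∂ (n + 1)) ι p)) :
    ∃ K : N → EuclideanSpace ℝ (Fin (n + 1)) →L[ℝ] EuclideanSpace ℝ (Fin n),
      ContMDiffAt (𝓡 n) 𝓘(ℝ, EuclideanSpace ℝ (Fin (n + 1)) →L[ℝ] EuclideanSpace ℝ (Fin n)) ∞ K p ∧
      ∀ᶠ y in 𝓝 p, ∀ v, K y (diffCoord ι p y v) = v := by
  have hinj : Function.Injective (diffCoord ι p p).toLinearMap := by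
    intro v w h
    have h' : diffCoord ι p p v = diffCoord ι p p w := h
    rw [diffCoord_apply, diffCoord_apply, tangentCoord_self, tangentCoord_self] at h'
    have h2 := congrArg (tangentCoord (𝓡 n) p p) (hp h')
    simpa only [tangentCoord_tangentVec (𝓡 n) (mem_chart_source _ p)] using h2
  -- A left inverse at the single point `p` composes with the differential at nearby points to a map
  -- close to the identity, hence invertible; inverting it corrects the left inverse smoothly.
  obtain ⟨K₀, hK₀⟩ := (diffCoord ι p p).toLinearMap.exists_leftInverse_of_injective
    (LinearMap.ker_eq_bot.2 hinj)
  let K₁ := LinearMap.toContinuousLinearMap K₀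
  have hB : ContMDiffAt (𝓡 n) 𝓘(ℝ, EuclideanSpace ℝ (Fin n) →L[ℝ] EuclideanSpace ℝ (Fin n)) ∞
      (fun y => K₁.comp (diffCoord ι p y)) p :=
    contMDiffAt_const.clm_comp (contMDiffAt_diffCoord ι p)
  have hBp : K₁.comp (diffCoord ι p p) =
      ((ContinuousLinearEquiv.refl ℝ (EuclideanSpace ℝ (Fin n)) :) :
        EuclideanSpace ℝ (Fin n) →L[ℝ] EuclideanSpace ℝ (Fin n)) := by
    ext1 v
    exact LinearMap.congr_fun hK₀ v
  have hinv : ContMDiffAt (𝓡 n) 𝓘(ℝ, EuclideanSpace ℝ (Fin n) →L[ℝ] EuclideanSpace ℝ (Fin n)) ∞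
      (fun y => ContinuousLinearMap.inverse (K₁.comp (diffCoord ι p y))) p := by
    refine ContMDiffAt.comp p (g := ContinuousLinearMap.inverse) (ContDiffAt.contMDiffAt ?_) hB
    rw [hBp]
    exact contDiffAt_map_inverse _
  refine ⟨fun y => (ContinuousLinearMap.inverse (K₁.comp (diffCoord ι p y))).comp K₁,
    hinv.clm_comp contMDiffAt_const, ?_⟩
  have hev : ∀ᶠ y in 𝓝 p, K₁.comp (diffCoord ι p y) ∈ Set.range
      ((↑) : (EuclideanSpace ℝ (Fin n) ≃L[ℝ] EuclideanSpace ℝ (Fin n)) → _) :=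
    hB.continuousAt.eventually (by
      have := ContinuousLinearEquiv.nhds (ContinuousLinearEquiv.refl ℝ (EuclideanSpace ℝ (Fin n)))
      rwa [← hBp] at this)
  filter_upwards [hev] with y ⟨e, he⟩ v
  have h1 : K₁ (diffCoord ι p y v) = e v := congrArg (fun L => L v) he.symm
  simp only [ContinuousLinearMap.comp_apply, ← he, ContinuousLinearMap.inverse_equiv, h1]
  simp

theorem leftInverse_tangentMap {p : N}
    (hp : Function.Injective (mfderiv (𝓡 n) (𝓡∂ (n + 1)) ι p)) (u : TangentSpace (𝓡 n) p) :
    (tangentMap ι p).leftInverse (tangentMap ι p u) = u :=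
  LinearMap.leftInverse_apply_of_inj (LinearMap.ker_eq_bot.2 hp) u

/-- The restriction to the boundary of a field of traces. -/
def pullTrace {k : ℕ} (χ : ∀ x : M, DualTensor (𝓡∂ (n + 1)) E (k + 1) (n + 1) x) (p : N) :
    DualTensor (𝓡 n) (ι *ᵖ E) k n p :=
  pullTensor (A := E (ι p)) (tangentMap ι p) (tangentMap ι p).leftInverse (traceField χ (ι p))

theorem pullTrace_apply {k : ℕ} (χ : ∀ x : M, DualTensor (𝓡∂ (n + 1)) E (k + 1) (n + 1) x) (p : N)
    (β : Fin k → Module.Dual ℝ (TangentSpace (𝓡 n) p)) (u : Fin n → TangentSpace (𝓡 n) p)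
    (e : (ι *ᵖ E) p) :
    pullTrace ι χ p β u e = pullDualTensor ι
      (fun x => trace (tangentBasis (𝓡∂ (n + 1)) x) (χ x)) p β u e := rfl

variable {ι}

theorem contract_pullTrace (hι : ∀ p, Function.Injective (mfderiv (𝓡 n) (𝓡∂ (n + 1)) ι p)) {k : ℕ}
    (χ : ∀ x : M, DualTensor (𝓡∂ (n + 1)) E (k + 1) (n + 1) x)
    (φ : ∀ x : M, Form (𝓡∂ (n + 1)) E k x) (p : N) :
    contract (tangentBasis (𝓡 n) p) (pullTrace ι χ p) (pullForm ι φ p) =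
      (contract (tangentBasis (𝓡∂ (n + 1)) (ι p)) (traceField χ (ι p)) (φ (ι p))).compLinearMap
        (tangentMap ι p) :=
  contract_pullTensor_trace (A := E (ι p)) _ (tangentBasis (𝓡 n) p) (tangentMap ι p) _
    (leftInverse_tangentMap ι (hι p)) (χ (ι p)) (φ (ι p))

theorem skewTensor_eq_sum {T A : Type*} [AddCommGroup T] [Module ℝ T] [AddCommMonoid A] [Module ℝ A]
    {m s r : ℕ} (b : Module.Basis (Fin m) ℝ T) (χ : SkewTensor T A s r)
    (β : Fin s → Module.Dual ℝ T) (u : Fin r → T) (e : A) :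
    χ β u e = ∑ L : Fin s → Fin m, (∏ i, β i (b (L i))) * χ (fun i => b.coord (L i)) u e := by
  have hβ : β = fun i => ∑ l, β i (b l) • b.coord l := by
    funext i
    refine b.ext fun l => ?_
    simp
  let Z : Module.Dual ℝ T [⋀^Fin s]→ₗ[ℝ] ℝ :=
    (LinearMap.mk (AddHom.mk (fun ψ : T [⋀^Fin r]→ₗ[ℝ] Module.Dual ℝ A => ψ u e)
      (fun _ _ => rfl)) (fun _ _ => rfl)).compAlternatingMap χ
  change Z β = ∑ L : Fin s → Fin m, (∏ i, β i (b (L i))) * Z (fun i => b.coord (L i))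
  have h1 : Z β = Z.toMultilinearMap (fun i => ∑ l, β i (b l) • b.coord l) := congrArg Z hβ
  rw [h1, MultilinearMap.map_sum]
  exact Finset.sum_congr rfl fun K _ => Z.toMultilinearMap.map_smul_univ _ _

/-- The left inverse in `pullTrace` is an arbitrary choice at each point. By `pullTensor_trace_eq` a
smooth local one may replace it, and the components become sums of products of smooth functions. -/
theorem pullTrace_mem [FiniteDimensional ℝ F] [ContMDiffVectorBundle ∞ F E (𝓡∂ (n + 1))]
    [∀ x, IsTopologicalAddGroup (E x)] [∀ x, ContinuousSMul ℝ (E x)]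
    (hι : ∀ p, Function.Injective (mfderiv (𝓡 n) (𝓡∂ (n + 1)) ι p)) {k : ℕ}
    (χ : Lambda (𝓡∂ (n + 1)) F E (k + 1) (n + 1)) :
    pullTrace ι χ.1 ∈ Lambda (𝓡 n) F (ι *ᵖ E) k n := by
  intro p β v f
  obtain ⟨K, hK, hKe⟩ := exists_smooth_leftInverse ι (hι p)
  let b := (EuclideanSpace.basisFun (Fin (n + 1)) ℝ).toBasis
  have h : ContMDiffAt (𝓡 n) 𝓘(ℝ, ℝ) ∞ (fun y => ∑ L : Fin k → Fin (n + 1),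
      (∏ i, β i (K y (b (L i)))) * dualTensorComp (𝓡∂ (n + 1)) F E (ι p) (fun i => b.coord (L i))
        (fun i => diffCoord ι p y (v i)) f (ι y) (traceField χ.1 (ι y))) p := by
    refine contMDiffAt_finsetSum fun L _ => ContMDiffAt.mul ?_ ?_
    · refine contMDiffAt_finsetProd fun i _ => ?_
      have h1 : ContMDiffAt (𝓡 n) 𝓘(ℝ, EuclideanSpace ℝ (Fin n)) ∞ (fun y => K y (b (L i))) p :=
        hK.clm_apply contMDiffAt_const
      exact (LinearMap.toContinuousLinearMap (β i)).contDiff.contMDiff.contMDiffAt.comp p h1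
    · exact contMDiffAt_alternating (I := 𝓡 n) (x := p)
        (a := fun y => (Module.Dual.eval ℝ F f).compAlternatingMap
          (dualFormMap (tangentVec (𝓡∂ (n + 1)) (ι p) (ι y)) (bundleVec F E (ι p) (ι y)) n
            (traceField χ.1 (ι y) fun i => b.coord (L i) ∘ₗ tangentCoord (𝓡∂ (n + 1)) (ι p) (ι y))))
        (fun w => ContMDiffAt.comp p (traceField_mem χ (ι p) _ w f) ι.contMDiff.contMDiffAt)
        (u := fun y i => diffCoord ι p y (v i)) (fun i => contMDiffAt_diffCoord_apply ι p (v i))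
  refine h.congr_of_eventuallyEq ?_
  filter_upwards [eventually_mem_source ι p, eventually_mem_baseSet (F := F) (E := E) ι p, hKe,
    chart_source_mem_nhds (mem_chart_source (EuclideanSpace ℝ (Fin n)) p)] with y hy hb hk hyp
  let K' : TangentSpace (𝓡∂ (n + 1)) (ι y) →ₗ[ℝ] TangentSpace (𝓡 n) y :=
    tangentVec (𝓡 n) p y ∘ₗ (K y).toLinearMap ∘ₗ tangentCoord (𝓡∂ (n + 1)) (ι p) (ι y)
  have hK' : ∀ u, K' (tangentMap ι y u) = u := by
    intro u
    conv_lhs => rw [← tangentVec_tangentCoord (𝓡 n) hyp u, tangentMap_tangentVec ι hy]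
    simp only [K', LinearMap.comp_apply, tangentCoord_tangentVec _ hy]
    refine (congrArg (tangentVec (𝓡 n) p y) (hk _)).trans ?_
    exact tangentVec_tangentCoord (𝓡 n) hyp u
  have e1 : pullTrace ι χ.1 y = pullTensor (A := E (ι y)) (tangentMap ι y) K'
      (traceField χ.1 (ι y)) :=
    pullTensor_trace_eq (A := E (ι y)) _ (tangentBasis (𝓡 n) y) (tangentMap ι y)
      (leftInverse_tangentMap ι (hι y)) hK' (χ.1 (ι y))
  rw [dualTensorComp, e1, bundleVec_pullback ι hb]
  refine (pullTensor_apply (A := E (ι y)) _ _ _ _ _ _).trans ?_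
  rw [skewTensor_eq_sum (chartBasis (𝓡∂ (n + 1)) hy)]
  refine Finset.sum_congr rfl fun L _ => ?_
  congr 1
  · refine Finset.prod_congr rfl fun i _ => ?_
    simp only [K', LinearMap.comp_apply, chartBasis_apply, chartFrame,
      tangentCoord_tangentVec _ hy, tangentCoord_tangentVec _ hyp, b, OrthonormalBasis.coe_toBasis]
    rfl
  · simp only [chartBasis_coord, tangentMap_tangentVec ι hy]
    rfl

end PullBack

/-! ### Orientations seen through signs of frames. -/

section OrientationSign

variable {m : ℕ} {H : Type*} [TopologicalSpace H]
  {I : ModelWithCorners ℝ (EuclideanSpace ℝ (Fin m)) H}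
  {X : Type*} [TopologicalSpace X] [ChartedSpace H X] [IsManifold I ∞ X]

/-- The function `sgn` is the sign of frames for an orientation. -/
structure IsOrientationSign (I : ModelWithCorners ℝ (EuclideanSpace ℝ (Fin m)) H) {X : Type*}
    [TopologicalSpace X] [ChartedSpace H X] [IsManifold I ∞ X]
    (sgn : ∀ x : X, (Fin m → TangentSpace I x) → ℝ) : Prop where
  exists_form : ∀ x, ∃ η : TangentSpace I x [⋀^Fin m]→ₗ[ℝ] ℝ, η ≠ 0 ∧
    ∀ u, sgn x u = (SignType.sign (η u) : ℝ)
  locally_constant : ∀ c, ∀ᶠ x in 𝓝 c, sgn x (chartFrame I c x) = sgn c (chartFrame I c c)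

theorem ManifoldOrientation.isOrientationSign (o : ManifoldOrientation I X) :
    IsOrientationSign I fun x => frameSign (o.orient x) :=
  ⟨fun x => ⟨(o.orient x).someVector, (o.orient x).someVector_ne_zero, fun _ => rfl⟩,
    o.locally_constant⟩

variable {sgn : ∀ x : X, (Fin m → TangentSpace I x) → ℝ}

/-- The sign is that of some nonzero top form, and a top form scales by the determinant. -/
theorem IsOrientationSign.eq_sign_det (hs : IsOrientationSign I sgn) {x : X}
    (b : Module.Basis (Fin m) ℝ (TangentSpace I x)) (u : Fin m → TangentSpace I x) :
    sgn x u = (SignType.sign (b.det u) : ℝ) * sgn x b := by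
  obtain ⟨η, -, h⟩ := hs.exists_form x
  rw [h, h, topForm_eq_det b η u, sign_mul]
  push_cast
  rfl

theorem IsOrientationSign.basis_ne_zero (hs : IsOrientationSign I sgn) {x : X}
    (b : Module.Basis (Fin m) ℝ (TangentSpace I x)) : sgn x b = 1 ∨ sgn x b = -1 := by
  obtain ⟨η, h0, h⟩ := hs.exists_form x
  have hb : η b ≠ 0 := fun hb => h0 (by rw [η.eq_smul_basis_det b, hb, zero_smul])
  rw [h]
  rcases lt_or_gt_of_ne hb with h1 | h1
  · right; simp [h1]
  · left; simp [h1]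

theorem IsOrientationSign.abs_le_one (hs : IsOrientationSign I sgn) {x : X}
    (u : Fin m → TangentSpace I x) : |sgn x u| ≤ 1 := by
  obtain ⟨η, -, h⟩ := hs.exists_form x
  rw [h]
  rcases lt_trichotomy (η u) 0 with h1 | h1 | h1 <;> simp [h1]

/-- The density `sgn • θ` of a form of top degree transforms with the absolute value of the
determinant. -/
theorem IsOrientationSign.mul_eq_abs_det (hs : IsOrientationSign I sgn) {x : X}
    (b : Module.Basis (Fin m) ℝ (TangentSpace I x)) (θ : TangentSpace I x [⋀^Fin m]→ₗ[ℝ] ℝ)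
    (u : Fin m → TangentSpace I x) : sgn x u * θ u = |b.det u| * (sgn x b * θ b) := by
  rw [hs.eq_sign_det b u, topForm_eq_det b θ u]
  have : (SignType.sign (b.det u) : ℝ) * b.det u = |b.det u| := sign_mul_self _
  rw [← this]
  ring

theorem frameDet_ne_zero {c c' y : X} (hy : y ∈ (chartAt H c).source)
    (hy' : y ∈ (chartAt H c').source) : frameDet I c c' y ≠ 0 := by
  have h := (chartBasis I hy').isUnit_det (chartBasis I hy)
  rw [chartBasis_det, coe_chartBasis] at h
  exact h.ne_zero

/-- Local constancy is assumed only at the centre of each chart. Elsewhere the two frames differ by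
a continuous nonvanishing determinant, whose sign is locally constant. -/
theorem IsOrientationSign.eventually_eq (hs : IsOrientationSign I sgn) {c x : X}
    (hx : x ∈ (chartAt H c).source) :
    ∀ᶠ y in 𝓝 x, sgn y (chartFrame I c y) = sgn x (chartFrame I c x) := by
  have hxx := mem_chart_source H x
  have h1 : ContinuousAt (fun y => SignType.sign (frameDet I c x y)) x :=
    (continuousAt_sign_of_ne_zero (frameDet_ne_zero hx hxx)).comp
      (contMDiffAt_frameDet hx hxx).continuousAt
  have h2 : ∀ᶠ y in 𝓝 x, SignType.sign (frameDet I c x y) = SignType.sign (frameDet I c x x) :=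
    h1.tendsto.eventually (p := fun s => s = SignType.sign (frameDet I c x x))
      (by rw [nhds_discrete]; exact Filter.eventually_pure.2 rfl)
  have h3 : ∀ y, y ∈ (chartAt H x).source → sgn y (chartFrame I c y) =
      (SignType.sign (frameDet I c x y) : ℝ) * sgn y (chartFrame I x y) := by
    intro y hy
    rw [hs.eq_sign_det (chartBasis I hy), chartBasis_det, coe_chartBasis]
    rfl
  filter_upwards [h2, hs.locally_constant x, chart_source_mem_nhds hxx] with y h4 h5 h6
  rw [h3 y h6, h3 x hxx, h4, h5]

/-- Continuity of a form of top degree. -/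
def ContinuousTop (I : ModelWithCorners ℝ (EuclideanSpace ℝ (Fin m)) H) {X : Type*}
    [TopologicalSpace X] [ChartedSpace H X] [IsManifold I ∞ X]
    (θ : ∀ x : X, TangentSpace I x [⋀^Fin m]→ₗ[ℝ] ℝ) : Prop :=
  ∀ c, ContinuousAt (fun y => θ y (chartFrame I c y)) c

theorem SmoothTop.continuousTop {θ : ∀ x : X, TangentSpace I x [⋀^Fin m]→ₗ[ℝ] ℝ}
    (h : SmoothTop I θ) : ContinuousTop I θ := fun c => (h c).continuousAt

theorem ContinuousTop.continuousAt {θ : ∀ x : X, TangentSpace I x [⋀^Fin m]→ₗ[ℝ] ℝ}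
    (h : ContinuousTop I θ) {c x : X} (hx : x ∈ (chartAt H c).source) :
    ContinuousAt (fun y => θ y (chartFrame I c y)) x := by
  have hxx := mem_chart_source H x
  refine ((contMDiffAt_frameDet (I := I) hx hxx).continuousAt.mul (h x)).congr ?_
  filter_upwards [chart_source_mem_nhds hxx] with y hy
  exact (topForm_frame_change hy _).symm

theorem ContinuousTop.add {θ θ' : ∀ x : X, TangentSpace I x [⋀^Fin m]→ₗ[ℝ] ℝ}
    (h : ContinuousTop I θ) (h' : ContinuousTop I θ') : ContinuousTop I fun x => θ x + θ' x :=
  fun c => (h c).add (h' c)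

theorem ContinuousTop.smul {θ : ∀ x : X, TangentSpace I x [⋀^Fin m]→ₗ[ℝ] ℝ}
    (h : ContinuousTop I θ) {f : X → ℝ} (hf : Continuous f) : ContinuousTop I fun x => f x • θ x :=
  fun c => hf.continuousAt.mul (h c)

theorem ContinuousTop.const_smul {θ : ∀ x : X, TangentSpace I x [⋀^Fin m]→ₗ[ℝ] ℝ}
    (h : ContinuousTop I θ) (a : ℝ) : ContinuousTop I fun x => a • θ x :=
  h.smul continuous_const

theorem IsOrientationSign.continuousAt (hs : IsOrientationSign I sgn)
    {θ : ∀ x : X, TangentSpace I x [⋀^Fin m]→ₗ[ℝ] ℝ} (h : ContinuousTop I θ) {c x : X}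
    (hx : x ∈ (chartAt H c).source) :
    ContinuousAt (fun y => sgn y (chartFrame I c y) * θ y (chartFrame I c y)) x := by
  refine (continuousAt_const.mul (h.continuousAt hx)).congr (f := fun y =>
    sgn x (chartFrame I c x) * θ y (chartFrame I c y)) ?_
  filter_upwards [hs.eventually_eq hx] with y hy
  rw [hy]

end OrientationSign

/-! ### Integration of top forms, differentiation under the integral, and the fundamental lemma. -/

section Integral

open MeasureTheory

variable {m : ℕ} {H : Type*} [TopologicalSpace H]
  {I : ModelWithCorners ℝ (EuclideanSpace ℝ (Fin m)) H}
  {X : Type*} [TopologicalSpace X] [ChartedSpace H X] [IsManifold I ∞ X]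

theorem measurableSet_chart_target (c : X) : MeasurableSet (extChartAt I c).target := by
  rw [extChartAt_target]
  exact ((chartAt H c).open_target.preimage I.continuous_symm).measurableSet.inter
    I.isClosed_range.measurableSet

/-- This lets a continuous function that vanishes almost everywhere, or at interior points only, be
shown to vanish at boundary points too. -/
theorem chart_target_subset_closure (c : X) :
    (extChartAt I c).target ⊆ closure (interior (extChartAt I c).target) := by
  rw [extChartAt_target]
  rintro z ⟨h1, h2⟩
  have ho := (chartAt H c).open_target.preimage I.continuous_symm
  refine closure_mono (interior_maximal ?_ (ho.inter isOpen_interior))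
    (ho.inter_closure ⟨h1, I.range_subset_closure_interior h2⟩)
  exact Set.inter_subset_inter_right _ interior_subset

theorem symm_mem_source {c : X} {z : EuclideanSpace ℝ (Fin m)} (hz : z ∈ (extChartAt I c).target) :
    (extChartAt I c).symm z ∈ (chartAt H c).source := by
  simpa using (extChartAt I c).map_target hz

theorem continuousOn_comp_symm {c : X} {g : X → ℝ}
    (hg : ∀ x ∈ (chartAt H c).source, ContinuousAt g x) :
    ContinuousOn (fun z => g ((extChartAt I c).symm z)) (extChartAt I c).target := fun _ hz =>
  (hg _ (symm_mem_source hz)).comp_continuousWithinAt (continuousOn_extChartAt_symm c _ hz)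

/-- The support of `ρ` is compact and stays inside the chart domain, so the integrand is continuous
on a compact set and zero outside it. -/
theorem integrableOn_chart [CompactSpace X] {c : X} {ρ g : X → ℝ} (hρ : Continuous ρ)
    (hs : tsupport ρ ⊆ (chartAt H c).source)
    (hg : ∀ x ∈ (chartAt H c).source, ContinuousAt g x) :
    IntegrableOn (fun z => ρ ((extChartAt I c).symm z) * g ((extChartAt I c).symm z))
      (extChartAt I c).target := by
  have hK : IsCompact (extChartAt I c '' tsupport ρ) :=
    (isClosed_tsupport ρ).isCompact.image_of_continuousOn
      ((continuousOn_extChartAt c).mono (by simpa using hs))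
  have hKt : extChartAt I c '' tsupport ρ ⊆ (extChartAt I c).target := by
    rintro _ ⟨x, hx, rfl⟩
    exact (extChartAt I c).map_source (by simpa using hs hx)
  have hc : ContinuousOn (fun z => ρ ((extChartAt I c).symm z) * g ((extChartAt I c).symm z))
      (extChartAt I c).target :=
    continuousOn_comp_symm (g := fun x => ρ x * g x) fun x hx => hρ.continuousAt.mul (hg x hx)
  refine ((hc.mono hKt).integrableOn_compact hK).of_forall_sdiff_eq_zero
    (measurableSet_chart_target c) ?_
  rintro z ⟨hz, hzK⟩
  have : (extChartAt I c).symm z ∉ tsupport ρ := fun h =>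
    hzK ⟨_, h, (extChartAt I c).right_inv hz⟩
  rw [image_eq_zero_of_notMem_tsupport this, zero_mul]

variable [T2Space X] [CompactSpace X]

theorem chartPartition_subordinate (c : X) :
    tsupport (chartPartition I X c) ⊆ (chartAt H c).source :=
  (SmoothPartitionOfUnity.exists_isSubordinate_chartAt_source I X).choose_spec c

theorem chartPartition_finite : {c : X | (Function.support (chartPartition I X c)).Nonempty}.Finite :=
  (chartPartition I X).locallyFinite.finite_nonempty_of_compact

variable (I X) in
/-- The indices of the nonzero functions of the partition of unity. -/
def chartIndex : Finset X := (chartPartition_finite (I := I) (X := X)).toFinset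

theorem chartPartition_eq_zero {c : X} (hc : c ∉ chartIndex I X) (x : X) :
    chartPartition I X c x = 0 := by
  by_contra h
  exact hc ((Set.Finite.mem_toFinset _).2 ⟨x, h⟩)

theorem sum_chartPartition (x : X) : ∑ c ∈ chartIndex I X, chartPartition I X c x = 1 := by
  rw [← (chartPartition I X).sum_eq_one (Set.mem_univ x), finsum_eq_sum_of_support_subset]
  intro c hc
  by_contra h
  exact hc (chartPartition_eq_zero h x)

/-- The contribution of one chart to the integral. -/
def chartIntegral (I : ModelWithCorners ℝ (EuclideanSpace ℝ (Fin m)) H) {X : Type*}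
    [TopologicalSpace X] [ChartedSpace H X] [IsManifold I ∞ X] [T2Space X] [CompactSpace X]
    (sgn : ∀ x : X, (Fin m → TangentSpace I x) → ℝ)
    (θ : ∀ x : X, TangentSpace I x [⋀^Fin m]→ₗ[ℝ] ℝ) (c : X) : ℝ :=
  ∫ z in (extChartAt I c).target, chartPartition I X c ((extChartAt I c).symm z) *
    (sgn ((extChartAt I c).symm z) (chartFrame I c ((extChartAt I c).symm z)) *
      θ ((extChartAt I c).symm z) (chartFrame I c ((extChartAt I c).symm z)))

variable {sgn : ∀ x : X, (Fin m → TangentSpace I x) → ℝ}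

theorem integral_eq_sum (θ : ∀ x : X, TangentSpace I x [⋀^Fin m]→ₗ[ℝ] ℝ) :
    integral I sgn θ = ∑ c ∈ chartIndex I X, chartIntegral I sgn θ c := by
  rw [integral, finsum_eq_sum_of_support_subset (s := chartIndex I X)]
  · simp only [chartIntegral, mul_assoc]
  · intro c hc
    by_contra h
    refine hc ?_
    have h' : c ∉ chartIndex I X := h
    simp only [chartPartition_eq_zero h', zero_mul, integral_zero]

theorem integrableOn_chartIntegral (hs : IsOrientationSign I sgn)
    {θ : ∀ x : X, TangentSpace I x [⋀^Fin m]→ₗ[ℝ] ℝ} (hθ : ContinuousTop I θ) (c : X) :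
    IntegrableOn (fun z => chartPartition I X c ((extChartAt I c).symm z) *
      (sgn ((extChartAt I c).symm z) (chartFrame I c ((extChartAt I c).symm z)) *
        θ ((extChartAt I c).symm z) (chartFrame I c ((extChartAt I c).symm z))))
      (extChartAt I c).target :=
  integrableOn_chart (chartPartition I X c).contMDiff.continuous (chartPartition_subordinate c)
    (g := fun y => sgn y (chartFrame I c y) * θ y (chartFrame I c y))
    fun _ hx => hs.continuousAt hθ hx

theorem integral_add_form (hs : IsOrientationSign I sgn)
    {θ θ' : ∀ x : X, TangentSpace I x [⋀^Fin m]→ₗ[ℝ] ℝ} (hθ : ContinuousTop I θ)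
    (hθ' : ContinuousTop I θ') :
    integral I sgn (fun x => θ x + θ' x) = integral I sgn θ + integral I sgn θ' := by
  simp only [integral_eq_sum, ← Finset.sum_add_distrib]
  refine Finset.sum_congr rfl fun c _ => ?_
  rw [chartIntegral, chartIntegral, chartIntegral, ← integral_add
    (integrableOn_chartIntegral hs hθ c) (integrableOn_chartIntegral hs hθ' c)]
  simp only [AlternatingMap.add_apply, mul_add]

theorem integral_smul_form (a : ℝ) (θ : ∀ x : X, TangentSpace I x [⋀^Fin m]→ₗ[ℝ] ℝ) :
    integral I sgn (fun x => a • θ x) = a * integral I sgn θ := by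
  simp only [integral_eq_sum, Finset.mul_sum]
  refine Finset.sum_congr rfl fun c _ => ?_
  rw [chartIntegral, chartIntegral, ← integral_const_mul]
  simp only [AlternatingMap.smul_apply, smul_eq_mul]
  congr 1
  ext z
  ring

theorem integral_zero_form : integral I sgn (fun _ => 0) = 0 := by
  have := integral_smul_form (I := I) (sgn := sgn) 0 fun _ => 0
  simpa using this

theorem integral_sum_form (hs : IsOrientationSign I sgn) {κ : Type*} (t : Finset κ)
    {θ : κ → ∀ x : X, TangentSpace I x [⋀^Fin m]→ₗ[ℝ] ℝ} (hθ : ∀ i ∈ t, ContinuousTop I (θ i)) :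
    ContinuousTop I (fun x => ∑ i ∈ t, θ i x) ∧
    integral I sgn (fun x => ∑ i ∈ t, θ i x) = ∑ i ∈ t, integral I sgn (θ i) := by
  classical
  induction t using Finset.induction_on with
  | empty =>
    simp only [Finset.sum_empty]
    exact ⟨fun c => continuousAt_const, integral_zero_form⟩
  | insert i t hi ih =>
    obtain ⟨h1, h2⟩ := ih fun j hj => hθ j (Finset.mem_insert_of_mem hj)
    have h3 := hθ i (Finset.mem_insert_self i t)
    simp only [Finset.sum_insert hi]
    exact ⟨h3.add h1, by rw [integral_add_form hs h3 h1, h2]⟩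

/-- Differentiation under the integral sign. -/
theorem hasDerivAt_integral (hs : IsOrientationSign I sgn)
    {θ θ' : ℝ → ∀ x : X, TangentSpace I x [⋀^Fin m]→ₗ[ℝ] ℝ}
    (hθ : ∀ ε, ContinuousTop I (θ ε))
    (hθ' : ∀ (ε : ℝ) (c : X),
      ContinuousAt (fun q : ℝ × X => θ' q.1 q.2 (chartFrame I c q.2)) (ε, c))
    (hd : ∀ ε x u, HasDerivAt (fun s => θ s x u) (θ' ε x u) ε) :
    HasDerivAt (fun ε => integral I sgn (θ ε)) (integral I sgn (θ' 0)) 0 := by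
  have hc' : ∀ ε, ContinuousTop I (θ' ε) := fun ε c =>
    ContinuousAt.comp (f := fun x : X => (ε, x)) (hθ' ε c) (by fun_prop)
  simp only [integral_eq_sum]
  refine HasDerivAt.fun_sum fun c _ => ?_
  have hjoint : ∀ ε : ℝ, ∀ x ∈ (chartAt H c).source,
      ContinuousAt (fun q : ℝ × X => θ' q.1 q.2 (chartFrame I c q.2)) (ε, x) := by
    intro ε x hx
    have hxx := mem_chart_source H x
    have h1 : ContinuousAt (fun q : ℝ × X => frameDet I c x q.2) (ε, x) :=
      ContinuousAt.comp (g := frameDet I c x) (f := fun q : ℝ × X => q.2)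
        (contMDiffAt_frameDet hx hxx).continuousAt continuousAt_snd
    refine (h1.mul (hθ' ε x)).congr ?_
    have h2 : ∀ᶠ q : ℝ × X in 𝓝 (ε, x), q.2 ∈ (chartAt H x).source :=
      continuousAt_snd.eventually (chart_source_mem_nhds hxx)
    filter_upwards [h2] with q hq
    exact (topForm_frame_change hq _).symm
  set ρ := chartPartition I X c with hρ
  have hsub : tsupport ρ ⊆ (chartAt H c).source := chartPartition_subordinate c
  -- Joint continuity of the derivative bounds it on the compact set `[-1, 1] × tsupport ρ`, which
  -- yields the dominating function `ρ C`.
  obtain ⟨C, hC⟩ : ∃ C, ∀ q ∈ Set.Icc (-1 : ℝ) 1 ×ˢ tsupport ρ,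
      ‖θ' q.1 q.2 (chartFrame I c q.2)‖ ≤ C :=
    (isCompact_Icc.prod (isClosed_tsupport ρ).isCompact).exists_bound_of_continuousOn
      fun q hq => (hjoint q.1 q.2 (hsub hq.2)).continuousWithinAt
  have hmeas := measurableSet_chart_target (I := I) c
  refine (hasDerivAt_integral_of_dominated_loc_of_deriv_le
    (μ := volume.restrict (extChartAt I c).target) (s := Metric.ball (0 : ℝ) 1)
    (F := fun ε z => ρ ((extChartAt I c).symm z) *
      (sgn ((extChartAt I c).symm z) (chartFrame I c ((extChartAt I c).symm z)) *
        θ ε ((extChartAt I c).symm z) (chartFrame I c ((extChartAt I c).symm z))))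
    (F' := fun ε z => ρ ((extChartAt I c).symm z) *
      (sgn ((extChartAt I c).symm z) (chartFrame I c ((extChartAt I c).symm z)) *
        θ' ε ((extChartAt I c).symm z) (chartFrame I c ((extChartAt I c).symm z))))
    (bound := fun z => ρ ((extChartAt I c).symm z) * C)
    (Metric.ball_mem_nhds 0 one_pos)
    (Filter.Eventually.of_forall fun ε => (integrableOn_chartIntegral hs (hθ ε) c).1)
    (integrableOn_chartIntegral hs (hθ 0) c) (integrableOn_chartIntegral hs (hc' 0) c).1
    ?_ (integrableOn_chart ρ.contMDiff.continuous hsub fun _ _ => continuousAt_const) ?_).2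
  · refine Filter.Eventually.of_forall fun z ε hε => ?_
    by_cases hz : (extChartAt I c).symm z ∈ tsupport ρ
    · have h0 : 0 ≤ ρ ((extChartAt I c).symm z) := (chartPartition I X).nonneg c _
      rw [norm_mul, Real.norm_of_nonneg h0, norm_mul]
      refine mul_le_mul_of_nonneg_left ?_ h0
      have h1 := hs.abs_le_one (chartFrame I c ((extChartAt I c).symm z))
      have h2 := hC (ε, (extChartAt I c).symm z) ⟨by
        rw [Metric.mem_ball, dist_zero_right, Real.norm_eq_abs, abs_lt] at hε
        exact ⟨hε.1.le, hε.2.le⟩, hz⟩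
      calc _ ≤ 1 * ‖θ' ε ((extChartAt I c).symm z) (chartFrame I c ((extChartAt I c).symm z))‖ :=
            mul_le_mul_of_nonneg_right h1 (norm_nonneg _)
        _ ≤ C := by rw [one_mul]; exact h2
    · rw [image_eq_zero_of_notMem_tsupport hz]
      simp
  · exact Filter.Eventually.of_forall fun z ε _ => ((hd ε _ _).const_mul _).const_mul _

/-- A nonnegative form with vanishing integral is zero. -/
theorem eq_zero_of_integral_eq_zero (hs : IsOrientationSign I sgn)
    {θ : ∀ x : X, TangentSpace I x [⋀^Fin m]→ₗ[ℝ] ℝ} (hθ : ContinuousTop I θ)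
    (h0 : ∀ x u, 0 ≤ sgn x u * θ x u) (hint : integral I sgn θ = 0) (x : X) : θ x = 0 := by
  have hnn : ∀ (c : X) z, 0 ≤ chartPartition I X c ((extChartAt I c).symm z) *
      (sgn ((extChartAt I c).symm z) (chartFrame I c ((extChartAt I c).symm z)) *
        θ ((extChartAt I c).symm z) (chartFrame I c ((extChartAt I c).symm z))) := fun c z =>
    mul_nonneg ((chartPartition I X).nonneg c _) (h0 _ _)
  rw [integral_eq_sum, Finset.sum_eq_zero_iff_of_nonneg fun c _ =>
    integral_nonneg fun z => hnn c z] at hint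
  obtain ⟨c, hc, hcx⟩ : ∃ c ∈ chartIndex I X, chartPartition I X c x ≠ 0 := by
    by_contra! h
    have := sum_chartPartition (I := I) x
    rw [Finset.sum_eq_zero h] at this
    exact zero_ne_one this
  have hxs : x ∈ (chartAt H c).source := chartPartition_subordinate c (subset_tsupport _ hcx)
  have h1 := hint c hc
  rw [chartIntegral, setIntegral_eq_zero_iff_of_nonneg_ae
    (Filter.Eventually.of_forall fun z => hnn c z) (integrableOn_chartIntegral hs hθ c)] at h1
  -- A continuous function that is zero almost everywhere on a set contained in the closure of its
  -- interior is zero on that set.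
  have h2 := Measure.eqOn_of_ae_eq h1
    (continuousOn_comp_symm (I := I) (c := c) (g := fun y => chartPartition I X c y *
      (sgn y (chartFrame I c y) * θ y (chartFrame I c y)))
      fun y hy => (chartPartition I X c).contMDiff.continuous.continuousAt.mul
        (hs.continuousAt hθ hy)) continuousOn_const (chart_target_subset_closure c)
  have hxs' : x ∈ (extChartAt I c).source := by simpa using hxs
  have h3 : (fun y => chartPartition I X c y * (sgn y (chartFrame I c y) *
      θ y (chartFrame I c y))) ((extChartAt I c).symm (extChartAt I c x)) = 0 :=
    h2 ((extChartAt I c).map_source hxs')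
  rw [(extChartAt I c).left_inv hxs'] at h3
  simp only [mul_eq_zero, hcx, false_or] at h3
  have h4 := hs.basis_ne_zero (chartBasis I hxs)
  rw [coe_chartBasis] at h4
  have h5 : θ x (chartFrame I c x) = 0 := h3.resolve_left fun h => by
    rw [h] at h4
    norm_num at h4
  rw [(θ x).eq_smul_basis_det (chartBasis I hxs), coe_chartBasis, h5, zero_smul]

/-- The fundamental lemma of the calculus of variations. -/
theorem eq_zero_of_forall_integral_eq_zero (hs : IsOrientationSign I sgn)
    {θ : ∀ x : X, TangentSpace I x [⋀^Fin m]→ₗ[ℝ] ℝ} (hθ : ContinuousTop I θ) (x : X)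
    (h : ∀ U ∈ 𝓝 x, ∃ f : X → ℝ, Continuous f ∧ (∀ y, 0 ≤ f y) ∧ f x ≠ 0 ∧
      Function.support f ⊆ U ∧ integral I sgn (fun y => f y • θ y) = 0) : θ x = 0 := by
  by_contra hne
  have hxx := mem_chart_source H x
  have h1 : θ x (chartFrame I x x) ≠ 0 := fun h1 => hne (by
    rw [(θ x).eq_smul_basis_det (chartBasis I hxx), coe_chartBasis, h1, zero_smul])
  have h4 := hs.basis_ne_zero (chartBasis I hxx)
  rw [coe_chartBasis] at h4
  set q := sgn x (chartFrame I x x) * θ x (chartFrame I x x) with hq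
  have hq0 : q ≠ 0 := mul_ne_zero (fun h => by rw [h] at h4; norm_num at h4) h1
  have hcont := hs.continuousAt hθ hxx
  have hev : ∀ᶠ y in 𝓝 x, 0 < q * (sgn y (chartFrame I x y) * θ y (chartFrame I x y)) :=
    (continuousAt_const.mul hcont).eventually (lt_mem_nhds (mul_self_pos.2 hq0))
  obtain ⟨f, hf, hf0, hfx, hsupp, hint⟩ := h _ (Filter.inter_mem hev (chart_source_mem_nhds hxx))
  -- Multiplying by the constant `q`, the value of the signed density at `x`, makes the form
  -- nonnegative near `x`; the support of `f` removes the rest.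
  have h5 := eq_zero_of_integral_eq_zero hs ((hθ.smul hf).const_smul q) (fun y u => by
    by_cases hy : f y = 0
    · simp [hy]
    · obtain ⟨h6, h7⟩ := hsupp hy
      have h8 := hs.mul_eq_abs_det (chartBasis I h7) (θ y) u
      rw [coe_chartBasis] at h8
      have h9 : sgn y u * (q • f y • θ y) u = f y * |(chartBasis I h7).det u| *
          (q * (sgn y (chartFrame I x y) * θ y (chartFrame I x y))) := by
        simp only [AlternatingMap.smul_apply, smul_eq_mul]
        linear_combination q * f y * h8
      rw [h9]
      exact mul_nonneg (mul_nonneg (hf0 y) (abs_nonneg _)) (le_of_lt h6))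
    (by rw [integral_smul_form, hint, mul_zero]) x
  rcases smul_eq_zero.1 h5 with h6 | h6
  · exact hq0 h6
  · exact (smul_eq_zero.1 h6).elim hfx hne

end Integral

/-! ### Independence of the integral of the chosen coordinates. -/

section ChangeOfVariables

open MeasureTheory

variable {m : ℕ} {H : Type*} [TopologicalSpace H]
  {I : ModelWithCorners ℝ (EuclideanSpace ℝ (Fin m)) H}
  {X : Type*} [TopologicalSpace X] [ChartedSpace H X] [IsManifold I ∞ X]

theorem measurableSet_chart_preimage (c : X) {W : Set X} (hW : IsOpen W) :
    MeasurableSet ((extChartAt I c).target ∩ (extChartAt I c).symm ⁻¹' W) := by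
  obtain ⟨u, hu, he⟩ := (continuousOn_iff'.1 (continuousOn_extChartAt_symm (I := I) c)) W hW
  rw [Set.inter_comm, he]
  exact hu.measurableSet.inter (measurableSet_chart_target c)

variable [T2Space X] [CompactSpace X] {sgn : ∀ x : X, (Fin m → TangentSpace I x) → ℝ}

/-- The integral of a form supported in the domain `W` of coordinates `τ` is the integral of its
component in these coordinates. -/
theorem integral_eq_setIntegral_image (hs : IsOrientationSign I sgn)
    {θ : ∀ x : X, TangentSpace I x [⋀^Fin m]→ₗ[ℝ] ℝ} (hθ : ContinuousTop I θ) {W : Set X}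
    (hW : IsOpen W) (h0 : ∀ x ∉ W, θ x = 0) {τ : X → EuclideanSpace ℝ (Fin m)}
    (hinj : Set.InjOn τ W) (hτ : ∀ x ∈ W, MDifferentiableAt I 𝓘(ℝ, EuclideanSpace ℝ (Fin m)) τ x)
    {h : EuclideanSpace ℝ (Fin m) → ℝ}
    (hh : ∀ x ∈ W, ∃ u : Fin m → TangentSpace I x,
      (∀ i, mvfderiv I τ x (u i) = EuclideanSpace.basisFun (Fin m) ℝ i) ∧
      h (τ x) = sgn x u * θ x u) :
    MeasurableSet (τ '' W) ∧ integral I sgn θ = ∫ z in τ '' W, h z := by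
  classical
  -- `Function.invFunOn` needs a point of `X`; on an empty manifold both integrals are zero.
  rcases isEmpty_or_nonempty X with hX | hX
  · have : τ '' W = ∅ := by
      rw [Set.image_eq_empty]
      exact Set.eq_empty_of_isEmpty W
    rw [this, Measure.restrict_empty, integral_zero_measure, integral_eq_sum,
      Finset.eq_empty_of_isEmpty (chartIndex I X), Finset.sum_empty]
    exact ⟨MeasurableSet.empty, rfl⟩
  let S : X → Set (EuclideanSpace ℝ (Fin m)) := fun c =>
    (extChartAt I c).target ∩ (extChartAt I c).symm ⁻¹' W
  have hSm : ∀ c, MeasurableSet (S c) := fun c => measurableSet_chart_preimage c hW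
  let Φ : X → EuclideanSpace ℝ (Fin m) → EuclideanSpace ℝ (Fin m) := fun c =>
    τ ∘ (extChartAt I c).symm
  let Φ' : X → EuclideanSpace ℝ (Fin m) →
      EuclideanSpace ℝ (Fin m) →L[ℝ] EuclideanSpace ℝ (Fin m) := fun c z =>
    fderivWithin ℝ (Φ c) (Set.range I) z
  have hd : ∀ c, ∀ z ∈ S c, HasFDerivWithinAt (Φ c) (Φ' c z) (S c) z := by
    intro c z hz
    have h1 := ((mdifferentiableAt_iff_chart I (symm_mem_source hz.1)).1 (hτ _ hz.2)).2
    rw [(extChartAt I c).right_inv hz.1] at h1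
    exact h1.hasFDerivWithinAt.mono fun y hy => extChartAt_target_subset_range c hy.1
  have hΦ : ∀ c, Set.InjOn (Φ c) (S c) := by
    intro c z hz z' hz' e
    exact (extChartAt I c).symm.injOn hz.1 hz'.1 (hinj hz.2 hz'.2 e)
  let inv : EuclideanSpace ℝ (Fin m) → X := Function.invFunOn τ W
  have hinv : ∀ x ∈ W, inv (τ x) = x := fun x hx => hinj.leftInvOn_invFunOn hx
  -- The density in the chart at `c` is the Jacobian of the transition `Φ c` to the coordinates `τ`
  -- times `h`. Both densities come from one form, and the frame `u` is dual to `τ`.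
  have hkey : ∀ c, ∀ z ∈ S c, |(Φ' c z).det| * h (Φ c z) =
      sgn ((extChartAt I c).symm z) (chartFrame I c ((extChartAt I c).symm z)) *
        θ ((extChartAt I c).symm z) (chartFrame I c ((extChartAt I c).symm z)) := by
    intro c z hz
    set x := (extChartAt I c).symm z with hx
    have hxc : x ∈ (chartAt H c).source := symm_mem_source hz.1
    obtain ⟨u, hu, e⟩ := hh x hz.2
    have hzx : extChartAt I c x = z := (extChartAt I c).right_inv hz.1
    have h1 : ∀ w, mvfderiv I τ x w = Φ' c z (tangentCoord I c x w) := by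
      intro w
      rw [mvfderiv_eq_chart I hxc (hτ x hz.2), hzx]
    -- The derivative of `Φ c` sends the chart coordinates of `u` to the standard basis.
    have h2 : (Φ' c z).det * (chartBasis I hxc).det u = 1 := by
      rw [chartBasis_det]
      have h3 := ((EuclideanSpace.basisFun (Fin m) ℝ).toBasis).det_comp
        (Φ' c z).toLinearMap (fun i => tangentCoord I c x (u i))
      refine h3.symm.trans ?_
      rw [← Module.Basis.det_self (EuclideanSpace.basisFun (Fin m) ℝ).toBasis]
      congr 1
      funext i
      rw [OrthonormalBasis.coe_toBasis, ← hu i, h1]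
      rfl
    have h4 := hs.mul_eq_abs_det (chartBasis I hxc) (θ x) u
    rw [coe_chartBasis] at h4
    change |(Φ' c z).det| * h (τ x) = _
    rw [e, h4, ← mul_assoc, ← abs_mul, h2, abs_one, one_mul]
  -- The share of the chart at `c`, transported to the `τ` coordinates; over the finite index set
  -- these functions add up to `h`.
  let g : X → EuclideanSpace ℝ (Fin m) → ℝ := fun c y => chartPartition I X c (inv y) * h y
  have hg : ∀ c, ∀ z ∈ S c, |(Φ' c z).det| • g c (Φ c z) =
      chartPartition I X c ((extChartAt I c).symm z) *
      (sgn ((extChartAt I c).symm z) (chartFrame I c ((extChartAt I c).symm z)) *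
        θ ((extChartAt I c).symm z) (chartFrame I c ((extChartAt I c).symm z))) := by
    intro c z hz
    have e : inv (Φ c z) = (extChartAt I c).symm z := hinv _ hz.2
    rw [← hkey c z hz, smul_eq_mul]
    change _ * (chartPartition I X c (inv (Φ c z)) * h (Φ c z)) = _
    rw [e]
    ring
  have himg : ∀ c, Φ c '' S c = τ '' (W ∩ (chartAt H c).source) := by
    intro c
    ext y
    constructor
    · rintro ⟨z, hz, rfl⟩
      exact ⟨_, ⟨hz.2, symm_mem_source hz.1⟩, rfl⟩
    · rintro ⟨x, ⟨hx, hxc⟩, rfl⟩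
      have hxs : x ∈ (extChartAt I c).source := by simpa using hxc
      refine ⟨extChartAt I c x, ⟨(extChartAt I c).map_source hxs, ?_⟩, ?_⟩
      · rw [Set.mem_preimage, (extChartAt I c).left_inv hxs]
        exact hx
      · exact congrArg τ ((extChartAt I c).left_inv hxs)
  have hmi : ∀ c, MeasurableSet (τ '' (W ∩ (chartAt H c).source)) := fun c => by
    rw [← himg]
    exact measurable_image_of_fderivWithin (hSm c) (hd c) (hΦ c)
  have hmW : MeasurableSet (τ '' W) := by
    have : τ '' W = ⋃ c ∈ chartIndex I X, τ '' (W ∩ (chartAt H c).source) := by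
      rw [← Set.image_iUnion₂]
      congr 1
      ext x
      simp only [Set.mem_iUnion, Set.mem_inter_iff, exists_prop]
      refine ⟨fun hx => ?_, fun ⟨_, _, hx, _⟩ => hx⟩
      by_contra hne
      have h1 := sum_chartPartition (I := I) x
      rw [Finset.sum_eq_zero] at h1
      · exact zero_ne_one h1
      · intro c hc
        by_contra hcx
        exact hne ⟨c, hc, hx, chartPartition_subordinate c (subset_tsupport _ hcx)⟩
    rw [this]
    exact Finset.measurableSet_biUnion _ fun c _ => hmi c
  have hoff : ∀ c, ∀ y ∈ τ '' W \ τ '' (W ∩ (chartAt H c).source), g c y = 0 := by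
    rintro c _ ⟨⟨x, hx, rfl⟩, hy⟩
    have : chartPartition I X c x = 0 := by
      by_contra hne
      exact hy ⟨x, ⟨hx, chartPartition_subordinate c (subset_tsupport _ hne)⟩, rfl⟩
    change chartPartition I X c (inv (τ x)) * h (τ x) = 0
    rw [hinv x hx, this, zero_mul]
  have hint : ∀ c, IntegrableOn (g c) (τ '' W) := by
    intro c
    refine IntegrableOn.of_forall_sdiff_eq_zero (s := τ '' (W ∩ (chartAt H c).source)) ?_ hmW
      (hoff c)
    rw [← himg, integrableOn_image_iff_integrableOn_abs_det_fderiv_smul volume (hSm c) (hd c) (hΦ c)]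
    exact ((integrableOn_chartIntegral hs hθ c).mono_set Set.inter_subset_left).congr_fun
      (fun z hz => (hg c z hz).symm) (hSm c)
  refine ⟨hmW, ?_⟩
  rw [integral_eq_sum]
  have hc : ∀ c, chartIntegral I sgn θ c = ∫ y in τ '' W, g c y := by
    intro c
    rw [setIntegral_eq_of_subset_of_forall_sdiff_eq_zero hmW
      (Set.image_mono Set.inter_subset_left) (hoff c), ← himg,
      integral_image_eq_integral_abs_det_fderiv_smul volume (hSm c) (hd c) (hΦ c),
      setIntegral_congr_fun (hSm c) (fun z hz => hg c z hz), chartIntegral]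
    refine (setIntegral_eq_of_subset_of_forall_sdiff_eq_zero (measurableSet_chart_target c)
      Set.inter_subset_left ?_)
    rintro z ⟨hz, hzS⟩
    have : (extChartAt I c).symm z ∉ W := fun hw => hzS ⟨hz, hw⟩
    rw [h0 _ this, AlternatingMap.zero_apply, mul_zero, mul_zero]
  simp only [hc]
  rw [← integral_finsetSum _ fun c _ => hint c]
  refine setIntegral_congr_fun hmW ?_
  rintro y hy
  simp only [g, ← Finset.sum_mul, sum_chartPartition, one_mul]

end ChangeOfVariables

/-! ### The divergence theorem on a half-space. -/

section HalfSpace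

open MeasureTheory

variable {n : ℕ}

/-- The projection `ℝⁿ⁺¹ → ℝⁿ` that forgets the first coordinate. -/
def dropVec (n : ℕ) : EuclideanSpace ℝ (Fin (n + 1)) →L[ℝ] EuclideanSpace ℝ (Fin n) :=
  LinearMap.toContinuousLinearMap
    { toFun := fun z => WithLp.toLp 2 fun i => z i.succ
      map_add' := fun _ _ => rfl
      map_smul' := fun _ _ => rfl }

/-- The inclusion `ℝⁿ → ℝⁿ⁺¹` as the hyperplane where the first coordinate is zero. -/
def consVec (n : ℕ) : EuclideanSpace ℝ (Fin n) →L[ℝ] EuclideanSpace ℝ (Fin (n + 1)) :=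
  LinearMap.toContinuousLinearMap
    { toFun := fun y => WithLp.toLp 2 (Fin.cons 0 fun i => y i)
      map_add' := fun y y' => by
        ext i
        refine Fin.cases ?_ (fun i => ?_) i <;> simp
      map_smul' := fun a y => by
        ext i
        refine Fin.cases ?_ (fun i => ?_) i <;> simp }

theorem dropVec_apply (z : EuclideanSpace ℝ (Fin (n + 1))) (i : Fin n) :
    dropVec n z i = z i.succ := rfl

theorem consVec_zero (y : EuclideanSpace ℝ (Fin n)) : consVec n y 0 = 0 := rfl

theorem dropVec_consVec (y : EuclideanSpace ℝ (Fin n)) : dropVec n (consVec n y) = y := rfl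

theorem consVec_dropVec {z : EuclideanSpace ℝ (Fin (n + 1))} (hz : z 0 = 0) :
    consVec n (dropVec n z) = z := by
  ext i
  refine Fin.cases ?_ (fun i => ?_) i
  · rw [consVec_zero, hz]
  · rfl

theorem dropVec_basisFun_succ (i : Fin n) :
    dropVec n (EuclideanSpace.basisFun (Fin (n + 1)) ℝ i.succ) =
      EuclideanSpace.basisFun (Fin n) ℝ i := by
  ext j
  simp [dropVec_apply]

/-- Expansion of a determinant along the first coordinate. -/
theorem det_cons_eq {w : EuclideanSpace ℝ (Fin (n + 1))}
    {v : Fin n → EuclideanSpace ℝ (Fin (n + 1))} (hv : ∀ i, v i 0 = 0) :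
    (EuclideanSpace.basisFun (Fin (n + 1)) ℝ).toBasis.det
        (Fin.cons w v : Fin (n + 1) → EuclideanSpace ℝ (Fin (n + 1))) =
      w 0 * (EuclideanSpace.basisFun (Fin n) ℝ).toBasis.det fun i => dropVec n (v i) := by
  rw [Module.Basis.det_apply, Module.Basis.det_apply, Matrix.det_succ_row_zero, Fin.sum_univ_succ,
    Finset.sum_eq_zero, add_zero]
  · have : (((EuclideanSpace.basisFun (Fin (n + 1)) ℝ).toBasis.toMatrix
        (Fin.cons w v : Fin (n + 1) → EuclideanSpace ℝ (Fin (n + 1)))).submatrix Fin.succ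
          (Fin.succAbove 0)) =
        (EuclideanSpace.basisFun (Fin n) ℝ).toBasis.toMatrix fun i => dropVec n (v i) := by
      ext i j
      simp [Module.Basis.toMatrix_apply, dropVec_apply]
    rw [this]
    simp [Module.Basis.toMatrix_apply]
  · intro i _
    simp [Module.Basis.toMatrix_apply, hv]

/-- The divergence theorem for compactly supported fields on a half-space. -/
theorem integral_divergence_halfSpace {f : Fin (n + 1) → EuclideanSpace ℝ (Fin (n + 1)) → ℝ}
    {D : EuclideanSpace ℝ (Fin (n + 1)) → ℝ} {K : Set (EuclideanSpace ℝ (Fin (n + 1)))}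
    (hK : IsCompact K) (hf : ∀ i, ContinuousOn (f i) {z | 0 ≤ z 0})
    (hD : ContinuousOn D {z | 0 ≤ z 0})
    (hd : ∀ z : EuclideanSpace ℝ (Fin (n + 1)), 0 < z 0 →
      ∃ f' : Fin (n + 1) → EuclideanSpace ℝ (Fin (n + 1)) →L[ℝ] ℝ,
        (∀ i, HasFDerivAt (f i) (f' i) z) ∧
        ∑ i, f' i (EuclideanSpace.basisFun (Fin (n + 1)) ℝ i) = D z)
    (hfK : ∀ i, ∀ z ∉ K, f i z = 0) (hDK : ∀ z ∉ K, D z = 0) :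
    ∫ z in {z : EuclideanSpace ℝ (Fin (n + 1)) | 0 ≤ z 0}, D z =
      -∫ y, f 0 (consVec n y) := by
  classical
  obtain ⟨R, hR0, hR⟩ : ∃ R : ℝ, 0 < R ∧ ∀ z ∈ K, ∀ i, |z i| < R := by
    obtain ⟨R, hR⟩ := hK.isBounded.exists_norm_le
    refine ⟨max R 0 + 1, by positivity, fun z hz i => ?_⟩
    have h1 : ‖z i‖ ≤ ‖z‖ := PiLp.norm_apply_le z i
    rw [Real.norm_eq_abs] at h1
    linarith [hR z hz, le_max_left R 0]
  let L : (Fin (n + 1) → ℝ) ≃L[ℝ] EuclideanSpace ℝ (Fin (n + 1)) :=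
    (PiLp.continuousLinearEquiv 2 ℝ fun _ : Fin (n + 1) => ℝ).symm
  have hL : ∀ z i, L z i = z i := fun z i => rfl
  have hLe : ∀ i, L (Pi.single i 1) = EuclideanSpace.basisFun (Fin (n + 1)) ℝ i := by
    intro i
    rw [EuclideanSpace.basisFun_apply]
    rfl
  choose f' hf' hsum using hd
  -- The box `[0, R] × [-R, R]ⁿ` contains the part of the support lying in the half-space; only its
  -- face in the hyperplane can meet the support.
  let a : Fin (n + 1) → ℝ := Fin.cons 0 fun _ => -R
  let b : Fin (n + 1) → ℝ := fun _ => R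
  -- Derivatives are available only where the first coordinate is positive. Elsewhere the values are
  -- chosen so that the divergence is `D` everywhere, and integrability follows from continuity of
  -- `D`.
  let G' : Fin (n + 1) → (Fin (n + 1) → ℝ) → (Fin (n + 1) → ℝ) →L[ℝ] ℝ := fun i z =>
    if h : 0 < L z 0 then (f' (L z) h i).comp (L : (Fin (n + 1) → ℝ) →L[ℝ] _)
    else if i = 0 then D (L z) • ContinuousLinearMap.proj 0 else 0
  have hG' : ∀ z, ∑ i, G' i z (Pi.single i 1) = D (L z) := by
    intro z
    by_cases h : 0 < L z 0
    · rw [← hsum (L z) h]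
      refine Finset.sum_congr rfl fun i _ => ?_
      simp only [G', dif_pos h, ← hLe]
      rfl
    · simp only [G', dif_neg h]
      rw [Finset.sum_eq_single 0]
      · simp
      · intro i _ hi
        simp [hi]
      · simp
  have hab : a ≤ b := by
    intro i
    refine Fin.cases ?_ (fun i => ?_) i
    · exact hR0.le
    · change -R ≤ R
      linarith
  have hmem : ∀ z ∈ Set.Icc a b, 0 ≤ L z 0 := fun z hz => hz.1 0
  have hmaps : Set.MapsTo L (Set.Icc a b) {z | 0 ≤ z 0} := hmem
  have hcont : ContinuousOn (fun z => D (L z)) (Set.Icc a b) :=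
    hD.comp L.continuous.continuousOn hmaps
  have hdiv := integral_divergence_of_hasFDerivAt_off_countable' a b hab (fun i z => f i (L z)) G'
    ∅ Set.countable_empty (fun i => (hf i).comp L.continuous.continuousOn hmaps)
    (fun z hz i => by
      have h0 : 0 < L z 0 := (hz.1 0 (Set.mem_univ _)).1
      simp only [G', dif_pos h0]
      exact (hf' (L z) h0 i).comp z L.hasFDerivAt)
    (by
      simp only [hG']
      exact hcont.integrableOn_compact isCompact_Icc)
  simp only [hG'] at hdiv
  have hout : ∀ z : Fin (n + 1) → ℝ, (∃ i, R ≤ |z i|) → L z ∉ K := by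
    rintro z ⟨i, hi⟩ hz
    exact absurd (hR _ hz i) (not_lt.2 hi)
  have hmp := PiLp.volume_preserving_toLp (Fin (n + 1))
  have hmp' := PiLp.volume_preserving_toLp (Fin n)
  have hhm : MeasurableSet {z : Fin (n + 1) → ℝ | 0 ≤ z 0} :=
    (isClosed_le continuous_const (continuous_apply 0)).measurableSet
  have hleft : ∫ z in {z : EuclideanSpace ℝ (Fin (n + 1)) | 0 ≤ z 0}, D z =
      ∫ z in Set.Icc a b, D (L z) := by
    rw [← hmp.setIntegral_preimage_emb
      (MeasurableEquiv.toLp 2 (Fin (n + 1) → ℝ)).measurableEmbedding]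
    refine setIntegral_eq_of_subset_of_forall_sdiff_eq_zero hhm (fun z hz => hmem z hz) ?_
    rintro z ⟨hz, hzab⟩
    refine hDK _ (hout z ?_)
    by_contra! h
    refine hzab ⟨fun i => ?_, fun i => (abs_lt.1 (h i)).2.le⟩
    refine Fin.cases ?_ (fun i => ?_) i
    · exact hz
    · exact (abs_lt.1 (h i.succ)).1.le
  rw [hleft, hdiv, Fin.sum_univ_succ, Finset.sum_eq_zero, add_zero]
  -- The face at distance `R` contributes nothing, and the face in the hyperplane enters with a
  -- minus sign.
  · rw [setIntegral_eq_zero_of_forall_eq_zero, zero_sub]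
    · congr 1
      rw [← hmp'.integral_comp (MeasurableEquiv.toLp 2 (Fin n → ℝ)).measurableEmbedding,
        ← setIntegral_univ (μ := volume) (f := fun y : Fin n → ℝ => f 0 (consVec n (WithLp.toLp 2 y)))]
      have he : ∀ y : Fin n → ℝ, L (Fin.insertNth 0 (a 0) y) = consVec n (WithLp.toLp 2 y) := by
        intro y
        rw [Fin.insertNth_zero]
        rfl
      simp only [he]
      symm
      refine setIntegral_eq_of_subset_of_forall_sdiff_eq_zero MeasurableSet.univ
        (Set.subset_univ _) ?_
      rintro y ⟨-, hy⟩
      rw [← he]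
      refine hfK 0 _ (hout _ ?_)
      by_contra! h
      refine hy ⟨fun i => ?_, fun i => ?_⟩
      · have := (abs_lt.1 (h i.succ)).1.le
        rw [Fin.insertNth_zero, Fin.cons_succ] at this
        exact this
      · have := (abs_lt.1 (h i.succ)).2.le
        rw [Fin.insertNth_zero, Fin.cons_succ] at this
        exact this
    · intro y _
      refine hfK 0 _ (hout _ ⟨0, ?_⟩)
      rw [Fin.insertNth_apply_same]
      exact le_abs_self R
  · intro i _
    rw [setIntegral_eq_zero_of_forall_eq_zero, setIntegral_eq_zero_of_forall_eq_zero, sub_zero]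
    · intro y _
      refine hfK _ _ (hout _ ⟨i.succ, ?_⟩)
      rw [Fin.insertNth_apply_same]
      change R ≤ |-R|
      rw [abs_neg]
      exact le_abs_self R
    · intro y _
      refine hfK _ _ (hout _ ⟨i.succ, ?_⟩)
      rw [Fin.insertNth_apply_same]
      exact le_abs_self R

end HalfSpace

/-! ### Derivatives of chart coordinates. -/

section CoordinateDerivatives

variable {m : ℕ} {H : Type*} [TopologicalSpace H]
  {I : ModelWithCorners ℝ (EuclideanSpace ℝ (Fin m)) H}
  {X : Type*} [TopologicalSpace X] [ChartedSpace H X] [IsManifold I ∞ X]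
  {Y : Type*} [NormedAddCommGroup Y] [NormedSpace ℝ Y]

theorem mvfderiv_clm_extChartAt (ℓ : EuclideanSpace ℝ (Fin m) →L[ℝ] Y) {c x : X}
    (hx : x ∈ (chartAt H c).source) :
    MDifferentiableAt I 𝓘(ℝ, Y) (fun y => ℓ (extChartAt I c y)) x ∧
    ∀ w, mvfderiv I (fun y => ℓ (extChartAt I c y)) x w = ℓ (tangentCoord I c x w) := by
  have : IsManifold I 1 X := IsManifold.of_le (n := ∞) (by simp)
  have h1 : HasMFDerivAt I 𝓘(ℝ, EuclideanSpace ℝ (Fin m)) (extChartAt I c) x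
      (mfderiv I 𝓘(ℝ, EuclideanSpace ℝ (Fin m)) (extChartAt I c) x) :=
    (mdifferentiableAt_extChartAt hx).hasMFDerivAt
  have h2 := ((ℓ.hasFDerivAt (x := extChartAt I c x)).hasMFDerivAt).comp x h1
  refine ⟨h2.mdifferentiableAt, fun w => ?_⟩
  rw [tangentCoord_eq_mfderiv I hx]
  exact congrArg (fun L : TangentSpace I x →L[ℝ] Y => L w) h2.mfderiv

end CoordinateDerivatives

/-! ### The boundary in charts, outward vectors, and the induced orientation. -/

section BoundaryGeometry

variable {n : ℕ}
  {M : Type*} [TopologicalSpace M] [ChartedSpace (EuclideanHalfSpace (n + 1)) M]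
  [IsManifold (𝓡∂ (n + 1)) ∞ M]
  {N : Type*} [TopologicalSpace N] [ChartedSpace (EuclideanSpace ℝ (Fin n)) N]
  [IsManifold (𝓡 n) ∞ N]

theorem extChartAt_zero_nonneg (c x : M) : 0 ≤ extChartAt (𝓡∂ (n + 1)) c x 0 := by
  have := extChartAt_mem_range (𝓡∂ (n + 1)) c x
  rwa [range_modelWithCornersEuclideanHalfSpace] at this

/-- Being an interior point can be tested in any chart, and the interior of the model half-space is
where the first coordinate is positive. -/
theorem mem_boundary_iff {c x : M} (hx : x ∈ (chartAt (EuclideanHalfSpace (n + 1)) c).source) :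
    x ∈ (𝓡∂ (n + 1)).boundary M ↔ extChartAt (𝓡∂ (n + 1)) c x 0 = 0 := by
  have hxs : x ∈ (extChartAt (𝓡∂ (n + 1)) c).source := by simpa using hx
  have ht := (extChartAt (𝓡∂ (n + 1)) c).map_source hxs
  have h1 := (𝓡∂ (n + 1)).isInteriorPoint_iff_of_mem_atlas (n := ∞) (by simp)
    (chart_mem_atlas _ c) hx
  change _ ↔ extChartAt (𝓡∂ (n + 1)) c x ∈ interior (extChartAt (𝓡∂ (n + 1)) c).target at h1
  rw [extChartAt_target] at h1 ht
  rw [interior_inter, ((chartAt _ c).open_target.preimage (𝓡∂ (n + 1)).continuous_symm).interior_eq,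
    interior_range_modelWithCornersEuclideanHalfSpace] at h1
  have h2 : x ∈ (𝓡∂ (n + 1)).boundary M ↔ (𝓡∂ (n + 1)).IsBoundaryPoint x := Iff.rfl
  rw [h2, ModelWithCorners.isBoundaryPoint_iff_not_isInteriorPoint, h1]
  have h3 := extChartAt_zero_nonneg (n := n) c x
  constructor
  · intro h
    by_contra hne
    exact h ⟨ht.1, lt_of_le_of_ne h3 (Ne.symm hne)⟩
  · rintro h ⟨-, h4⟩
    exact absurd h (ne_of_gt h4)

variable (ι : C^∞⟮𝓡 n, N; 𝓡∂ (n + 1), M⟯)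

theorem mvfderiv_clm_extChartAt_comp {Y : Type*} [NormedAddCommGroup Y] [NormedSpace ℝ Y]
    (ℓ : EuclideanSpace ℝ (Fin (n + 1)) →L[ℝ] Y) {c : M} {p : N}
    (hp : ι p ∈ (chartAt (EuclideanHalfSpace (n + 1)) c).source) :
    MDifferentiableAt (𝓡 n) 𝓘(ℝ, Y) (fun q => ℓ (extChartAt (𝓡∂ (n + 1)) c (ι q))) p ∧
    ∀ v, mvfderiv (𝓡 n) (fun q => ℓ (extChartAt (𝓡∂ (n + 1)) c (ι q))) p v =
      ℓ (tangentCoord (𝓡∂ (n + 1)) c (ι p) (tangentMap ι p v)) := by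
  obtain ⟨h1, h2⟩ := mvfderiv_clm_extChartAt (I := 𝓡∂ (n + 1)) ℓ hp
  have h3 : HasMFDerivAt (𝓡 n) (𝓡∂ (n + 1)) ι p (mfderiv (𝓡 n) (𝓡∂ (n + 1)) ι p) :=
    (ι.contMDiff.contMDiffAt.mdifferentiableAt (by simp)).hasMFDerivAt
  have h4 := h1.hasMFDerivAt.comp p h3
  refine ⟨h4.mdifferentiableAt, fun v => ?_⟩
  rw [← h2]
  exact congrArg (fun L : TangentSpace (𝓡 n) p →L[ℝ] Y => L v) h4.mfderiv

variable {ι} (hι : IsBoundaryInclusion ι)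

include hι

theorem extChartAt_boundary_zero {c : M} {p : N}
    (hp : ι p ∈ (chartAt (EuclideanHalfSpace (n + 1)) c).source) :
    extChartAt (𝓡∂ (n + 1)) c (ι p) 0 = 0 := by
  rw [← mem_boundary_iff hp, ← hι.range_eq]
  exact ⟨p, rfl⟩

/-- Vectors tangent to the boundary have no component in the first coordinate direction. -/
theorem tangentCoord_tangentMap_zero {c : M} {p : N}
    (hp : ι p ∈ (chartAt (EuclideanHalfSpace (n + 1)) c).source) (v : TangentSpace (𝓡 n) p) :
    tangentCoord (𝓡∂ (n + 1)) c (ι p) (tangentMap ι p v) 0 = 0 := by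
  have h := (mvfderiv_clm_extChartAt_comp ι (EuclideanSpace.proj (𝕜 := ℝ) (0 : Fin (n + 1))) hp).2 v
  refine h.symm.trans ?_
  have h2 : (fun q => EuclideanSpace.proj (𝕜 := ℝ) (0 : Fin (n + 1))
      (extChartAt (𝓡∂ (n + 1)) c (ι q))) =ᶠ[𝓝 p] fun _ => (0 : ℝ) := by
    filter_upwards [ι.contMDiff.continuous.continuousAt.eventually (chart_source_mem_nhds hp)]
      with q hq
    exact extChartAt_boundary_zero hι hq
  rw [mvfderiv_congr (I := 𝓡 n) h2]
  have h3 : mfderiv (𝓡 n) 𝓘(ℝ, ℝ) (fun _ : N => (0 : ℝ)) p = 0 := mfderiv_const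
  exact congrArg (fun L : TangentSpace (𝓡 n) p →L[ℝ] ℝ => L v) h3

/-- All vectors without component in the first coordinate direction are tangent to the boundary. -/
theorem exists_tangentMap_eq {c : M} {p : N}
    (hp : ι p ∈ (chartAt (EuclideanHalfSpace (n + 1)) c).source)
    {w : TangentSpace (𝓡∂ (n + 1)) (ι p)} (hw : tangentCoord (𝓡∂ (n + 1)) c (ι p) w 0 = 0) :
    ∃ v, tangentMap ι p v = w := by
  -- The tangential coordinates of the differential form an injective endomorphism of `ℝⁿ`, hence a
  -- surjective one.
  let T : EuclideanSpace ℝ (Fin n) →ₗ[ℝ] EuclideanSpace ℝ (Fin n) :=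
    (dropVec n).toLinearMap ∘ₗ tangentCoord (𝓡∂ (n + 1)) c (ι p) ∘ₗ tangentMap ι p
  have hT : Function.Injective T := by
    intro v v' h
    refine hι.injective_mfderiv p (a₁ := v) (a₂ := v') ?_
    have h1 : consVec n (T v) = consVec n (T v') := congrArg _ h
    have h2 : tangentCoord (𝓡∂ (n + 1)) c (ι p) (tangentMap ι p v) =
        tangentCoord (𝓡∂ (n + 1)) c (ι p) (tangentMap ι p v') :=
      (consVec_dropVec (tangentCoord_tangentMap_zero hι hp v)).symm.trans
        (h1.trans (consVec_dropVec (tangentCoord_tangentMap_zero hι hp v')))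
    have h3 := congrArg (tangentVec (𝓡∂ (n + 1)) c (ι p)) h2
    rw [tangentVec_tangentCoord _ hp, tangentVec_tangentCoord _ hp] at h3
    exact h3
  obtain ⟨v, hv⟩ := (LinearMap.injective_iff_surjective.1 hT)
    (dropVec n (tangentCoord (𝓡∂ (n + 1)) c (ι p) w))
  refine ⟨v, ?_⟩
  have h1 : consVec n (T v) = consVec n (dropVec n (tangentCoord (𝓡∂ (n + 1)) c (ι p) w)) :=
    congrArg _ hv
  have h2 := (consVec_dropVec (tangentCoord_tangentMap_zero hι hp v)).symm.trans
    (h1.trans (consVec_dropVec hw))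
  have h3 := congrArg (tangentVec (𝓡∂ (n + 1)) c (ι p)) h2
  rwa [tangentVec_tangentCoord _ hp, tangentVec_tangentCoord _ hp] at h3

/-- The outward vector is outward pointing in all charts. -/
theorem tangentCoord_outward_neg {c : M} {p : N}
    (hp : ι p ∈ (chartAt (EuclideanHalfSpace (n + 1)) c).source) :
    tangentCoord (𝓡∂ (n + 1)) c (ι p) (outward (ι p)) 0 < 0 := by
  set x := ι p with hx
  have hxx := mem_chart_source (EuclideanHalfSpace (n + 1)) x
  let e₀ : TangentSpace (𝓡∂ (n + 1)) x :=
    (EuclideanSpace.basisFun (Fin (n + 1)) ℝ 0 : EuclideanSpace ℝ (Fin (n + 1)))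
  have hout : outward x = -e₀ := rfl
  have h0 : (0 : ℝ) ≤ tangentCoord (𝓡∂ (n + 1)) c x e₀ 0 := by
    obtain ⟨h1, h2⟩ := mvfderiv_clm_extChartAt (I := 𝓡∂ (n + 1))
      (EuclideanSpace.proj (𝕜 := ℝ) (0 : Fin (n + 1))) hp
    have h3 := h2 e₀
    rw [mvfderiv_eq_chart _ hxx h1, tangentCoord_self] at h3
    have hd := ((mdifferentiableAt_iff_chart _ hxx).1 h1).2
    -- The first coordinate of any chart attains its minimum `0` at a boundary point, so its
    -- derivative along the inward vector is nonnegative.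
    have hmin : IsLocalMinOn ((fun y => EuclideanSpace.proj (𝕜 := ℝ) (0 : Fin (n + 1))
        (extChartAt (𝓡∂ (n + 1)) c y)) ∘ (extChartAt (𝓡∂ (n + 1)) x).symm)
        (Set.range (𝓡∂ (n + 1))) (extChartAt (𝓡∂ (n + 1)) x x) := by
      refine Filter.Eventually.of_forall fun z => ?_
      have h4 : extChartAt (𝓡∂ (n + 1)) c x 0 = 0 := extChartAt_boundary_zero hι hp
      have h5 := (extChartAt (𝓡∂ (n + 1)) x).left_inv (mem_extChartAt_source x)
      simp only [Function.comp_apply, h5]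
      exact h4.le.trans (extChartAt_zero_nonneg c _)
    refine (hmin.hasFDerivWithinAt_nonneg hd.hasFDerivWithinAt
      (mem_posTangentConeAt_of_segment_subset ?_)).trans_eq h3
    refine ((𝓡∂ (n + 1)).convex_range).segment_subset (extChartAt_mem_range _ x x) ?_
    rw [range_modelWithCornersEuclideanHalfSpace]
    have := extChartAt_zero_nonneg (n := n) x x
    have h6 : (EuclideanSpace.basisFun (Fin (n + 1)) ℝ 0 : EuclideanSpace ℝ (Fin (n + 1))) 0 = 1 := by
      simp
    change 0 ≤ extChartAt (𝓡∂ (n + 1)) x x 0 +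
      (EuclideanSpace.basisFun (Fin (n + 1)) ℝ 0 : EuclideanSpace ℝ (Fin (n + 1))) 0
    rw [h6]
    linarith
  -- If that derivative vanished, the inward vector would be tangent to the boundary, contradicting
  -- its first coordinate `1` in the preferred chart.
  have hne : tangentCoord (𝓡∂ (n + 1)) c x e₀ 0 ≠ 0 := by
    intro h
    obtain ⟨v, hv⟩ := exists_tangentMap_eq hι hp h
    have h7 := tangentCoord_tangentMap_zero hι hxx v
    rw [hv, tangentCoord_self] at h7
    have h6 : (EuclideanSpace.basisFun (Fin (n + 1)) ℝ 0 : EuclideanSpace ℝ (Fin (n + 1))) 0 = 1 := by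
      simp
    exact one_ne_zero (h6.symm.trans h7)
  rw [hout, map_neg]
  exact neg_neg_of_pos (lt_of_le_of_ne h0 hne.symm)

/-- The boundary sign of a frame, in terms of its coordinates in a chart of `M`. -/
theorem boundarySign_eq (o : ManifoldOrientation (𝓡∂ (n + 1)) M) {c : M} {p : N}
    (hp : ι p ∈ (chartAt (EuclideanHalfSpace (n + 1)) c).source)
    (u : Fin n → TangentSpace (𝓡 n) p) :
    boundarySign o ι p u = -(SignType.sign ((EuclideanSpace.basisFun (Fin n) ℝ).toBasis.det fun i =>
        dropVec n (tangentCoord (𝓡∂ (n + 1)) c (ι p) (tangentMap ι p (u i)))) : ℝ) *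
      frameSign (o.orient (ι p)) (chartFrame (𝓡∂ (n + 1)) c (ι p)) := by
  have h1 := o.isOrientationSign.eq_sign_det (chartBasis (𝓡∂ (n + 1)) hp)
    (Fin.cons (outward (ι p)) fun i => tangentMap ι p (u i))
  rw [coe_chartBasis, chartBasis_det] at h1
  refine h1.trans ?_
  have h2 : (fun i => tangentCoord (𝓡∂ (n + 1)) c (ι p)
      ((Fin.cons (outward (ι p)) fun i => tangentMap ι p (u i) :
        Fin (n + 1) → TangentSpace (𝓡∂ (n + 1)) (ι p)) i)) =
      (Fin.cons (tangentCoord (𝓡∂ (n + 1)) c (ι p) (outward (ι p))) fun i =>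
        tangentCoord (𝓡∂ (n + 1)) c (ι p) (tangentMap ι p (u i)) :
        Fin (n + 1) → EuclideanSpace ℝ (Fin (n + 1))) := by
    funext i
    refine Fin.cases ?_ (fun i => ?_) i <;> rfl
  rw [h2, det_cons_eq fun i => tangentCoord_tangentMap_zero hι hp (u i), sign_mul,
    sign_neg (tangentCoord_outward_neg hι hp)]
  simp

/-- The form is the orientation form of `M` with the outward vector inserted, pulled back. The
outward vector changes discontinuously with the point, so local constancy is read off from
`boundarySign_eq`, where only a nonvanishing determinant and the orientation of `M` remain. -/
theorem isOrientationSign_boundarySign (o : ManifoldOrientation (𝓡∂ (n + 1)) M) :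
    IsOrientationSign (𝓡 n) (boundarySign o ι) := by
  have hdet : ∀ p : N, ∀ y : N, ι y ∈ (chartAt (EuclideanHalfSpace (n + 1)) (ι p)).source →
      y ∈ (chartAt (EuclideanSpace ℝ (Fin n)) p).source →
      (EuclideanSpace.basisFun (Fin n) ℝ).toBasis.det (fun i => dropVec n
        (tangentCoord (𝓡∂ (n + 1)) (ι p) (ι y) (tangentMap ι y (chartFrame (𝓡 n) p y i)))) ≠ 0 := by
    intro p y hy hyp
    let T : EuclideanSpace ℝ (Fin n) →ₗ[ℝ] EuclideanSpace ℝ (Fin n) :=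
      (dropVec n).toLinearMap ∘ₗ tangentCoord (𝓡∂ (n + 1)) (ι p) (ι y) ∘ₗ tangentMap ι y ∘ₗ
        tangentVec (𝓡 n) p y
    have hT : Function.Surjective T := by
      intro v
      obtain ⟨w, hw⟩ := exists_tangentMap_eq hι hy
        (w := tangentVec (𝓡∂ (n + 1)) (ι p) (ι y) (consVec n v))
        (by rw [tangentCoord_tangentVec _ hy, consVec_zero])
      refine ⟨tangentCoord (𝓡 n) p y w, ?_⟩
      change dropVec n (tangentCoord (𝓡∂ (n + 1)) (ι p) (ι y) (tangentMap ι y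
        (tangentVec (𝓡 n) p y (tangentCoord (𝓡 n) p y w)))) = v
      rw [tangentVec_tangentCoord _ hyp, hw, tangentCoord_tangentVec _ hy, dropVec_consVec]
    have hTi := LinearMap.injective_iff_surjective.2 hT
    have h := (EuclideanSpace.basisFun (Fin n) ℝ).toBasis.isUnit_det
      ((EuclideanSpace.basisFun (Fin n) ℝ).toBasis.map (LinearEquiv.ofBijective T ⟨hTi, hT⟩))
    have e : ⇑((EuclideanSpace.basisFun (Fin n) ℝ).toBasis.map
        (LinearEquiv.ofBijective T ⟨hTi, hT⟩)) = fun i => dropVec n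
        (tangentCoord (𝓡∂ (n + 1)) (ι p) (ι y) (tangentMap ι y (chartFrame (𝓡 n) p y i))) := by
      funext i
      rw [Module.Basis.map_apply, OrthonormalBasis.coe_toBasis]
      rfl
    rw [e] at h
    exact h.ne_zero
  refine ⟨fun p => ?_, fun p => ?_⟩
  · refine ⟨(((o.orient (ι p)).someVector).curryLeft (outward (ι p))).compLinearMap
      (tangentMap ι p), fun h => ?_, fun u => rfl⟩
    have hpp := mem_chart_source (EuclideanHalfSpace (n + 1)) (ι p)
    have h1 : boundarySign o ι p (chartFrame (𝓡 n) p p) = 0 := by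
      change ((SignType.sign ((((o.orient (ι p)).someVector).curryLeft (outward (ι p))).compLinearMap
        (tangentMap ι p) (chartFrame (𝓡 n) p p)) : SignType) : ℝ) = 0
      rw [h]
      simp
    rw [boundarySign_eq hι o hpp] at h1
    have h2 := o.isOrientationSign.basis_ne_zero (chartBasis (𝓡∂ (n + 1)) hpp)
    rw [coe_chartBasis] at h2
    rcases mul_eq_zero.1 h1 with h3 | h3
    · rw [neg_eq_zero] at h3
      have h4 : ∀ s : SignType, (s : ℝ) = 0 → s = 0 := by
        intro s hs
        rcases s with _ | _ | _
        · rfl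
        · norm_num at hs
        · norm_num at hs
      exact hdet p p hpp (mem_chart_source _ p) (sign_eq_zero_iff.1 (h4 _ h3))
    · rw [h3] at h2
      norm_num at h2
  · have hpp := mem_chart_source (EuclideanHalfSpace (n + 1)) (ι p)
    have hcont : ContinuousAt (fun y => (EuclideanSpace.basisFun (Fin n) ℝ).toBasis.det fun i =>
        dropVec n (diffCoord ι p y (EuclideanSpace.basisFun (Fin n) ℝ i))) p := by
      refine (contMDiffAt_alternating (I := 𝓡 n) (x := p)
        (a := fun _ => (EuclideanSpace.basisFun (Fin n) ℝ).toBasis.det)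
        (u := fun y i => dropVec n (diffCoord ι p y (EuclideanSpace.basisFun (Fin n) ℝ i)))
        (fun _ => contMDiffAt_const) fun i => ?_).continuousAt
      exact (dropVec n).contDiff.contMDiff.contMDiffAt.comp p
        (contMDiffAt_diffCoord_apply ι p (EuclideanSpace.basisFun (Fin n) ℝ i))
    have h1 := (continuousAt_sign_of_ne_zero (hdet p p hpp (mem_chart_source _ p))).comp
      (f := fun y => (EuclideanSpace.basisFun (Fin n) ℝ).toBasis.det fun i =>
        dropVec n (diffCoord ι p y (EuclideanSpace.basisFun (Fin n) ℝ i))) (x := p) hcont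
    have h2 := h1.tendsto.eventually (p := fun s => s = SignType.sign
        ((EuclideanSpace.basisFun (Fin n) ℝ).toBasis.det fun i =>
        dropVec n (diffCoord ι p p (EuclideanSpace.basisFun (Fin n) ℝ i))))
      (by rw [nhds_discrete]; exact Filter.eventually_pure.2 rfl)
    filter_upwards [h2, eventually_mem_source ι p,
      ι.contMDiff.continuous.continuousAt.eventually (o.locally_constant (ι p))] with y h3 h4 h5
    rw [boundarySign_eq hι o hpp, boundarySign_eq hι o h4, h5]
    have h6 : ((SignType.sign ((EuclideanSpace.basisFun (Fin n) ℝ).toBasis.det fun i => dropVec n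
        (tangentCoord (𝓡∂ (n + 1)) (ι p) (ι y) (tangentMap ι y (chartFrame (𝓡 n) p y i)))) :
        SignType) : ℝ) = (SignType.sign ((EuclideanSpace.basisFun (Fin n) ℝ).toBasis.det fun i =>
        dropVec n (tangentCoord (𝓡∂ (n + 1)) (ι p) (ι p)
          (tangentMap ι p (chartFrame (𝓡 n) p p i)))) : SignType) := congrArg _ h3
    rw [h6]

end BoundaryGeometry

theorem alternating_sum_apply {T κ : Type*} [AddCommGroup T] [Module ℝ T] {r : ℕ} (t : Finset κ)
    (θ : κ → T [⋀^Fin r]→ₗ[ℝ] ℝ) (w : Fin r → T) : (∑ i ∈ t, θ i) w = ∑ i ∈ t, θ i w := by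
  classical
  induction t using Finset.induction_on with
  | empty => simp
  | insert i t hi ih => rw [Finset.sum_insert hi, Finset.sum_insert hi, AlternatingMap.add_apply, ih]

/-! ### The exterior derivative of real-valued forms. -/

section ExteriorDerivative

variable {m : ℕ} {H : Type*} [TopologicalSpace H]
  {I : ModelWithCorners ℝ (EuclideanSpace ℝ (Fin m)) H}
  {X : Type*} [TopologicalSpace X] [ChartedSpace H X] [IsManifold I ∞ X]

theorem SmoothForm.contMDiffAt {r : ℕ} {θ : ∀ x : X, TangentSpace I x [⋀^Fin r]→ₗ[ℝ] ℝ}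
    (h : SmoothForm I θ) {c x : X} (hx : x ∈ (chartAt H c).source)
    (v : Fin r → EuclideanSpace ℝ (Fin m)) :
    ContMDiffAt I 𝓘(ℝ, ℝ) ∞ (fun y => θ y fun i => tangentVec I c y (v i)) x := by
  have hxx := mem_chart_source H x
  have h2 : ∀ w : Fin r → EuclideanSpace ℝ (Fin m), ContMDiffAt I 𝓘(ℝ, ℝ) ∞
      (fun y => (θ y).compLinearMap (tangentVec I x y) w) x := fun w => h x w
  have h3 : ∀ i, ContMDiffAt I 𝓘(ℝ, EuclideanSpace ℝ (Fin m)) ∞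
      (fun y => tangentCoord I x y (tangentVec I c y (v i))) x := fun i =>
    contMDiffAt_tangentCoord_change hxx hx (v i)
  have h1 : ContMDiffAt I 𝓘(ℝ, ℝ) ∞ (fun y => (θ y).compLinearMap (tangentVec I x y)
      fun i => tangentCoord I x y (tangentVec I c y (v i))) x :=
    contMDiffAt_alternating h2 h3
  refine h1.congr_of_eventuallyEq ?_
  filter_upwards [chart_source_mem_nhds hxx] with y hy
  simp only [AlternatingMap.compLinearMap_apply, tangentVec_tangentCoord I hy]

theorem SmoothForm.differentiable_chartForm {r : ℕ}
    {θ : ∀ x : X, TangentSpace I x [⋀^Fin r]→ₗ[ℝ] ℝ} (h : SmoothForm I θ) {c x : X}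
    (hx : x ∈ (chartAt H c).source) :
    DifferentiableWithinAt ℝ (chartForm I θ c) (Set.range I) (extChartAt I c x) :=
  (contDiffWithinAt_chartForm I le_rfl hx fun v => h.contMDiffAt hx v).differentiableWithinAt
    (by simp)

variable (I) in
/-- The exterior derivative of a form, as an alternating map. -/
def dFormMap {r : ℕ} (θ : ∀ x : X, TangentSpace I x [⋀^Fin r]→ₗ[ℝ] ℝ) (x : X) :
    TangentSpace I x [⋀^Fin (r + 1)]→ₗ[ℝ] ℝ :=
  (extDerivWithin (chartForm I θ x) (Set.range I) (extChartAt I x x)).toAlternatingMap.compLinearMap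
    (tangentCoord I x x)

theorem dFormMap_apply {r : ℕ} {θ : ∀ x : X, TangentSpace I x [⋀^Fin r]→ₗ[ℝ] ℝ}
    (h : SmoothForm I θ) (x : X) (w : Fin (r + 1) → TangentSpace I x) :
    dFormMap I θ x w = dForm I θ x w :=
  (dForm_eq_extDerivWithin I (mem_chart_source H x)
    (h.differentiable_chartForm (mem_chart_source H x)) w).symm

theorem SmoothForm.dFormMap {r : ℕ} {θ : ∀ x : X, TangentSpace I x [⋀^Fin r]→ₗ[ℝ] ℝ}
    (h : SmoothForm I θ) : SmoothForm I (dFormMap I θ) :=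
  h.dForm (dFormMap_apply h)

theorem dForm_congr {r : ℕ} {θ θ' : ∀ x : X, TangentSpace I x [⋀^Fin r]→ₗ[ℝ] ℝ} {x : X}
    (h : ∀ᶠ y in 𝓝 x, θ y = θ' y) (w : Fin (r + 1) → TangentSpace I x) :
    dForm I θ x w = dForm I θ' x w := by
  refine Finset.sum_congr rfl fun j _ => ?_
  rw [mvfderiv_congr]
  filter_upwards [h] with y hy
  rw [hy]

theorem dForm_zero {r : ℕ} (x : X) (w : Fin (r + 1) → TangentSpace I x) :
    dForm I (fun x => (0 : TangentSpace I x [⋀^Fin r]→ₗ[ℝ] ℝ)) x w = 0 := by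
  refine Finset.sum_eq_zero fun j _ => ?_
  simp only [AlternatingMap.zero_apply, mvfderiv_const]
  exact smul_zero _

theorem SmoothForm.zero {r : ℕ} :
    SmoothForm I (fun x : X => (0 : TangentSpace I x [⋀^Fin r]→ₗ[ℝ] ℝ)) :=
  fun _ _ => contMDiffAt_const

theorem SmoothForm.add {r : ℕ} {θ θ' : ∀ x : X, TangentSpace I x [⋀^Fin r]→ₗ[ℝ] ℝ}
    (h : SmoothForm I θ) (h' : SmoothForm I θ') : SmoothForm I fun x => θ x + θ' x :=
  fun c v => (h c v).add (h' c v)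

theorem dForm_add {r : ℕ} {θ θ' : ∀ x : X, TangentSpace I x [⋀^Fin r]→ₗ[ℝ] ℝ}
    (h : SmoothForm I θ) (h' : SmoothForm I θ') (x : X) (w : Fin (r + 1) → TangentSpace I x) :
    dForm I (fun x => θ x + θ' x) x w = dForm I θ x w + dForm I θ' x w := by
  simp only [dForm]
  rw [← Finset.sum_add_distrib]
  refine Finset.sum_congr rfl fun j _ => ?_
  rw [← smul_add]
  congr 1
  have h1 := (h x fun i => tangentCoord I x x (w (j.succAbove i))).mdifferentiableAt (by simp)
  have h2 := (h' x fun i => tangentCoord I x x (w (j.succAbove i))).mdifferentiableAt (by simp)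
  exact congrArg (fun L : TangentSpace I x →L[ℝ] ℝ => L (w j)) (mvfderiv_fun_add h1 h2)

theorem dForm_sum {r : ℕ} {κ : Type*} (t : Finset κ)
    {θ : κ → ∀ x : X, TangentSpace I x [⋀^Fin r]→ₗ[ℝ] ℝ} (h : ∀ i, SmoothForm I (θ i)) (x : X)
    (w : Fin (r + 1) → TangentSpace I x) :
    SmoothForm I (fun x => ∑ i ∈ t, θ i x) ∧
    dForm I (fun x => ∑ i ∈ t, θ i x) x w = ∑ i ∈ t, dForm I (θ i) x w := by
  classical
  induction t using Finset.induction_on with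
  | empty =>
    simp only [Finset.sum_empty]
    exact ⟨SmoothForm.zero, dForm_zero x w⟩
  | insert i t hi ih =>
    simp only [Finset.sum_insert hi]
    exact ⟨(h i).add ih.1, by rw [dForm_add (h i) ih.1, ih.2]⟩

end ExteriorDerivative

/-! ### Functions in a chart, extended by zero. -/

section ChartExtension

variable {m : ℕ} {H : Type*} [TopologicalSpace H]
  {I : ModelWithCorners ℝ (EuclideanSpace ℝ (Fin m)) H}
  {X : Type*} [TopologicalSpace X] [ChartedSpace H X] [IsManifold I ∞ X]

open Classical in
/-- The expression of a function in a chart, extended by zero. -/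
def chartExtend (I : ModelWithCorners ℝ (EuclideanSpace ℝ (Fin m)) H) {X : Type*}
    [TopologicalSpace X] [ChartedSpace H X] (c : X) (g : X → ℝ) :
    EuclideanSpace ℝ (Fin m) → ℝ :=
  Set.indicator (extChartAt I c).target (g ∘ (extChartAt I c).symm)

theorem chartExtend_of_mem {c : X} (g : X → ℝ) {z : EuclideanSpace ℝ (Fin m)}
    (hz : z ∈ (extChartAt I c).target) :
    chartExtend I c g z = g ((extChartAt I c).symm z) := Set.indicator_of_mem hz _

theorem chartExtend_of_notMem {c : X} (g : X → ℝ) {z : EuclideanSpace ℝ (Fin m)}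
    (hz : z ∉ (extChartAt I c).target) : chartExtend I c g z = 0 := Set.indicator_of_notMem hz _

theorem chartExtend_apply {c x : X} (g : X → ℝ) (hx : x ∈ (chartAt H c).source) :
    chartExtend I c g (extChartAt I c x) = g x := by
  have hxs : x ∈ (extChartAt I c).source := by simpa using hx
  rw [chartExtend_of_mem g ((extChartAt I c).map_source hxs), (extChartAt I c).left_inv hxs]

theorem chartExtend_eq_zero {c : X} {g : X → ℝ} {C : Set X} (hg : ∀ x ∉ C, g x = 0)
    {z : EuclideanSpace ℝ (Fin m)} (hz : z ∉ extChartAt I c '' C) : chartExtend I c g z = 0 := by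
  by_cases h : z ∈ (extChartAt I c).target
  · rw [chartExtend_of_mem g h]
    exact hg _ fun hC => hz ⟨_, hC, (extChartAt I c).right_inv h⟩
  · exact chartExtend_of_notMem g h

variable {c : X} {C : Set X}

theorem isCompact_chart_image (hC : IsCompact C) (hCs : C ⊆ (chartAt H c).source) :
    IsCompact (extChartAt I c '' C) :=
  hC.image_of_continuousOn ((continuousOn_extChartAt c).mono (by simpa using hCs))

/-- Outside the chart target the extension vanishes near the point, because the image of the compact
support is closed. -/
theorem continuousOn_chartExtend (hC : IsCompact C) (hCs : C ⊆ (chartAt H c).source) {g : X → ℝ}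
    (hg : ∀ x ∈ (chartAt H c).source, ContinuousAt g x) (h0 : ∀ x ∉ C, g x = 0) :
    ContinuousOn (chartExtend I c g) (Set.range I) := by
  intro z hz
  by_cases h : z ∈ (extChartAt I c).target
  · have h1 := extChartAt_target_mem_nhdsWithin_of_mem h
    refine ContinuousWithinAt.mono_of_mem_nhdsWithin ?_ h1
    exact (continuousOn_comp_symm hg z h).congr (fun y hy => chartExtend_of_mem g hy)
      (chartExtend_of_mem g h)
  · have hzK : z ∉ extChartAt I c '' C := by
      rintro ⟨x, hx, rfl⟩
      exact h ((extChartAt I c).map_source (by simpa using hCs hx))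
    have h1 : chartExtend I c g =ᶠ[𝓝 z] fun _ => 0 := by
      filter_upwards [(isCompact_chart_image hC hCs).isClosed.isOpen_compl.mem_nhds hzK] with y hy
      exact chartExtend_eq_zero h0 hy
    exact (continuousAt_const.congr h1.symm).continuousWithinAt

end ChartExtension

/-! ### Stokes' theorem. -/

section Stokes

open MeasureTheory

variable {n : ℕ}
  {M : Type*} [TopologicalSpace M] [ChartedSpace (EuclideanHalfSpace (n + 1)) M]
  [IsManifold (𝓡∂ (n + 1)) ∞ M] [T2Space M] [CompactSpace M]
  {N : Type*} [TopologicalSpace N] [ChartedSpace (EuclideanSpace ℝ (Fin n)) N]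
  [IsManifold (𝓡 n) ∞ N] [T2Space N] [CompactSpace N]
  {ι : C^∞⟮𝓡 n, N; 𝓡∂ (n + 1), M⟯} (hι : IsBoundaryInclusion ι)
  (o : ManifoldOrientation (𝓡∂ (n + 1)) M)

include hι in
/-- The integral over the boundary of a form supported in a chart of `M`. -/
theorem integral_boundary_eq {η : ∀ x : M, TangentSpace (𝓡∂ (n + 1)) x [⋀^Fin n]→ₗ[ℝ] ℝ}
    (hη : SmoothForm (𝓡∂ (n + 1)) η) {c : M} {C : Set M}
    (hCs : C ⊆ (chartAt (EuclideanHalfSpace (n + 1)) c).source) (h0 : ∀ x ∉ C, η x = 0) :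
    integral (𝓡 n) (boundarySign o ι) (fun p => (η (ι p)).compLinearMap (tangentMap ι p)) =
      -∫ y, chartExtend (𝓡∂ (n + 1)) c (fun x => frameSign (o.orient x)
        (chartFrame (𝓡∂ (n + 1)) c x) * η x fun j => chartFrame (𝓡∂ (n + 1)) c x j.succ)
          (consVec n y) := by
  set g : M → ℝ := fun x => frameSign (o.orient x)
        (chartFrame (𝓡∂ (n + 1)) c x) * η x fun j => chartFrame (𝓡∂ (n + 1)) c x j.succ with hg
  set W : Set N := ι ⁻¹' (chartAt (EuclideanHalfSpace (n + 1)) c).source with hW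
  have hWo : IsOpen W := (chartAt _ c).open_source.preimage ι.contMDiff.continuous
  -- The last `n` coordinates of the chart of `M`, restricted to the boundary, serve as coordinates
  -- on `N`. No adapted atlas of `N` is needed, since `integral_eq_setIntegral_image` accepts any
  -- coordinates.
  let τ : N → EuclideanSpace ℝ (Fin n) := fun p => dropVec n (extChartAt (𝓡∂ (n + 1)) c (ι p))
  have hτc : ∀ p ∈ W, consVec n (τ p) = extChartAt (𝓡∂ (n + 1)) c (ι p) := fun p hp =>
    consVec_dropVec (extChartAt_boundary_zero hι hp)
  obtain ⟨hm, hint⟩ := integral_eq_setIntegral_image (isOrientationSign_boundarySign hι o)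
    (θ := fun p => (η (ι p)).compLinearMap (tangentMap ι p)) (hη.pull ι).smoothTop.continuousTop hWo
    (fun p hp => by
      have : η (ι p) = 0 := h0 _ fun h => hp (hCs h)
      simp only [this, AlternatingMap.zero_compLinearMap])
    (τ := τ)
    (fun p hp q hq e => by
      have e1 := congrArg (consVec n) e
      rw [hτc p hp, hτc q hq] at e1
      exact hι.isEmbedding.injective ((extChartAt (𝓡∂ (n + 1)) c).injOn
        (by rw [extChartAt_source]; exact hp) (by rw [extChartAt_source]; exact hq) e1))
    (fun p hp => (mvfderiv_clm_extChartAt_comp ι (dropVec n) hp).1)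
    (h := fun y => -chartExtend (𝓡∂ (n + 1)) c g (consVec n y))
    (fun p hp => by
      have h1 : ∀ i : Fin n, ∃ v, tangentMap ι p v = chartFrame (𝓡∂ (n + 1)) c (ι p) i.succ := by
        intro i
        refine exists_tangentMap_eq hι hp ?_
        rw [chartFrame, tangentCoord_tangentVec _ hp]
        simp
      choose u hu using h1
      have h2 : ∀ i, dropVec n (tangentCoord (𝓡∂ (n + 1)) c (ι p) (tangentMap ι p (u i))) =
          EuclideanSpace.basisFun (Fin n) ℝ i := by
        intro i
        rw [hu, chartFrame, tangentCoord_tangentVec _ hp, dropVec_basisFun_succ]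
      refine ⟨u, fun i => ?_, ?_⟩
      · exact ((mvfderiv_clm_extChartAt_comp ι (dropVec n) hp).2 (u i)).trans (h2 i)
      · have h3 := boundarySign_eq hι o hp u
        have h4 : ((EuclideanSpace.basisFun (Fin n) ℝ).toBasis.det fun i =>
            dropVec n (tangentCoord (𝓡∂ (n + 1)) c (ι p) (tangentMap ι p (u i)))) = 1 := by
          simp only [h2]
          rw [← OrthonormalBasis.coe_toBasis, Module.Basis.det_self]
        rw [h4] at h3
        rw [h3, hτc p hp, chartExtend_apply g hp, AlternatingMap.compLinearMap_apply]
        simp only [hu, hg, sign_one, SignType.coe_one]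
        ring)
  rw [hint, setIntegral_eq_integral_of_forall_compl_eq_zero, integral_neg]
  intro y hy
  rw [neg_eq_zero]
  -- A point of the hyperplane in the chart target comes from a boundary point of `M`, hence from
  -- `N`, and so lies in the image of `τ`.
  refine chartExtend_of_notMem _ fun hT => hy ?_
  have hs := symm_mem_source hT
  have hr := (extChartAt (𝓡∂ (n + 1)) c).right_inv hT
  have hb : (extChartAt (𝓡∂ (n + 1)) c).symm (consVec n y) ∈ Set.range ι := by
    rw [hι.range_eq, mem_boundary_iff hs, hr, consVec_zero]
  obtain ⟨p, hp⟩ := hb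
  refine ⟨p, ?_, ?_⟩
  · rw [hW, Set.mem_preimage, hp]
    exact hs
  · simp only [τ, hp, hr, dropVec_consVec]

include hι in
/-- Stokes' theorem for forms supported in a chart. -/
theorem stokes_chart {η : ∀ x : M, TangentSpace (𝓡∂ (n + 1)) x [⋀^Fin n]→ₗ[ℝ] ℝ}
    (hη : SmoothForm (𝓡∂ (n + 1)) η) {c : M} {C : Set M} (hC : IsClosed C)
    (hCs : C ⊆ (chartAt (EuclideanHalfSpace (n + 1)) c).source) (h0 : ∀ x ∉ C, η x = 0) :
    integral (𝓡∂ (n + 1)) (fun x => frameSign (o.orient x)) (dFormMap (𝓡∂ (n + 1)) η) =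
      integral (𝓡 n) (boundarySign o ι) (fun p => (η (ι p)).compLinearMap (tangentMap ι p)) := by
  rw [integral_boundary_eq hι o hη hCs h0]
  have hsgn := o.isOrientationSign
  set s : M → ℝ := fun x => frameSign (o.orient x) (chartFrame (𝓡∂ (n + 1)) c x) with hs
  -- The components of `η` with the signs that make its exterior derivative the divergence of a
  -- vector field; the factor `s` is locally constant and passes through derivatives.
  let g : Fin (n + 1) → M → ℝ := fun i x =>
    (-1) ^ (i : ℕ) * (s x * η x fun j => chartFrame (𝓡∂ (n + 1)) c x (i.succAbove j))
  let gD : M → ℝ := fun x => s x * dFormMap (𝓡∂ (n + 1)) η x (chartFrame (𝓡∂ (n + 1)) c x)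
  have hd0 : ∀ x ∉ C, dFormMap (𝓡∂ (n + 1)) η x = 0 := by
    intro x hx
    ext w
    rw [dFormMap_apply hη, dForm_congr (θ' := fun _ => 0), dForm_zero]
    · rfl
    · filter_upwards [hC.isOpen_compl.mem_nhds hx] with y hy
      exact h0 y hy
  have hg0 : ∀ i, ∀ x ∉ C, g i x = 0 := by
    intro i x hx
    simp only [g, h0 x hx, AlternatingMap.zero_apply, mul_zero]
  have hgD0 : ∀ x ∉ C, gD x = 0 := by
    intro x hx
    simp only [gD, hd0 x hx, AlternatingMap.zero_apply, mul_zero]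
  have hsev : ∀ x ∈ (chartAt (EuclideanHalfSpace (n + 1)) c).source, ∀ᶠ y in 𝓝 x, s y = s x :=
    fun x hx => hsgn.eventually_eq hx
  have hgc : ∀ i, ∀ x ∈ (chartAt (EuclideanHalfSpace (n + 1)) c).source,
      ContinuousAt (g i) x := by
    intro i x hx
    have h1 : ContinuousAt s x := continuousAt_const.congr
      ((hsev x hx).mono fun y hy => hy.symm)
    exact continuousAt_const.mul (h1.mul (hη.contMDiffAt hx _).continuousAt)
  have hgDc : ∀ x ∈ (chartAt (EuclideanHalfSpace (n + 1)) c).source, ContinuousAt gD x :=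
    fun x hx => hsgn.continuousAt hη.dFormMap.smoothTop.continuousTop hx
  obtain ⟨-, hint⟩ := integral_eq_setIntegral_image hsgn
    hη.dFormMap.smoothTop.continuousTop (chartAt (EuclideanHalfSpace (n + 1)) c).open_source
    (fun x hx => hd0 x fun h => hx (hCs h)) (τ := extChartAt (𝓡∂ (n + 1)) c)
    (fun x hx y hy e => (extChartAt (𝓡∂ (n + 1)) c).injOn (by simpa using hx) (by simpa using hy) e)
    (fun x hx => (mvfderiv_clm_extChartAt (I := 𝓡∂ (n + 1))
      (ContinuousLinearMap.id ℝ (EuclideanSpace ℝ (Fin (n + 1)))) hx).1)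
    (h := chartExtend (𝓡∂ (n + 1)) c gD)
    (fun x hx => ⟨chartFrame (𝓡∂ (n + 1)) c x, fun i => by
      refine ((mvfderiv_clm_extChartAt (I := 𝓡∂ (n + 1))
        (ContinuousLinearMap.id ℝ (EuclideanSpace ℝ (Fin (n + 1)))) hx).2 _).trans ?_
      exact tangentCoord_tangentVec _ hx _, chartExtend_apply gD hx⟩)
  have himg : extChartAt (𝓡∂ (n + 1)) c '' (chartAt (EuclideanHalfSpace (n + 1)) c).source =
      (extChartAt (𝓡∂ (n + 1)) c).target := by
    rw [← extChartAt_source (𝓡∂ (n + 1))]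
    exact (extChartAt (𝓡∂ (n + 1)) c).image_source_eq_target
  have hrange := range_modelWithCornersEuclideanHalfSpace (n + 1)
  have hsub : (extChartAt (𝓡∂ (n + 1)) c).target ⊆ {z | 0 ≤ z 0} := by
    rw [← hrange]
    exact extChartAt_target_subset_range c
  have hmeas : MeasurableSet {z : EuclideanSpace ℝ (Fin (n + 1)) | 0 ≤ z 0} := by
    rw [← hrange]
    exact (𝓡∂ (n + 1)).isClosed_range.measurableSet
  rw [hint, himg, ← setIntegral_eq_of_subset_of_forall_sdiff_eq_zero hmeas hsub
    fun z hz => chartExtend_of_notMem gD hz.2]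
  have hK := isCompact_chart_image (I := 𝓡∂ (n + 1)) hC.isCompact hCs
  have hdiv := integral_divergence_halfSpace (f := fun i => chartExtend (𝓡∂ (n + 1)) c (g i))
    (D := chartExtend (𝓡∂ (n + 1)) c gD) hK
    (fun i => hrange ▸ continuousOn_chartExtend hC.isCompact hCs (hgc i) (hg0 i))
    (hrange ▸ continuousOn_chartExtend hC.isCompact hCs hgDc hgD0)
    (fun z hz => by
      -- Inside the chart target the field is differentiated as a form; outside, it vanishes near
      -- `z` because its support has compact image.
      by_cases hT : z ∈ (extChartAt (𝓡∂ (n + 1)) c).target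
      · have hx := symm_mem_source hT
        set x := (extChartAt (𝓡∂ (n + 1)) c).symm z with hxdef
        have hzx : extChartAt (𝓡∂ (n + 1)) c x = z := (extChartAt (𝓡∂ (n + 1)) c).right_inv hT
        have hnhds : Set.range (𝓡∂ (n + 1)) ∈ 𝓝 z := by
          refine Filter.mem_of_superset (isOpen_interior.mem_nhds ?_) interior_subset
          rw [interior_range_modelWithCornersEuclideanHalfSpace]
          exact hz
        have hTn : (extChartAt (𝓡∂ (n + 1)) c).target ∈ 𝓝 z := by
          have := extChartAt_target_mem_nhdsWithin_of_mem hT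
          rwa [nhdsWithin_eq_nhds.2 hnhds] at this
        have hcd := hη.differentiable_chartForm hx
        rw [hzx] at hcd
        have hcd' := hcd.differentiableAt hnhds
        have hcs : ContinuousAt (extChartAt (𝓡∂ (n + 1)) c).symm z :=
          continuousAt_extChartAt_symm'' hT
        have hse : ∀ᶠ y in 𝓝 z, s ((extChartAt (𝓡∂ (n + 1)) c).symm y) = s x :=
          hcs.eventually (hsev x hx)
        let v : Fin (n + 1) → Fin n → EuclideanSpace ℝ (Fin (n + 1)) := fun i j =>
          EuclideanSpace.basisFun (Fin (n + 1)) ℝ (i.succAbove j)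
        have hv : ∀ i, DifferentiableAt ℝ
            (fun y => chartForm (𝓡∂ (n + 1)) η c y (v i)) z := fun i =>
          (ContinuousAlternatingMap.apply ℝ _ ℝ (v i)).differentiableAt.comp z hcd'
        refine ⟨fun i => ((-1) ^ (i : ℕ) * s x) •
          fderiv ℝ (fun y => chartForm (𝓡∂ (n + 1)) η c y (v i)) z, fun i => ?_, ?_⟩
        · refine ((hv i).hasFDerivAt.const_smul ((-1) ^ (i : ℕ) * s x)).congr_of_eventuallyEq ?_
          filter_upwards [hTn, hse] with y hy hsy
          rw [chartExtend_of_mem _ hy]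
          simp only [g, hsy, Pi.smul_apply, smul_eq_mul, mul_assoc]
          rfl
        · have e : (fun j => tangentCoord (𝓡∂ (n + 1)) c x (chartFrame (𝓡∂ (n + 1)) c x j)) =
              EuclideanSpace.basisFun (Fin (n + 1)) ℝ := funext fun j =>
            tangentCoord_tangentVec _ hx _
          have h2 : dFormMap (𝓡∂ (n + 1)) η x (chartFrame (𝓡∂ (n + 1)) c x) =
              ∑ i : Fin (n + 1), (-1 : ℝ) ^ (i : ℕ) • fderiv ℝ (fun y => chartForm (𝓡∂ (n + 1)) η c y (v i)) z
                (EuclideanSpace.basisFun (Fin (n + 1)) ℝ i) := by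
            rw [dFormMap_apply hη, dForm_eq_extDerivWithin _ hx (by rw [hzx]; exact hcd), e, hzx,
              extDerivWithin_apply hcd (hzx ▸ (𝓡∂ (n + 1)).uniqueDiffOn _
                (extChartAt_mem_range (𝓡∂ (n + 1)) c x))]
            refine Finset.sum_congr rfl fun i _ => ?_
            rw [fderivWithin_of_mem_nhds hnhds, zsmul_eq_mul, smul_eq_mul]
            push_cast
            rfl
          rw [chartExtend_of_mem _ hT]
          refine Eq.trans ?_ (congrArg (fun a => s x * a) h2.symm)
          rw [Finset.mul_sum]
          refine Finset.sum_congr rfl fun i _ => ?_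
          rw [smul_apply, smul_eq_mul, smul_eq_mul]
          ring
      · have hzK : z ∉ extChartAt (𝓡∂ (n + 1)) c '' C := by
          rintro ⟨x, hx, rfl⟩
          exact hT ((extChartAt (𝓡∂ (n + 1)) c).map_source (by simpa using hCs hx))
        refine ⟨fun _ => 0, fun i => ?_, ?_⟩
        · refine (hasFDerivAt_const (0 : ℝ) z).congr_of_eventuallyEq ?_
          filter_upwards [hK.isClosed.isOpen_compl.mem_nhds hzK] with y hy
          exact chartExtend_eq_zero (hg0 i) hy
        · rw [chartExtend_eq_zero hgD0 hzK]
          simp)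
    (fun i z hz => chartExtend_eq_zero (hg0 i) hz) (fun z hz => chartExtend_eq_zero hgD0 hz)
  rw [hdiv]
  have e : g 0 = fun x => s x * η x fun j => chartFrame (𝓡∂ (n + 1)) c x j.succ := by
    funext x
    simp [g]
  rw [e]

include hι in
/-- Stokes' theorem. -/
theorem stokes {η : ∀ x : M, TangentSpace (𝓡∂ (n + 1)) x [⋀^Fin n]→ₗ[ℝ] ℝ}
    (hη : SmoothForm (𝓡∂ (n + 1)) η) :
    integral (𝓡∂ (n + 1)) (fun x => frameSign (o.orient x)) (dFormMap (𝓡∂ (n + 1)) η) =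
      integral (𝓡 n) (boundarySign o ι) (fun p => (η (ι p)).compLinearMap (tangentMap ι p)) := by
  -- The sum of the `ρ c` is constant, so `d η` is the sum of the `d (ρ c • η)` and the chart case
  -- applies to each term.
  let ρ : M → M → ℝ := fun c => chartPartition (𝓡∂ (n + 1)) M c
  have hρ : ∀ c, ContMDiff (𝓡∂ (n + 1)) 𝓘(ℝ, ℝ) ∞ (ρ c) := fun c =>
    (chartPartition (𝓡∂ (n + 1)) M c).contMDiff
  have hs : ∀ c, SmoothForm (𝓡∂ (n + 1)) fun x => ρ c x • η x := fun c => hη.smul (hρ c)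
  have hsum : ∀ x, ∑ c ∈ chartIndex (𝓡∂ (n + 1)) M, ρ c x • η x = η x := fun x => by
    rw [← Finset.sum_smul, sum_chartPartition, one_smul]
  have h1 : dFormMap (𝓡∂ (n + 1)) η = fun x =>
      ∑ c ∈ chartIndex (𝓡∂ (n + 1)) M, dFormMap (𝓡∂ (n + 1)) (fun x => ρ c x • η x) x := by
    funext x
    ext w
    rw [dFormMap_apply hη, alternating_sum_apply]
    simp only [dFormMap_apply (hs _)]
    rw [← (dForm_sum _ hs x w).2]
    simp only [hsum]
  have h2 : (fun p => (η (ι p)).compLinearMap (tangentMap ι p)) = fun p =>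
      ∑ c ∈ chartIndex (𝓡∂ (n + 1)) M,
        (ρ c (ι p) • η (ι p)).compLinearMap (tangentMap ι p) := by
    funext p
    ext w
    rw [alternating_sum_apply]
    simp only [AlternatingMap.compLinearMap_apply]
    conv_lhs => rw [← hsum (ι p)]
    rw [alternating_sum_apply]
  rw [h1, h2, (integral_sum_form o.isOrientationSign _ fun c _ =>
    (hs c).dFormMap.smoothTop.continuousTop).2,
    (integral_sum_form (isOrientationSign_boundarySign hι o) _ fun c _ =>
      ((hs c).pull ι).smoothTop.continuousTop).2]
  refine Finset.sum_congr rfl fun c _ => stokes_chart hι o (hs c) (isClosed_tsupport (ρ c))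
    (chartPartition_subordinate c) fun x hx => ?_
  rw [image_eq_zero_of_notMem_tsupport hx, zero_smul]

end Stokes

/-! ### The Lagrange–Dirac condition for a nondegenerate pairing. -/

section DiracCondition

variable {V R : Type*} [AddCommGroup V] [Module ℝ V] [AddCommGroup R] [Module ℝ R]

/-- The Lagrange--Dirac condition for a nondegenerate bilinear pairing. -/
theorem lagrangeDiracCondition_iff (B : R →ₗ[ℝ] V →ₗ[ℝ] ℝ) (hR : ∀ a, (∀ v, B a v = 0) → a = 0)
    (hV : ∀ v, (∀ a, B a v = 0) → v = 0) {L : V → V → ℝ} {f : V → V → R} {φ ν : V} {p : R} {dφ : V}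
    {dp a b : R} (ha : ∀ δ, B a δ = partialPhi L φ ν δ) (hb : ∀ δ, B b δ = partialNu L φ ν δ) :
    LagrangeDiracCondition (fun a v => B a v) L f φ ν p dφ dp ↔
      dφ = ν ∧ p = b ∧ dp = a + f φ ν := by
  have hinj : Function.Injective fun (a : R) (v : V) => B a v := by
    intro c c' h
    refine sub_eq_zero.1 (hR _ fun v => ?_)
    rw [map_sub, LinearMap.sub_apply, sub_eq_zero]
    exact congrFun h v
  -- Injectivity of the pairing in the dual variable makes the chosen inverse return the true
  -- representative.
  have hrep : ∀ (c : R) (l : V → ℝ), (∀ δ, B c δ = l δ) →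
      representative (fun a v => B a v) l = c := by
    intro c l h
    have e : l = (fun (a : R) (v : V) => B a v) c := funext fun δ => (h δ).symm
    rw [e]
    exact Function.leftInverse_invFun hinj c
  have hder : ∀ (c c' : R) (v : V), deriv (fun ε : ℝ => B (c + ε • c') v) 0 = B c' v := by
    intro c c' v
    have : (fun ε : ℝ => B (c + ε • c') v) = fun ε => B c v + ε * B c' v := by
      funext ε
      simp
    rw [this]
    simp
  simp only [LagrangeDiracCondition, canonicalDirac, Set.mem_ofPred_eq, diracDifferential, tulczyjew,
    differential, forceField, hrep a _ ha, hrep b _ hb, covectorPairing, canonicalTwoForm,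
    canonicalOneForm, Prod.mk.injEq, true_and, Prod.mk_sub_mk, sub_zero, Prod.snd_add,
    Prod.smul_snd, hder]
  constructor
  · rintro ⟨h1, h2⟩
    refine ⟨?_, h1, ?_⟩
    · refine (sub_eq_zero.1 (hV _ fun c => ?_)).symm
      -- A vertical test vector isolates the velocity `dφ`; the horizontal one below isolates `dp`.
      have := h2 (0, c)
      simp only [map_zero, zero_add, zero_sub, neg_neg] at this
      rw [map_sub, this, sub_self]
    · refine sub_eq_zero.1 (hR _ fun v => ?_)
      have := h2 (v, 0)
      simp only [map_zero, LinearMap.zero_apply, add_zero, sub_zero, map_sub, map_neg,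
        LinearMap.sub_apply, LinearMap.neg_apply] at this
      simp only [map_sub, map_add, LinearMap.sub_apply, LinearMap.add_apply]
      linarith
  · rintro ⟨rfl, rfl, rfl⟩
    refine ⟨rfl, fun w => ?_⟩
    simp only [map_sub, map_neg, map_add, LinearMap.sub_apply, LinearMap.neg_apply,
      LinearMap.add_apply]
    ring

end DiracCondition

/-! ### Nondegeneracy of pairings given by integrals. -/

section FieldPairing

variable {n : ℕ}
  {M : Type*} [TopologicalSpace M] [ChartedSpace (EuclideanHalfSpace (n + 1)) M]
  [IsManifold (𝓡∂ (n + 1)) ∞ M] [T2Space M] [CompactSpace M]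
  {N : Type*} [TopologicalSpace N] [ChartedSpace (EuclideanSpace ℝ (Fin n)) N]
  [IsManifold (𝓡 n) ∞ N] [T2Space N] [CompactSpace N]
  {F : Type*} [NormedAddCommGroup F] [NormedSpace ℝ F]
  {E : M → Type*} [∀ x, AddCommGroup (E x)] [∀ x, Module ℝ (E x)]
  [TopologicalSpace (Bundle.TotalSpace F E)] [∀ x, TopologicalSpace (E x)]
  [FiberBundle F E] [VectorBundle ℝ F E]

/-- The product of a smooth function and a smooth form. -/
def funSmul {k : ℕ} {f : M → ℝ} (hf : ContMDiff (𝓡∂ (n + 1)) 𝓘(ℝ, ℝ) ∞ f)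
    (φ : Omega (𝓡∂ (n + 1)) F E k) : Omega (𝓡∂ (n + 1)) F E k :=
  ⟨fun y => f y • φ.1 y, smul_mem_Omega hf φ⟩

/-- A pairing of forms with elements of `R`, which is the sum of integrals over `M` and over its
boundary of fields that depend pointwise on the form, and which is nondegenerate pointwise. -/
structure IsFieldPairing {R : Type*} [AddCommGroup R] [Module ℝ R]
    (o : ManifoldOrientation (𝓡∂ (n + 1)) M) (ι : C^∞⟮𝓡 n, N; 𝓡∂ (n + 1), M⟯) {k : ℕ}
    (pair : R → Omega (𝓡∂ (n + 1)) F E k → ℝ)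
    (θ : R → Omega (𝓡∂ (n + 1)) F E k →
      ∀ x : M, TangentSpace (𝓡∂ (n + 1)) x [⋀^Fin (n + 1)]→ₗ[ℝ] ℝ)
    (β : R → Omega (𝓡∂ (n + 1)) F E k → ∀ p : N, TangentSpace (𝓡 n) p [⋀^Fin n]→ₗ[ℝ] ℝ) :
    Prop where
  pair_eq : ∀ a φ, pair a φ =
    integral (𝓡∂ (n + 1)) (fun x => frameSign (o.orient x)) (θ a φ) +
      integral (𝓡 n) (boundarySign o ι) (β a φ)
  continuous_interior : ∀ a φ, ContinuousTop (𝓡∂ (n + 1)) (θ a φ)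
  continuous_boundary : ∀ a φ, ContinuousTop (𝓡 n) (β a φ)
  add_left : ∀ a a' φ, θ (a + a') φ = (fun x => θ a φ x + θ a' φ x) ∧
    β (a + a') φ = fun p => β a φ p + β a' φ p
  smul_left : ∀ (c : ℝ) a φ, θ (c • a) φ = (fun x => c • θ a φ x) ∧
    β (c • a) φ = fun p => c • β a φ p
  add_right : ∀ a φ φ', θ a (φ + φ') = (fun x => θ a φ x + θ a φ' x) ∧
    β a (φ + φ') = fun p => β a φ p + β a φ' p
  smul_right : ∀ a {f : M → ℝ} (hf : ContMDiff (𝓡∂ (n + 1)) 𝓘(ℝ, ℝ) ∞ f) φ,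
    θ a (funSmul hf φ) = (fun x => f x • θ a φ x) ∧
    β a (funSmul hf φ) = fun p => f (ι p) • β a φ p
  eq_zero : ∀ a, (∀ φ x, θ a φ x = 0) → (∀ φ p, β a φ p = 0) → a = 0
  exists_ne_zero : ∀ (φ : Omega (𝓡∂ (n + 1)) F E k) x, φ.1 x ≠ 0 → ∃ a, θ a φ x ≠ 0 ∧
    ∀ f : M → ℝ, ContMDiff (𝓡∂ (n + 1)) 𝓘(ℝ, ℝ) ∞ f →
      ∃ a', θ a' φ = (fun y => f y • θ a φ y) ∧ β a' φ = fun _ => 0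

namespace IsFieldPairing

variable {R : Type*} [AddCommGroup R] [Module ℝ R]
  {o : ManifoldOrientation (𝓡∂ (n + 1)) M} {ι : C^∞⟮𝓡 n, N; 𝓡∂ (n + 1), M⟯} {k : ℕ}
  {pair : R → Omega (𝓡∂ (n + 1)) F E k → ℝ}
  {θ : R → Omega (𝓡∂ (n + 1)) F E k →
    ∀ x : M, TangentSpace (𝓡∂ (n + 1)) x [⋀^Fin (n + 1)]→ₗ[ℝ] ℝ}
  {β : R → Omega (𝓡∂ (n + 1)) F E k → ∀ p : N, TangentSpace (𝓡 n) p [⋀^Fin n]→ₗ[ℝ] ℝ}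
  (hP : IsFieldPairing o ι pair θ β) (hι : IsBoundaryInclusion ι)

include hP

include hι in
theorem pair_add_left (a a' : R) (φ) : pair (a + a') φ = pair a φ + pair a' φ := by
  rw [hP.pair_eq, hP.pair_eq, hP.pair_eq, (hP.add_left a a' φ).1, (hP.add_left a a' φ).2,
    integral_add_form o.isOrientationSign (hP.continuous_interior a φ) (hP.continuous_interior a' φ),
    integral_add_form (isOrientationSign_boundarySign hι o) (hP.continuous_boundary a φ)
      (hP.continuous_boundary a' φ)]
  ring

include hι in
theorem pair_add_right (a : R) (φ φ') : pair a (φ + φ') = pair a φ + pair a φ' := by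
  rw [hP.pair_eq, hP.pair_eq, hP.pair_eq, (hP.add_right a φ φ').1, (hP.add_right a φ φ').2,
    integral_add_form o.isOrientationSign (hP.continuous_interior a φ) (hP.continuous_interior a φ'),
    integral_add_form (isOrientationSign_boundarySign hι o) (hP.continuous_boundary a φ)
      (hP.continuous_boundary a φ')]
  ring

theorem pair_smul_left (c : ℝ) (a : R) (φ) : pair (c • a) φ = c * pair a φ := by
  rw [hP.pair_eq, hP.pair_eq, (hP.smul_left c a φ).1, (hP.smul_left c a φ).2, integral_smul_form,
    integral_smul_form]
  ring

theorem pair_smul_right (c : ℝ) (a : R) (φ) : pair a (c • φ) = c * pair a φ := by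
  have e : c • φ = funSmul (contMDiff_const (c := c)) φ := rfl
  rw [e, hP.pair_eq, hP.pair_eq, (hP.smul_right a contMDiff_const φ).1,
    (hP.smul_right a contMDiff_const φ).2, integral_smul_form, integral_smul_form]
  ring

include hι in
-- Bumps vanishing on the boundary remove the boundary integral, which settles interior points;
-- boundary points are limits of these.
theorem interior_eq_zero {a : R} (h : ∀ φ, pair a φ = 0) (φ) (x : M) : θ a φ x = 0 := by
  have hcl : IsClosed ((𝓡∂ (n + 1)).boundary M) :=
    (𝓡∂ (n + 1)).isClosed_boundary (n := ∞) (by simp)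
  have hint : ∀ x ∉ (𝓡∂ (n + 1)).boundary M, θ a φ x = 0 := by
    intro x hx
    refine eq_zero_of_forall_integral_eq_zero o.isOrientationSign (hP.continuous_interior a φ) x
      fun U hU => ?_
    obtain ⟨ρ, hρ, hs, h0, h1⟩ := exists_bump (I := 𝓡∂ (n + 1))
      (Filter.inter_mem hU (hcl.isOpen_compl.mem_nhds hx))
    refine ⟨ρ, hρ.continuous, h0, by rw [h1.self_of_nhds]; exact one_ne_zero,
      fun y hy => (hs (subset_tsupport _ hy)).1, ?_⟩
    have h2 := h (funSmul hρ φ)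
    have h3 : (fun p => ρ (ι p) • β a φ p) = fun _ => 0 := by
      funext p
      have : ρ (ι p) = 0 := by
        by_contra hne
        refine (hs (subset_tsupport _ hne)).2 ?_
        rw [← hι.range_eq]
        exact ⟨p, rfl⟩
      rw [this, zero_smul]
    rwa [hP.pair_eq, (hP.smul_right a hρ φ).1, (hP.smul_right a hρ φ).2, h3, integral_zero_form,
      add_zero] at h2
  have hxx := mem_chart_source (EuclideanHalfSpace (n + 1)) x
  have h1 : ContinuousOn (fun z => (fun y => θ a φ y (chartFrame (𝓡∂ (n + 1)) x y))
      ((extChartAt (𝓡∂ (n + 1)) x).symm z)) (extChartAt (𝓡∂ (n + 1)) x).target :=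
    continuousOn_comp_symm fun y hy => (hP.continuous_interior a φ).continuousAt hy
  have h2 : Set.EqOn (fun z => (fun y => θ a φ y (chartFrame (𝓡∂ (n + 1)) x y))
      ((extChartAt (𝓡∂ (n + 1)) x).symm z)) (fun _ => 0)
      (interior (extChartAt (𝓡∂ (n + 1)) x).target) := by
    intro z hz
    have hzt := interior_subset hz
    have hz0 : 0 < z 0 := by
      have := interior_mono (extChartAt_target_subset_range x) hz
      rwa [interior_range_modelWithCornersEuclideanHalfSpace] at this
    have : θ a φ ((extChartAt (𝓡∂ (n + 1)) x).symm z) = 0 := by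
      refine hint _ fun hb => ?_
      rw [mem_boundary_iff (symm_mem_source hzt), (extChartAt (𝓡∂ (n + 1)) x).right_inv hzt] at hb
      exact hz0.ne' hb
    simp only [this, AlternatingMap.zero_apply]
  have h3 := (h2.of_subset_closure h1 continuousOn_const interior_subset
    (chart_target_subset_closure x)) (mem_extChartAt_target x)
  have h4 : (fun y => θ a φ y (chartFrame (𝓡∂ (n + 1)) x y))
      ((extChartAt (𝓡∂ (n + 1)) x).symm (extChartAt (𝓡∂ (n + 1)) x x)) = 0 := h3
  rw [extChartAt_to_inv] at h4
  have h5 : θ a φ x (chartFrame (𝓡∂ (n + 1)) x x) = 0 := h4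
  rw [(θ a φ x).eq_smul_basis_det (chartBasis (𝓡∂ (n + 1)) hxx), coe_chartBasis, h5, zero_smul]

include hι in
-- The interior term is already zero for every test form, so bumps on `M` need not avoid anything;
-- as `ι` is an embedding they localise on `N`.
theorem boundary_eq_zero {a : R} (h : ∀ φ, pair a φ = 0) (φ) (p : N) : β a φ p = 0 := by
  refine eq_zero_of_forall_integral_eq_zero (isOrientationSign_boundarySign hι o)
    (hP.continuous_boundary a φ) p fun U hU => ?_
  rw [hι.isEmbedding.isInducing.nhds_eq_comap, Filter.mem_comap] at hU
  obtain ⟨V, hV, hVU⟩ := hU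
  obtain ⟨ρ, hρ, hs, h0, h1⟩ := exists_bump (I := 𝓡∂ (n + 1)) hV
  refine ⟨fun q => ρ (ι q), hρ.continuous.comp ι.contMDiff.continuous, fun q => h0 _,
    by simp only [h1.self_of_nhds]; exact one_ne_zero,
    fun q hq => hVU (hs (subset_tsupport _ hq)), ?_⟩
  have h2 := h (funSmul hρ φ)
  have h3 : θ a (funSmul hρ φ) = fun _ => 0 := funext fun x => hP.interior_eq_zero hι h _ x
  rwa [hP.pair_eq, h3, (hP.smul_right a hρ φ).2, integral_zero_form, zero_add] at h2

include hι in
theorem eq_zero_left {a : R} (h : ∀ φ, pair a φ = 0) : a = 0 :=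
  hP.eq_zero a (hP.interior_eq_zero hι h) (hP.boundary_eq_zero hι h)

/-- Here the localisation is on the dual side: `exists_ne_zero` provides elements with no boundary
part that can be multiplied by any bump function. -/
theorem eq_zero_right {φ : Omega (𝓡∂ (n + 1)) F E k} (h : ∀ a, pair a φ = 0) : φ = 0 := by
  by_contra hne
  obtain ⟨x, hx⟩ : ∃ x, φ.1 x ≠ 0 := by
    by_contra! hall
    exact hne (Subtype.ext (funext hall))
  obtain ⟨a, ha, hf⟩ := hP.exists_ne_zero φ x hx
  refine ha (eq_zero_of_forall_integral_eq_zero o.isOrientationSign (hP.continuous_interior a φ) x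
    fun U hU => ?_)
  obtain ⟨ρ, hρ, hs, h0, h1⟩ := exists_bump (I := 𝓡∂ (n + 1)) hU
  obtain ⟨a', ha', hb'⟩ := hf ρ hρ
  refine ⟨ρ, hρ.continuous, h0, by rw [h1.self_of_nhds]; exact one_ne_zero,
    fun y hy => hs (subset_tsupport _ hy), ?_⟩
  have h2 := h a'
  rwa [hP.pair_eq, ha', hb', integral_zero_form, add_zero] at h2

include hι in
/-- The Lagrange--Dirac condition in terms of the representatives of the partial functional
derivatives. -/
theorem lagrangeDiracCondition_iff
    {L : Omega (𝓡∂ (n + 1)) F E k → Omega (𝓡∂ (n + 1)) F E k → ℝ}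
    {f : Omega (𝓡∂ (n + 1)) F E k → Omega (𝓡∂ (n + 1)) F E k → R}
    {φ ν : Omega (𝓡∂ (n + 1)) F E k} {p : R} {dφ : Omega (𝓡∂ (n + 1)) F E k} {dp a b : R}
    (ha : ∀ δ, pair a δ = partialPhi L φ ν δ) (hb : ∀ δ, pair b δ = partialNu L φ ν δ) :
    LagrangeDiracCondition pair L f φ ν p dφ dp ↔ dφ = ν ∧ p = b ∧ dp = a + f φ ν :=
  LagrangeDirac.lagrangeDiracCondition_iff
    (LinearMap.mk₂ ℝ pair (hP.pair_add_left hι) hP.pair_smul_left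
      (fun a φ φ' => hP.pair_add_right hι a φ φ') fun c a φ => hP.pair_smul_right c a φ)
    (fun _ h => hP.eq_zero_left hι h) (fun _ h => hP.eq_zero_right h) ha hb

end IsFieldPairing

end FieldPairing

/-! ### The three concrete pairings. -/

section Pairings

variable {n : ℕ}
  {M : Type*} [TopologicalSpace M] [ChartedSpace (EuclideanHalfSpace (n + 1)) M]
  [IsManifold (𝓡∂ (n + 1)) ∞ M] [T2Space M] [CompactSpace M]
  {N : Type*} [TopologicalSpace N] [ChartedSpace (EuclideanSpace ℝ (Fin n)) N]
  [IsManifold (𝓡 n) ∞ N] [T2Space N] [CompactSpace N]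
  {F : Type*} [NormedAddCommGroup F] [NormedSpace ℝ F] [FiniteDimensional ℝ F]
  {E : M → Type*} [∀ x, AddCommGroup (E x)] [∀ x, Module ℝ (E x)]
  [TopologicalSpace (Bundle.TotalSpace F E)] [∀ x, TopologicalSpace (E x)]
  [∀ x, IsTopologicalAddGroup (E x)] [∀ x, ContinuousSMul ℝ (E x)]
  [FiberBundle F E] [VectorBundle ℝ F E] [ContMDiffVectorBundle ∞ F E (𝓡∂ (n + 1))]
  {k : ℕ} (o : ManifoldOrientation (𝓡∂ (n + 1)) M) {ι : C^∞⟮𝓡 n, N; 𝓡∂ (n + 1), M⟯}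
  (hι : IsBoundaryInclusion ι)

include hι in
-- A form on the boundary is extended at one point by a left inverse of the differential, and then
-- to a smooth form on `M`.
theorem exists_pullForm_eq (p : N) (θ : Form (𝓡 n) (ι *ᵖ E) k p) :
    ∃ φ : Omega (𝓡∂ (n + 1)) F E k, pullForm ι φ.1 p = θ := by
  let θ₀ : TangentSpace (𝓡 n) p [⋀^Fin k]→ₗ[ℝ] E (ι p) := θ
  obtain ⟨φ, hφ⟩ := exists_omega_eq (I := 𝓡∂ (n + 1)) (F := F) (E := E) (ι p)
    (θ₀.compLinearMap (tangentMap ι p).leftInverse)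
  refine ⟨φ, ?_⟩
  ext u
  change φ.1 (ι p) (fun i => tangentMap ι p (u i)) = θ u
  rw [hφ, AlternatingMap.compLinearMap_apply]
  simp only [leftInverse_tangentMap ι (hι.injective_mfderiv p)]
  rfl

include hι in
theorem isFieldPairing_star : IsFieldPairing o ι (pairStar (F := F) (E := E) (k := k) o ι)
    (fun a φ x => contract (tangentBasis (𝓡∂ (n + 1)) x) (a.1.1 x) (φ.1 x))
    (fun a φ p => contract (tangentBasis (𝓡 n) p) (a.2.1 p) (pullForm ι φ.1 p)) where
  pair_eq _ _ := rfl
  continuous_interior a φ := (smoothForm_contract a.1 φ).smoothTop.continuousTop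
  continuous_boundary a φ :=
    (smoothForm_contract (E := ι *ᵖ E) a.2 ⟨_, pullForm_mem ι φ⟩).smoothTop.continuousTop
  add_left a a' φ := ⟨funext fun x => contract_add_left _ (a.1.1 x) (a'.1.1 x) (φ.1 x),
    funext fun p => contract_add_left (A := (ι *ᵖ E) p) _ (a.2.1 p) (a'.2.1 p) (pullForm ι φ.1 p)⟩
  smul_left c a φ := ⟨funext fun x => contract_smul_left _ c (a.1.1 x) (φ.1 x),
    funext fun p => contract_smul_left (A := (ι *ᵖ E) p) _ c (a.2.1 p) (pullForm ι φ.1 p)⟩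
  add_right a φ φ' := ⟨funext fun x => contract_add_right _ (a.1.1 x) (φ.1 x) (φ'.1 x),
    funext fun p => contract_add_right (A := (ι *ᵖ E) p) _ (a.2.1 p) (pullForm ι φ.1 p)
      (pullForm ι φ'.1 p)⟩
  smul_right a f hf φ := ⟨funext fun x => contract_smul_right _ (a.1.1 x) (f x) (φ.1 x),
    funext fun p => contract_smul_right (A := (ι *ᵖ E) p) _ (a.2.1 p) (f (ι p))
      (pullForm ι φ.1 p)⟩
  eq_zero a h1 h2 := by
    refine Prod.ext (Subtype.ext (funext fun x => ?_)) (Subtype.ext (funext fun p => ?_))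
    · refine eq_zero_of_contract_left (tangentBasis (𝓡∂ (n + 1)) x) _ fun θ => ?_
      obtain ⟨φ, rfl⟩ := exists_omega_eq (I := 𝓡∂ (n + 1)) (F := F) (E := E) x θ
      exact h1 φ x
    · refine eq_zero_of_contract_left (A := (ι *ᵖ E) p) (tangentBasis (𝓡 n) p) _ fun θ => ?_
      obtain ⟨φ, rfl⟩ := exists_pullForm_eq (F := F) hι p θ
      exact h2 φ p
  exists_ne_zero φ x hx := by
    obtain ⟨χ, hχ⟩ := exists_contract_ne (F := F) hx
    refine ⟨(χ, 0), hχ, fun f hf => ⟨(⟨_, smul_mem_Lambda hf χ⟩, 0), ?_, ?_⟩⟩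
    · exact funext fun y => contract_smul_left _ (f y) (χ.1 y) (φ.1 y)
    · refine funext fun p => ?_
      have := contract_smul_left (A := (ι *ᵖ E) p) (tangentBasis (𝓡 n) p) 0
        (0 : SkewTensor (TangentSpace (𝓡 n) p) ((ι *ᵖ E) p) k n) (pullForm ι φ.1 p)
      rw [zero_smul, zero_smul] at this
      exact this

include hι in
theorem isFieldPairing_dagger {j : ℕ} (h : k + j = n) :
    IsFieldPairing o ι (pairDagger (F := F) (E := E) (k := k) o ι h)
    (fun a φ x => wedge (congrArg Nat.succ h) (φ.1 x) (a.1.1 x))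
    (fun a φ p => wedge h (pullForm ι φ.1 p) (a.2.1 p)) where
  pair_eq _ _ := rfl
  continuous_interior a φ :=
    (smoothForm_wedge (congrArg Nat.succ h) φ a.1).smoothTop.continuousTop
  continuous_boundary a φ :=
    (smoothForm_wedge (E := ι *ᵖ E) h ⟨_, pullForm_mem ι φ⟩ a.2).smoothTop.continuousTop
  add_left a a' φ := ⟨funext fun x => wedge_add_right _ (φ.1 x) (a.1.1 x) (a'.1.1 x),
    funext fun p => wedge_add_right (A := (ι *ᵖ E) p) _ (pullForm ι φ.1 p) (a.2.1 p) (a'.2.1 p)⟩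
  smul_left c a φ := ⟨funext fun x => wedge_smul_right _ c (φ.1 x) (a.1.1 x),
    funext fun p => wedge_smul_right (A := (ι *ᵖ E) p) _ c (pullForm ι φ.1 p) (a.2.1 p)⟩
  add_right a φ φ' := ⟨funext fun x => wedge_add_left _ (φ.1 x) (φ'.1 x) (a.1.1 x),
    funext fun p => wedge_add_left (A := (ι *ᵖ E) p) _ (pullForm ι φ.1 p)
      (pullForm ι φ'.1 p) (a.2.1 p)⟩
  smul_right a f hf φ := ⟨funext fun x => wedge_smul_left _ (f x) (φ.1 x) (a.1.1 x),
    funext fun p => wedge_smul_left (A := (ι *ᵖ E) p) _ (f (ι p)) (pullForm ι φ.1 p) (a.2.1 p)⟩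
  eq_zero a h1 h2 := by
    refine Prod.ext (Subtype.ext (funext fun x => ?_)) (Subtype.ext (funext fun p => ?_))
    · refine eq_zero_of_wedge_left (congrArg Nat.succ h) (tangentBasis (𝓡∂ (n + 1)) x) _
        fun θ => ?_
      obtain ⟨φ, rfl⟩ := exists_omega_eq (I := 𝓡∂ (n + 1)) (F := F) (E := E) x θ
      exact h1 φ x
    · refine eq_zero_of_wedge_left (A := (ι *ᵖ E) p) h (tangentBasis (𝓡 n) p) _ fun θ => ?_
      obtain ⟨φ, rfl⟩ := exists_pullForm_eq (F := F) hι p θ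
      exact h2 φ p
  exists_ne_zero φ x hx := by
    obtain ⟨ψ, hψ⟩ := exists_wedge_ne (F := F) (j := j + 1)
      (show k + (j + 1) = n + 1 from congrArg Nat.succ h) hx
    refine ⟨(ψ, 0), hψ, fun f hf => ⟨(⟨_, smul_mem_OmegaDual hf ψ⟩, 0), ?_, ?_⟩⟩
    · exact funext fun y => wedge_smul_right _ (f y) (φ.1 y) (ψ.1 y)
    · refine funext fun p => ?_
      have := wedge_smul_right (A := (ι *ᵖ E) p) h 0 (pullForm ι φ.1 p) 0
      rw [zero_smul, zero_smul] at this
      exact this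

/-- For `k = m` the dual has no boundary component, so the boundary field is taken to be zero and
the general argument applies unchanged. -/
theorem isFieldPairing_daggerTop (h : k = n + 1) :
    IsFieldPairing o ι (pairDaggerTop (F := F) (E := E) (k := k) o h)
    (fun a φ x => wedge (j := 0) h (φ.1 x) (a.1 x)) (fun _ _ _ => 0) where
  pair_eq a φ := by rw [integral_zero_form, add_zero]; rfl
  continuous_interior a φ := (smoothForm_wedge (j := 0) h φ a).smoothTop.continuousTop
  continuous_boundary a φ := fun _ => continuousAt_const
  add_left a a' φ := ⟨funext fun x => wedge_add_right _ (φ.1 x) (a.1 x) (a'.1 x),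
    funext fun p => (add_zero _).symm⟩
  smul_left c a φ := ⟨funext fun x => wedge_smul_right _ c (φ.1 x) (a.1 x),
    funext fun p => (smul_zero _).symm⟩
  add_right a φ φ' := ⟨funext fun x => wedge_add_left _ (φ.1 x) (φ'.1 x) (a.1 x),
    funext fun p => (add_zero _).symm⟩
  smul_right a f hf φ := ⟨funext fun x => wedge_smul_left _ (f x) (φ.1 x) (a.1 x),
    funext fun p => (smul_zero _).symm⟩
  eq_zero a h1 _ := by
    refine Subtype.ext (funext fun x => ?_)
    refine eq_zero_of_wedge_left (j := 0) h (tangentBasis (𝓡∂ (n + 1)) x) _ fun θ => ?_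
    obtain ⟨φ, rfl⟩ := exists_omega_eq (I := 𝓡∂ (n + 1)) (F := F) (E := E) x θ
    exact h1 φ x
  exists_ne_zero φ x hx := by
    obtain ⟨ψ, hψ⟩ := exists_wedge_ne (F := F) (j := 0) h hx
    exact ⟨ψ, hψ, fun f hf => ⟨⟨_, smul_mem_OmegaDual hf ψ⟩,
      funext fun y => wedge_smul_right _ (f y) (φ.1 y) (ψ.1 y), rfl⟩⟩

end Pairings

/-! ### Partial functional derivatives of the Lagrangian. -/

section FunctionalDerivatives

variable {n : ℕ}
  {M : Type*} [TopologicalSpace M] [ChartedSpace (EuclideanHalfSpace (n + 1)) M]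
  [IsManifold (𝓡∂ (n + 1)) ∞ M] [T2Space M] [CompactSpace M]
  {F : Type*} [NormedAddCommGroup F] [NormedSpace ℝ F] [FiniteDimensional ℝ F]
  {E : M → Type*} [∀ x, AddCommGroup (E x)] [∀ x, Module ℝ (E x)]
  [TopologicalSpace (Bundle.TotalSpace F E)] [∀ x, TopologicalSpace (E x)]
  [∀ x, IsTopologicalAddGroup (E x)] [∀ x, ContinuousSMul ℝ (E x)]
  [FiberBundle F E] [VectorBundle ℝ F E] [ContMDiffVectorBundle ∞ F E (𝓡∂ (n + 1))]
  {k : ℕ} (o : ManifoldOrientation (𝓡∂ (n + 1)) M) (nab : CovariantDerivative (𝓡∂ (n + 1)) F E)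
  [CovariantDerivative.ContMDiffCovariantDerivative nab ∞]
  {ℒ : Density n E k} (hℒ : ℒ.IsSmooth F) (φ ν δ : Omega (𝓡∂ (n + 1)) F E k)

include hℒ

/-- Along a line of smooth fields the density is a smooth family of top forms, so differentiation
under the integral applies; at `0` the derivative agrees with `densityDeriv` by uniqueness. -/
theorem hasDerivAt_integral_density (δν : Omega (𝓡∂ (n + 1)) F E k)
    (δζ : Omega (𝓡∂ (n + 1)) F E (k + 1)) :
    HasDerivAt (fun ε : ℝ => integral (𝓡∂ (n + 1)) (fun x => frameSign (o.orient x)) fun x =>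
        ℒ x (φ.1 x + ε • δ.1 x) (ν.1 x + ε • δν.1 x) (extCovDeriv nab φ x + ε • δζ.1 x))
      (integral (𝓡∂ (n + 1)) (fun x => frameSign (o.orient x)) fun x =>
        densityDeriv nab φ ν ℒ x (δ.1 x, δν.1 x, δζ.1 x)) 0 := by
  have h := hℒ.smoothTopFamily φ ν δ δν ⟨_, extCovDeriv_mem nab φ⟩ δζ
  obtain ⟨θ', h1, h2⟩ := h.exists_deriv
  have e : (fun x => densityDeriv nab φ ν ℒ x (δ.1 x, δν.1 x, δζ.1 x)) = θ' 0 := by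
    funext x
    ext u
    exact (densityDeriv_spec nab hℒ φ ν x (δ.1 x, δν.1 x, δζ.1 x) u).unique (h2 0 x u)
  rw [e]
  exact hasDerivAt_integral o.isOrientationSign (fun ε => (h.smoothTop ε).continuousTop)
    (fun ε c => (h1 ε c).continuousAt) h2

/-- Since `d^∇` is linear, varying `φ` along `δ` moves the arguments of the density along the line
with direction `(δ, 0, d^∇ δ)`. -/
theorem partialPhi_lagrangian : partialPhi (lagrangian o nab ℒ) φ ν δ =
    integral (𝓡∂ (n + 1)) (fun x => frameSign (o.orient x)) fun x =>
      densityDeriv nab φ ν ℒ x (δ.1 x, 0, extCovDeriv nab δ x) := by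
  have h := hasDerivAt_integral_density o nab hℒ φ ν δ 0 ⟨_, extCovDeriv_mem nab δ⟩
  refine Eq.trans ?_ h.deriv
  rw [partialPhi]
  congr 1
  funext ε
  rw [lagrangian]
  congr 1
  funext x
  rw [extCovDeriv_add, extCovDeriv_smul]
  have e : ν.1 x + ε • (0 : Omega (𝓡∂ (n + 1)) F E k).1 x = ν.1 x := by
    refine (congrArg (fun a => ν.1 x + a) (smul_zero ε)).trans (add_zero _)
  rw [e]
  rfl

theorem partialNu_lagrangian : partialNu (lagrangian o nab ℒ) φ ν δ =
    integral (𝓡∂ (n + 1)) (fun x => frameSign (o.orient x)) fun x =>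
      densityDeriv nab φ ν ℒ x (0, δ.1 x, 0) := by
  have h := hasDerivAt_integral_density o nab hℒ φ ν 0 δ 0
  refine Eq.trans ?_ h.deriv
  rw [partialNu]
  congr 1
  funext ε
  rw [lagrangian]
  congr 1
  funext x
  have e : φ.1 x + ε • (0 : Omega (𝓡∂ (n + 1)) F E k).1 x = φ.1 x := by
    refine (congrArg (fun a => φ.1 x + a) (smul_zero ε)).trans (add_zero _)
  have e' : extCovDeriv nab φ x + ε • (0 : Omega (𝓡∂ (n + 1)) F E (k + 1)).1 x =
      extCovDeriv nab φ x := by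
    refine (congrArg (fun a => extCovDeriv nab φ x + a) (smul_zero ε)).trans (add_zero _)
  rw [e, e']
  rfl

end FunctionalDerivatives

/-! ### Integration by parts and the representatives in the restricted duals. -/

section Representatives

variable {n : ℕ}
  {M : Type*} [TopologicalSpace M] [ChartedSpace (EuclideanHalfSpace (n + 1)) M]
  [IsManifold (𝓡∂ (n + 1)) ∞ M] [T2Space M] [CompactSpace M]
  {N : Type*} [TopologicalSpace N] [ChartedSpace (EuclideanSpace ℝ (Fin n)) N]
  [IsManifold (𝓡 n) ∞ N] [T2Space N] [CompactSpace N]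
  {F : Type*} [NormedAddCommGroup F] [NormedSpace ℝ F] [FiniteDimensional ℝ F]
  {E : M → Type*} [∀ x, AddCommGroup (E x)] [∀ x, Module ℝ (E x)]
  [TopologicalSpace (Bundle.TotalSpace F E)] [∀ x, TopologicalSpace (E x)]
  [∀ x, IsTopologicalAddGroup (E x)] [∀ x, ContinuousSMul ℝ (E x)]
  [FiberBundle F E] [VectorBundle ℝ F E] [ContMDiffVectorBundle ∞ F E (𝓡∂ (n + 1))]
  {k : ℕ} (o : ManifoldOrientation (𝓡∂ (n + 1)) M) {ι : C^∞⟮𝓡 n, N; 𝓡∂ (n + 1), M⟯}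
  (hι : IsBoundaryInclusion ι) (nab : CovariantDerivative (𝓡∂ (n + 1)) F E)
  [CovariantDerivative.ContMDiffCovariantDerivative nab ∞]
  {ℒ : Density n E k} (hℒ : ℒ.IsSmooth F) (φ ν δ : Omega (𝓡∂ (n + 1)) F E k)

include hℒ

theorem densityDeriv_add_densityDeriv (x : M) (a : Form (𝓡∂ (n + 1)) E k x)
    (b : Form (𝓡∂ (n + 1)) E (k + 1) x) :
    densityDeriv nab φ ν ℒ x (a, 0, b) =
      densityDeriv nab φ ν ℒ x (a, 0, 0) + densityDeriv nab φ ν ℒ x (0, 0, b) := by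
  rw [← map_add]
  congr 1
  refine Prod.ext (add_zero _).symm (Prod.ext (add_zero _).symm (zero_add _).symm)

/-- Smoothness of the divergence term need not be proved directly: its product with a test form is a
smooth derivative of the density minus a smooth exact form. -/
theorem smoothTop_of_add_dForm
    {θ : ∀ x : M, TangentSpace (𝓡∂ (n + 1)) x [⋀^Fin (n + 1)]→ₗ[ℝ] ℝ}
    {η : ∀ x : M, TangentSpace (𝓡∂ (n + 1)) x [⋀^Fin n]→ₗ[ℝ] ℝ}
    (hη : SmoothForm (𝓡∂ (n + 1)) η)
    (hθ : ∀ x w, θ x w + dForm (𝓡∂ (n + 1)) η x w =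
      densityDeriv nab φ ν ℒ x (δ.1 x, 0, extCovDeriv nab δ x) w) :
    SmoothTop (𝓡∂ (n + 1)) θ := by
  intro c
  have h := (smoothTop_densityDeriv nab hℒ φ ν δ 0 ⟨_, extCovDeriv_mem nab δ⟩ c).sub
    (hη.dFormMap.smoothTop c)
  refine h.congr_of_eventuallyEq (Filter.Eventually.of_forall fun y => ?_)
  have := hθ y (chartFrame (𝓡∂ (n + 1)) c y)
  rw [← dFormMap_apply hη] at this
  exact eq_sub_of_add_eq this

include hι in
/-- A field that differs from the derivative of the density by an exact form, together with the
boundary values of a primitive of that form, represents the partial functional derivative. -/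
theorem IsFieldPairing.eq_partialPhi {R : Type*} [AddCommGroup R] [Module ℝ R]
    {pair : R → Omega (𝓡∂ (n + 1)) F E k → ℝ}
    {θ : R → Omega (𝓡∂ (n + 1)) F E k →
      ∀ x : M, TangentSpace (𝓡∂ (n + 1)) x [⋀^Fin (n + 1)]→ₗ[ℝ] ℝ}
    {β : R → Omega (𝓡∂ (n + 1)) F E k → ∀ p : N, TangentSpace (𝓡 n) p [⋀^Fin n]→ₗ[ℝ] ℝ}
    (hP : IsFieldPairing o ι pair θ β) {a : R}
    {η : ∀ x : M, TangentSpace (𝓡∂ (n + 1)) x [⋀^Fin n]→ₗ[ℝ] ℝ}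
    (hη : SmoothForm (𝓡∂ (n + 1)) η)
    (hθ : ∀ x w, θ a δ x w + dForm (𝓡∂ (n + 1)) η x w =
      densityDeriv nab φ ν ℒ x (δ.1 x, 0, extCovDeriv nab δ x) w)
    (hβ : ∀ p, β a δ p = (η (ι p)).compLinearMap (tangentMap ι p)) :
    pair a δ = partialPhi (lagrangian o nab ℒ) φ ν δ := by
  -- Stokes' theorem turns the boundary integral into the integral of `dη`, which completes the
  -- interior field to the derivative of the density.
  rw [partialPhi_lagrangian o nab hℒ, hP.pair_eq, funext hβ, ← stokes hι o hη,
    ← integral_add_form o.isOrientationSign (hP.continuous_interior a δ)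
      hη.dFormMap.smoothTop.continuousTop]
  congr 1
  funext x
  ext w
  rw [AlternatingMap.add_apply, dFormMap_apply hη, hθ]

include hι in
-- `(A, A')` represents `δL/δφ` and `(∂ℒ/∂ν, 0)` represents `δL/δν`. Here `A` and `A'` are genuine
-- smooth fields, which the pointwise formulas for divergence and pull-back alone do not provide.
theorem lagrangeDiracCondition_star_iff :
    ∃ (A : Lambda (𝓡∂ (n + 1)) F E k (n + 1)) (A' : Lambda (𝓡 n) F (ι *ᵖ E) k n),
      (∀ x β u e, A.1 x β u e = derivPhi nab ℒ φ ν x β u e -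
        (-1) ^ k * divergence nab (derivZeta nab ℒ φ ν) x β u e) ∧
      (∀ p β u e, A'.1 p β u e = pullDualTensor ι
        (fun x => trace (tangentBasis (𝓡∂ (n + 1)) x) (derivZeta nab ℒ φ ν x)) p β u e) ∧
      ∀ (f : Omega (𝓡∂ (n + 1)) F E k → Omega (𝓡∂ (n + 1)) F E k → DualStar F E ι k)
        (α : Lambda (𝓡∂ (n + 1)) F E k (n + 1)) (αb : Lambda (𝓡 n) F (ι *ᵖ E) k n)
        (dφ : Omega (𝓡∂ (n + 1)) F E k) (dα : Lambda (𝓡∂ (n + 1)) F E k (n + 1))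
        (dαb : Lambda (𝓡 n) F (ι *ᵖ E) k n),
        LagrangeDiracCondition (pairStar o ι) (lagrangian o nab ℒ) f φ ν (α, αb) dφ (dα, dαb) ↔
          dφ = ν ∧ ((∀ x, α.1 x = derivNu nab ℒ φ ν x) ∧ αb = 0) ∧
            dα = A + (f φ ν).1 ∧ dαb = A' + (f φ ν).2 := by
  let χ : Lambda (𝓡∂ (n + 1)) F E (k + 1) (n + 1) := ⟨_, derivZeta_mem nab hℒ φ ν⟩
  choose Z hZ hZd using fun x => exists_divergence nab χ x
  let A₀ : ∀ x, DualTensor (𝓡∂ (n + 1)) E k (n + 1) x :=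
    fun x => derivPhi nab ℒ φ ν x + (-(-1) ^ k : ℝ) • Z x
  have hη : ∀ δ : Omega (𝓡∂ (n + 1)) F E k, SmoothForm (𝓡∂ (n + 1)) fun x =>
      contract (tangentBasis (𝓡∂ (n + 1)) x) (traceField χ.1 x) (δ.1 x) := fun δ =>
    smoothForm_contract ⟨_, traceField_mem χ⟩ δ
  -- The Leibniz rule with `η = (tr χ) • δ`: the multiple of the divergence in `A₀` cancels the one
  -- in `dη` and leaves `χ • d^∇ δ`.
  have hA : ∀ (δ : Omega (𝓡∂ (n + 1)) F E k) x w,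
      contract (tangentBasis (𝓡∂ (n + 1)) x) (A₀ x) (δ.1 x) w +
        dForm (𝓡∂ (n + 1)) (fun y =>
          contract (tangentBasis (𝓡∂ (n + 1)) y) (traceField χ.1 y) (δ.1 y)) x w =
      densityDeriv nab φ ν ℒ x (δ.1 x, 0, extCovDeriv nab δ x) w := by
    intro δ x w
    rw [hZd x δ w, densityDeriv_add_densityDeriv nab hℒ, ← contract_derivPhi nab hℒ,
      ← contract_derivZeta nab hℒ, contract_add_left, contract_smul_left]
    simp only [AlternatingMap.add_apply, AlternatingMap.smul_apply, smul_eq_mul]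
    ring
  let A : Lambda (𝓡∂ (n + 1)) F E k (n + 1) := ⟨A₀, mem_Lambda_of_contract fun δ =>
    smoothTop_of_add_dForm nab hℒ φ ν δ (hη δ) (hA δ)⟩
  let A' : Lambda (𝓡 n) F (ι *ᵖ E) k n := ⟨pullTrace ι χ.1, pullTrace_mem hι.injective_mfderiv χ⟩
  let B : Lambda (𝓡∂ (n + 1)) F E k (n + 1) := ⟨_, derivNu_mem nab hℒ φ ν⟩
  refine ⟨A, A', fun x β u e => ?_, fun p β u e => pullTrace_apply ι χ.1 p β u e,
    fun f α αb dφ dα dαb => ?_⟩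
  · rw [← hZ x β u e, sub_eq_add_neg, ← neg_mul]
    rfl
  have hP := isFieldPairing_star (F := F) (E := E) (k := k) o hι
  have hb : ∀ δ, pairStar o ι ((B, 0) : DualStar F E ι k) δ =
      partialNu (lagrangian o nab ℒ) φ ν δ := by
    intro δ
    rw [partialNu_lagrangian o nab hℒ, pairStar]
    have e : (fun p => contract (A := (ι *ᵖ E) p) (tangentBasis (𝓡 n) p)
        ((0 : Lambda (𝓡 n) F (ι *ᵖ E) k n).1 p) (pullForm ι δ.1 p)) = fun _ => 0 := by
      refine funext fun p => ?_
      have := contract_smul_left (A := (ι *ᵖ E) p) (tangentBasis (𝓡 n) p) 0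
        (0 : SkewTensor (TangentSpace (𝓡 n) p) ((ι *ᵖ E) p) k n) (pullForm ι δ.1 p)
      rw [zero_smul, zero_smul] at this
      exact this
    refine (congrArg₂ (· + ·) ?_ ((congrArg _ e).trans integral_zero_form)).trans (add_zero _)
    exact congrArg _ (funext fun x => contract_derivNu nab hℒ φ ν x (δ.1 x))
  have ha : ∀ δ, pairStar o ι ((A, A') : DualStar F E ι k) δ =
      partialPhi (lagrangian o nab ℒ) φ ν δ := fun δ =>
    hP.eq_partialPhi o hι nab hℒ φ ν δ (hη δ) (hA δ)
      fun p => contract_pullTrace hι.injective_mfderiv χ.1 δ.1 p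
  rw [hP.lagrangeDiracCondition_iff hι ha hb]
  simp only [Prod.ext_iff, Prod.fst_add, Prod.snd_add]
  have : α = B ↔ ∀ x, α.1 x = derivNu nab ℒ φ ν x := Subtype.ext_iff.trans funext_iff
  rw [this]

include hι in
-- The same integration by parts with primitive `η = δ ∧ ψ`, where `ψ` is the wedge realisation of
-- `∂ℒ/∂ζ`. Its pull-back is `ι* δ ∧ ι* ψ`, since pull-back commutes with the wedge product.
theorem lagrangeDiracCondition_dagger_iff {j : ℕ} (h : k + j = n) (hk : k + (j + 1) = n + 1)
    (hk' : k + 1 + j = n + 1) :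
    ∃ (A : OmegaDual (𝓡∂ (n + 1)) F E (j + 1)) (A' : OmegaDual (𝓡 n) F (ι *ᵖ E) j),
      (∀ x u e, A.1 x u e = derivWedgePhi nab ℒ φ ν hk x u e -
        (-1) ^ k * extCovDerivDual nab (derivWedgeZeta nab ℒ φ ν hk') x u e) ∧
      (∀ p u e, A'.1 p u e = pullDualForm ι (derivWedgeZeta nab ℒ φ ν hk') p u e) ∧
      ∀ (f : Omega (𝓡∂ (n + 1)) F E k → Omega (𝓡∂ (n + 1)) F E k → DualDagger F E ι j)
        (α : OmegaDual (𝓡∂ (n + 1)) F E (j + 1)) (αb : OmegaDual (𝓡 n) F (ι *ᵖ E) j)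
        (dφ : Omega (𝓡∂ (n + 1)) F E k) (dα : OmegaDual (𝓡∂ (n + 1)) F E (j + 1))
        (dαb : OmegaDual (𝓡 n) F (ι *ᵖ E) j),
        LagrangeDiracCondition (pairDagger o ι h) (lagrangian o nab ℒ) f φ ν (α, αb) dφ
            (dα, dαb) ↔
          dφ = ν ∧ ((∀ x, α.1 x = derivWedgeNu nab ℒ φ ν hk x) ∧ αb = 0) ∧
            dα = A + (f φ ν).1 ∧ dαb = A' + (f φ ν).2 := by
  let ψ : OmegaDual (𝓡∂ (n + 1)) F E j := ⟨_, derivWedgeZeta_mem nab hℒ φ ν hk'⟩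
  choose Z hZ hZd using fun x => exists_extCovDerivDual nab h hk' hk ψ x
  let A₀ : ∀ x, DualForm (𝓡∂ (n + 1)) E (j + 1) x :=
    fun x => derivWedgePhi nab ℒ φ ν hk x + (-(-1) ^ k : ℝ) • Z x
  have hη : ∀ δ : Omega (𝓡∂ (n + 1)) F E k, SmoothForm (𝓡∂ (n + 1)) fun x =>
      wedge h (δ.1 x) (ψ.1 x) := fun δ => smoothForm_wedge h δ ψ
  have hA : ∀ (δ : Omega (𝓡∂ (n + 1)) F E k) x w, wedge hk (δ.1 x) (A₀ x) w +
        dForm (𝓡∂ (n + 1)) (fun y => wedge h (δ.1 y) (ψ.1 y)) x w =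
      densityDeriv nab φ ν ℒ x (δ.1 x, 0, extCovDeriv nab δ x) w := by
    intro δ x w
    rw [hZd x δ w, densityDeriv_add_densityDeriv nab hℒ, ← wedge_derivWedgePhi nab hℒ φ ν hk,
      ← wedge_derivWedgeZeta nab hℒ φ ν hk', wedge_add_right, wedge_smul_right]
    simp only [AlternatingMap.add_apply, AlternatingMap.smul_apply, smul_eq_mul]
    ring
  let A : OmegaDual (𝓡∂ (n + 1)) F E (j + 1) := ⟨A₀, mem_OmegaDual_of_wedge hk fun δ =>
    smoothTop_of_add_dForm nab hℒ φ ν δ (hη δ) (hA δ)⟩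
  let A' : OmegaDual (𝓡 n) F (ι *ᵖ E) j := ⟨pullDualForm ι ψ.1, pullDualForm_mem ι ψ⟩
  let B : OmegaDual (𝓡∂ (n + 1)) F E (j + 1) := ⟨_, derivWedgeNu_mem nab hℒ φ ν hk⟩
  refine ⟨A, A', fun x u e => ?_, fun p u e => rfl, fun f α αb dφ dα dαb => ?_⟩
  · rw [← hZ x u e, sub_eq_add_neg, ← neg_mul]
    rfl
  have hP := isFieldPairing_dagger (F := F) (E := E) (k := k) o hι h
  have hb : ∀ δ, pairDagger o ι h ((B, 0) : DualDagger F E ι j) δ =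
      partialNu (lagrangian o nab ℒ) φ ν δ := by
    intro δ
    rw [partialNu_lagrangian o nab hℒ, pairDagger]
    have e : (fun p => wedge (A := (ι *ᵖ E) p) h (pullForm ι δ.1 p)
        ((0 : OmegaDual (𝓡 n) F (ι *ᵖ E) j).1 p)) = fun _ => 0 := by
      refine funext fun p => ?_
      have := wedge_smul_right (A := (ι *ᵖ E) p) h 0 (pullForm ι δ.1 p) 0
      rw [zero_smul, zero_smul] at this
      exact this
    refine (congrArg₂ (· + ·) ?_ ((congrArg _ e).trans integral_zero_form)).trans (add_zero _)
    exact congrArg _ (funext fun x => wedge_derivWedgeNu nab hℒ φ ν hk x (δ.1 x))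
  have ha : ∀ δ, pairDagger o ι h ((A, A') : DualDagger F E ι j) δ =
      partialPhi (lagrangian o nab ℒ) φ ν δ := fun δ =>
    hP.eq_partialPhi o hι nab hℒ φ ν δ (hη δ) (hA δ)
      fun p => wedge_compLinearMap h (δ.1 (ι p)) (ψ.1 (ι p)) (tangentMap ι p)
  rw [hP.lagrangeDiracCondition_iff hι ha hb]
  simp only [Prod.ext_iff, Prod.fst_add, Prod.snd_add]
  have : α = B ↔ ∀ x, α.1 x = derivWedgeNu nab ℒ φ ν hk x := Subtype.ext_iff.trans funext_iff
  rw [this]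

include hι in
-- For `k = m` the form `d^∇ δ` has degree above the dimension and vanishes, so there is nothing to
-- integrate by parts.
theorem lagrangeDiracCondition_daggerTop_iff (h : k = n + 1) :
    ∃ A : OmegaDual (𝓡∂ (n + 1)) F E 0,
      (∀ x u e, A.1 x u e = derivWedgePhi nab ℒ φ ν (j := 0) h x u e) ∧
      ∀ (f : Omega (𝓡∂ (n + 1)) F E k → Omega (𝓡∂ (n + 1)) F E k → OmegaDual (𝓡∂ (n + 1)) F E 0)
        (α : OmegaDual (𝓡∂ (n + 1)) F E 0) (dφ : Omega (𝓡∂ (n + 1)) F E k)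
        (dα : OmegaDual (𝓡∂ (n + 1)) F E 0),
        LagrangeDiracCondition (pairDaggerTop o h) (lagrangian o nab ℒ) f φ ν α dφ dα ↔
          dφ = ν ∧ (∀ x, α.1 x = derivWedgeNu nab ℒ φ ν (j := 0) h x) ∧ dα = A + f φ ν := by
  let A : OmegaDual (𝓡∂ (n + 1)) F E 0 := ⟨_, derivWedgePhi_mem nab hℒ φ ν (j := 0) h⟩
  let B : OmegaDual (𝓡∂ (n + 1)) F E 0 := ⟨_, derivWedgeNu_mem nab hℒ φ ν (j := 0) h⟩
  refine ⟨A, fun x u e => rfl, fun f α dφ dα => ?_⟩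
  have hP := isFieldPairing_daggerTop (F := F) (E := E) (k := k) o (ι := ι) h
  have hb : ∀ δ, pairDaggerTop o h B δ = partialNu (lagrangian o nab ℒ) φ ν δ := by
    intro δ
    rw [partialNu_lagrangian o nab hℒ, pairDaggerTop]
    exact congrArg _ (funext fun x => wedge_derivWedgeNu nab hℒ φ ν (j := 0) h x (δ.1 x))
  have ha : ∀ δ, pairDaggerTop o h A δ = partialPhi (lagrangian o nab ℒ) φ ν δ := by
    intro δ
    rw [partialPhi_lagrangian o nab hℒ, pairDaggerTop]
    refine congrArg _ (funext fun x => ?_)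
    have e : extCovDeriv nab δ x = 0 :=
      alternatingMap_eq_zero_of_lt (tangentBasis (𝓡∂ (n + 1)) x) (by omega) _
    rw [e]
    exact wedge_derivWedgePhi nab hℒ φ ν (j := 0) h x (δ.1 x)
  rw [hP.lagrangeDiracCondition_iff hι ha hb]
  have : α = B ↔ ∀ x, α.1 x = derivWedgeNu nab ℒ φ ν (j := 0) h x :=
    Subtype.ext_iff.trans funext_iff
  rw [this]

end Representatives

end LagrangeDirac

end

/-! ### The proposition, at each instant of time. -/

open LagrangeDirac in
theorem proposition2p17 {n k : ℕ} (hk : k ≤ n + 1)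
    {M : Type*} [TopologicalSpace M] [ChartedSpace (EuclideanHalfSpace (n + 1)) M]
    [IsManifold (𝓡∂ (n + 1)) ∞ M] [T2Space M] [CompactSpace M]
    {N : Type*} [TopologicalSpace N] [ChartedSpace (EuclideanSpace ℝ (Fin n)) N]
    [IsManifold (𝓡 n) ∞ N] [T2Space N] [CompactSpace N]
    (ι : C^∞⟮𝓡 n, N; 𝓡∂ (n + 1), M⟯) (hι : IsBoundaryInclusion ι)
    (o : ManifoldOrientation (𝓡∂ (n + 1)) M)
    {F : Type*} [NormedAddCommGroup F] [NormedSpace ℝ F] [FiniteDimensional ℝ F]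
    {E : M → Type*} [∀ x, AddCommGroup (E x)] [∀ x, Module ℝ (E x)]
    [TopologicalSpace (Bundle.TotalSpace F E)] [∀ x, TopologicalSpace (E x)]
    [∀ x, IsTopologicalAddGroup (E x)] [∀ x, ContinuousSMul ℝ (E x)]
    [FiberBundle F E] [VectorBundle ℝ F E] [ContMDiffVectorBundle ∞ F E (𝓡∂ (n + 1))]
    (nab : CovariantDerivative (𝓡∂ (n + 1)) F E) [CovariantDerivative.ContMDiffCovariantDerivative nab ∞]
    (ℒ : Density n E k) (hℒ : ℒ.IsSmooth F) {t₀ t₁ : ℝ} (ht : t₀ < t₁) :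
    -- (i) the restricted dual `V⋆`
    (∀ (f : Omega (𝓡∂ (n + 1)) F E k → Omega (𝓡∂ (n + 1)) F E k → DualStar F E ι k)
        (φ ν : ℝ → Omega (𝓡∂ (n + 1)) F E k) (α : ℝ → Lambda (𝓡∂ (n + 1)) F E k (n + 1))
        (αb : ℝ → Lambda (𝓡 n) F (ι *ᵖ E) k n),
      Omega.SmoothCurve (Set.Icc t₀ t₁) φ → Omega.SmoothCurve (Set.Icc t₀ t₁) ν →
      Lambda.SmoothCurve (Set.Icc t₀ t₁) α → Lambda.SmoothCurve (Set.Icc t₀ t₁) αb →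
      (IsSolutionStar o ι nab ℒ f (Set.Icc t₀ t₁) φ ν α αb ↔
        ∀ t ∈ Set.Icc t₀ t₁,
          Omega.HasTimeDeriv (Set.Icc t₀ t₁) φ t (fun x w => (ν t).1 x w) ∧
          (∀ x, (α t).1 x = derivNu nab ℒ (φ t) (ν t) x) ∧
          Lambda.HasTimeDeriv (Set.Icc t₀ t₁) α t (fun x β w e =>
            derivPhi nab ℒ (φ t) (ν t) x β w e
              - (-1) ^ k * divergence nab (derivZeta nab ℒ (φ t) (ν t)) x β w e
              + (f (φ t) (ν t)).1.1 x β w e) ∧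
          αb t = 0 ∧
          Lambda.HasTimeDeriv (Set.Icc t₀ t₁) αb t (fun p β w e =>
            pullDualTensor ι
                (fun x => trace (tangentBasis (𝓡∂ (n + 1)) x)
                  (derivZeta nab ℒ (φ t) (ν t) x)) p β w e
              + (f (φ t) (ν t)).2.1 p β w e))) ∧
    -- (ii) the restricted dual `V†`, for `k < m = n + 1`, with `j = m - k - 1`
    (∀ (j : ℕ) (h : k + j = n)
        (f : Omega (𝓡∂ (n + 1)) F E k → Omega (𝓡∂ (n + 1)) F E k → DualDagger F E ι j)
        (φ ν : ℝ → Omega (𝓡∂ (n + 1)) F E k) (α : ℝ → OmegaDual (𝓡∂ (n + 1)) F E (j + 1))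
        (αb : ℝ → OmegaDual (𝓡 n) F (ι *ᵖ E) j),
      Omega.SmoothCurve (Set.Icc t₀ t₁) φ → Omega.SmoothCurve (Set.Icc t₀ t₁) ν →
      OmegaDual.SmoothCurve (Set.Icc t₀ t₁) α → OmegaDual.SmoothCurve (Set.Icc t₀ t₁) αb →
      (IsSolutionDagger o ι nab ℒ h f (Set.Icc t₀ t₁) φ ν α αb ↔
        ∀ t ∈ Set.Icc t₀ t₁,
          Omega.HasTimeDeriv (Set.Icc t₀ t₁) φ t (fun x w => (ν t).1 x w) ∧
          (∀ x, (α t).1 x = derivWedgeNu nab ℒ (φ t) (ν t) (by omega) x) ∧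
          OmegaDual.HasTimeDeriv (Set.Icc t₀ t₁) α t (fun x w e =>
            derivWedgePhi nab ℒ (φ t) (ν t) (by omega) x w e
              - (-1) ^ k * extCovDerivDual nab
                  (derivWedgeZeta nab ℒ (φ t) (ν t) (by omega)) x w e
              + (f (φ t) (ν t)).1.1 x w e) ∧
          αb t = 0 ∧
          OmegaDual.HasTimeDeriv (Set.Icc t₀ t₁) αb t (fun p w e =>
            pullDualForm ι (derivWedgeZeta nab ℒ (φ t) (ν t) (by omega)) p w e
              + (f (φ t) (ν t)).2.1 p w e))) ∧
    -- (ii) the restricted dual `V†`, for `k = m = n + 1`: forms of degree `m - k - 1` are `0`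
    (∀ (h : k = n + 1)
        (f : Omega (𝓡∂ (n + 1)) F E k → Omega (𝓡∂ (n + 1)) F E k →
          OmegaDual (𝓡∂ (n + 1)) F E 0)
        (φ ν : ℝ → Omega (𝓡∂ (n + 1)) F E k) (α : ℝ → OmegaDual (𝓡∂ (n + 1)) F E 0),
      Omega.SmoothCurve (Set.Icc t₀ t₁) φ → Omega.SmoothCurve (Set.Icc t₀ t₁) ν →
      OmegaDual.SmoothCurve (Set.Icc t₀ t₁) α →
      (IsSolutionDaggerTop o nab ℒ h f (Set.Icc t₀ t₁) φ ν α ↔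
        ∀ t ∈ Set.Icc t₀ t₁,
          Omega.HasTimeDeriv (Set.Icc t₀ t₁) φ t (fun x w => (ν t).1 x w) ∧
          (∀ x, (α t).1 x = derivWedgeNu nab ℒ (φ t) (ν t) (j := 0) h x) ∧
          OmegaDual.HasTimeDeriv (Set.Icc t₀ t₁) α t (fun x w e =>
            derivWedgePhi nab ℒ (φ t) (ν t) (j := 0) h x w e
              + (f (φ t) (ν t)).1 x w e))) := by
  -- Both sides are conditions at each time separately, so the equivalence is proved for fixed `t`.
  refine ⟨fun f φ ν α αb _ _ _ _ => forall₂_congr fun t _ => ?_,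
    fun j h f φ ν α αb _ _ _ _ => forall₂_congr fun t _ => ?_,
    fun h f φ ν α _ _ _ => forall₂_congr fun t _ => ?_⟩
  · obtain ⟨A, A', hA, hA', H⟩ := lagrangeDiracCondition_star_iff o hι nab hℒ (φ t) (ν t)
    have e : ∀ x β u e, (A + (f (φ t) (ν t)).1).1 x β u e =
        derivPhi nab ℒ (φ t) (ν t) x β u e
          - (-1) ^ k * divergence nab (derivZeta nab ℒ (φ t) (ν t)) x β u e
          + (f (φ t) (ν t)).1.1 x β u e := fun x β u e =>
      congrArg (· + (f (φ t) (ν t)).1.1 x β u e) (hA x β u e)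
    have e' : ∀ p β u e, (A' + (f (φ t) (ν t)).2).1 p β u e =
        pullDualTensor ι (fun x => trace (tangentBasis (𝓡∂ (n + 1)) x)
          (derivZeta nab ℒ (φ t) (ν t) x)) p β u e + (f (φ t) (ν t)).2.1 p β u e :=
      fun p β u e => congrArg (· + (f (φ t) (ν t)).2.1 p β u e) (hA' p β u e)
    constructor
    · rintro ⟨dφ, dα, dαb, h1, h2, h3, h4⟩
      obtain ⟨rfl, ⟨h5, h6⟩, rfl, rfl⟩ := (H f (α t) (αb t) dφ dα dαb).1 h4
      exact ⟨h1, h5, fun x β w u => (h2 x β w u).congr_deriv (e x β w u), h6,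
        fun p β w u => (h3 p β w u).congr_deriv (e' p β w u)⟩
    · rintro ⟨h1, h2, h3, h4, h5⟩
      -- The velocities required by the definition of a solution must be elements of `V` and `V*`;
      -- the smooth fields `ν t`, `A + 𝓕` and `A' + 𝓕_∂` are taken.
      exact ⟨ν t, A + (f (φ t) (ν t)).1, A' + (f (φ t) (ν t)).2, h1, fun x β w u => (h3 x β w u).congr_deriv (e x β w u).symm,
        fun p β w u => (h5 p β w u).congr_deriv (e' p β w u).symm,
        (H f _ _ _ _ _).2 ⟨rfl, ⟨h2, h4⟩, rfl, rfl⟩⟩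
  · obtain ⟨A, A', hA, hA', H⟩ := lagrangeDiracCondition_dagger_iff o hι nab hℒ (φ t) (ν t) h
      (by omega) (by omega)
    have e : ∀ x u e, (A + (f (φ t) (ν t)).1).1 x u e =
        derivWedgePhi nab ℒ (φ t) (ν t) (by omega) x u e
          - (-1) ^ k * extCovDerivDual nab
            (derivWedgeZeta nab ℒ (φ t) (ν t) (by omega)) x u e
          + (f (φ t) (ν t)).1.1 x u e := fun x u e =>
      congrArg (· + (f (φ t) (ν t)).1.1 x u e) (hA x u e)
    have e' : ∀ p u e, (A' + (f (φ t) (ν t)).2).1 p u e =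
        pullDualForm ι (derivWedgeZeta nab ℒ (φ t) (ν t) (by omega)) p u e
          + (f (φ t) (ν t)).2.1 p u e :=
      fun p u e => congrArg (· + (f (φ t) (ν t)).2.1 p u e) (hA' p u e)
    constructor
    · rintro ⟨dφ, dα, dαb, h1, h2, h3, h4⟩
      obtain ⟨rfl, ⟨h5, h6⟩, rfl, rfl⟩ := (H f (α t) (αb t) dφ dα dαb).1 h4
      exact ⟨h1, h5, fun x w u => (h2 x w u).congr_deriv (e x w u), h6, fun p w u => (h3 p w u).congr_deriv (e' p w u)⟩
    · rintro ⟨h1, h2, h3, h4, h5⟩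
      exact ⟨ν t, A + (f (φ t) (ν t)).1, A' + (f (φ t) (ν t)).2, h1, fun x w u => (h3 x w u).congr_deriv (e x w u).symm,
        fun p w u => (h5 p w u).congr_deriv (e' p w u).symm,
        (H f _ _ _ _ _).2 ⟨rfl, ⟨h2, h4⟩, rfl, rfl⟩⟩
  · obtain ⟨A, hA, H⟩ := lagrangeDiracCondition_daggerTop_iff o hι nab hℒ (φ t) (ν t) h
    have e : ∀ x u e, (A + f (φ t) (ν t)).1 x u e =
        derivWedgePhi nab ℒ (φ t) (ν t) (j := 0) h x u e + (f (φ t) (ν t)).1 x u e :=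
      fun x u e => congrArg (· + (f (φ t) (ν t)).1 x u e) (hA x u e)
    constructor
    · rintro ⟨dφ, dα, h1, h2, h3⟩
      obtain ⟨rfl, h4, rfl⟩ := (H f (α t) dφ dα).1 h3
      exact ⟨h1, h4, fun x w u => (h2 x w u).congr_deriv (e x w u)⟩
    · rintro ⟨h1, h2, h3⟩
      exact ⟨ν t, A + f (φ t) (ν t), h1, fun x w u => (h3 x w u).congr_deriv (e x w u).symm,
        (H f _ _ _).2 ⟨rfl, h2, rfl⟩⟩
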